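/- Let $F$ be a $p$-adic field (a non-Archimedean local field of characteristic zero) with ring of integers $\mathcal O_F$, residue cardinality $q_F$ and normalized absolute value $|\cdot|_F$, and let $E$ be either a quadratic field extension of $F$ (ramified or unramified; the inert case) or $F\times F$ (the split case), with ring of integers $\mathcal O_E$ (the integral closure of $\mathcal O_F$ in $E$). Let $n\ge 1$, let $G_n=\mathrm{GL}_n$ and let $N_n\subset G_n$ be the subgroup of unipotent upper triangular matrices. Let $\psi':F\to\mathbb S^1$ and $\psi:E\to\mathbb S^1$ be continuous additive characters, with $\psi$ trivial on $F$, which are unramified, i.e. the largest fractional ideals on which they are trivial are $\mathcal O_F$ and $\mathcal O_E$ respectively. Put $\psi_n(u)=\psi\big((-1)^n\sum_{i=1}^{n-1}u_{i,i+1}\big)$ for $u\in N_n(E)$. Let $\pi$ be an irreducible smooth complex representation of $G_n(E)$ which is generic and unramified (it has a nonzero $G_n(\mathcal O_E)$-fixed vector), let $\mathcal W(\pi,\psi_n)$ be its Whittaker model, let $W\in\mathcal W(\pi,\psi_n)^{G_n(\mathcal O_E)}$ be normalized by $W(1)=1$, and let $\phi$ be the characteristic function of $\mathcal O_F^n\subset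 F^n$. Then, for all $s\in\mathbb C$ with sufficiently large real part, the zeta integral $$Z(s,W,\phi)=\int_{N_n(F)\backslash G_n(F)}W(h)\,\phi(e_nh)\,|\det h|_F^s\,dh,\qquad e_n=(0,\dots,0,1),$$ (for any choice of invariant measure) converges absolutely and $$Z(s,W,\phi)=\mathrm{vol}\big(N_n(\mathcal O_F)\backslash G_n(\mathcal O_F)\big)\,L(s,\pi,\mathrm{As}).$$ Here $L(s,\pi,\mathrm{As})$ is the Asai $L$-factor of $\pi$. In the inert case it is the Artin $L$-factor $L(s,\mathrm{As}(\phi_\pi))$, where $\phi_\pi$ is the Langlands parameter of $\pi$, a representation on a space $M$ of the Weil group $W_E$, and, for a fixed $w_0\in W_F\setminus W_E$, $\mathrm{As}(\phi_\pi)$ is the representation of $W_F$ on $M\otimes M$ with $\mathrm{As}(\phi_\pi)(w)=\phi_\pi(w)\otimes\phi_\pi(w_0ww_0^{-1})$ for $w\in W_E$ and $\mathrm{As}(\phi_\pi)(w_0)(x\otimes y)=y\otimes\phi_\pi(w_0^2)x$. In the split case it is $L(s,\phi_1\otimes\phi_2)$, where $(\phi_1,\phi_2)$ are the Langlands parameters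 of $\pi_1,\pi_2$ with $\pi=\pi_1\boxtimes\pi_2$. (For $\pi$ unramified, the Langlands parameter is the sum of the characters that correspond, by local class field theory with uniformizers corresponding to geometric Frobenius elements, to the unramified characters $\chi_1,\dots,\chi_n$ of $E^\times$ such that $\pi$ is a subquotient of the normalized parabolic induction $\chi_1\times\cdots\times\chi_n$.) -/

import Mathlib

open scoped ValuativeRel TensorProduct

noncomputable section

namespace AsaiZeta

/-! ### The p-adic field `F` and its étale quadratic algebra `E` -/

section LocalField

variable (F : Type*) [Field F] [ValuativeRel F] [TopologicalSpace F] [IsNonarchimedeanLocalField F]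

/-- The cardinality `q_F` of the residue field of `F`. -/
def residueCard : ℕ := Nat.card 𝓀[F]

/-- The ring of integers `𝒪_E` of an `F`-algebra `E`, i.e. the integral closure of `𝒪_F` in `E`.
For a finite field extension it is the usual valuation ring, for `E = F × F` it is `𝒪_F × 𝒪_F`,
and for `E = F` it is `𝒪_F`. -/
abbrev integers (E : Type*) [CommRing E] [Algebra F E] : Subalgebra 𝒪[F] E :=
  integralClosure 𝒪[F] E

variable {F}

/-- The normalized (surjective onto `ℤ`) additive valuation of `F`; junk value `0` at `0`. -/
def ord (x : F) : ℤ :=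
  -WithZero.log (IsNonarchimedeanLocalField.valueGroupWithZeroIsoInt F (ValuativeRel.valuation F x))

theorem ord_mul (x y : Fˣ) : ord ((x * y : Fˣ) : F) = ord (x : F) + ord (y : F) := by
  simp only [ord, Units.val_mul, map_mul]
  rw [WithZero.log_mul (by simp) (by simp)]
  ring

open Classical in
/-- The normalized absolute value `|x|_F = q_F ^ (- ord x)`. -/
def absF (x : F) : ℝ := if x = 0 then 0 else (residueCard F : ℝ) ^ (-ord x)

variable (F) in
/-- The normalized absolute value of `E`: `|x|_E = |N_{E/F}(x)|_F`. In the case `E = F × F` this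
is `|x₁|_F |x₂|_F`. -/
def absE {E : Type*} [CommRing E] [Algebra F E] (x : E) : ℝ := absF (Algebra.norm F x)

/-- The unramified character `x ↦ z ^ ord x` of `Fˣ`. -/
def unramChar (z : ℂˣ) : Fˣ →* ℂˣ where
  toFun x := z ^ ord (x : F)
  map_one' := by simp [ord]
  map_mul' x y := by rw [ord_mul, zpow_add]

variable (F) in
/-- An additive character of `E` is unramified if `𝒪_E` is the largest fractional ideal on which
it is trivial: it is trivial on `x 𝒪_E` exactly when `x ∈ 𝒪_E`. -/
def IsUnramifiedAddChar {E : Type*} [CommRing E] [Algebra F E] (ψ : AddChar E Circle) : Prop :=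
  ∀ x : E, (∀ a ∈ integers F E, ψ (x * a) = 1) ↔ x ∈ integers F E

end LocalField

/-! ### Subgroups of `GL_n` and generic characters -/

section Groups

open Matrix

/-- The group `N_n(R)` of unipotent upper triangular matrices. -/
def unipotent (n : ℕ) (R : Type*) [CommRing R] : Subgroup (GL (Fin n) R) where
  carrier := {u | (∀ i j, j < i → (u : Matrix (Fin n) (Fin n) R) i j = 0) ∧
    ∀ i, (u : Matrix (Fin n) (Fin n) R) i i = 1}
  one_mem' := ⟨fun i j h => by simp [Matrix.one_apply_ne h.ne'], fun i => by simp⟩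
  mul_mem' := by
    rintro a b ⟨ha, ha'⟩ ⟨hb, hb'⟩
    refine ⟨fun i j h => ?_, fun i => ?_⟩
    · rw [Units.val_mul, Matrix.mul_apply]
      refine Finset.sum_eq_zero fun k _ => ?_
      rcases lt_or_ge k i with hk | hk
      · rw [ha i k hk, zero_mul]
      · rw [hb k j (h.trans_le hk), mul_zero]
    · rw [Units.val_mul, Matrix.mul_apply, Finset.sum_eq_single i]
      · rw [ha', hb', one_mul]
      · intro k _ hk
        rcases lt_or_gt_of_ne hk with hk | hk
        · rw [ha i k hk, zero_mul]
        · rw [hb k i hk, mul_zero]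
      · simp
  inv_mem' := by
    rintro a ⟨ha, ha'⟩
    have hinv : ∀ i j, j < i → ((a⁻¹ : GL (Fin n) R) : Matrix (Fin n) (Fin n) R) i j = 0 := by
      intro i j h
      have hb : (a : Matrix (Fin n) (Fin n) R).BlockTriangular id := fun i j h => ha i j h
      have : Invertible (a : Matrix (Fin n) (Fin n) R) := a.invertible
      have := Matrix.blockTriangular_inv_of_blockTriangular hb
      rw [Matrix.coe_units_inv]
      exact this h
    refine ⟨hinv, fun i => ?_⟩
    have h1 : ((a * a⁻¹ : GL (Fin n) R) : Matrix (Fin n) (Fin n) R) i i = 1 := by simp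
    rw [Units.val_mul, Matrix.mul_apply, Finset.sum_eq_single i, ha', one_mul] at h1
    · exact h1
    · intro k _ hk
      rcases lt_or_gt_of_ne hk with hk | hk
      · rw [ha i k hk, zero_mul]
      · rw [hinv k i hk, mul_zero]
    · simp

/-- The generic character `ψ_n(u) = ψ((-1)^n ∑_i u_{i,i+1})` (as a function on all matrices). -/
def genericChar {E : Type*} [CommRing E] (n : ℕ) (ψ : AddChar E Circle)
    (u : Matrix (Fin n) (Fin n) E) : ℂ :=
  ψ ((-1) ^ n * ∑ i : Fin n, ∑ j : Fin n, if i.val + 1 = j.val then u i j else 0)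

/-- The subgroup `GL_n(𝒪_E)` of `GL_n(E)`. -/
def integralGL (F : Type*) [Field F] [ValuativeRel F] [TopologicalSpace F]
    [IsNonarchimedeanLocalField F] (n : ℕ) (E : Type*) [CommRing E] [Algebra F E] :
    Subgroup (GL (Fin n) E) :=
  (Matrix.GeneralLinearGroup.map (algebraMap (integers F E) E)).range

end Groups

/-! ### Representations of `GL_n(E)` and Whittaker models -/

section Representations

variable {E : Type*} [CommRing E] {n : ℕ} {V : Type*} [AddCommGroup V] [Module ℂ V]

/-- Every vector has an open stabilizer. -/
def IsSmooth [TopologicalSpace E] (π : Representation ℂ (GL (Fin n) E) V) : Prop :=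
  ∀ v : V, IsOpen {g : GL (Fin n) E | π g v = v}

/-- `ℓ` is a Whittaker functional for `π` with respect to `ψ_n`. -/
def IsWhittakerFunctional (π : Representation ℂ (GL (Fin n) E) V) (ψ : AddChar E Circle)
    (ℓ : V →ₗ[ℂ] ℂ) : Prop :=
  ∀ u ∈ unipotent n E, ∀ v : V, ℓ (π u v) = genericChar n ψ u * ℓ v

/-- `π` has a nonzero Whittaker functional. -/
def IsGeneric (π : Representation ℂ (GL (Fin n) E) V) (ψ : AddChar E Circle) : Prop :=
  ∃ ℓ : V →ₗ[ℂ] ℂ, ℓ ≠ 0 ∧ IsWhittakerFunctional π ψ ℓ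

/-- The Whittaker model `𝒲(π, ψ_n)`: the functions `g ↦ ℓ(π(g)v)` with `ℓ` a nonzero Whittaker
functional (for irreducible `π`, `ℓ` is unique up to a scalar) and `v` in the space of `π`. -/
def whittakerModel (π : Representation ℂ (GL (Fin n) E) V) (ψ : AddChar E Circle) :
    Set (GL (Fin n) E → ℂ) :=
  {W | ∃ ℓ : V →ₗ[ℂ] ℂ, ℓ ≠ 0 ∧ IsWhittakerFunctional π ψ ℓ ∧ ∃ v : V, ∀ g, W g = ℓ (π g v)}

/-- `π` has a nonzero vector fixed by `GL_n(𝒪_E)`. -/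
def IsUnramified (F : Type*) [Field F] [ValuativeRel F] [TopologicalSpace F]
    [IsNonarchimedeanLocalField F] [Algebra F E] (π : Representation ℂ (GL (Fin n) E) V) : Prop :=
  ∃ v : V, v ≠ 0 ∧ ∀ k ∈ integralGL F n E, π k v = v

/-- The space of the normalized (smooth) parabolic induction `χ_1 × ⋯ × χ_n` from the upper
triangular Borel subgroup to `GL_n(E)`: the functions `f` that are right invariant under an open
subgroup and satisfy `f(b g) = δ_{n,E}(b)^{1/2} χ(b) f(g)`. Here `a` is the diagonal of `b`, and
`δ_{n,E}(b)^{1/2} = ∏_i |a_i|_E^{(n + 1 - 2 i)/2}` for `i = 1, …, n` (below, `i = 0, …, n - 1`). -/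
def principalSeries (F : Type*) [Field F] [ValuativeRel F] [TopologicalSpace F]
    [IsNonarchimedeanLocalField F] [Algebra F E] [TopologicalSpace E]
    (χ : Fin n → (Eˣ →* ℂˣ)) : Submodule ℂ (GL (Fin n) E → ℂ) where
  carrier := {f | (∃ U : Subgroup (GL (Fin n) E), IsOpen (U : Set (GL (Fin n) E)) ∧
      ∀ k ∈ U, ∀ g, f (g * k) = f g) ∧
    ∀ (b : GL (Fin n) E) (a : Fin n → Eˣ),
      (∀ i j, j < i → (b : Matrix (Fin n) (Fin n) E) i j = 0) →
      (∀ i, (b : Matrix (Fin n) (Fin n) E) i i = a i) →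
      ∀ g, f (b * g) =
        (∏ i : Fin n, ((absE F (a i : E) ^ (((n : ℝ) - 1 - 2 * (i : ℝ)) / 2) : ℝ) : ℂ) *
          (χ i (a i) : ℂ)) * f g}
  zero_mem' := ⟨⟨⊤, isOpen_univ, by simp⟩, by simp⟩
  add_mem' := by
    rintro f f' ⟨⟨U, hU, h⟩, hf⟩ ⟨⟨U', hU', h'⟩, hf'⟩
    refine ⟨⟨U ⊓ U', hU.inter hU', fun k hk g => ?_⟩, fun b a hb ha g => ?_⟩
    · simp only [Pi.add_apply, h k hk.1, h' k hk.2]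
    · simp only [Pi.add_apply, hf b a hb ha, hf' b a hb ha, mul_add]
  smul_mem' := by
    rintro c f ⟨⟨U, hU, h⟩, hf⟩
    refine ⟨⟨U, hU, fun k hk g => ?_⟩, fun b a hb ha g => ?_⟩
    · simp only [Pi.smul_apply, h k hk]
    · simp only [Pi.smul_apply, hf b a hb ha, smul_eq_mul]
      ring

/-- `π` is isomorphic to a subquotient of `χ_1 × ⋯ × χ_n`: it is a quotient of a
subrepresentation `U` (the group acting by right translation). -/
def IsSubquotientOfPrincipalSeries (F : Type*) [Field F] [ValuativeRel F] [TopologicalSpace F]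
    [IsNonarchimedeanLocalField F] [Algebra F E] [TopologicalSpace E]
    (π : Representation ℂ (GL (Fin n) E) V) (χ : Fin n → (Eˣ →* ℂˣ)) : Prop :=
  ∃ U : Submodule ℂ (GL (Fin n) E → ℂ), U ≤ principalSeries F χ ∧
    (∀ g, ∀ f ∈ U, (fun x => f (x * g)) ∈ U) ∧
    ∃ T : U →ₗ[ℂ] V, Function.Surjective T ∧
      ∀ (g : GL (Fin n) E) (f f' : U), (∀ x, f'.1 x = f.1 (x * g)) → T f' = π g (T f)

end Representations

/-! ### The Weil group and Artin `L`-factors -/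

section Weil

variable (F : Type*) [Field F] [ValuativeRel F] [TopologicalSpace F] [IsNonarchimedeanLocalField F]

/-- The maximal ideal of the ring of integers of the algebraic closure of `F`, written as the
radical of the extension of the maximal ideal of `𝒪_F`. -/
def maxIdealBar : Ideal (integers F (AlgebraicClosure F)) :=
  (Ideal.map (algebraMap 𝒪[F] (integers F (AlgebraicClosure F))) 𝓂[F]).radical

/-- `σ` acts on the residue field of the algebraic closure of `F` as the `k`-th power of the
geometric Frobenius, i.e. as `x ↦ x ^ (q_F ^ (-k))`. (This is written without negative powers;
the residue field is perfect, so the choice of `a` and `b` does not matter.) -/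
def IsGeomFrobPow (σ : AlgebraicClosure F ≃ₐ[F] AlgebraicClosure F) (k : ℤ) : Prop :=
  ∃ a b : ℕ, (b : ℤ) - a = k ∧ ∀ x y : integers F (AlgebraicClosure F),
    (y : AlgebraicClosure F) = σ x →
      y ^ (residueCard F ^ b) - x ^ (residueCard F ^ a) ∈ maxIdealBar F

theorem exists_integers_apply {A : Type*} [CommRing A] [Algebra F A] (σ : A ≃ₐ[F] A)
    (x : integers F A) : ∃ y : integers F A, (y : A) = σ x :=
  ⟨⟨σ x, IsIntegral.map (σ.toAlgHom.restrictScalars 𝒪[F]) x.2⟩, rfl⟩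

theorem pow_sub_pow_mem {R : Type*} [CommRing R] {I : Ideal R} {x y : R} (h : x - y ∈ I) (m : ℕ) :
    x ^ m - y ^ m ∈ I :=
  Ideal.mem_of_dvd I (sub_dvd_pow_sub_pow x y m) h

/-- The Weil group `W_F`: the elements of the absolute Galois group that act on the residue field
as an integral power of the Frobenius, each recorded with that power (in other words the fibre
product of the absolute Galois group with `ℤ` over the Galois group of the residue field). -/
def weilGroup : Subgroup ((AlgebraicClosure F ≃ₐ[F] AlgebraicClosure F) × Multiplicative ℤ) where
  carrier := {w | IsGeomFrobPow F w.1 w.2.toAdd}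
  one_mem' := ⟨0, 0, by simp, fun x y h => by
    have : y = x := Subtype.ext (by simpa using h)
    simp [this]⟩
  mul_mem' := by
    rintro ⟨σ, k⟩ ⟨σ', k'⟩ ⟨a, b, hab, h⟩ ⟨a', b', hab', h'⟩
    refine ⟨a + a', b + b', ?_, fun x y hy => ?_⟩
    · simp only [Prod.mk_mul_mk, toAdd_mul] at hab hab' ⊢
      push_cast
      omega
    · obtain ⟨x', hx'⟩ := exists_integers_apply F σ' x
      have h1 := pow_sub_pow_mem (h x' y (by rw [hx']; exact hy)) (residueCard F ^ b')
      have h2 := pow_sub_pow_mem (h' x x' hx') (residueCard F ^ a)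
      rw [← pow_mul, ← pow_mul, ← pow_add, ← pow_add] at h1 h2
      rw [show b' + a = a + b' from add_comm _ _, show a' + a = a + a' from add_comm _ _] at h2
      simpa using add_mem h1 h2
  inv_mem' := by
    rintro ⟨σ, k⟩ ⟨a, b, hab, h⟩
    refine ⟨b, a, ?_, fun x y hy => ?_⟩
    · simp only [Prod.inv_mk, toAdd_inv] at hab ⊢
      omega
    · have hx : (x : AlgebraicClosure F) = σ y := by
        rw [hy]
        exact (σ.apply_symm_apply _).symm
      have := neg_mem (h y x hx)
      simpa using this

/-- The degree `W_F → ℤ` that sends geometric Frobenius elements to `1`. -/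
def weilDeg : weilGroup F →* Multiplicative ℤ :=
  (MonoidHom.snd _ _).comp (weilGroup F).subtype

/-- The inertia subgroup `I_F` of `W_F`. -/
def inertia : Subgroup (weilGroup F) := (weilDeg F).ker

instance : (inertia F).Normal := inferInstanceAs (weilDeg F).ker.Normal

variable {F}

/-- The Artin `L`-factor `L(s, ρ) = det(1 - q_F^{-s} ρ(Φ) | M^{I_F})⁻¹` of a representation of the
Weil group (trivial on the `SL_2` factor of the Weil–Deligne group), where `Φ` is any geometric
Frobenius element. -/
def artinL {M : Type*} [AddCommGroup M] [Module ℂ M] (ρ : Representation ℂ (weilGroup F) M)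
    (s : ℂ) : ℂ :=
  (LinearMap.det (1 - ((residueCard F : ℂ) ^ (-s)) • ρ.toInvariants (inertia F)
    (Classical.epsilon fun Φ : weilGroup F => weilDeg F Φ = Multiplicative.ofAdd 1)))⁻¹

/-- The sum of the unramified characters `w ↦ z_i ^ deg w` of `W_F`. By local class field theory
(normalized so that uniformizers correspond to geometric Frobenius elements), the `i`-th one
corresponds to the unramified character `unramChar (z i)` of `Fˣ`. -/
def unramRep {n : ℕ} (z : Fin n → ℂˣ) : Representation ℂ (weilGroup F) (Fin n → ℂ) where
  toFun w := LinearMap.pi fun i =>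
    ((z i ^ (weilDeg F w).toAdd : ℂˣ) : ℂ) • (LinearMap.proj i : (Fin n → ℂ) →ₗ[ℂ] ℂ)
  map_one' := by ext; simp
  map_mul' w w' := by
    refine LinearMap.ext fun v => funext fun i => ?_
    simp [zpow_add, mul_assoc]

end Weil

/-! ### The Asai representation -/

section Asai

variable {G : Type*} [Group G] (H : Subgroup G) {M : Type*} [AddCommGroup M] [Module ℂ M]

open Classical in
/-- A representation of `H`, extended by the identity outside `H`. -/
def extendRep (φ : Representation ℂ H M) (g : G) : M →ₗ[ℂ] M :=
  if h : g ∈ H then φ ⟨g, h⟩ else 1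

theorem extendRep_mul (φ : Representation ℂ H M) {g g' : G} (h : g ∈ H) (h' : g' ∈ H) :
    extendRep H φ (g * g') = extendRep H φ g * extendRep H φ g' := by
  simp only [extendRep, h, h', mul_mem h h', dif_pos, ← map_mul]
  rfl

open Classical in
/-- Let `s ∈ G` represent the nontrivial coset of a subgroup `H` of index two, and let `φ` be a
representation of `H` on `M`. The Asai representation `As(φ)` of `G` on `M ⊗ M` is determined by
`As(φ)(w) = φ(w) ⊗ φ(s w s⁻¹)` for `w ∈ H` and `As(φ)(s) = (Id ⊗ φ(s²)) ∘ ι`, where `ι` exchanges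
the two factors. Hence `As(φ)(g) = As(φ)(g s⁻¹) As(φ)(s) = (φ(g s⁻¹) ⊗ φ(s g)) ∘ ι` outside `H`. -/
def asaiRep (φ : Representation ℂ H M) (s : G) (hs : ∀ g, Xor (g * s ∈ H) (g ∈ H)) :
    Representation ℂ G (M ⊗[ℂ] M) where
  toFun g :=
    if g ∈ H then TensorProduct.map (extendRep H φ g) (extendRep H φ (s * g * s⁻¹))
    else TensorProduct.map (extendRep H φ (g * s⁻¹)) (extendRep H φ (s * g)) ∘ₗ
      (TensorProduct.comm ℂ M M).toLinearMap
  map_one' := by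
    have h1 : extendRep H φ 1 = 1 := by
      simp only [extendRep, one_mem, dif_pos]
      exact map_one φ
    rw [if_pos H.one_mem, mul_one, mul_inv_cancel, h1]
    exact TensorProduct.map_one
  map_mul' a b := by
    have hin : ∀ g, g ∉ H → g * s⁻¹ ∈ H := fun g hg => by
      have := hs (g * s⁻¹)
      rw [inv_mul_cancel_right] at this
      exact this.elim (fun h => absurd h.1 hg) (fun h => h.1)
    have hs0 : s ∉ H := fun h => by
      have := hs 1
      rw [one_mul] at this
      exact this.elim (fun h' => h'.2 H.one_mem) (fun h' => h'.2 h)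
    have hin' : ∀ g, g ∉ H → s * g ∈ H := fun g hg => by
      have h1 : g⁻¹ * s⁻¹ ∈ H := hin _ (fun h => hg (by simpa using H.inv_mem h))
      simpa using H.inv_mem h1
    have hconj : ∀ g ∈ H, s * g * s⁻¹ ∈ H := fun g hg =>
      hin _ fun h => hs0 (by simpa using H.mul_mem h (H.inv_mem hg))
    by_cases ha : a ∈ H <;> by_cases hb : b ∈ H
    · have hab := H.mul_mem ha hb
      simp only [ha, hb, hab, if_true]
      rw [show s * (a * b) * s⁻¹ = (s * a * s⁻¹) * (s * b * s⁻¹) by group,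
        extendRep_mul H φ ha hb, extendRep_mul H φ (hconj a ha) (hconj b hb)]
      exact TensorProduct.map_mul _ _ _ _
    · have hab : a * b ∉ H := fun h => hb (by simpa using H.mul_mem (H.inv_mem ha) h)
      simp only [ha, hb, hab, if_true, if_false]
      rw [show a * b * s⁻¹ = a * (b * s⁻¹) by group,
        show s * (a * b) = (s * a * s⁻¹) * (s * b) by group,
        extendRep_mul H φ ha (hin b hb), extendRep_mul H φ (hconj a ha) (hin' b hb)]
      refine TensorProduct.ext' fun x y => ?_
      simp
    · have hab : a * b ∉ H := fun h => ha (by simpa using H.mul_mem h (H.inv_mem hb))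
      simp only [ha, hb, hab, if_true, if_false]
      rw [show a * b * s⁻¹ = (a * s⁻¹) * (s * b * s⁻¹) by group,
        show s * (a * b) = (s * a) * b by group,
        extendRep_mul H φ (hin a ha) (hconj b hb), extendRep_mul H φ (hin' a ha) hb]
      refine TensorProduct.ext' fun x y => ?_
      simp
    · have hab : a * b ∈ H := by
        have := H.mul_mem (hin a ha) (hin' b hb)
        rwa [show a * s⁻¹ * (s * b) = a * b by group] at this
      simp only [ha, hb, hab, if_true, if_false]
      rw [show a * b = (a * s⁻¹) * (s * b) by group,
        extendRep_mul H φ (hin a ha) (hin' b hb),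
        show s * (a * s⁻¹ * (s * b)) * s⁻¹ = (s * a) * (b * s⁻¹) by group,
        extendRep_mul H φ (hin' a ha) (hin b hb)]
      refine TensorProduct.ext' fun x y => ?_
      simp

variable {F : Type*} [Field F] [ValuativeRel F] [TopologicalSpace F] [IsNonarchimedeanLocalField F]
  {E : Type*} [CommRing E] [Algebra F E]

/-- The Weil group of the field `E`, as the subgroup of `W_F` of elements that fix (the image under
the embedding `i` of) `E`. -/
def weilSubgroup (i : E →ₐ[F] AlgebraicClosure F) : Subgroup (weilGroup F) where
  carrier := {w | ∀ x : E, w.1.1 (i x) = i x}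
  one_mem' x := rfl
  mul_mem' := by
    intro a b ha hb x
    change a.1.1 (b.1.1 (i x)) = i x
    rw [hb, ha]
  inv_mem' := by
    intro a ha x
    change a.1.1.symm (i x) = i x
    rw [AlgEquiv.symm_apply_eq, ha]

theorem weilSubgroup_xor [CharZero F] (hE : IsField E) (h2 : Module.finrank F E = 2)
    (i : E →ₐ[F] AlgebraicClosure F) (s : weilGroup F) (hs : s ∉ weilSubgroup i) (g : weilGroup F) :
    Xor (g * s ∈ weilSubgroup i) (g ∈ weilSubgroup i) := by
  let _ : Field E := hE.toField
  have : FiniteDimensional F E := Module.finite_of_finrank_pos (by omega)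
  have hcard : Fintype.card (E →ₐ[F] AlgebraicClosure F) = 2 := by
    rw [AlgHom.card, h2]
  classical
  have key : ∀ j k : E →ₐ[F] AlgebraicClosure F, j ≠ i → k ≠ i → j = k := by
    intro j k hj hk
    by_contra hjk
    have : ({i, j, k} : Finset (E →ₐ[F] AlgebraicClosure F)).card = 3 :=
      Finset.card_eq_three.mpr ⟨i, j, k, hj.symm, hk.symm, hjk, rfl⟩
    have h3 := Finset.card_le_univ ({i, j, k} : Finset (E →ₐ[F] AlgebraicClosure F))
    omega
  have hmem : ∀ w : weilGroup F, w ∈ weilSubgroup i ↔ w.1.1.toAlgHom.comp i = i := fun w =>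
    ⟨fun h => AlgHom.ext h, fun h x => DFunLike.congr_fun h x⟩
  by_cases hg : g ∈ weilSubgroup i
  · refine Or.inr ⟨hg, fun h => hs ?_⟩
    simpa using (weilSubgroup i).mul_mem ((weilSubgroup i).inv_mem hg) h
  · refine Or.inl ⟨?_, hg⟩
    have hg' : g⁻¹ ∉ weilSubgroup i := fun h => hg (by simpa using (weilSubgroup i).inv_mem h)
    rw [hmem] at hs hg'
    have heq := key _ _ hs hg'
    intro x
    have hx : s.1.1 (i x) = g.1.1.symm (i x) := DFunLike.congr_fun heq x
    change g.1.1 (s.1.1 (i x)) = i x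
    rw [hx, AlgEquiv.apply_symm_apply]

variable [CharZero F] [TopologicalSpace E] {n : ℕ} {V : Type*} [AddCommGroup V] [Module ℂ V]

/-- `L` is the value at `s` of the Asai `L`-factor of the unramified representation `π` of
`GL_n(E)`. The Langlands parameter of an unramified `π` is the sum of the characters that
correspond by class field theory to the unramified characters `χ_i` of `Eˣ` such that `π` is a
subquotient of `χ_1 × ⋯ × χ_n`.

If `E` is a field, every unramified character of `Eˣ` has the form `η ∘ N_{E/F}` with `η` an
unramified character of `Fˣ`, and it corresponds to the restriction to `W_E` of the character of
`W_F` corresponding to `η`. So the parameter of `π` is the restriction of `unramRep z` to `W_E`,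
and the Asai factor is the Artin factor of its Asai representation.

If `E = F × F`, the `χ_i` are pairs of unramified characters of `Fˣ`, the parameter is a pair
`(φ₁, φ₂)` of representations of `W_F`, and the Asai factor is the Artin factor of `φ₁ ⊗ φ₂`. -/
def IsAsaiLValue (π : Representation ℂ (GL (Fin n) E) V) (s : ℂ) (L : ℂ) : Prop :=
  (∃ (hE : IsField E) (h2 : Module.finrank F E = 2) (z : Fin n → ℂˣ)
    (i : E →ₐ[F] AlgebraicClosure F) (w : weilGroup F) (hw : w ∉ weilSubgroup i),
      IsSubquotientOfPrincipalSeries F π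
        (fun j => (unramChar (F := F) (z j)).comp (Units.map (Algebra.norm F : E →* F))) ∧
      L = artinL (asaiRep (weilSubgroup i) ((unramRep z).comp (weilSubgroup i).subtype) w
        (weilSubgroup_xor hE h2 i w hw)) s) ∨
  (∃ (e : E ≃ₐ[F] F × F) (z z' : Fin n → ℂˣ),
      IsSubquotientOfPrincipalSeries F π
        (fun j =>
          (unramChar (F := F) (z j)).comp (Units.map ((RingHom.fst F F).comp
            (e : E →+* F × F) : E →* F)) *
          (unramChar (F := F) (z' j)).comp (Units.map ((RingHom.snd F F).comp
            (e : E →+* F × F) : E →* F))) ∧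
      L = artinL ((unramRep (F := F) z).tprod (unramRep (F := F) z')) s)

variable (F) in
/-- The Asai `L`-factor `L(s, π, As)` of an unramified irreducible representation `π` of `GL_n(E)`
(the value does not depend on the choices in `IsAsaiLValue`). -/
def asaiL (π : Representation ℂ (GL (Fin n) E) V) (s : ℂ) : ℂ :=
  Classical.epsilon (IsAsaiLValue (F := F) π s)

end Asai

/-! ### The zeta integrals -/

section Zeta

open MeasureTheory Matrix

variable (n : ℕ) (F : Type*) [Field F] [ValuativeRel F] [TopologicalSpace F]
  [IsNonarchimedeanLocalField F]

/-- The quotient `N_n(F) \ GL_n(F)`, with the quotient topology and its Borel sets. -/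
def UnipotentQuotient : Type _ := Quotient (QuotientGroup.rightRel (unipotent n F))

instance : TopologicalSpace (UnipotentQuotient n F) :=
  inferInstanceAs (TopologicalSpace (Quotient (QuotientGroup.rightRel (unipotent n F))))

instance : MeasurableSpace (UnipotentQuotient n F) := borel _

instance : BorelSpace (UnipotentQuotient n F) := ⟨rfl⟩

variable {n F}

/-- The class `N_n(F) h`. -/
def UnipotentQuotient.mk (h : GL (Fin n) F) : UnipotentQuotient n F :=
  Quotient.mk (QuotientGroup.rightRel (unipotent n F)) h

/-- A representative of a class. -/
def UnipotentQuotient.rep (x : UnipotentQuotient n F) : GL (Fin n) F := Quotient.out x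

/-- The right translation `N_n(F) h ↦ N_n(F) h g`. -/
def UnipotentQuotient.rightMul (g : GL (Fin n) F) :
    UnipotentQuotient n F → UnipotentQuotient n F :=
  Quotient.map (· * g) fun a b h => by
    change QuotientGroup.rightRel _ _ _ at h
    change QuotientGroup.rightRel _ _ _
    rw [QuotientGroup.rightRel_apply] at h ⊢
    simpa [mul_assoc] using h

/-- A `GL_n(F)`-invariant Radon measure on `N_n(F) \ GL_n(F)`, that is, a quotient of a Haar measure
on `GL_n(F)` by a Haar measure on `N_n(F)`. -/
structure IsInvariantMeasure (μ : Measure (UnipotentQuotient n F)) : Prop where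
  ne_zero : μ ≠ 0
  finite_on_compacts : ∀ K : Set (UnipotentQuotient n F), IsCompact K → μ K < ⊤
  map_rightMul : ∀ g, μ.map (UnipotentQuotient.rightMul g) = μ

variable {E : Type*} [CommRing E] [Algebra F E]

variable (n F) in
/-- The row vector `e_n = (0, …, 0, 1)`. -/
def lastVec : Fin n → F := fun i => if i.val + 1 = n then 1 else 0

/-- The function `h ↦ W(h) φ(e_n h) |det h|_F^s` on `GL_n(F)`. -/
def zetaIntegrand (W : GL (Fin n) E → ℂ) (φ : (Fin n → F) → ℂ) (s : ℂ) (h : GL (Fin n) F) : ℂ :=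
  W (Matrix.GeneralLinearGroup.map (algebraMap F E) h) *
    φ (lastVec n F ᵥ* (h : Matrix (Fin n) (Fin n) F)) *
    (absF (h : Matrix (Fin n) (Fin n) F).det : ℂ) ^ s

/-- The same function on `N_n(F) \ GL_n(F)`; see `zetaIntegrandQuot_mk`. -/
def zetaIntegrandQuot (W : GL (Fin n) E → ℂ) (φ : (Fin n → F) → ℂ) (s : ℂ)
    (x : UnipotentQuotient n F) : ℂ :=
  zetaIntegrand W φ s x.rep

/-- The zeta integral `Z(s, W, φ) = ∫_{N_n(F) \ GL_n(F)} W(h) φ(e_n h) |det h|_F^s dh`. -/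
def zetaIntegral (μ : Measure (UnipotentQuotient n F)) (W : GL (Fin n) E → ℂ)
    (φ : (Fin n → F) → ℂ) (s : ℂ) : ℂ :=
  ∫ x, zetaIntegrandQuot W φ s x ∂μ

/-- For `W` in a Whittaker model relative to a character trivial on `F`, the integrand is left
invariant under `N_n(F)`, so it descends to the quotient. -/
theorem zetaIntegrandQuot_mk {V : Type*} [AddCommGroup V] [Module ℂ V]
    (π : Representation ℂ (GL (Fin n) E) V) (ψ : AddChar E Circle)
    (hψ : ∀ x : F, ψ (algebraMap F E x) = 1) (W : GL (Fin n) E → ℂ) (hW : W ∈ whittakerModel π ψ)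
    (φ : (Fin n → F) → ℂ) (s : ℂ) (h : GL (Fin n) F) :
    zetaIntegrandQuot W φ s (UnipotentQuotient.mk h) = zetaIntegrand W φ s h := by
  have key : ∀ u ∈ unipotent n F, ∀ h : GL (Fin n) F,
      zetaIntegrand W φ s (u * h) = zetaIntegrand W φ s h := by
    intro u hu h
    obtain ⟨ℓ, -, hℓ, v, hv⟩ := hW
    have hdet : (u : Matrix (Fin n) (Fin n) F).det = 1 := by
      rw [Matrix.det_of_isUpperTriangular (fun i j hij => hu.1 i j hij)]
      exact Finset.prod_eq_one fun i _ => hu.2 i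
    have hvec : lastVec n F ᵥ* (u : Matrix (Fin n) (Fin n) F) = lastVec n F := by
      funext j
      simp only [Matrix.vecMul, dotProduct, lastVec, ite_mul, one_mul, zero_mul]
      by_cases hj : j.val + 1 = n
      · rw [Finset.sum_eq_single j]
        · simp [hj, hu.2 j]
        · intro k _ hk
          rw [if_neg]
          intro hk'
          exact hk (Fin.ext (by omega))
        · simp
      · rw [if_neg hj]
        refine Finset.sum_eq_zero fun k _ => ?_
        split_ifs with hk
        · exact hu.1 k j (Fin.lt_def.mpr (by omega))
        · rfl
    have hu' : Matrix.GeneralLinearGroup.map (algebraMap F E) u ∈ unipotent n E := by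
      refine ⟨fun i j hij => ?_, fun i => ?_⟩
      · simp [hu.1 i j hij]
      · simp [hu.2 i]
    have hchar : genericChar n ψ
        (Matrix.GeneralLinearGroup.map (algebraMap F E) u : GL (Fin n) E).1 = 1 := by
      have : ((-1 : E) ^ n * ∑ i : Fin n, ∑ j : Fin n, if i.val + 1 = j.val then
          (Matrix.GeneralLinearGroup.map (algebraMap F E) u : GL (Fin n) E).1 i j else 0) =
          algebraMap F E ((-1) ^ n * ∑ i : Fin n, ∑ j : Fin n, if i.val + 1 = j.val then
            u.1 i j else 0) := by
        simp only [map_mul, map_pow, map_neg, map_one, map_sum]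
        congr 1
        refine Finset.sum_congr rfl fun i _ => Finset.sum_congr rfl fun j _ => ?_
        split_ifs <;> simp
      rw [genericChar, this, hψ]
      simp
    simp only [zetaIntegrand, map_mul, hv]
    rw [Module.End.mul_apply, hℓ _ hu', hchar, Units.val_mul, ← Matrix.vecMul_vecMul, hvec,
      Matrix.det_mul, hdet, one_mul, one_mul]
  have hrel : QuotientGroup.rightRel (unipotent n F) (UnipotentQuotient.mk h).rep h :=
    Quotient.mk_out (s := QuotientGroup.rightRel (unipotent n F)) h
  rw [QuotientGroup.rightRel_apply] at hrel
  rw [zetaIntegrandQuot, ← key _ hrel]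
  simp

variable (n F) in
/-- The characteristic function of `𝒪_F^n`. -/
def charIntegers : (Fin n → F) → ℂ :=
  Set.indicator {v | ∀ i, v i ∈ 𝒪[F]} fun _ => 1

/-- The volume of `N_n(𝒪_F) \ GL_n(𝒪_F)`, identified with the image of `GL_n(𝒪_F)` in
`N_n(F) \ GL_n(F)`. -/
def volIntegral (μ : Measure (UnipotentQuotient n F)) : ℝ :=
  μ.real (UnipotentQuotient.mk '' (integralGL F n F : Set (GL (Fin n) F)))

end Zeta

end AsaiZeta

end

/-! By the Iwasawa decomposition of `GL_n(F)`, the integral is a sum over the cells `N ϖ^λ K`. The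
Whittaker function vanishes unless `λ` is dominant, and `φ` kills the cells with `λ_n < 0`. What
remains is a sum over partitions `λ` of `vol(N\N ϖ^λ K) · W(ϖ^λ) · X^|λ|` with `X = q^(-s)`. The
volume is `δ_F(ϖ^λ)⁻¹ vol(N\N K)` (`measure_torus`, `uniIndex_mul_modHalf_sq`). Shintani's formula
gives `W` on the torus of `E` as `δ_E^(1/2)` times Schur functions of the Satake parameters, and
`δ_E^(1/2)` restricts to `δ_F` on the torus of `F` (`modHalf_eq_sq`). The modulus characters
therefore cancel, and `zetaIntegral_eq` identifies the integral with the volume times `∑_λ (∏_j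
s_{e_j λ}(α_j)) X^|λ|`, where `j` runs over the places of `E` above `F` and `e_j` is the
ramification index.

There are three generating functions: the sum of all Schur functions (unramified), of those of even
weights (ramified), and of products of two (split). Littlewood's and Cauchy's identities
(`hasSum_schur`, `hasSum_schur_even`, `hasSum_schur_mul_schur`) evaluate them. They are proved for
distinct parameters by induction on `n` with Lagrange interpolation, and extended to all parameters
by continuity.

Shintani's formula rests on explicit representatives of the minuscule double cosets. They turn the
Hecke eigenvalue equations for `W`, divided by `δ_E^(1/2)`, into Pieri's rule on dominant weights.
Antisymmetrization removes the boundary of the dominant cone, and then Pieri's rule becomes a linear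
recurrence in each coordinate, whose only solution up to a factor is the Schur function
(`eq_schur_of_pieri`).

For the fixed vector to be an eigenvector, the Hecke operators must act by scalars on the fixed
vectors. They commute, as can be read off from Whittaker functions. They have no proper common
invariant subspace, because a family of bi-`K`-invariant functions stable under them vanishes once
it vanishes at `1` (`eq_zero_of_apply_one`). The Nullstellensatz then gives scalars without any
finiteness of dimension. The same uniqueness principle embeds `π` as a subquotient of a principal
series (`exists_subquotient`). Conversely, any principal series with subquotient `π` has the same
Satake parameters up to order, so the choice hidden in `asaiL` does not matter.

On the Galois side, the Asai representation of a sum of unramified characters is diagonalized by the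
vectors `e_i ⊗ e_j ± c · e_j ⊗ e_i`. For unramified `E`, a Frobenius lies outside `W_E` and produces
the signs. For ramified `E`, inertia does not lie in `W_E`, and only the vectors with the plus sign
are invariant under it. This requires a geometric Frobenius element and the position of inertia
relative to `W_E`, both obtained by lifting automorphisms of the residue field of the algebraic
closure.

The three types of `E` are treated together through `PlaceData`, which records valuations,
uniformizers, residue representatives and the Iwasawa and Cartan decompositions. -/

noncomputable section

namespace AsaiZeta

/-! ### Schur functions through Pieri's rule -/

section Schur

open Finset Equiv

variable {n : ℕ}

/-- The indicator function of a finite set, with integral values. -/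
def indZ (ε : Finset (Fin n)) : Fin n → ℤ := fun i => if i ∈ ε then 1 else 0

/-- The elementary symmetric polynomials of a family. -/
def esym {R : Type*} [CommSemiring R] (α : Fin n → R) (k : ℕ) : R :=
  ∑ ε ∈ powersetCard k univ, ∏ i ∈ ε, α i

/-- The exponents `(n - 1, …, 1, 0)`. -/
def staircase (n : ℕ) : Fin n → ℤ := fun i => (n : ℤ) - 1 - i

/-- The antisymmetric extension of a function on the dominant weights, shifted by the staircase. -/
def antisymExt (a : (Fin n → ℤ) → ℂ) (m : Fin n → ℤ) : ℂ :=
  ∑ σ : Perm (Fin n), ((Perm.sign σ : ℤ) : ℂ) * a (m ∘ σ - staircase n)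

theorem antisymExt_comp_perm (a : (Fin n → ℤ) → ℂ) (m : Fin n → ℤ) (τ : Perm (Fin n)) :
    antisymExt a (m ∘ τ) = ((Perm.sign τ : ℤ) : ℂ) * antisymExt a m := by
  unfold antisymExt
  rw [mul_sum]
  refine Fintype.sum_equiv (Equiv.mulLeft τ) _ _ fun σ => ?_
  simp only [Equiv.coe_mulLeft, Perm.coe_mul, Function.comp_assoc, Perm.sign_mul]
  rw [← mul_assoc]
  congr 1
  rcases Int.units_eq_one_or (Perm.sign τ) with h | h <;> simp [h]

theorem indZ_comp (ε : Finset (Fin n)) (σ : Perm (Fin n)) :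
    indZ ε ∘ σ = indZ (ε.map σ.symm.toEmbedding) := by
  funext i
  simp [indZ, Finset.mem_map_equiv]

theorem sum_powersetCard_perm {M : Type*} [AddCommMonoid M] (f : Finset (Fin n) → M) (k : ℕ)
    (σ : Perm (Fin n)) :
    ∑ ε ∈ powersetCard k univ, f (ε.map σ.toEmbedding) = ∑ ε ∈ powersetCard k univ, f ε := by
  refine Finset.sum_bij' (fun ε _ => ε.map σ.toEmbedding) (fun ε _ => ε.map σ.symm.toEmbedding)
    ?_ ?_ ?_ ?_ ?_
  · intro ε hε; simpa [mem_powersetCard] using hε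
  · intro ε hε; simpa [mem_powersetCard] using hε
  · intro ε _; ext; simp [Finset.mem_map_equiv]
  · intro ε _; ext; simp [Finset.mem_map_equiv]
  · intro ε _; rfl

/-- A transposition of two equal coordinates fixes `m` but changes the sign. -/
theorem antisymExt_eq_zero (a : (Fin n → ℤ) → ℂ) {m : Fin n → ℤ} (hm : ¬ Function.Injective m) :
    antisymExt a m = 0 := by
  simp only [Function.Injective, not_forall] at hm
  obtain ⟨i, j, hij, hne⟩ := hm
  have h1 : m ∘ (swap i j) = m := by
    funext x
    simp only [Function.comp_apply, swap_apply_def]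
    split_ifs with h h' <;> simp [*]
  have := antisymExt_comp_perm a m (swap i j)
  rw [h1, Perm.sign_swap hne] at this
  simp only [Units.val_neg, Units.val_one, Int.cast_neg, Int.cast_one, neg_mul, one_mul] at this
  exact self_eq_neg.mp this

theorem antitone_fin_iff {f : Fin n → ℤ} :
    Antitone f ↔ ∀ (i j : Fin n), i.val + 1 = j.val → f j ≤ f i := by
  constructor
  · intro h i j hij
    exact h (Fin.le_def.mpr (by omega))
  · intro h
    cases n with
    | zero => exact fun i => i.elim0
    | succ n =>
      rw [Fin.antitone_iff_succ_le]
      intro i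
      exact h _ _ (by simp)

/-- The antisymmetric extension turns the Pieri operators into sums of shifts. -/
theorem antisymExt_pieri {a b : (Fin n → ℤ) → ℂ} {k : ℕ} (ha : ∀ l, ¬ Antitone l → a l = 0)
    (hb : ∀ l, ¬ Antitone l → b l = 0)
    (hab : ∀ l, Antitone l → b l = ∑ ε ∈ powersetCard k univ, a (l + indZ ε)) (m : Fin n → ℤ) :
    antisymExt b m = ∑ ε ∈ powersetCard k univ, antisymExt a (m + indZ ε) := by
  by_cases hm : Function.Injective m
  · have key : ∀ σ : Perm (Fin n), b (m ∘ σ - staircase n) =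
        ∑ ε ∈ powersetCard k univ, a ((m + indZ ε) ∘ σ - staircase n) := by
      intro σ
      have h1 : ∀ ε, (m + indZ ε) ∘ σ - staircase n =
          (m ∘ σ - staircase n) + indZ (ε.map σ.symm.toEmbedding) := by
        intro ε
        rw [← indZ_comp]
        funext i
        simp only [Pi.sub_apply, Pi.add_apply, Function.comp_apply]
        ring
      simp only [h1]
      rw [sum_powersetCard_perm (fun ε => a (m ∘ σ - staircase n + indZ ε)) k σ.symm]
      by_cases hd : Antitone (m ∘ σ - staircase n)
      · exact hab _ hd
      -- Both sides vanish. At a failure of dominance between neighbours, adding a 0/1 vector could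
      -- restore dominance only if the two coordinates of `m ∘ σ` were equal, which injectivity
      -- excludes.
      · rw [hb _ hd]
        symm
        refine sum_eq_zero fun ε _ => ha _ fun hanti => ?_
        rw [antitone_fin_iff] at hd hanti
        push Not at hd
        obtain ⟨i, j, hij, hlt⟩ := hd
        have h2 := hanti i j hij
        have h3 : i ≠ j := fun h => by simp [h] at hij
        have h4 : m (σ i) ≠ m (σ j) := fun h => h3 (σ.injective (hm h))
        simp only [Pi.sub_apply, Pi.add_apply, Function.comp_apply, staircase, indZ] at h2 hlt
        have : ((j : ℕ) : ℤ) = (i : ℕ) + 1 := by exact_mod_cast hij.symm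
        rw [this] at h2 hlt
        split_ifs at h2 <;> omega
    simp only [antisymExt, key]
    rw [sum_comm]
    simp only [mul_sum]
  -- With `m i = m j`, the transposition of `i` and `j` permutes the sets `ε` and negates every
  -- summand, so the right-hand side is its own negative.
  · rw [antisymExt_eq_zero b hm]
    simp only [Function.Injective, not_forall] at hm
    obtain ⟨i, j, hij, hne⟩ := hm
    have h1 : m ∘ (swap i j) = m := by
      funext x
      simp only [Function.comp_apply, swap_apply_def]
      split_ifs with h h' <;> simp [*]
    have h2 := sum_powersetCard_perm (fun ε => antisymExt a (m + indZ ε)) k (swap i j)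
    have h3 : ∀ ε : Finset (Fin n), antisymExt a (m + indZ (ε.map (swap i j).toEmbedding)) =
        - antisymExt a (m + indZ ε) := by
      intro ε
      have := antisymExt_comp_perm a (m + indZ ε) (swap i j)
      rw [Perm.sign_swap hne] at this
      rw [show (m + indZ ε) ∘ (swap i j) = m + indZ (ε.map (swap i j).toEmbedding) by
        have h4 := indZ_comp ε (swap i j)
        rw [symm_swap] at h4
        rw [← h4]
        conv_rhs => rw [← h1]
        rfl] at this
      simpa using this
    simp only [h3, sum_neg_distrib] at h2
    exact (self_eq_neg.mp h2.symm).symm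

/-- The shifted weight is strictly decreasing. A permutation of it stays dominant after subtracting
the staircase only if the permutation is increasing, hence trivial, so one summand survives. -/
theorem antisymExt_of_antitone {a : (Fin n → ℤ) → ℂ} (ha : ∀ l, ¬ Antitone l → a l = 0)
    {l : Fin n → ℤ} (hl : Antitone l) : antisymExt a (l + staircase n) = a l := by
  unfold antisymExt
  have hst : StrictAnti (l + staircase n) := by
    intro i j hij
    have := hl hij.le
    simp only [Pi.add_apply, staircase]
    have : (i : ℤ) < j := by exact_mod_cast hij
    omega
  rw [sum_eq_single 1]
  · have : (l + staircase n) ∘ (1 : Perm (Fin n)) - staircase n = l := by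
      funext i
      simp
    rw [this]
    simp
  · intro σ _ hσ
    rw [ha, mul_zero]
    intro hanti
    apply hσ
    have h1 : StrictMono σ := by
      intro i j hij
      have h2 := hanti hij.le
      simp only [Pi.sub_apply, Function.comp_apply, staircase] at h2
      have h3 : (i : ℤ) < j := by exact_mod_cast hij
      have h4 : (l + staircase n) (σ j) < (l + staircase n) (σ i) := by
        omega
      exact hst.lt_iff_gt.mp h4
    have h5 : Set.range σ = Set.range (id : Fin n → Fin n) := by
      simp [σ.surjective.range_eq]
    have := (StrictMono.range_inj h1 strictMono_id).mp h5
    ext i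
    simp [this]
  · simp

/-- The linear recurrence with characteristic polynomial `∏ (T - α_i)`. -/
def rootRec (α : Fin n → ℂ) : LinearRecurrence ℂ where
  order := n
  coeffs i := -((-1) ^ (n - (i : ℕ)) * esym α (n - i))

/-- A sequence is a solution if and only if the alternating sum with the elementary symmetric
polynomials vanishes. -/
theorem isSolution_rootRec_iff (α : Fin n → ℂ) (u : ℕ → ℂ) :
    (rootRec α).IsSolution u ↔
      ∀ m, ∑ k ∈ range (n + 1), (-1) ^ k * esym α k * u (m + (n - k)) = 0 := by
  have h0 : esym α 0 = 1 := by simp [esym]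
  refine forall_congr' fun m => ?_
  have h1 : ∑ k ∈ range (n + 1), (-1) ^ k * esym α k * u (m + (n - k)) =
      u (m + n) + ∑ i : Fin n, (-1) ^ (n - (i : ℕ)) * esym α (n - i) * u (m + i) := by
    rw [sum_range_succ', ← Finset.sum_range (fun i => (-1) ^ (n - i) * esym α (n - i) * u (m + i)),
      ← Finset.sum_range_reflect, add_comm]
    simp only [h0, pow_zero, one_mul, Nat.sub_zero]
    congr 1
    refine sum_congr rfl fun k hk => ?_
    rw [mem_range] at hk
    rw [show n - 1 - k + 1 = n - k by omega, show n - (n - k) = k by omega]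
  rw [h1]
  simp only [rootRec]
  simp only [neg_mul, sum_neg_distrib, eq_neg_iff_add_eq_zero]
  rfl

/-- The fundamental solutions of the recurrence. -/
def fundSol (α : Fin n → ℂ) (m : ℕ) (j : Fin n) : ℂ :=
  (rootRec α).mkSol (fun i : Fin n => if i = j then 1 else 0) m

theorem fundSol_isSolution (α : Fin n → ℂ) (j : Fin n) :
    (rootRec α).IsSolution (fun m => fundSol α m j) :=
  (rootRec α).is_sol_mkSol _

theorem fundSol_val (α : Fin n → ℂ) (i j : Fin n) : fundSol α i j = if i = j then 1 else 0 :=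
  (rootRec α).mkSol_eq_init _ i

/-- Both sides solve the recurrence and agree at the first `n` arguments. -/
theorem eq_sum_fundSol {α : Fin n → ℂ} {u : ℕ → ℂ} (hu : (rootRec α).IsSolution u) (m : ℕ) :
    u m = ∑ j : Fin n, fundSol α m j * u j := by
  have h : (fun m => ∑ j : Fin n, fundSol α m j * u j) ∈ (rootRec α).solSpace := by
    have : (fun m => ∑ j : Fin n, fundSol α m j * u j) =
        ∑ j : Fin n, u j • fun m => fundSol α m j := by
      funext m
      simp [mul_comm]
    rw [this]
    exact Submodule.sum_mem _ fun j _ => Submodule.smul_mem _ _ (fundSol_isSolution α j)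
  have h2 := (LinearRecurrence.eq_iff_eqOn_range_order (rootRec α) u _ hu
    ((rootRec α).is_sol_iff_mem_solSpace _ |>.mpr h)).mpr ?_
  · exact congrFun h2 m
  · intro i hi
    have hi' : i < n := by simpa [rootRec] using hi
    have : ∀ j, fundSol α i j = if (⟨i, hi'⟩ : Fin n) = j then 1 else 0 :=
      fun j => fundSol_val α ⟨i, hi'⟩ j
    simp [this]

/-- Toggling `i` in `ε` reverses the sign and leaves the argument unchanged, since the shift by `n -
#ε` in coordinate `i` compensates for the indicator. Together with the Pieri relations for all `k`,
this says that each coordinate separately satisfies the recurrence with roots `α`, in the manner of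
Cayley–Hamilton. -/
theorem sum_powerset_shift (b : (Fin n → ℤ) → ℂ) (m : Fin n → ℤ) (i : Fin n) :
    ∑ ε : Finset (Fin n), (-1) ^ ε.card *
      b (m + Pi.single i ((n : ℤ) - ε.card) + indZ ε) = 0 := by
  have hsc : ∀ ε : Finset (Fin n), i ∈ ε →
      m + Pi.single i ((n : ℤ) - ε.card) + indZ ε =
        m + Pi.single i ((n : ℤ) - (ε.erase i).card) + indZ (ε.erase i) := by
    intro ε hi
    rw [card_erase_of_mem hi]
    have : 1 ≤ ε.card := card_pos.mpr ⟨i, hi⟩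
    funext x
    by_cases hx : x = i
    · subst hx
      simp [indZ, hi, Nat.cast_sub this]
      ring
    · simp [indZ, hx]
  refine Finset.sum_involution (fun ε _ => if i ∈ ε then ε.erase i else insert i ε) ?_ ?_ ?_ ?_
  · intro ε _
    split_ifs with h
    · rw [← hsc ε h, card_erase_of_mem h]
      have : 1 ≤ ε.card := card_pos.mpr ⟨i, h⟩
      obtain ⟨c, hc⟩ := Nat.exists_eq_add_of_le' this
      rw [hc]
      simp [pow_succ]
    · have h' := hsc (insert i ε) (mem_insert_self i ε)
      rw [erase_insert h] at h'
      rw [h', card_insert_of_notMem h, pow_succ]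
      ring
  · intro ε _ _
    split_ifs with h
    · exact erase_ne_self.mpr h
    · exact insert_ne_self.mpr h
  · intro ε _; simp
  · intro ε _
    by_cases h : i ∈ ε
    · simp [h, insert_erase]
    · simp [h]

/-- The Schur function attached to `α` through the fundamental solutions. -/
def schur (α : Fin n → ℂ) (l : Fin n → ℕ) : ℂ :=
  (Matrix.of fun i j : Fin n => fundSol α (l i + (n - 1 - i)) j.rev).det

/-- With the other coordinates fixed, `b` solves the recurrence `rootRec α` in each coordinate.
Expanding one coordinate after another reduces everything to the values on `{0, …, n - 1}^n`. -/
theorem antisymExt_eq_sum {α : Fin n → ℂ} {b : (Fin n → ℤ) → ℂ}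
    (hb : ∀ k ≤ n, ∀ m, esym α k * b m = ∑ ε ∈ powersetCard k univ, b (m + indZ ε))
    (m : Fin n → ℕ) :
    b (fun i => m i) = ∑ j : Fin n → Fin n, (∏ i, fundSol α (m i) (j i)) * b (fun i => j i) := by
  have hsol : ∀ (m : Fin n → ℤ) (i : Fin n),
      (rootRec α).IsSolution (fun t => b (Function.update m i t)) := by
    intro m i
    rw [isSolution_rootRec_iff]
    intro t
    have h1 := sum_powerset_shift b (Function.update m i t) i
    rw [← powerset_univ, sum_powerset, card_univ, Fintype.card_fin] at h1
    rw [← h1]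
    refine sum_congr rfl fun k hk => ?_
    have hk' : k ≤ n := by rw [mem_range] at hk; omega
    have h2 : Function.update m i ((t + (n - k) : ℕ) : ℤ) =
        Function.update m i t + Pi.single i ((n : ℤ) - k) := by
      funext x
      by_cases hx : x = i
      · subst hx; simp [Nat.cast_sub hk']
      · simp [hx]
    rw [h2, mul_assoc, hb k hk', mul_sum]
    refine sum_congr rfl fun ε hε => ?_
    rw [(mem_powersetCard.mp hε).2]
  -- Here `s` is the set of coordinates already expanded. Outside `s` the index function is frozen
  -- to the identity, so that each choice on `s` is counted once.
  have main : ∀ (s : Finset (Fin n)) (m : Fin n → ℕ), b (fun i => m i) =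
      ∑ j ∈ Fintype.piFinset (fun _ : Fin n => (univ : Finset (Fin n))) with
        (∀ i ∉ s, j i = i), (∏ i ∈ s, fundSol α (m i) (j i)) *
          b (fun i => if i ∈ s then (j i : ℤ) else m i) := by
    intro s
    induction s using Finset.induction_on with
    | empty =>
      intro m
      have : (Finset.filter (fun j : Fin n → Fin n => ∀ i ∉ (∅ : Finset (Fin n)), j i = i)
          (Fintype.piFinset fun _ : Fin n => univ)) = {id} := by
        ext j
        simp [funext_iff]
      rw [this]
      simp
    | insert x s hx ih =>
      intro m
      rw [ih m]
      have h3 : ∀ j : Fin n → Fin n, b (fun i => if i ∈ s then (j i : ℤ) else m i) =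
          ∑ y : Fin n, fundSol α (m x) y *
            b (fun i => if i ∈ insert x s then (Function.update j x y i : ℤ) else m i) := by
        intro j
        have h4 := eq_sum_fundSol (hsol (fun i => if i ∈ s then (j i : ℤ) else m i) x) (m x)
        have h5 : Function.update (fun i => if i ∈ s then (j i : ℤ) else m i) x (m x : ℤ) =
            fun i => if i ∈ s then (j i : ℤ) else m i := by
          funext i
          by_cases hi : i = x
          · subst hi; simp [hx]
          · simp [hi]
        simp only [h5] at h4
        rw [h4]
        refine sum_congr rfl fun y _ => ?_
        congr 2
        funext i
        by_cases hi : i = x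
        · subst hi; simp
        · simp [hi]
      simp only [h3, mul_sum]
      rw [← sum_product']
      refine Finset.sum_bij' (fun p _ => Function.update p.1 x p.2)
        (fun j _ => (Function.update j x x, j x)) ?_ ?_ ?_ ?_ ?_
      · rintro ⟨j, y⟩ h
        simp only [mem_product, mem_filter, mem_univ, and_true, Fintype.mem_piFinset,
          implies_true, true_and] at h ⊢
        intro i hi
        rw [mem_insert, not_or] at hi
        simp [hi.1, h i hi.2]
      · intro j h
        simp only [mem_product, mem_filter, mem_univ, and_true, Fintype.mem_piFinset,
          implies_true, true_and] at h ⊢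
        intro i hi
        by_cases hix : i = x
        · subst hix; simp
        · simp [hix, h i (by simp [hix, hi])]
      · rintro ⟨j, y⟩ h
        simp only [mem_product, mem_filter, mem_univ, and_true, Fintype.mem_piFinset,
          implies_true, true_and] at h
        have := h x hx
        ext i
        · simp only [Function.update_idem]
          by_cases hix : i = x
          · subst hix; simp [this]
          · simp [hix]
        · simp
      · intro j h
        simp
      · rintro ⟨j, y⟩ h
        rw [prod_insert hx]
        simp only [Function.update_self]
        rw [prod_congr rfl (fun i hi => by
          rw [Function.update_of_ne (ne_of_mem_of_not_mem hi hx)] :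
          ∀ i ∈ s, fundSol α (m i) (Function.update j x y i) = fundSol α (m i) (j i))]
        ring
  have := main univ m
  simpa using this

/-- Uniqueness in Pieri's rule. The antisymmetric extension satisfies the rule on the whole lattice,
hence is determined by its values on `{0, …, n - 1}^n`. There only permutations of the staircase
contribute, and the expansion collapses to the determinant defining `schur`. The `α i` need not be
distinct. -/
theorem eq_schur_of_pieri {α : Fin n → ℂ} {a : (Fin n → ℤ) → ℂ}
    (ha : ∀ l, ¬ Antitone l → a l = 0)
    (hp : ∀ k, 1 ≤ k → k ≤ n → ∀ l, Antitone l →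
      esym α k * a l = ∑ ε ∈ powersetCard k univ, a (l + indZ ε))
    {l : Fin n → ℕ} (hl : Antitone l) : a (fun i => l i) = a 0 * schur α l := by
  have hE : ∀ k ≤ n, ∀ m, esym α k * antisymExt a m =
      ∑ ε ∈ powersetCard k univ, antisymExt a (m + indZ ε) := by
    intro k hk m
    rcases Nat.eq_zero_or_pos k with rfl | hk0
    · have : (indZ (∅ : Finset (Fin n))) = 0 := by funext; simp [indZ]
      simp [esym, this]
    · rw [← antisymExt_pieri (b := fun l => esym α k * a l) ha
        (fun l h => by simp only [ha l h, mul_zero]) (fun l h => hp k hk0 hk l h) m]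
      simp only [antisymExt, mul_sum]
      exact sum_congr rfl fun σ _ => by ring
  have hcast : ∀ l : Fin n → ℕ, (fun i => (l i : ℤ)) + staircase n =
      fun i => ((l i + (n - 1 - i) : ℕ) : ℤ) := by
    intro l
    funext i
    have := i.isLt
    simp only [Pi.add_apply, staircase]
    omega
  have hperm : ∀ m : Fin n → ℕ, antisymExt a (fun i => m i) =
      antisymExt a (fun i => ((i.rev : Fin n) : ℕ)) *
        (Matrix.of fun i j : Fin n => fundSol α (m i) j.rev).det := by
    intro m
    rw [antisymExt_eq_sum hE m, ← Matrix.det_transpose, Matrix.det_apply']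
    have h0 : ∀ j : Fin n → Fin n, ¬ Function.Injective j →
        antisymExt a (fun i => ((j i : ℕ) : ℤ)) = 0 := fun j hj =>
      antisymExt_eq_zero _ fun h => hj fun x y hxy => h (by simp [hxy])
    rw [mul_sum]
    symm
    refine Finset.sum_of_injOn (fun σ : Perm (Fin n) => (fun i => (σ i).rev)) ?_ ?_ ?_ ?_
    · intro σ _ τ _ h
      exact Equiv.ext fun i => Fin.rev_injective (congrFun h i)
    · intro σ _; simp
    · intro j _ hj
      rw [h0 j, mul_zero]
      intro hinj
      apply hj
      have hb : Function.Bijective (fun i => (j i).rev) :=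
        (Finite.injective_iff_bijective).mp (Fin.rev_injective.comp hinj)
      exact ⟨Equiv.ofBijective _ hb, by simp, by funext i; simp⟩
    · intro σ _
      have := antisymExt_comp_perm a (fun i => ((i.rev : Fin n) : ℕ)) σ
      have h3 : (fun i : Fin n => (((i.rev : Fin n) : ℕ) : ℤ)) ∘ σ =
          fun i => (((σ i).rev : ℕ) : ℤ) := rfl
      rw [h3] at this
      rw [this]
      simp only [Matrix.transpose_apply, Matrix.of_apply]
      ring
  have h1 : a (fun i => l i) = antisymExt a (fun i => ((l i + (n - 1 - i) : ℕ) : ℤ)) := by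
    rw [← hcast, antisymExt_of_antitone ha]
    intro i j hij
    exact Int.ofNat_le.mpr (hl hij)
  have h2 : a 0 = antisymExt a (fun i : Fin n => ((i.rev : Fin n) : ℕ)) := by
    have := antisymExt_of_antitone ha (l := (0 : Fin n → ℤ)) (fun _ _ _ => le_rfl)
    rw [← this]
    congr 1
    funext i
    have := i.isLt
    simp only [Pi.add_apply, Pi.zero_apply, staircase, Fin.val_rev]
    omega
  rw [h1, hperm, h2]
  rfl

end Schur

end AsaiZeta

namespace AsaiZeta

/-! ### Generating functions of alternants -/

section Alternant

open Finset

variable {n : ℕ}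

/-- The dominant weight with coordinates `m` in the basis of fundamental weights. -/
def domWeight (m : Fin n → ℕ) (i : Fin n) : ℕ := ∑ k, if i ≤ k then m k else 0

theorem domWeight_snoc_castSucc (m : Fin n → ℕ) (t : ℕ) (i : Fin n) :
    domWeight (Fin.snoc m t : Fin (n + 1) → ℕ) i.castSucc = domWeight m i + t := by
  simp [domWeight, Fin.sum_univ_castSucc, Fin.le_last]

theorem domWeight_snoc_last (m : Fin n → ℕ) (t : ℕ) :
    domWeight (Fin.snoc m t : Fin (n + 1) → ℕ) (Fin.last n) = t := by
  simp [domWeight, Fin.sum_univ_castSucc]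

/-- The product of `f (x_i) (x_j)` over all pairs `i < j`. -/
def pairProd (f : ℂ → ℂ → ℂ) (x : Fin n → ℂ) : ℂ :=
  ∏ i, ∏ j, if i < j then f (x i) (x j) else 1

theorem pairProd_succAbove (f : ℂ → ℂ → ℂ) (x : Fin (n + 1) → ℂ) (p : Fin (n + 1)) :
    pairProd f x = pairProd f (x ∘ p.succAbove) *
      ∏ k, if p < p.succAbove k then f (x p) (x (p.succAbove k))
        else f (x (p.succAbove k)) (x p) := by
  unfold pairProd
  rw [Fin.prod_univ_succAbove _ p, Fin.prod_univ_succAbove _ p]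
  simp only [lt_self_iff_false, if_false, one_mul]
  have h : ∀ i, (∏ j, if p.succAbove i < j then f (x (p.succAbove i)) (x j) else 1) =
      (if p.succAbove i < p then f (x (p.succAbove i)) (x p) else 1) *
        ∏ j, if i < j then f (x (p.succAbove i)) (x (p.succAbove j)) else 1 := by
    intro i
    rw [Fin.prod_univ_succAbove _ p]
    simp only [Fin.succAbove_lt_succAbove_iff]
  simp only [h, prod_mul_distrib, Function.comp_apply]
  rw [← mul_assoc, ← prod_mul_distrib, mul_comm]
  congr 1
  refine prod_congr rfl fun k _ => ?_
  rcases lt_or_gt_of_ne (Fin.succAbove_ne p k) with h | h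
  · simp [h, not_lt_of_gt h]
  · simp [h, not_lt_of_gt h]

theorem pairProd_succAbove_of_symm {f : ℂ → ℂ → ℂ} (hf : ∀ a b, f a b = f b a)
    (x : Fin (n + 1) → ℂ) (p : Fin (n + 1)) :
    pairProd f x = pairProd f (x ∘ p.succAbove) * ∏ k, f (x p) (x (p.succAbove k)) := by
  rw [pairProd_succAbove f x p]
  congr 1
  refine prod_congr rfl fun k _ => ?_
  split_ifs
  · rfl
  · exact hf _ _

/-- The sign counts the `p` pairs in which `x p` is the second entry. -/
theorem pairProd_sub_succAbove (x : Fin (n + 1) → ℂ) (p : Fin (n + 1)) :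
    pairProd (· - ·) x = pairProd (· - ·) (x ∘ p.succAbove) *
      ((-1) ^ (p : ℕ) * ∏ k, (x p - x (p.succAbove k))) := by
  rw [pairProd_succAbove _ x p]
  congr 1
  have h1 : (-1 : ℂ) ^ (p : ℕ) = ∏ k : Fin n, if p < p.succAbove k then (1 : ℂ) else -1 := by
    rw [prod_ite, prod_const_one, one_mul, prod_const]
    congr 1
    have : (univ.filter fun k : Fin n => ¬ p < p.succAbove k) =
        univ.filter fun k : Fin n => (k : ℕ) < p := by
      ext k
      simp only [mem_filter, mem_univ, true_and]
      rw [Fin.lt_succAbove_iff_le_castSucc, not_le, Fin.lt_def]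
      simp
    rw [this, Fin.card_filter_val_lt]
    have := p.isLt
    omega
  rw [h1, ← prod_mul_distrib]
  refine prod_congr rfl fun k _ => ?_
  split_ifs <;> ring

/-- The alternant attached to `d` times the dominant weight with coordinates `m`. -/
def alternant (d : ℕ) (x : Fin n → ℂ) (m : Fin n → ℕ) : ℂ :=
  (Matrix.of fun i j : Fin n => x i ^ (d * domWeight m j + (n - 1 - j))).det

theorem alternant_zero (d : ℕ) (x : Fin n → ℂ) : alternant d x 0 = pairProd (· - ·) x := by
  have h : (Matrix.of fun i j : Fin n => x i ^ (d * domWeight (0 : Fin n → ℕ) j + (n - 1 - j))) =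
      Matrix.projVandermonde (fun _ => 1) x := by
    ext i j
    simp only [domWeight, Matrix.of_apply, Matrix.projVandermonde_apply, Fin.val_rev]
    rw [show n - 1 - (j : ℕ) = n - (j + 1) by omega]
    simp
  rw [alternant, h, Matrix.det_projVandermonde, pairProd]
  refine prod_congr rfl fun i _ => ?_
  rw [← prod_filter]
  refine prod_congr ?_ fun j _ => by ring
  ext j
  simp

/-- The new coordinate `t` raises every weight by `t`, so `x i ^ (d * t)` comes out of row `i` and
the last column becomes constant `1`. Expansion along that column leaves alternants in `n` variables
with one spare factor per row. -/
theorem alternant_snoc (d : ℕ) (x : Fin (n + 1) → ℂ) (m : Fin n → ℕ) (t : ℕ) :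
    alternant d x (Fin.snoc m t) = ((∏ i, x i) ^ d) ^ t *
      ∑ i : Fin (n + 1), (-1) ^ ((i : ℕ) + n) * (∏ k, x (i.succAbove k)) *
        alternant d (x ∘ i.succAbove) m := by
  have h1 : (Matrix.of fun i j : Fin (n + 1) =>
      x i ^ (d * domWeight (Fin.snoc m t : Fin (n + 1) → ℕ) j + (n + 1 - 1 - j))) =
      Matrix.of fun i j : Fin (n + 1) => x i ^ (d * t) *
        (Matrix.of fun i j : Fin (n + 1) => if h : (j : ℕ) < n then
          x i * x i ^ (d * domWeight m ⟨j, h⟩ + (n - 1 - j)) else 1) i j := by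
    ext i j
    simp only [Matrix.of_apply]
    induction j using Fin.lastCases with
    | last => simp [domWeight_snoc_last]
    | cast j =>
      rw [domWeight_snoc_castSucc, dif_pos (by simp)]
      rw [← pow_succ', ← pow_add]
      congr 1
      have := j.isLt
      simp only [Fin.val_castSucc, Fin.eta]
      rw [mul_add]
      omega
  rw [alternant, h1, Matrix.det_mul_column, Matrix.det_succ_column _ (Fin.last n),
    prod_pow, pow_mul]
  congr 1
  refine sum_congr rfl fun i _ => ?_
  simp only [Matrix.of_apply, Fin.val_last, lt_self_iff_false, dif_neg, not_false_eq_true, mul_one,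
    mul_assoc]
  congr 1
  have h2 : (Matrix.of fun i j : Fin (n + 1) => if h : (j : ℕ) < n then
      x i * x i ^ (d * domWeight m ⟨j, h⟩ + (n - 1 - j)) else 1).submatrix i.succAbove
        (Fin.last n).succAbove = Matrix.of fun k j : Fin n => x (i.succAbove k) *
          (Matrix.of fun k j : Fin n =>
            (x ∘ i.succAbove) k ^ (d * domWeight m j + (n - 1 - j))) k j := by
    ext k j
    simp
  rw [h2, Matrix.det_mul_column]
  rfl

/-- Lagrange interpolation of the leading coefficient. -/
theorem coeff_eq_sum_succAbove {v : Fin (n + 1) → ℂ} (hv : Function.Injective v)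
    {p : Polynomial ℂ} (hp : p.natDegree ≤ n) :
    p.coeff n = ∑ i, p.eval (v i) / ∏ k, (v i - v (i.succAbove k)) := by
  have h := Lagrange.coeff_eq_sum (s := univ) (v := v) hv.injOn (P := p) (by
    rw [card_univ, Fintype.card_fin]
    exact lt_of_le_of_lt Polynomial.degree_le_natDegree (by exact_mod_cast Nat.lt_succ_of_le hp))
  rw [card_univ, Fintype.card_fin, Nat.add_sub_cancel] at h
  rw [h]
  refine sum_congr rfl fun i _ => ?_
  congr 1
  rw [show univ.erase i = univ.image i.succAbove by
    rw [Fin.image_succAbove_univ]; ext; simp]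
  rw [prod_image (fun a _ b _ h => Fin.succAbove_right_injective h)]

/-- The polynomial `∏ (1 - y_k T)`. -/
def revPoly {m : ℕ} (y : Fin m → ℂ) : Polynomial ℂ :=
  ∏ k, (1 - Polynomial.C (y k) * Polynomial.X)

theorem revPoly_eval {m : ℕ} (y : Fin m → ℂ) (t : ℂ) :
    (revPoly y).eval t = ∏ k, (1 - y k * t) := by
  simp [revPoly, Polynomial.eval_prod]

theorem natDegree_one_sub_le (a : ℂ) :
    (1 - Polynomial.C a * Polynomial.X : Polynomial ℂ).natDegree ≤ 1 := by
  compute_degree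

theorem revPoly_natDegree_le {m : ℕ} (y : Fin m → ℂ) : (revPoly y).natDegree ≤ m := by
  refine (Polynomial.natDegree_prod_le _ _).trans ?_
  refine (sum_le_card_nsmul _ _ 1 fun i _ => natDegree_one_sub_le _).trans ?_
  simp

theorem revPoly_coeff {m : ℕ} (y : Fin m → ℂ) : (revPoly y).coeff m = ∏ k, (- y k) := by
  have h := Polynomial.coeff_prod_of_natDegree_le (univ : Finset (Fin m))
    (fun k => (1 - Polynomial.C (y k) * Polynomial.X : Polynomial ℂ)) 1
    (fun i _ => natDegree_one_sub_le _)
  simp only [card_univ, Fintype.card_fin, mul_one] at h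
  rw [revPoly, h]
  refine prod_congr rfl fun k _ => ?_
  simp [Polynomial.coeff_one]

theorem cons_zero_injective {x : Fin n → ℂ} (hx : Function.Injective x) (h0 : ∀ i, x i ≠ 0) :
    Function.Injective (Fin.cons 0 x : Fin (n + 1) → ℂ) :=
  Fin.cons_injective_iff.mpr ⟨fun ⟨i, hi⟩ => h0 i hi, hx⟩

/-- Partial fractions with nodes `x_i` and `0`. -/
theorem sum_eval_div_nodes_zero {x : Fin (n + 1) → ℂ} (hx : Function.Injective x)
    (h0 : ∀ i, x i ≠ 0) {p : Polynomial ℂ} (hp : p.natDegree ≤ n + 1) :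
    ∑ i, p.eval (x i) / (x i * ∏ k, (x i - x (i.succAbove k))) =
      p.coeff (n + 1) - p.eval 0 / ∏ k, (- x k) := by
  have h := coeff_eq_sum_succAbove (cons_zero_injective hx h0) hp
  rw [Fin.sum_univ_succ] at h
  simp only [Fin.cons_zero, Fin.cons_succ, Fin.succAbove_zero, zero_sub] at h
  rw [h, add_sub_cancel_left]
  refine sum_congr rfl fun i _ => ?_
  congr 1
  rw [Fin.prod_univ_succ]
  simp

/-- Partial fractions with nodes `x_i`, `0` and `-1`. -/
theorem sum_eval_div_nodes_zero_neg_one {x : Fin (n + 1) → ℂ} (hx : Function.Injective x)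
    (h0 : ∀ i, x i ≠ 0) (h1 : ∀ i, x i ≠ -1) {p : Polynomial ℂ} (hp : p.natDegree ≤ n + 1) :
    ∑ i, p.eval (x i) / ((x i + 1) * (x i * ∏ k, (x i - x (i.succAbove k)))) =
      p.eval (-1) / ∏ k, (-1 - x k) - p.eval 0 / ∏ k, (- x k) := by
  have hinj : Function.Injective (Fin.cons (-1) (Fin.cons 0 x : Fin (n + 2) → ℂ) :
      Fin (n + 3) → ℂ) := by
    refine Fin.cons_injective_iff.mpr ⟨?_, cons_zero_injective hx h0⟩
    rintro ⟨i, hi⟩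
    induction i using Fin.cases with
    | zero => simp at hi
    | succ i => exact h1 i (by simpa using hi)
  have h := coeff_eq_sum_succAbove hinj (hp.trans (Nat.le_succ _))
  -- There are `n + 3` nodes and the degree is at most `n + 1`, so the interpolated top coefficient
  -- is zero.
  rw [Polynomial.coeff_eq_zero_of_natDegree_lt (by omega), Fin.sum_univ_succ,
    Fin.sum_univ_succ] at h
  simp only [Fin.cons_zero, Fin.cons_succ, Fin.succAbove_zero, Fin.prod_univ_succ,
    Fin.succ_succAbove_zero, Fin.succ_succAbove_succ, sub_neg_eq_add, zero_add, zero_sub,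
    sub_zero, one_mul] at h
  simp only [Fin.prod_univ_succ]
  rw [eq_sub_iff_add_eq]
  have e1 : (-1 : ℂ) * ((-1 - x 0) * ∏ i : Fin n, (-1 - x i.succ)) =
      -((-1 - x 0) * ∏ i : Fin n, (-1 - x i.succ)) := by ring
  rw [e1, div_neg, neg_neg, one_mul] at h
  linear_combination -h

theorem prod_neg_fin {m : ℕ} (x : Fin m → ℂ) : ∏ k, (- x k) = (-1) ^ m * ∏ k, x k := by
  rw [prod_neg, card_univ, Fintype.card_fin]

/-- Partial fractions of `∏ (1 - x_k T)` at the nodes `x_i` and `0`; the factor with `k = i`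
supplies `1 - x_i ^ 2`. It drives the induction of `hasSum_alternant` for `d = 2`. -/
theorem lagrange_two {x : Fin (n + 1) → ℂ} (hx : Function.Injective x) (h0 : ∀ i, x i ≠ 0) :
    ∑ i, (-1) ^ n * ((∏ k, x (i.succAbove k)) * (1 - x i ^ 2) *
      ∏ k, ((1 - x i * x (i.succAbove k)) / (x i - x (i.succAbove k)))) =
      1 - (∏ k, x k) ^ 2 := by
  have h := sum_eval_div_nodes_zero hx h0 (revPoly_natDegree_le x)
  rw [revPoly_coeff] at h
  simp only [revPoly_eval, prod_neg_fin, mul_zero, sub_zero, prod_const_one] at h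
  have hP : ∏ k, x k ≠ 0 := prod_ne_zero_iff.mpr fun i _ => h0 i
  have hsq : ((-1 : ℂ) ^ n) * (-1) ^ n = 1 := by rw [← mul_pow]; simp
  have h2 : ∑ i, (-1) ^ n * ((∏ k, x (i.succAbove k)) * (1 - x i ^ 2) *
      ∏ k, ((1 - x i * x (i.succAbove k)) / (x i - x (i.succAbove k)))) =
      (-1) ^ n * (∏ k, x k) *
        ∑ i, (∏ k, (1 - x k * x i)) / (x i * ∏ k, (x i - x (i.succAbove k))) := by
    rw [mul_sum]
    refine sum_congr rfl fun i _ => ?_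
    rw [Fin.prod_univ_succAbove x i, Fin.prod_univ_succAbove (fun k => 1 - x k * x i) i,
      prod_div_distrib, mul_div_mul_comm,
      show (1 - x i * x i) / x i = (1 - x i ^ 2) * (x i)⁻¹ by rw [div_eq_mul_inv]; ring]
    have : ∀ k, 1 - x (i.succAbove k) * x i = 1 - x i * x (i.succAbove k) := fun k => by ring
    simp only [this]
    have hi := h0 i
    field_simp
  rw [h2, h, pow_succ]
  have hs : ((-1 : ℂ) ^ n) ≠ 0 := by simp
  field_simp
  linear_combination (-(∏ k, x k) ^ 2) * hsq

/-- Compared with `lagrange_two`, the factor `1 - x_i` arises from `1 - x_i ^ 2` by division by `1 +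
x_i`. This introduces the node `-1`, whose contribution is only a sign. -/
theorem lagrange_one {x : Fin (n + 1) → ℂ} (hx : Function.Injective x) (h0 : ∀ i, x i ≠ 0)
    (h1 : ∀ i, x i ≠ -1) :
    ∑ i, (-1) ^ n * ((∏ k, x (i.succAbove k)) * (1 - x i ^ 1) *
      ∏ k, ((1 - x i * x (i.succAbove k)) / (x i - x (i.succAbove k)))) =
      1 - (∏ k, x k) ^ 1 := by
  have h := sum_eval_div_nodes_zero_neg_one hx h0 h1 (revPoly_natDegree_le x)
  simp only [revPoly_eval, prod_neg_fin, mul_zero, sub_zero, prod_const_one, mul_neg, mul_one,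
    sub_neg_eq_add] at h
  have hP : ∏ k, x k ≠ 0 := prod_ne_zero_iff.mpr fun i _ => h0 i
  have hQ : ∏ k, (1 + x k) ≠ 0 := prod_ne_zero_iff.mpr fun i _ h => h1 i (by
    linear_combination h)
  have hQ' : ∏ k, (-1 - x k) = (-1) ^ (n + 1) * ∏ k, (1 + x k) := by
    rw [← prod_neg_fin]
    exact prod_congr rfl fun k _ => by ring
  have hsq : ((-1 : ℂ) ^ n) * (-1) ^ n = 1 := by rw [← mul_pow]; simp
  have h2 : ∑ i, (-1) ^ n * ((∏ k, x (i.succAbove k)) * (1 - x i ^ 1) *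
      ∏ k, ((1 - x i * x (i.succAbove k)) / (x i - x (i.succAbove k)))) =
      (-1) ^ n * (∏ k, x k) * ∑ i, (∏ k, (1 - x k * x i)) /
        ((x i + 1) * (x i * ∏ k, (x i - x (i.succAbove k)))) := by
    rw [mul_sum]
    refine sum_congr rfl fun i _ => ?_
    have hi := h0 i
    have hi1 : x i + 1 ≠ 0 := fun h => h1 i (by linear_combination h)
    rw [Fin.prod_univ_succAbove x i, Fin.prod_univ_succAbove (fun k => 1 - x k * x i) i,
      prod_div_distrib, ← mul_assoc (x i + 1), mul_div_mul_comm,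
      show (1 - x i * x i) / ((x i + 1) * x i) = (1 - x i ^ 1) * (x i)⁻¹ by field_simp; ring]
    have : ∀ k, 1 - x (i.succAbove k) * x i = 1 - x i * x (i.succAbove k) := fun k => by ring
    simp only [this]
    field_simp
  rw [h2, h, hQ', pow_succ]
  have hs : ((-1 : ℂ) ^ n) ≠ 0 := by simp
  field_simp
  ring

/-- Two partial fraction expansions. For fixed `i`, the sum over `j` interpolates a polynomial of
degree at most `n` at the `y_j` and `0`, and its value does not depend on `i`; the sum over `i` is
then the expansion of `∏ (1 - y_l T)` at the `x_i` and `0`. -/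
theorem lagrange_cauchy {x y : Fin (n + 1) → ℂ} (hx : Function.Injective x) (h0 : ∀ i, x i ≠ 0)
    (hy : Function.Injective y) (h0' : ∀ i, y i ≠ 0) :
    ∑ i, ∑ j, (∏ k, x (i.succAbove k)) * (∏ k, y (j.succAbove k)) *
      ((∏ l, (1 - x i * y l)) * (∏ k, (1 - x (i.succAbove k) * y j)) /
        ((∏ k, (x i - x (i.succAbove k))) * ∏ k, (y j - y (j.succAbove k)))) =
      1 - (∏ k, x k) * ∏ k, y k := by
  have hP : ∏ k, x k ≠ 0 := prod_ne_zero_iff.mpr fun i _ => h0 i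
  have hP' : ∏ k, y k ≠ 0 := prod_ne_zero_iff.mpr fun i _ => h0' i
  have hsq : ((-1 : ℂ) ^ n) * (-1) ^ n = 1 := by rw [← mul_pow]; simp
  have hs : ((-1 : ℂ) ^ n) ≠ 0 := by simp
  have h1 : ∀ i : Fin (n + 1), ∑ j, (∏ k, (1 - x (i.succAbove k) * y j)) /
      (y j * ∏ k, (y j - y (j.succAbove k))) = (-1) ^ n / ∏ k, y k := by
    intro i
    have h := sum_eval_div_nodes_zero hy h0'
      ((revPoly_natDegree_le (x ∘ i.succAbove)).trans (Nat.le_succ n))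
    rw [Polynomial.coeff_eq_zero_of_natDegree_lt
      (Nat.lt_succ_of_le (revPoly_natDegree_le (x ∘ i.succAbove)))] at h
    simp only [revPoly_eval, prod_neg_fin, mul_zero, sub_zero, prod_const_one,
      Function.comp_apply] at h
    rw [h, pow_succ]
    field_simp
    linear_combination -hsq
  have h2 := sum_eval_div_nodes_zero hx h0 (revPoly_natDegree_le y)
  rw [revPoly_coeff] at h2
  simp only [revPoly_eval, prod_neg_fin, mul_zero, sub_zero, prod_const_one] at h2
  have h3 : ∀ i j : Fin (n + 1), (∏ k, x (i.succAbove k)) * (∏ k, y (j.succAbove k)) *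
      ((∏ l, (1 - x i * y l)) * (∏ k, (1 - x (i.succAbove k) * y j)) /
        ((∏ k, (x i - x (i.succAbove k))) * ∏ k, (y j - y (j.succAbove k)))) =
      (∏ k, x k) * (∏ k, y k) * ((∏ l, (1 - y l * x i)) /
        (x i * ∏ k, (x i - x (i.succAbove k)))) * ((∏ k, (1 - x (i.succAbove k) * y j)) /
      (y j * ∏ k, (y j - y (j.succAbove k)))) := by
    intro i j
    rw [Fin.prod_univ_succAbove x i, Fin.prod_univ_succAbove y j]
    have hi := h0 i
    have hj := h0' j
    have : ∀ l, 1 - y l * x i = 1 - x i * y l := fun k => by ring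
    simp only [this]
    generalize (∏ k, (1 - x (i.succAbove k) * y j)) = A
    field_simp
  simp only [h3, ← mul_sum, h1, ← sum_mul]
  rw [h2, pow_succ]
  field_simp
  linear_combination (-((∏ k, x k) * ∏ k, y k)) * hsq

end Alternant

end AsaiZeta

namespace AsaiZeta

/-! ### Littlewood's and Cauchy's identities as convergent series. -/

section SchurSeries

open Finset Filter Topology

variable {n : ℕ}

theorem norm_prod_lt_one {x : Fin (n + 1) → ℂ} (h : ∀ i, ‖x i‖ < 1) : ‖∏ i, x i‖ < 1 := by
  rw [Fin.prod_univ_succ, norm_mul]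
  have h2 : ‖∏ i : Fin n, x i.succ‖ ≤ 1 := by
    rw [norm_prod]
    exact prod_le_one (fun i _ => norm_nonneg _) fun i _ => (h _).le
  calc ‖x 0‖ * ‖∏ i : Fin n, x i.succ‖ ≤ ‖x 0‖ * 1 := by gcongr
    _ < 1 := by simpa using h 0

theorem one_sub_ne_zero_of_norm_lt {z : ℂ} (h : ‖z‖ < 1) : 1 - z ≠ 0 := by
  intro h0
  rw [← sub_eq_zero.mp h0] at h
  simp at h

/-- Peeling off the last coordinate of a sum over `Fin (n + 1) → ℕ`. -/
theorem hasSum_snoc {f : (Fin (n + 1) → ℕ) → ℂ} {g : (Fin n → ℕ) → ℂ} {a z : ℂ} (hz : ‖z‖ < 1)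
    (hf : ∀ m t, f (Fin.snoc m t) = z ^ t * g m) (hg : HasSum g a) :
    HasSum f ((1 - z)⁻¹ * a) := by
  have h1 := hasSum_geometric_of_norm_lt_one hz
  have h2 := h1.mul hg (summable_mul_of_summable_norm h1.summable.norm hg.summable.norm)
  rw [← (Fin.snocEquiv (fun _ : Fin (n + 1) => ℕ)).hasSum_iff]
  refine h2.congr_fun ?_ |> fun h => h
  intro p
  exact hf p.2 p.1

theorem summable_prod_pow (r : ℝ) (h0 : 0 ≤ r) (h1 : r < 1) :
    Summable fun m : Fin n → ℕ => r ^ (∑ k, m k) := by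
  suffices h : ∃ a, HasSum (fun m : Fin n → ℕ => (r : ℂ) ^ (∑ k, m k)) a by
    obtain ⟨a, ha⟩ := h
    have := ha.summable.norm
    simpa [abs_of_nonneg h0] using this
  induction n with
  | zero => exact ⟨_, hasSum_fintype _⟩
  | succ n ih =>
    obtain ⟨a, ha⟩ := ih
    refine ⟨_, hasSum_snoc (z := (r : ℂ)) (by simpa [abs_of_nonneg h0] using h1) ?_ ha⟩
    intro m t
    rw [Fin.sum_univ_castSucc]
    simp [pow_add, mul_comm]

/-- The value of the generating function of alternants. -/
def littlewoodFactor (d : ℕ) (x : Fin n → ℂ) : ℂ :=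
  (∏ i, (1 - x i ^ d)⁻¹) * pairProd (fun a b => (1 - a * b)⁻¹) x

/-- Induction on `n`. Summing over the last coordinate gives a geometric series in `(∏ x_i) ^ d`,
and expanding the alternant gives sums in `n` variables. That these add up to the product formula is
exactly `lagrange_one` or `lagrange_two`. -/
theorem hasSum_alternant {d : ℕ} (hd : d = 1 ∨ d = 2) {x : Fin n → ℂ}
    (hx : Function.Injective x) (h0 : ∀ i, x i ≠ 0) (h1 : ∀ i, ‖x i‖ < 1) :
    HasSum (alternant d x) (pairProd (· - ·) x * littlewoodFactor d x) := by
  induction n with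
  | zero =>
    have := hasSum_fintype (alternant d x)
    simpa [alternant, pairProd, littlewoodFactor] using this
  | succ n ih =>
    have hd0 : d ≠ 0 := by omega
    have hG := hasSum_sum (s := univ) fun (i : Fin (n + 1)) _ =>
      (ih (x := x ∘ i.succAbove) (hx.comp Fin.succAbove_right_injective) (fun k => h0 _)
        fun k => h1 _).mul_left ((-1) ^ ((i : ℕ) + n) * (∏ k, x (i.succAbove k)))
    have hP : ‖(∏ i, x i) ^ d‖ < 1 := by
      rw [norm_pow]
      exact pow_lt_one₀ (norm_nonneg _) (norm_prod_lt_one h1) hd0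
    have hS := hasSum_snoc hP (alternant_snoc d x) hG
    convert hS using 1
    have hL : ∑ i : Fin (n + 1), (-1) ^ n * ((∏ k, x (i.succAbove k)) * (1 - x i ^ d) *
        ∏ k, ((1 - x i * x (i.succAbove k)) / (x i - x (i.succAbove k)))) =
        1 - (∏ k, x k) ^ d := by
      rcases hd with rfl | rfl
      · exact lagrange_one hx h0 fun i h => by have := h1 i; rw [h] at this; simp at this
      · exact lagrange_two hx h0
    have hne := one_sub_ne_zero_of_norm_lt hP
    rw [eq_inv_mul_iff_mul_eq₀ hne, ← hL, sum_mul]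
    refine sum_congr rfl fun i _ => ?_
    have hxi : 1 - x i ^ d ≠ 0 := one_sub_ne_zero_of_norm_lt (by
      rw [norm_pow]; exact pow_lt_one₀ (norm_nonneg _) (h1 i) hd0)
    have hA : ∏ k, (x i - x (i.succAbove k)) ≠ 0 := prod_ne_zero_iff.mpr fun k _ =>
      sub_ne_zero.mpr fun h => (Fin.succAbove_ne i k) (hx h).symm
    have hB : ∏ k, (1 - x i * x (i.succAbove k)) ≠ 0 := prod_ne_zero_iff.mpr fun k _ =>
      one_sub_ne_zero_of_norm_lt (by
        rw [norm_mul]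
        exact mul_lt_one_of_nonneg_of_lt_one_left (norm_nonneg _) (h1 _) (h1 _).le)
    rw [littlewoodFactor, littlewoodFactor, pairProd_sub_succAbove x i,
      pairProd_succAbove_of_symm (f := fun a b => (1 - a * b)⁻¹)
        (fun a b => by rw [mul_comm]) x i, Fin.prod_univ_succAbove (fun i => (1 - x i ^ d)⁻¹) i,
      prod_div_distrib, prod_inv_distrib (f := fun k => 1 - x i * x (i.succAbove k))]
    simp only [Function.comp_apply, pow_add]
    field_simp

/-- The same induction with both alternants expanded along their last columns; the identity needed
is `lagrange_cauchy`. -/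
theorem hasSum_alternant_mul {x y : Fin n → ℂ}
    (hx : Function.Injective x) (h0 : ∀ i, x i ≠ 0) (h1 : ∀ i, ‖x i‖ < 1)
    (hy : Function.Injective y) (h0' : ∀ i, y i ≠ 0) (h1' : ∀ i, ‖y i‖ < 1) :
    HasSum (fun m => alternant 1 x m * alternant 1 y m) (pairProd (· - ·) x * pairProd (· - ·) y *
      ∏ i, ∏ j, (1 - x i * y j)⁻¹) := by
  induction n with
  | zero =>
    have := hasSum_fintype (fun m => alternant 1 x m * alternant 1 y m)
    simp [alternant, pairProd] at this ⊢
  | succ n ih =>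
    have hG := hasSum_sum (s := univ) fun (i : Fin (n + 1)) _ =>
      hasSum_sum (s := univ) fun (j : Fin (n + 1)) _ =>
      (ih (x := x ∘ i.succAbove) (hx.comp Fin.succAbove_right_injective) (fun k => h0 _)
        (fun k => h1 _) (y := y ∘ j.succAbove) (hy.comp Fin.succAbove_right_injective)
        (fun k => h0' _) fun k => h1' _).mul_left (((-1) ^ ((i : ℕ) + n) *
          (∏ k, x (i.succAbove k))) * ((-1) ^ ((j : ℕ) + n) * (∏ k, y (j.succAbove k))))
    have hP : ‖(∏ i, x i) * ∏ i, y i‖ < 1 := by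
      rw [norm_mul]
      exact mul_lt_one_of_nonneg_of_lt_one_left (norm_nonneg _) (norm_prod_lt_one h1)
        (norm_prod_lt_one h1').le
    have hS := hasSum_snoc hP (f := fun m => alternant 1 x m * alternant 1 y m) (fun m t => by
      rw [alternant_snoc, alternant_snoc, pow_one, pow_one, mul_pow, mul_mul_mul_comm,
        sum_mul_sum]
      congr 1
      exact sum_congr rfl fun i _ => sum_congr rfl fun j _ => mul_mul_mul_comm _ _ _ _) hG
    convert hS using 1
    have hne := one_sub_ne_zero_of_norm_lt hP
    rw [eq_inv_mul_iff_mul_eq₀ hne, ← lagrange_cauchy hx h0 hy h0', sum_mul]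
    refine sum_congr rfl fun i _ => ?_
    rw [sum_mul]
    refine sum_congr rfl fun j _ => ?_
    have hA : ∏ k, (x i - x (i.succAbove k)) ≠ 0 := prod_ne_zero_iff.mpr fun k _ =>
      sub_ne_zero.mpr fun h => (Fin.succAbove_ne i k) (hx h).symm
    have hA' : ∏ k, (y j - y (j.succAbove k)) ≠ 0 := prod_ne_zero_iff.mpr fun k _ =>
      sub_ne_zero.mpr fun h => (Fin.succAbove_ne j k) (hy h).symm
    have hxy : ∀ i j, 1 - x i * y j ≠ 0 := fun i j => one_sub_ne_zero_of_norm_lt (by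
        rw [norm_mul]
        exact mul_lt_one_of_nonneg_of_lt_one_left (norm_nonneg _) (h1 _) (h1' _).le)
    have hB : ∏ l, (1 - x i * y l) ≠ 0 := prod_ne_zero_iff.mpr fun k _ => hxy _ _
    have hB' : ∏ k, (1 - x (i.succAbove k) * y j) ≠ 0 := prod_ne_zero_iff.mpr fun k _ => hxy _ _
    rw [pairProd_sub_succAbove x i, pairProd_sub_succAbove y j,
      Fin.prod_univ_succAbove (fun i => ∏ j, (1 - x i * y j)⁻¹) i]
    have h3 : ∀ k, ∏ l, (1 - x (i.succAbove k) * y l)⁻¹ = (1 - x (i.succAbove k) * y j)⁻¹ *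
        ∏ l, (1 - x (i.succAbove k) * y (j.succAbove l))⁻¹ := fun k =>
      Fin.prod_univ_succAbove (fun l => (1 - x (i.succAbove k) * y l)⁻¹) j
    simp only [h3, prod_mul_distrib, Function.comp_apply, pow_add]
    rw [prod_inv_distrib (f := fun l => 1 - x i * y l),
      prod_inv_distrib (f := fun k => 1 - x (i.succAbove k) * y j)]
    have hs : ((-1 : ℂ) ^ n) * (-1) ^ n = 1 := by rw [← mul_pow]; simp
    generalize ((-1 : ℂ) ^ n) = c at *
    generalize (∏ k, (1 - x (i.succAbove k) * y j)) = A at *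
    generalize (∏ x_1, ∏ l, (1 - x (i.succAbove x_1) * y (j.succAbove l))⁻¹) = Z
    field_simp
    rw [pow_two, hs, mul_one]

/-- The numerator in the bialternant formula. -/
def bialternant (x : Fin n → ℂ) (l : Fin n → ℕ) : ℂ :=
  (Matrix.of fun i j : Fin n => x i ^ (l j + (n - 1 - j))).det

/-- `α i` is a root of the characteristic polynomial `∏ (T - α j)`. -/
theorem isSolution_pow (α : Fin n → ℂ) (i : Fin n) :
    (rootRec α).IsSolution (fun m => α i ^ m) := by
  rw [isSolution_rootRec_iff]
  intro m
  have h1 : ∏ j, (α i - α j) = 0 := prod_eq_zero (mem_univ i) (sub_self _)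
  have h2 : ∏ j, (α i - α j) = ∑ k ∈ range (n + 1), (-1) ^ k * esym α k * α i ^ (n - k) := by
    have h3 : ∀ j, α i - α j = -α j + α i := fun j => by ring
    simp only [h3]
    rw [prod_add, sum_powerset, card_univ, Fintype.card_fin]
    refine sum_congr rfl fun k hk => ?_
    rw [esym, mul_sum, sum_mul]
    refine sum_congr rfl fun ε hε => ?_
    have hc := (mem_powersetCard.mp hε).2
    rw [prod_neg, prod_const, card_sdiff_of_subset (subset_univ _), card_univ,
      Fintype.card_fin, hc]
  rw [h1] at h2
  calc ∑ k ∈ range (n + 1), (-1) ^ k * esym α k * α i ^ (m + (n - k))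
      = α i ^ m * ∑ k ∈ range (n + 1), (-1) ^ k * esym α k * α i ^ (n - k) := by
        rw [mul_sum]
        exact sum_congr rfl fun k _ => by rw [pow_add]; ring
    _ = 0 := by rw [← h2, mul_zero]

/-- The bialternant formula. The powers of `α i` solve the recurrence, so the matrix of powers is
the Vandermonde matrix times the matrix of fundamental solutions. -/
theorem schur_mul_pairProd (α : Fin n → ℂ) (l : Fin n → ℕ) :
    schur α l * pairProd (· - ·) α = bialternant α l := by
  have h0 : pairProd (· - ·) α =
      (Matrix.of fun i j : Fin n => α i ^ ((j.rev : Fin n) : ℕ)).det := by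
    rw [← alternant_zero 1 α, alternant]
    congr 1
    ext i j
    simp only [domWeight, Matrix.of_apply, Fin.val_rev]
    rw [show n - 1 - (j : ℕ) = n - (j + 1) by omega]
    simp
  rw [h0, mul_comm, schur, ← Matrix.det_transpose (Matrix.of fun i j : Fin n =>
    fundSol α (l i + (n - 1 - i)) j.rev), ← Matrix.det_mul, bialternant]
  congr 1
  ext i j
  simp only [Matrix.mul_apply, Matrix.of_apply, Matrix.transpose_apply]
  rw [eq_sum_fundSol (isSolution_pow α i) (l j + (n - 1 - j))]
  rw [← Equiv.sum_comp Fin.revPerm]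
  exact sum_congr rfl fun k _ => by rw [mul_comm]; simp

theorem bialternant_smul (c : ℂ) (x : Fin n → ℂ) (l : Fin n → ℕ) :
    bialternant (fun i => c * x i) l =
      c ^ (∑ i, l i) * c ^ (∑ i : Fin n, (n - 1 - (i : ℕ))) * bialternant x l := by
  rw [← pow_add, ← sum_add_distrib, ← prod_pow_eq_pow_sum, bialternant, bialternant,
    ← Matrix.det_mul_row]
  congr 1
  ext i j
  simp [mul_pow]

theorem pairProd_sub_smul (c : ℂ) (x : Fin n → ℂ) :
    pairProd (· - ·) (fun i => c * x i) =
      c ^ (∑ i : Fin n, (n - 1 - (i : ℕ))) * pairProd (· - ·) x := by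
  have h : ∀ y : Fin n → ℂ, pairProd (· - ·) y = bialternant y 0 := fun y => by
    rw [← alternant_zero 1 y, alternant, bialternant]
    congr 1
    ext i j
    simp [domWeight]
  rw [h, h, bialternant_smul]
  simp

theorem pairProd_sub_ne_zero {x : Fin n → ℂ} (hx : Function.Injective x) :
    pairProd (· - ·) x ≠ 0 := by
  refine prod_ne_zero_iff.mpr fun i _ => prod_ne_zero_iff.mpr fun j _ => ?_
  split_ifs with h
  · exact sub_ne_zero.mpr fun h' => h.ne (hx h')
  · exact one_ne_zero

theorem continuous_esym (k : ℕ) : Continuous fun α : Fin n → ℂ => esym α k := by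
  unfold esym
  fun_prop

theorem fundSol_add (α : Fin n → ℂ) (m : ℕ) (j : Fin n) :
    fundSol α (m + n) j = ∑ i : Fin n, (rootRec α).coeffs i * fundSol α (m + i) j :=
  fundSol_isSolution α j m

theorem continuous_fundSol (m : ℕ) (j : Fin n) : Continuous fun α : Fin n → ℂ => fundSol α m j := by
  induction m using Nat.strong_induction_on with
  | _ m ih =>
    by_cases hm : m < n
    · have : (fun α : Fin n → ℂ => fundSol α m j) =
          fun _ => if (⟨m, hm⟩ : Fin n) = j then 1 else 0 := by
        funext α
        exact fundSol_val α ⟨m, hm⟩ j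
      rw [this]
      exact continuous_const
    · obtain ⟨t, rfl⟩ := Nat.exists_eq_add_of_le' (not_lt.mp hm)
      simp only [fundSol_add]
      refine continuous_finsetSum _ fun i _ => Continuous.mul ?_ (ih _ (by omega))
      simp only [rootRec]
      exact (continuous_const.mul (continuous_esym _)).neg

/-- Each step of the recurrence costs at most the sum of the absolute values of its coefficients. -/
theorem norm_fundSol_le {α : Fin n → ℂ} {B : ℝ} (hB1 : 1 ≤ B)
    (hB : ∑ i : Fin n, ‖esym α (n - i)‖ ≤ B) (m : ℕ) (j : Fin n) : ‖fundSol α m j‖ ≤ B ^ m := by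
  induction m using Nat.strong_induction_on with
  | _ m ih =>
    by_cases hm : m < n
    · have : fundSol α m j = if (⟨m, hm⟩ : Fin n) = j then 1 else 0 := fundSol_val α ⟨m, hm⟩ j
      rw [this]
      have h1 : (1 : ℝ) ≤ B ^ m := one_le_pow₀ hB1
      split_ifs
      · simpa using h1
      · simpa using zero_le_one.trans h1
    · obtain ⟨t, rfl⟩ := Nat.exists_eq_add_of_le' (not_lt.mp hm)
      rw [fundSol_add]
      rcases Nat.eq_zero_or_pos n with rfl | hn
      · exact j.elim0
      calc ‖∑ i : Fin n, (rootRec α).coeffs i * fundSol α (t + i) j‖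
          ≤ ∑ i : Fin n, ‖esym α (n - i)‖ * B ^ (t + n - 1) := by
            refine (norm_sum_le _ _).trans (sum_le_sum fun i _ => ?_)
            rw [norm_mul]
            have h1 : ‖(rootRec α).coeffs i‖ = ‖esym α (n - i)‖ := by simp [rootRec]
            rw [h1]
            gcongr
            refine (ih (t + i) (by omega)).trans (pow_le_pow_right₀ hB1 ?_)
            have := i.isLt
            omega
        _ ≤ B * B ^ (t + n - 1) := by
            rw [← sum_mul]
            gcongr
        _ = B ^ (t + n) := by
            rw [← pow_succ']
            congr 1
            omega

theorem continuous_schur (l : Fin n → ℕ) : Continuous fun α : Fin n → ℂ => schur α l := by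
  unfold schur
  refine Continuous.matrix_det (continuous_matrix fun i j => ?_)
  exact continuous_fundSol _ _

/-- Locally uniform bound for Schur functions. -/
theorem exists_norm_schur_le (α : Fin n → ℂ) : ∃ B : ℝ, 1 ≤ B ∧ ∀ β ∈ Metric.closedBall α 1,
    (∀ i, ‖β i‖ ≤ B) ∧ ∀ l : Fin n → ℕ, ‖schur β l‖ ≤ B * B ^ ∑ i, l i := by
  have hc : Continuous fun β : Fin n → ℂ => ∑ i : Fin n, ‖esym β (n - i)‖ :=
    continuous_finsetSum _ fun i _ => (continuous_esym _).norm
  obtain ⟨B₀, hB₀⟩ := (isCompact_closedBall α 1).bddAbove_image hc.continuousOn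
  set B := max (max 1 B₀) (‖α‖ + 1) with hBdef
  have hB1 : 1 ≤ B := (le_max_left _ _).trans (le_max_left _ _)
  set D := ∑ i : Fin n, (n - 1 - (i : ℕ)) with hD
  have hcard : (1 : ℝ) ≤ (Fintype.card (Equiv.Perm (Fin n)) : ℝ) := by
    exact_mod_cast Fintype.card_pos
  have hBD : (1 : ℝ) ≤ B ^ D := one_le_pow₀ hB1
  -- The determinant has `n!` terms, and the staircase contributes the fixed total exponent `D`;
  -- both are absorbed into one constant.
  set B' := (Fintype.card (Equiv.Perm (Fin n)) : ℝ) * B ^ D * B with hB'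
  have hBB' : B ≤ B' := by
    have : (1 : ℝ) ≤ (Fintype.card (Equiv.Perm (Fin n)) : ℝ) * B ^ D := by nlinarith
    nlinarith
  refine ⟨B', hB1.trans hBB', fun β hβ => ⟨fun i => ?_, fun l => ?_⟩⟩
  · have h1 : ‖β‖ ≤ ‖α‖ + 1 := by
      have := norm_le_of_mem_closedBall hβ
      linarith
    exact (norm_le_pi_norm β i).trans (h1.trans ((le_max_right _ _).trans hBB'))
  · have hβB : ∑ i : Fin n, ‖esym β (n - i)‖ ≤ B :=
      (hB₀ ⟨β, hβ, rfl⟩).trans ((le_max_right _ _).trans (le_max_left _ _))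
    rw [schur, Matrix.det_apply]
    calc _ ≤ ∑ σ : Equiv.Perm (Fin n), B ^ (∑ i, l i) * B ^ D := by
          refine (norm_sum_le _ _).trans (sum_le_sum fun σ _ => ?_)
          rw [Units.smul_def, zsmul_eq_mul, norm_mul, norm_prod]
          have h1 : ‖((Equiv.Perm.sign σ : ℤ) : ℂ)‖ = 1 := by
            rcases Int.units_eq_one_or (Equiv.Perm.sign σ) with h | h <;> simp [h]
          rw [h1, one_mul, ← pow_add, hD, ← sum_add_distrib, ← prod_pow_eq_pow_sum,
            ← Equiv.prod_comp σ (fun i => B ^ (l i + (n - 1 - i)))]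
          exact prod_le_prod (fun i _ => norm_nonneg _) fun i _ => norm_fundSol_le hB1 hβB _ _
      _ = (Fintype.card (Equiv.Perm (Fin n)) : ℝ) * B ^ D * B ^ (∑ i, l i) := by
          rw [sum_const, card_univ, nsmul_eq_mul]
          ring
      _ ≤ B' * B' ^ (∑ i, l i) := by
          gcongr
          rw [hB']
          nlinarith

theorem sum_le_sum_domWeight (m : Fin n → ℕ) : ∑ k, m k ≤ ∑ i, domWeight m i := by
  refine sum_le_sum fun i _ => ?_
  refine le_trans ?_ (single_le_sum (f := fun k => if i ≤ k then m k else 0)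
    (fun _ _ => Nat.zero_le _) (mem_univ i))
  simp

/-- Perturbation to distinct parameters: an identity between a dominated series and a continuous
function holds everywhere if it holds for distinct nonzero parameters. -/
theorem hasSum_of_injective {ι : Type*} {α : Fin n → ℂ} {f : (Fin n → ℂ) → ι → ℂ}
    {Φ : (Fin n → ℂ) → ℂ} {u : ι → ℝ} (hu : Summable u) (hf : ∀ m, Continuous fun β => f β m)
    (hb : ∀ β ∈ Metric.closedBall α 1, ∀ m, ‖f β m‖ ≤ u m) (hΦ : ContinuousAt Φ α)
    (h : ∀ β ∈ Metric.closedBall α 1, Function.Injective β → (∀ i, β i ≠ 0) →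
      HasSum (f β) (Φ β)) : HasSum (f α) (Φ α) := by
  have hα : α ∈ Metric.closedBall α 1 := Metric.mem_closedBall_self zero_le_one
  have hsum : Summable (f α) := Summable.of_norm_bounded hu (hb α hα)
  have hcont : ContinuousOn (fun β => ∑' m, f β m) (Metric.closedBall α 1) :=
    continuousOn_tsum (fun m => (hf m).continuousOn) hu fun m β hβ => hb β hβ m
  -- The slopes are distinct and nonzero, so for small `t ≠ 0` the coordinates are distinct and
  -- nonzero.
  let γ : ℂ → Fin n → ℂ := fun t i => α i + t * ((i : ℕ) + 1)
  have hγ0 : γ 0 = α := by funext i; simp [γ]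
  have hγc : Continuous γ := by
    refine continuous_pi fun i => ?_
    simp only [γ]
    fun_prop
  have hball : Metric.closedBall α 1 ∈ 𝓝 (γ 0) := by
    rw [hγ0]; exact Metric.closedBall_mem_nhds _ one_pos
  have hev : ∀ᶠ t in 𝓝[≠] (0 : ℂ), γ t ∈ Metric.closedBall α 1 ∧ Function.Injective (γ t) ∧
      ∀ i, γ t i ≠ 0 := by
    have h1 : ∀ᶠ t in 𝓝[≠] (0 : ℂ), γ t ∈ Metric.closedBall α 1 :=
      (hγc.continuousAt.eventually hball).filter_mono nhdsWithin_le_nhds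
    have h2 : ∀ a b : ℂ, b ≠ 0 → ∀ᶠ t in 𝓝[≠] (0 : ℂ), a + t * b ≠ 0 := by
      intro a b hb
      by_cases ha : a = 0
      · filter_upwards [self_mem_nhdsWithin] with t ht
        rw [ha, zero_add]
        exact mul_ne_zero ht hb
      · have hc : Continuous fun t : ℂ => a + t * b := by fun_prop
        have := (hc.continuousAt (x := (0 : ℂ))).eventually_ne
          (show a + 0 * b ≠ 0 by simpa using ha)
        exact this.filter_mono nhdsWithin_le_nhds
    have h3 : ∀ i : Fin n, ∀ᶠ t in 𝓝[≠] (0 : ℂ), γ t i ≠ 0 := fun i =>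
      h2 (α i) _ (by exact_mod_cast Nat.succ_ne_zero i)
    have h4 : ∀ i j : Fin n, ∀ᶠ t in 𝓝[≠] (0 : ℂ), i ≠ j → γ t i ≠ γ t j := by
      intro i j
      by_cases hij : i = j
      · exact Eventually.of_forall fun t h => absurd hij h
      · filter_upwards [h2 (α i - α j) ((i : ℕ) - (j : ℕ)) (by
          rw [sub_ne_zero]
          exact_mod_cast fun h => hij (Fin.ext h))] with t ht _ heq
        apply ht
        simp only [γ] at heq
        linear_combination heq
    filter_upwards [h1, eventually_all.mpr h3, eventually_all.mpr fun i =>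
      eventually_all.mpr (h4 i)] with t h1 h3 h4
    exact ⟨h1, fun i j hij => by_contra fun hne => h4 i j hne hij, h3⟩
  have hl1 : Tendsto (fun t => ∑' m, f (γ t) m) (𝓝[≠] 0) (𝓝 (∑' m, f α m)) := by
    have h1 : ContinuousAt (fun β => ∑' m, f β m) (γ 0) := hcont.continuousAt hball
    have h2 : ContinuousAt (fun t => ∑' m, f (γ t) m) 0 :=
      ContinuousAt.comp (f := γ) (g := fun β => ∑' m, f β m) h1 hγc.continuousAt
    have h3 := h2.tendsto
    rw [hγ0] at h3
    exact h3.mono_left nhdsWithin_le_nhds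
  have hl2 : Tendsto (fun t => Φ (γ t)) (𝓝[≠] 0) (𝓝 (Φ α)) := by
    have h1 : ContinuousAt Φ (γ 0) := by rw [hγ0]; exact hΦ
    have h2 : ContinuousAt (fun t => Φ (γ t)) 0 :=
      ContinuousAt.comp (f := γ) (g := Φ) h1 hγc.continuousAt
    have h3 := h2.tendsto
    rw [hγ0] at h3
    exact h3.mono_left nhdsWithin_le_nhds
  have hl3 : Tendsto (fun t => Φ (γ t)) (𝓝[≠] 0) (𝓝 (∑' m, f α m)) :=
    hl1.congr' (by
      filter_upwards [hev] with t ht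
      exact (h _ ht.1 ht.2.1 ht.2.2).tsum_eq)
  rw [tendsto_nhds_unique hl2 hl3]
  exact hsum.hasSum

theorem norm_schur_mul_pow_le {B : ℝ} (hB1 : 1 ≤ B) {β : Fin n → ℂ}
    (hB : ∀ l : Fin n → ℕ, ‖schur β l‖ ≤ B * B ^ ∑ i, l i) {d : ℕ} (hd : d ≠ 0) {Y : ℂ}
    (hY : B * ‖Y‖ < 1) (m : Fin n → ℕ) :
    ‖schur β (fun i => d * domWeight m i) * Y ^ (d * ∑ i, domWeight m i)‖ ≤
      B * (B * ‖Y‖) ^ ∑ k, m k := by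
  rw [norm_mul, norm_pow]
  calc _ ≤ B * B ^ (d * ∑ i, domWeight m i) * ‖Y‖ ^ (d * ∑ i, domWeight m i) := by
        have h := hB fun i => d * domWeight m i
        rw [← mul_sum] at h
        gcongr
    _ = B * (B * ‖Y‖) ^ (d * ∑ i, domWeight m i) := by rw [mul_pow]; ring
    _ ≤ B * (B * ‖Y‖) ^ ∑ k, m k := by
        refine mul_le_mul_of_nonneg_left ?_ (by linarith)
        refine pow_le_pow_of_le_one (by positivity) hY.le ?_
        exact (sum_le_sum_domWeight m).trans (Nat.le_mul_of_pos_left _ (Nat.pos_of_ne_zero hd))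

/-- For distinct parameters, divide `hasSum_alternant` at `Y * α i` by the Vandermonde determinant.
Homogeneity turns the scaling into the powers of `Y`. The general case follows by perturbation, the
series being dominated on a ball around `α`. -/
theorem hasSum_schur_aux {d : ℕ} (hd : d = 1 ∨ d = 2) (α : Fin n → ℂ) :
    ∃ ρ : ℝ, 0 < ρ ∧ ∀ Y : ℂ, Y ≠ 0 → ‖Y‖ < ρ →
      HasSum (fun m => schur α (fun i => d * domWeight m i) * Y ^ (d * ∑ i, domWeight m i))
        (littlewoodFactor d fun i => Y * α i) := by
  obtain ⟨B, hB1, hB⟩ := exists_norm_schur_le α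
  have hd0 : d ≠ 0 := by omega
  refine ⟨B⁻¹, by positivity, fun Y hY0 hY => ?_⟩
  have hBY : B * ‖Y‖ < 1 := by
    calc B * ‖Y‖ < B * B⁻¹ := by gcongr
      _ = 1 := mul_inv_cancel₀ (by positivity)
  have hα : α ∈ Metric.closedBall α 1 := Metric.mem_closedBall_self zero_le_one
  have hlt : ∀ β ∈ Metric.closedBall α 1, ∀ i, ‖Y * β i‖ < 1 := fun β hβ i => by
    rw [norm_mul]
    calc ‖Y‖ * ‖β i‖ ≤ ‖Y‖ * B := by gcongr; exact (hB β hβ).1 i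
      _ < 1 := by rwa [mul_comm]
  refine hasSum_of_injective
    (f := fun β m => schur β (fun i => d * domWeight m i) * Y ^ (d * ∑ i, domWeight m i))
    (Φ := fun β => littlewoodFactor d fun i => Y * β i)
    (u := fun m => B * (B * ‖Y‖) ^ ∑ k, m k)
    ((summable_prod_pow _ (by positivity) hBY).mul_left B)
    (fun m => (continuous_schur _).mul continuous_const)
    (fun β hβ m => norm_schur_mul_pow_le hB1 (hB β hβ).2 hd0 hBY m) ?_ ?_
  · unfold littlewoodFactor pairProd
    refine ContinuousAt.mul (tendsto_finsetProd _ fun i _ => ?_) (tendsto_finsetProd _ fun i _ =>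
      tendsto_finsetProd _ fun j _ => ?_)
    · refine ContinuousAt.inv₀ (f := fun β : Fin n → ℂ => 1 - (Y * β i) ^ d)
        (continuous_const.sub ((continuous_const.mul (continuous_apply i)).pow d)).continuousAt
        (one_sub_ne_zero_of_norm_lt ?_)
      rw [norm_pow]
      exact pow_lt_one₀ (norm_nonneg _) (hlt α hα i) hd0
    · split_ifs
      · refine ContinuousAt.inv₀ (f := fun β : Fin n → ℂ => 1 - Y * β i * (Y * β j))
          (by fun_prop) (one_sub_ne_zero_of_norm_lt ?_)
        rw [norm_mul]
        exact mul_lt_one_of_nonneg_of_lt_one_left (norm_nonneg _) (hlt α hα _) (hlt α hα _).le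
      · exact tendsto_const_nhds
  · intro β hβ hinj hne
    have h := hasSum_alternant hd (x := fun i => Y * β i)
      (fun i j hij => hinj (mul_left_cancel₀ hY0 hij)) (fun i => mul_ne_zero hY0 (hne i))
      (hlt β hβ)
    rw [pairProd_sub_smul] at h
    have hV := pairProd_sub_ne_zero hinj
    have hc : Y ^ (∑ i : Fin n, (n - 1 - (i : ℕ))) * pairProd (· - ·) β ≠ 0 :=
      mul_ne_zero (pow_ne_zero _ hY0) hV
    rw [← hasSum_mul_left_iff hc]
    refine (congrArg₂ (fun f a => HasSum f a) (funext fun m => ?_) (by ring)).mp h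
    have : alternant d (fun i => Y * β i) m =
        bialternant (fun i => Y * β i) fun i => d * domWeight m i := rfl
    rw [this, bialternant_smul, ← schur_mul_pairProd, ← mul_sum]
    ring

/-- Littlewood's identity for the sum of all Schur functions. -/
theorem hasSum_schur (α : Fin n → ℂ) : ∃ ρ : ℝ, 0 < ρ ∧ ∀ X : ℂ, X ≠ 0 → ‖X‖ < ρ →
    HasSum (fun m => schur α (domWeight m) * X ^ (∑ i, domWeight m i))
      ((∏ i, (1 - α i * X)⁻¹) * pairProd (fun a b => (1 - a * b * X ^ 2)⁻¹) α) := by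
  obtain ⟨ρ, h0, h⟩ := hasSum_schur_aux (Or.inl rfl) α
  refine ⟨ρ, h0, fun X hX hlt => ?_⟩
  have := h X hX hlt
  simp only [one_mul, littlewoodFactor, pairProd, pow_one] at this ⊢
  convert this using 3
  · rw [mul_comm]
  · refine prod_congr rfl fun j _ => ?_
    split_ifs
    · congr 2; ring
    · rfl

/-- Littlewood's identity for the sum of the Schur functions of even weights. -/
theorem hasSum_schur_even (α : Fin n → ℂ) : ∃ ρ : ℝ, 0 < ρ ∧ ∀ X : ℂ, X ≠ 0 → ‖X‖ < ρ →
    HasSum (fun m => schur α (fun i => 2 * domWeight m i) * X ^ (∑ i, domWeight m i))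
      ((∏ i, (1 - α i * α i * X)⁻¹) * pairProd (fun a b => (1 - a * b * X)⁻¹) α) := by
  obtain ⟨ρ, h0, h⟩ := hasSum_schur_aux (Or.inr rfl) α
  refine ⟨ρ ^ 2, by positivity, fun X hX hlt => ?_⟩
  -- Scaling the parameters by `Y` gives a weight `2λ` the factor `Y ^ (2|λ|) = X ^ |λ|`.
  obtain ⟨Y, hY⟩ := IsAlgClosed.exists_pow_nat_eq X (n := 2) two_pos
  have hY0 : Y ≠ 0 := by rintro rfl; apply hX; rw [← hY]; simp
  have := h Y hY0 (by
    rw [← hY, norm_pow] at hlt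
    exact lt_of_pow_lt_pow_left₀ 2 h0.le hlt)
  simp only [littlewoodFactor, pairProd, pow_mul, hY] at this ⊢
  convert this using 3
  · rw [mul_pow, hY]; ring
  · refine prod_congr rfl fun j _ => ?_
    split_ifs
    · congr 2; rw [← hY]; ring
    · rfl

/-- Cauchy's identity. -/
theorem hasSum_schur_mul_schur (α α' : Fin n → ℂ) : ∃ ρ : ℝ, 0 < ρ ∧ ∀ X : ℂ, X ≠ 0 → ‖X‖ < ρ →
    HasSum (fun m => schur α (domWeight m) * schur α' (domWeight m) * X ^ (∑ i, domWeight m i))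
      (∏ i, ∏ j, (1 - α i * α' j * X)⁻¹) := by
  obtain ⟨B, hB1, hB⟩ := exists_norm_schur_le α
  obtain ⟨B', hB1', hB'⟩ := exists_norm_schur_le α'
  refine ⟨((B * B')⁻¹) ^ 2, by positivity, fun X hX0 hX => ?_⟩
  -- The scaling is shared equally between the two families of parameters.
  obtain ⟨Y, rfl⟩ := IsAlgClosed.exists_pow_nat_eq X (n := 2) two_pos
  have hY0 : Y ≠ 0 := by rintro rfl; apply hX0; simp
  have hY : B * B' * ‖Y‖ < 1 := by
    rw [norm_pow] at hX
    have h1 := lt_of_pow_lt_pow_left₀ 2 (by positivity) hX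
    calc B * B' * ‖Y‖ < B * B' * (B * B')⁻¹ := by gcongr
      _ = 1 := mul_inv_cancel₀ (by positivity)
  have hBY : B * ‖Y‖ < 1 := by
    refine lt_of_le_of_lt ?_ hY
    have : B * 1 ≤ B * B' := by gcongr
    have := norm_nonneg Y
    nlinarith
  have hBY' : B' * ‖Y‖ < 1 := by
    refine lt_of_le_of_lt ?_ hY
    have : 1 * B' ≤ B * B' := by gcongr
    have := norm_nonneg Y
    nlinarith
  have hlt : ∀ β ∈ Metric.closedBall α 1, ∀ i, ‖Y * β i‖ < 1 := fun β hβ i => by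
    rw [norm_mul]
    calc ‖Y‖ * ‖β i‖ ≤ ‖Y‖ * B := by gcongr; exact (hB β hβ).1 i
      _ < 1 := by rwa [mul_comm]
  have hlt' : ∀ β ∈ Metric.closedBall α' 1, ∀ i, ‖Y * β i‖ < 1 := fun β hβ i => by
    rw [norm_mul]
    calc ‖Y‖ * ‖β i‖ ≤ ‖Y‖ * B' := by gcongr; exact (hB' β hβ).1 i
      _ < 1 := by rwa [mul_comm]
  have hbound : ∀ β ∈ Metric.closedBall α 1, ∀ β' ∈ Metric.closedBall α' 1, ∀ m,
      ‖schur β (domWeight m) * schur β' (domWeight m) * (Y ^ 2) ^ (∑ i, domWeight m i)‖ ≤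
        B * B' * (B * ‖Y‖) ^ ∑ k, m k := by
    intro β hβ β' hβ' m
    have h1 := norm_schur_mul_pow_le hB1 (hB β hβ).2 one_ne_zero hBY m
    have h2 := norm_schur_mul_pow_le hB1' (hB' β' hβ').2 one_ne_zero hBY' m
    simp only [one_mul] at h1 h2
    have h3 : B' * (B' * ‖Y‖) ^ ∑ k, m k ≤ B' := by
      have : (B' * ‖Y‖) ^ ∑ k, m k ≤ 1 := pow_le_one₀ (by positivity) hBY'.le
      nlinarith
    calc _ = ‖schur β (domWeight m) * Y ^ (∑ i, domWeight m i)‖ *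
          ‖schur β' (domWeight m) * Y ^ (∑ i, domWeight m i)‖ := by
          rw [← norm_mul]; congr 1; ring
      _ ≤ B * (B * ‖Y‖) ^ (∑ k, m k) * B' := by
          gcongr
          exact h2.trans h3
      _ = _ := by ring
  have hsu : Summable fun m : Fin n → ℕ => B * B' * (B * ‖Y‖) ^ ∑ k, m k :=
    (summable_prod_pow _ (by positivity) hBY).mul_left _
  have hnz : ∀ β ∈ Metric.closedBall α 1, ∀ β' ∈ Metric.closedBall α' 1, ∀ i j,
      1 - β i * β' j * Y ^ 2 ≠ 0 := fun β hβ β' hβ' i j => one_sub_ne_zero_of_norm_lt (by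
    rw [show β i * β' j * Y ^ 2 = (Y * β i) * (Y * β' j) by ring, norm_mul]
    exact mul_lt_one_of_nonneg_of_lt_one_left (norm_nonneg _) (hlt β hβ i) (hlt' β' hβ' j).le)
  have hα : α ∈ Metric.closedBall α 1 := Metric.mem_closedBall_self zero_le_one
  have hα' : α' ∈ Metric.closedBall α' 1 := Metric.mem_closedBall_self zero_le_one
  -- First `α` is moved to distinct parameters with `α'` fixed, then `α'`.
  refine hasSum_of_injective
    (f := fun β m => schur β (domWeight m) * schur α' (domWeight m) *
      (Y ^ 2) ^ (∑ i, domWeight m i))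
    (Φ := fun β => ∏ i, ∏ j, (1 - β i * α' j * Y ^ 2)⁻¹) hsu
    (fun m => ((continuous_schur _).mul continuous_const).mul continuous_const)
    (fun β hβ m => hbound β hβ α' hα' m)
    (tendsto_finsetProd _ fun i _ => tendsto_finsetProd _ fun j _ =>
      ContinuousAt.inv₀ (f := fun β : Fin n → ℂ => 1 - β i * α' j * Y ^ 2)
        (continuous_const.sub (((continuous_apply i).mul continuous_const).mul
          continuous_const)).continuousAt (hnz α hα α' hα' i j)) ?_
  intro β hβ hinj hne
  refine hasSum_of_injective
    (f := fun β' m => schur β (domWeight m) * schur β' (domWeight m) *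
      (Y ^ 2) ^ (∑ i, domWeight m i))
    (Φ := fun β' => ∏ i, ∏ j, (1 - β i * β' j * Y ^ 2)⁻¹) hsu
    (fun m => (continuous_const.mul (continuous_schur _)).mul continuous_const)
    (fun β' hβ' m => hbound β hβ β' hβ' m)
    (tendsto_finsetProd _ fun i _ => tendsto_finsetProd _ fun j _ =>
      ContinuousAt.inv₀ (f := fun β' : Fin n → ℂ => 1 - β i * β' j * Y ^ 2)
        (continuous_const.sub ((continuous_const.mul (continuous_apply j)).mul
          continuous_const)).continuousAt (hnz β hβ α' hα' i j)) ?_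
  intro β' hβ' hinj' hne'
  have h := hasSum_alternant_mul (x := fun i => Y * β i) (y := fun i => Y * β' i)
    (fun i j hij => hinj (mul_left_cancel₀ hY0 hij)) (fun i => mul_ne_zero hY0 (hne i))
    (hlt β hβ) (fun i j hij => hinj' (mul_left_cancel₀ hY0 hij))
    (fun i => mul_ne_zero hY0 (hne' i)) (hlt' β' hβ')
  rw [pairProd_sub_smul, pairProd_sub_smul] at h
  have hc : (Y ^ (∑ i : Fin n, (n - 1 - (i : ℕ))) * pairProd (· - ·) β) *
      (Y ^ (∑ i : Fin n, (n - 1 - (i : ℕ))) * pairProd (· - ·) β') ≠ 0 :=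
    mul_ne_zero (mul_ne_zero (pow_ne_zero _ hY0) (pairProd_sub_ne_zero hinj))
      (mul_ne_zero (pow_ne_zero _ hY0) (pairProd_sub_ne_zero hinj'))
  rw [← hasSum_mul_left_iff hc]
  refine (congrArg₂ (fun f a => HasSum f a) (funext fun m => ?_) ?_).mp h
  · have : ∀ γ : Fin n → ℂ, alternant 1 (fun i => Y * γ i) m =
        bialternant (fun i => Y * γ i) (domWeight m) := fun γ => by
      simp only [alternant, bialternant, one_mul]
    rw [this, this, bialternant_smul, bialternant_smul, ← schur_mul_pairProd,
      ← schur_mul_pairProd]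
    ring
  · congr 1
    refine prod_congr rfl fun i _ => prod_congr rfl fun j _ => ?_
    congr 2
    ring

end SchurSeries

end AsaiZeta

namespace AsaiZeta

/-! ### Invertible matrices over a ring with finitely many discrete places. -/

section Places

open Matrix Finset

/-- The group `GL_n(O)` inside `GL_n(E)`, for a subring `O` of `E`. -/
def intGL {E : Type*} [CommRing E] (O : Subring E) (n : ℕ) : Subgroup (GL (Fin n) E) where
  carrier := {g | (∀ i j, (g : Matrix (Fin n) (Fin n) E) i j ∈ O) ∧
    ∀ i j, ((g⁻¹ : GL (Fin n) E) : Matrix (Fin n) (Fin n) E) i j ∈ O}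
  one_mem' := by
    have : ∀ i j, (1 : Matrix (Fin n) (Fin n) E) i j ∈ O := fun i j => by
      rw [Matrix.one_apply]; split_ifs; exacts [O.one_mem, O.zero_mem]
    exact ⟨by simpa using this, by simpa using this⟩
  mul_mem' := by
    rintro a b ⟨ha, ha'⟩ ⟨hb, hb'⟩
    refine ⟨fun i j => ?_, fun i j => ?_⟩
    · rw [Units.val_mul, Matrix.mul_apply]
      exact O.sum_mem fun k _ => O.mul_mem (ha _ _) (hb _ _)
    · rw [_root_.mul_inv_rev, Units.val_mul, Matrix.mul_apply]
      exact O.sum_mem fun k _ => O.mul_mem (hb' _ _) (ha' _ _)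
  inv_mem' := by
    rintro a ⟨ha, ha'⟩
    exact ⟨ha', by simpa using ha⟩

/-- Diagonal matrices with unit entries. -/
def diagGL {E : Type*} [CommRing E] {n : ℕ} (a : Fin n → Eˣ) : GL (Fin n) E where
  val := Matrix.diagonal fun i => (a i : E)
  inv := Matrix.diagonal fun i => ((a i)⁻¹ : Eˣ)
  val_inv := by simp
  inv_val := by simp

/-- The diagonal matrix with entries `∏_j ϖ_j ^ l_{j,i}`. -/
def torusOf {E : Type*} [CommRing E] {J : Type*} [Fintype J] {n : ℕ} (ϖ : J → Eˣ)
    (l : J → Fin n → ℤ) : GL (Fin n) E :=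
  diagGL fun i => ∏ j, ϖ j ^ l j i

/-- A finite set `J` of discrete places of a ring `E` with integral elements `O`: a field with
a discrete valuation (with finite residue field), or a finite product of such fields. -/
structure PlaceData (E : Type*) [CommRing E] (O : Subring E) (J : Type*) [Fintype J]
    [DecidableEq J] where
  /-- the additive valuations -/
  ord : J → Eˣ → ℤ
  /-- the uniformizers -/
  unif : J → Eˣ
  /-- representatives of the residue fields -/
  res : J → Finset E
  ord_mul : ∀ j x y, ord j (x * y) = ord j x + ord j y
  ord_unif : ∀ i j, ord i (unif j) = if i = j then 1 else 0
  mem_iff : ∀ x : Eˣ, (x : E) ∈ O ↔ ∀ j, 0 ≤ ord j x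
  res_mem : ∀ j, ∀ r ∈ res j, r ∈ O
  res_exists : ∀ j, ∀ a ∈ O, ∃ r ∈ res j, ∃ b ∈ O, a - r = unif j * b
  res_unique : ∀ j, ∀ r ∈ res j, ∀ r' ∈ res j, ∀ b ∈ O, r - r' = unif j * b → r = r'
  iwasawa : ∀ (n : ℕ) (g : GL (Fin n) E), ∃ k ∈ intGL O n, ∀ a b, b < a →
    ((g * k : GL (Fin n) E) : Matrix (Fin n) (Fin n) E) a b = 0
  cartan : ∀ (n : ℕ) (g : GL (Fin n) E), ∃ k ∈ intGL O n, ∃ k' ∈ intGL O n, ∃ a : Fin n → Eˣ,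
    g = k * diagGL a * k'
  perm : ∀ (n : ℕ) (j : J) (σ : Equiv.Perm (Fin n)) (l : J → Fin n → ℤ),
    ∃ k ∈ intGL O n, ∃ k' ∈ intGL O n,
      torusOf unif (Function.update l j (l j ∘ σ)) = k * torusOf unif l * k'

variable {E : Type*} [CommRing E] {O : Subring E} {J : Type*} [Fintype J] [DecidableEq J] {n : ℕ}

theorem diagGL_mul (a b : Fin n → Eˣ) : diagGL (a * b) = diagGL a * diagGL b :=
  Units.ext (Matrix.diagonal_mul_diagonal _ _).symm

theorem diagGL_one : diagGL (1 : Fin n → Eˣ) = 1 := by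
  ext i j
  simp [diagGL]

theorem diagGL_inv (a : Fin n → Eˣ) : (diagGL a)⁻¹ = diagGL a⁻¹ := by
  rw [inv_eq_iff_mul_eq_one, ← diagGL_mul]
  simp [diagGL_one]

theorem torusOf_add (ϖ : J → Eˣ) (l l' : J → Fin n → ℤ) :
    torusOf ϖ (l + l') = torusOf ϖ l * torusOf ϖ l' := by
  rw [torusOf, torusOf, torusOf, ← diagGL_mul]
  congr 1
  funext i
  simp [_root_.zpow_add, prod_mul_distrib]

theorem torusOf_zero (ϖ : J → Eˣ) : torusOf ϖ (0 : J → Fin n → ℤ) = 1 := by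
  rw [torusOf, ← diagGL_one]
  congr 1
  funext i
  simp

theorem torusOf_neg (ϖ : J → Eˣ) (l : J → Fin n → ℤ) : torusOf ϖ (-l) = (torusOf ϖ l)⁻¹ := by
  rw [eq_inv_iff_mul_eq_one, ← torusOf_add, neg_add_cancel, torusOf_zero]

theorem diagGL_mul_apply (a : Fin n → Eˣ) (g : GL (Fin n) E) (i j : Fin n) :
    (diagGL a * g : GL (Fin n) E) i j = a i * g i j := by
  rw [Units.val_mul]
  exact Matrix.diagonal_mul _ _ _ _

theorem mul_diagGL_apply (a : Fin n → Eˣ) (g : GL (Fin n) E) (i j : Fin n) :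
    (g * diagGL a : GL (Fin n) E) i j = g i j * a j := by
  rw [Units.val_mul]
  exact Matrix.mul_diagonal _ _ _ _

theorem mul_diagGL_mul_apply (a b : Fin n → Eˣ) (g : GL (Fin n) E) (i j : Fin n) :
    (diagGL a * g * diagGL b : GL (Fin n) E) i j = a i * g i j * b j := by
  rw [mul_diagGL_apply, diagGL_mul_apply]

/-- Upper triangular invertible matrices. -/
def borelGL (n : ℕ) (E : Type*) [CommRing E] : Subgroup (GL (Fin n) E) where
  carrier := {u | ∀ i j, j < i → (u : Matrix (Fin n) (Fin n) E) i j = 0}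
  one_mem' := fun i j h => by simp [Matrix.one_apply_ne h.ne']
  mul_mem' := by
    rintro a b ha hb i j h
    rw [Units.val_mul, Matrix.mul_apply]
    refine Finset.sum_eq_zero fun k _ => ?_
    rcases lt_or_ge k i with hk | hk
    · rw [ha i k hk, zero_mul]
    · rw [hb k j (h.trans_le hk), mul_zero]
  inv_mem' := by
    rintro a ha i j h
    have hb : (a : Matrix (Fin n) (Fin n) E).BlockTriangular id := fun i j h => ha i j h
    have : Invertible (a : Matrix (Fin n) (Fin n) E) := a.invertible
    have := Matrix.blockTriangular_inv_of_blockTriangular hb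
    rw [Matrix.coe_units_inv]
    exact this h

theorem borelGL_mul_apply_self {a b : GL (Fin n) E} (ha : a ∈ borelGL n E) (hb : b ∈ borelGL n E)
    (i : Fin n) : (a * b : GL (Fin n) E) i i = a i i * b i i := by
  rw [Units.val_mul, Matrix.mul_apply, Finset.sum_eq_single i]
  · intro k _ hk
    rcases lt_or_gt_of_ne hk with hk | hk
    · rw [ha i k hk, zero_mul]
    · rw [hb k i hk, mul_zero]
  · simp

/-- The diagonal entries of an upper triangular matrix, as units. -/
def borelDiag : borelGL n E →* (Fin n → Eˣ) where
  toFun b i :=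
    { val := b.1 i i
      inv := (b⁻¹).1 i i
      val_inv := by
        rw [← borelGL_mul_apply_self b.2 (b⁻¹).2 i, ← Subgroup.coe_mul, mul_inv_cancel]
        simp
      inv_val := by
        rw [← borelGL_mul_apply_self (b⁻¹).2 b.2 i, ← Subgroup.coe_mul, inv_mul_cancel]
        simp }
  map_one' := by ext i; simp
  map_mul' a b := by
    ext i
    exact borelGL_mul_apply_self a.2 b.2 i

theorem borelDiag_apply (b : borelGL n E) (i : Fin n) : (borelDiag b i : E) = b.1 i i := rfl

theorem diagGL_mem_borelGL (a : Fin n → Eˣ) : diagGL a ∈ borelGL n E := fun i j h =>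
  Matrix.diagonal_apply_ne _ h.ne'

theorem unipotent_le_borelGL : unipotent n E ≤ borelGL n E := fun _ h => h.1

theorem borelDiag_diagGL (a : Fin n → Eˣ) : borelDiag ⟨diagGL a, diagGL_mem_borelGL a⟩ = a := by
  ext i
  exact Matrix.diagonal_apply_eq _ _

theorem borelDiag_unipotent {u : GL (Fin n) E} (hu : u ∈ unipotent n E) :
    borelDiag ⟨u, unipotent_le_borelGL hu⟩ = 1 := by
  ext i
  exact hu.2 i

namespace PlaceData

variable (P : PlaceData E O J)

theorem ord_one (j : J) : P.ord j 1 = 0 := by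
  have := P.ord_mul j 1 1
  rw [one_mul] at this
  omega

/-- The valuation as a homomorphism. -/
def ordHom (j : J) : Eˣ →* Multiplicative ℤ where
  toFun x := Multiplicative.ofAdd (P.ord j x)
  map_one' := by rw [P.ord_one]; rfl
  map_mul' x y := by rw [P.ord_mul]; rfl

theorem ord_inv (j : J) (x : Eˣ) : P.ord j x⁻¹ = - P.ord j x := by
  have := P.ord_mul j x x⁻¹
  rw [mul_inv_cancel, P.ord_one] at this
  omega

theorem ord_zpow (j : J) (x : Eˣ) (k : ℤ) : P.ord j (x ^ k) = k * P.ord j x := by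
  have := map_zpow (P.ordHom j) x k
  have h2 := congrArg Multiplicative.toAdd this
  rw [toAdd_zpow, smul_eq_mul] at h2
  exact h2

theorem ord_prod (j : J) {ι : Type*} (s : Finset ι) (f : ι → Eˣ) :
    P.ord j (∏ i ∈ s, f i) = ∑ i ∈ s, P.ord j (f i) := by
  have := map_prod (P.ordHom j) f s
  have h2 := congrArg Multiplicative.toAdd this
  rw [toAdd_prod] at h2
  exact h2

theorem ord_prod_unif (i : J) (l : J → ℤ) : P.ord i (∏ j, P.unif j ^ l j) = l i := by
  rw [ord_prod, Finset.sum_eq_single i]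
  · rw [ord_zpow, ord_unif]; simp
  · intro j _ hj
    rw [ord_zpow, ord_unif, if_neg hj.symm, mul_zero]
  · simp

theorem unit_mem_of_ord_eq_zero {x : Eˣ} (h : ∀ j, P.ord j x = 0) :
    (x : E) ∈ O ∧ ((x⁻¹ : Eˣ) : E) ∈ O := by
  refine ⟨(P.mem_iff x).mpr fun j => (h j).ge, (P.mem_iff _).mpr fun j => ?_⟩
  rw [ord_inv, h j, neg_zero]

theorem ord_eq_zero_of_mem {x : Eˣ} (h : (x : E) ∈ O) (h' : ((x⁻¹ : Eˣ) : E) ∈ O) (j : J) :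
    P.ord j x = 0 := by
  have h1 := (P.mem_iff x).mp h j
  have h2 := (P.mem_iff _).mp h' j
  rw [ord_inv] at h2
  omega

/-- The element `ϖ^l` of the diagonal torus. -/
def torus (l : J → Fin n → ℤ) : GL (Fin n) E := torusOf P.unif l

theorem torus_add (l l' : J → Fin n → ℤ) : P.torus (l + l') = P.torus l * P.torus l' :=
  torusOf_add _ _ _

theorem torus_zero : P.torus (0 : J → Fin n → ℤ) = 1 := torusOf_zero _

theorem torus_neg (l : J → Fin n → ℤ) : P.torus (-l) = (P.torus l)⁻¹ := torusOf_neg _ _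

theorem diagGL_mem_intGL {a : Fin n → Eˣ} (h : ∀ i j, P.ord j (a i) = 0) :
    diagGL a ∈ intGL O n := by
  refine ⟨fun i j => ?_, fun i j => ?_⟩
  · by_cases hij : i = j
    · subst hij
      have : (diagGL a : GL (Fin n) E) i i = a i := Matrix.diagonal_apply_eq _ _
      rw [this]
      exact (P.unit_mem_of_ord_eq_zero (h i)).1
    · have : (diagGL a : GL (Fin n) E) i j = 0 := Matrix.diagonal_apply_ne _ hij
      rw [this]
      exact O.zero_mem
  · rw [diagGL_inv]
    by_cases hij : i = j
    · subst hij
      have : (diagGL a⁻¹ : GL (Fin n) E) i i = (a⁻¹) i := Matrix.diagonal_apply_eq _ _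
      rw [this]
      exact (P.unit_mem_of_ord_eq_zero (h i)).2
    · have : (diagGL a⁻¹ : GL (Fin n) E) i j = 0 := Matrix.diagonal_apply_ne _ hij
      rw [this]
      exact O.zero_mem

/-- Every diagonal matrix is `ϖ^l` up to an integral diagonal matrix. -/
theorem diagGL_eq_torus_mul (a : Fin n → Eˣ) :
    ∃ k ∈ intGL O n, diagGL a = P.torus (fun j i => P.ord j (a i)) * k := by
  refine ⟨diagGL fun i => (∏ j, P.unif j ^ P.ord j (a i))⁻¹ * a i,
    P.diagGL_mem_intGL fun i j => ?_, ?_⟩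
  · rw [ord_mul, ord_inv, ord_prod_unif, neg_add_cancel]
  · rw [torus, torusOf, ← diagGL_mul]
    congr 1
    funext i
    simp

theorem borelDiag_torus (l : J → Fin n → ℤ) :
    borelDiag ⟨P.torus l, diagGL_mem_borelGL _⟩ = fun i => ∏ j, P.unif j ^ l j i :=
  borelDiag_diagGL _

/-- The Iwasawa decomposition. -/
theorem exists_iwasawa (g : GL (Fin n) E) : ∃ u ∈ unipotent n E, ∃ l : J → Fin n → ℤ,
    ∃ k ∈ intGL O n, g = u * P.torus l * k := by
  obtain ⟨k, hk, hb⟩ := P.iwasawa n g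
  set b : borelGL n E := ⟨g * k, hb⟩ with hbdef
  obtain ⟨k', hk', hd⟩ := P.diagGL_eq_torus_mul (borelDiag b)
  refine ⟨g * k * (diagGL (borelDiag b))⁻¹, ⟨?_, ?_⟩, fun j i => P.ord j (borelDiag b i), k' * k⁻¹,
    (intGL O n).mul_mem hk' ((intGL O n).inv_mem hk), ?_⟩
  · exact (borelGL n E).mul_mem hb ((borelGL n E).inv_mem (diagGL_mem_borelGL _))
  · intro i
    rw [borelGL_mul_apply_self hb ((borelGL n E).inv_mem (diagGL_mem_borelGL _)), diagGL_inv,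
      show (diagGL (borelDiag b)⁻¹ : GL (Fin n) E) i i = ((borelDiag b i)⁻¹ : Eˣ) from
        Matrix.diagonal_apply_eq _ _]
    exact (borelDiag b i).mul_inv
  · rw [mul_assoc (g * k * _), ← mul_assoc (P.torus _), ← hd]
    group

/-- The Cartan decomposition. -/
theorem exists_cartan (g : GL (Fin n) E) : ∃ k ∈ intGL O n, ∃ k' ∈ intGL O n,
    ∃ l : J → Fin n → ℤ, g = k * P.torus l * k' := by
  obtain ⟨k, hk, k', hk', a, h⟩ := P.cartan n g
  obtain ⟨k'', hk'', hd⟩ := P.diagGL_eq_torus_mul a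
  exact ⟨k, hk, k'' * k', (intGL O n).mul_mem hk'' hk', fun j i => P.ord j (a i),
    by rw [h, hd]; group⟩

/-- The determinant of an invertible matrix, as a unit. -/
abbrev detU (g : GL (Fin n) E) : Eˣ := Matrix.GeneralLinearGroup.det g

theorem detU_borel (b : borelGL n E) : detU b.1 = ∏ i, borelDiag b i := by
  ext
  rw [Units.coe_prod]
  exact Matrix.det_of_isUpperTriangular (fun i j hij => b.2 i j hij)

theorem detU_diagGL (a : Fin n → Eˣ) : detU (diagGL a) = ∏ i, a i := by
  rw [detU_borel ⟨diagGL a, diagGL_mem_borelGL a⟩, borelDiag_diagGL]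

theorem ord_detU_torus (i : J) (l : J → Fin n → ℤ) :
    P.ord i (detU (P.torus l)) = ∑ a, l i a := by
  rw [torus, torusOf, detU_diagGL, ord_prod]
  simp only [ord_prod_unif]

theorem det_mem_of_forall_mem {M : Matrix (Fin n) (Fin n) E} (h : ∀ i j, M i j ∈ O) :
    M.det ∈ O := by
  rw [Matrix.det_apply]
  exact O.sum_mem fun σ _ => by
    rw [Units.smul_def]
    exact O.zsmul_mem (O.prod_mem fun i _ => h _ _) _

theorem ord_detU_of_mem {k : GL (Fin n) E} (hk : k ∈ intGL O n) (j : J) :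
    P.ord j (detU k) = 0 := by
  refine P.ord_eq_zero_of_mem (det_mem_of_forall_mem hk.1) ?_ j
  rw [← map_inv]
  exact det_mem_of_forall_mem hk.2

/-- Cramer's rule: the inverse is the adjugate divided by a determinant that is a unit of `O`. -/
theorem mem_intGL_of_ord_det {g : GL (Fin n) E} (h : ∀ i j, g i j ∈ O)
    (h' : ∀ j, P.ord j (detU g) = 0) : g ∈ intGL O n := by
  refine ⟨h, fun i j => ?_⟩
  have h1 : ((g⁻¹ : GL (Fin n) E) : Matrix (Fin n) (Fin n) E) =
      (((detU g)⁻¹ : Eˣ) : E) • (g : Matrix (Fin n) (Fin n) E).adjugate := by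
    rw [Matrix.coe_units_inv, Matrix.inv_def]
    congr 1
    exact Ring.inverse_unit (detU g)
  rw [h1, Matrix.smul_apply, smul_eq_mul]
  refine O.mul_mem (P.unit_mem_of_ord_eq_zero h').2 ?_
  rw [Matrix.adjugate_apply]
  refine det_mem_of_forall_mem fun a b => ?_
  rw [Matrix.updateRow_apply]
  split_ifs
  · by_cases hb : b = i
    · subst hb; simp [O.one_mem]
    · simp [hb, O.zero_mem]
  · exact h _ _

theorem ord_borelDiag_of_mem {b : borelGL n E} (hb : b.1 ∈ intGL O n) (i : Fin n) (j : J) :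
    P.ord j (borelDiag b i) = 0 := by
  refine P.ord_eq_zero_of_mem (hb.1 i i) ?_ j
  have : (borelDiag b i)⁻¹ = borelDiag b⁻¹ i := by rw [map_inv]; rfl
  rw [this]
  exact hb.2 i i

/-! ### Spherical functions on the flag variety -/

/-- The character of the upper triangular group attached to `c`. -/
def borelChar (c : J → Fin n → ℂ) (b : borelGL n E) : ℂ :=
  ∏ i, ∏ j, c j i ^ P.ord j (borelDiag b i)

theorem borelChar_mul {c : J → Fin n → ℂ} (hc : ∀ j i, c j i ≠ 0) (b b' : borelGL n E) :
    P.borelChar c (b * b') = P.borelChar c b * P.borelChar c b' := by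
  simp only [borelChar, map_mul, Pi.mul_apply, ord_mul, zpow_add₀ (hc _ _), prod_mul_distrib]

theorem borelChar_of_mem (c : J → Fin n → ℂ) {b : borelGL n E} (hb : b.1 ∈ intGL O n) :
    P.borelChar c b = 1 := by
  refine prod_eq_one fun i _ => prod_eq_one fun j _ => ?_
  rw [P.ord_borelDiag_of_mem hb, zpow_zero]

/-- The function `b k ↦ borelChar c b` on `GL_n(E) = B K`. -/
def sphFun (c : J → Fin n → ℂ) (g : GL (Fin n) E) : ℂ :=
  P.borelChar c ⟨g * (P.iwasawa n g).choose, (P.iwasawa n g).choose_spec.2⟩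

/-- Two Iwasawa decompositions of an element differ by an upper triangular integral matrix. Its
diagonal entries are units, so the character is trivial on it, and the choice made in `sphFun` is
immaterial. -/
theorem sphFun_eq {c : J → Fin n → ℂ} (hc : ∀ j i, c j i ≠ 0) (b : borelGL n E)
    {k : GL (Fin n) E} (hk : k ∈ intGL O n) : P.sphFun c (b.1 * k) = P.borelChar c b := by
  set k' := (P.iwasawa n (b.1 * k)).choose with hk'def
  have hk' := (P.iwasawa n (b.1 * k)).choose_spec.1
  have hb := (P.iwasawa n (b.1 * k)).choose_spec.2
  set b' : borelGL n E := ⟨b.1 * k * k', hb⟩ with hb'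
  have h1 : (b⁻¹ * b').1 ∈ intGL O n := by
    have : (b⁻¹ * b').1 = k * k' := by
      simp only [Subgroup.coe_mul, Subgroup.coe_inv, hb']
      group
    rw [this]
    exact (intGL O n).mul_mem hk hk'
  have h2 : b' = b * (b⁻¹ * b') := by group
  change P.borelChar c b' = _
  rw [h2, P.borelChar_mul hc, P.borelChar_of_mem c h1, mul_one]

theorem sphFun_borel_mul {c : J → Fin n → ℂ} (hc : ∀ j i, c j i ≠ 0) (b : borelGL n E)
    (g : GL (Fin n) E) : P.sphFun c (b.1 * g) = P.borelChar c b * P.sphFun c g := by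
  obtain ⟨k, hk, hb⟩ := P.iwasawa n g
  have h1 : g = (⟨g * k, hb⟩ : borelGL n E).1 * k⁻¹ := by group
  have hk' := (intGL O n).inv_mem hk
  conv_lhs => rw [h1, ← mul_assoc]
  conv_rhs => rw [h1]
  rw [P.sphFun_eq hc _ hk', ← P.borelChar_mul hc, ← P.sphFun_eq hc _ hk']
  rfl

theorem sphFun_mul_mem {c : J → Fin n → ℂ} (hc : ∀ j i, c j i ≠ 0) (g : GL (Fin n) E)
    {k : GL (Fin n) E} (hk : k ∈ intGL O n) : P.sphFun c (g * k) = P.sphFun c g := by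
  obtain ⟨k', hk', hb⟩ := P.iwasawa n g
  have h1 : g = (⟨g * k', hb⟩ : borelGL n E).1 * k'⁻¹ := by group
  have hk'' := (intGL O n).inv_mem hk'
  conv_lhs => rw [h1, mul_assoc]
  conv_rhs => rw [h1]
  rw [P.sphFun_eq hc _ hk'', P.sphFun_eq hc _ ((intGL O n).mul_mem hk'' hk)]

theorem sphFun_one {c : J → Fin n → ℂ} (hc : ∀ j i, c j i ≠ 0) : P.sphFun c 1 = 1 := by
  have := P.sphFun_eq hc (1 : borelGL n E) (intGL O n).one_mem
  rw [Subgroup.coe_one, one_mul] at this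
  rw [this]
  exact P.borelChar_of_mem c (intGL O n).one_mem

theorem sphFun_unipotent_mul_torus {c : J → Fin n → ℂ} (hc : ∀ j i, c j i ≠ 0)
    {u : GL (Fin n) E} (hu : u ∈ unipotent n E) (l : J → Fin n → ℤ) :
    P.sphFun c (u * P.torus l) = ∏ i, ∏ j, c j i ^ l j i := by
  have h1 := P.sphFun_eq hc (⟨u, unipotent_le_borelGL hu⟩ * ⟨P.torus l, diagGL_mem_borelGL _⟩)
    (intGL O n).one_mem
  rw [mul_one] at h1
  change P.sphFun c (u * P.torus l) = _ at h1
  rw [h1, borelChar]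
  refine prod_congr rfl fun i _ => prod_congr rfl fun j _ => ?_
  rw [map_mul, borelDiag_unipotent hu, one_mul, P.borelDiag_torus, ord_prod_unif]

/-- The entry `(a, b)` is multiplied by `ϖ^(l_a - l_b)`, which is integral for `a ≤ b` when the
weight is dominant. -/
theorem torus_conj_mem {l : J → Fin n → ℤ} (hl : ∀ j, Antitone (l j)) {u : GL (Fin n) E}
    (hu : u ∈ unipotent n E) (huO : ∀ a b, u a b ∈ O) :
    P.torus l * u * (P.torus l)⁻¹ ∈ intGL O n := by
  have hmem : P.torus l * u * (P.torus l)⁻¹ ∈ borelGL n E :=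
    (borelGL n E).mul_mem ((borelGL n E).mul_mem (diagGL_mem_borelGL _) (unipotent_le_borelGL hu))
      ((borelGL n E).inv_mem (diagGL_mem_borelGL _))
  refine P.mem_intGL_of_ord_det (fun a b => ?_) fun j => ?_
  · rcases lt_or_ge b a with h | h
    · rw [hmem a b h]
      exact O.zero_mem
    · rw [torus, torusOf, diagGL_inv, mul_diagGL_mul_apply, mul_comm, ← mul_assoc]
      refine O.mul_mem ?_ (huO a b)
      rw [← Units.val_mul]
      refine (P.mem_iff _).mpr fun j => ?_
      rw [ord_mul, Pi.inv_apply, ord_inv, ord_prod_unif, ord_prod_unif]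
      have := hl j h
      omega
  · have h1 : detU u = 1 := by
      rw [detU_borel ⟨u, unipotent_le_borelGL hu⟩, borelDiag_unipotent hu]
      simp
    rw [detU, map_mul, map_mul, map_inv, ← detU, ← detU, h1, mul_one, mul_inv_cancel, ord_one]

end PlaceData

end Places

end AsaiZeta

namespace AsaiZeta

/-! ### Representatives of the cosets in a minuscule double coset. -/

section Cosets

open Matrix Finset

variable {E : Type*} [CommRing E] {O : Subring E} {J : Type*} [Fintype J] [DecidableEq J] {n : ℕ}

/-- The number of pairs `a < b` with `a ∈ ε`, `b ∉ ε`. -/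
def crossings (ε : Finset (Fin n)) : ℕ := ∑ a, ∑ b, if a ∈ ε ∧ b ∉ ε ∧ a < b then 1 else 0

/-- Among pairs in `ε × εᶜ`, count those with `a < b` and those with `b < a`. The two counts add up
to `#ε (n - #ε)`. They differ by the sum of `n - 1 - 2a` over `ε`, because pairs inside `ε` cancel.
This compares the number of cosets with the modulus character. -/
theorem two_mul_crossings (ε : Finset (Fin n)) :
    (2 * crossings ε : ℤ) = #ε * (n - #ε) + ∑ i ∈ ε, ((n : ℤ) - 1 - 2 * i) := by
  have hA : (crossings ε : ℤ) = ∑ a ∈ ε, ∑ b ∈ εᶜ, if a < b then 1 else 0 := by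
    rw [crossings]
    push_cast
    rw [← sum_filter_add_sum_filter_not univ (· ∈ ε), filter_mem_eq_inter, univ_inter,
      sum_eq_zero (s := univ.filter (· ∉ ε)), add_zero]
    · refine sum_congr rfl fun a ha => ?_
      rw [← sum_filter_add_sum_filter_not univ (· ∈ ε), sum_eq_zero (s := univ.filter (· ∈ ε)),
        zero_add]
      · refine sum_congr (by ext; simp) fun b hb => ?_
        have hb' : b ∉ ε := by simpa using hb
        simp [ha, hb']
      · intro b hb
        simp [(mem_filter.mp hb).2]
    · intro a ha
      simp [(mem_filter.mp ha).2]
  have hsum : ∑ a ∈ ε, ∑ b ∈ ε, ((if a < b then (1 : ℤ) else 0) - if b < a then 1 else 0) = 0 := by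
    simp only [sum_sub_distrib]
    rw [sub_eq_zero]
    conv_rhs => rw [sum_comm]
  have hB : ∑ a ∈ ε, ∑ b ∈ εᶜ, ((if a < b then (1 : ℤ) else 0) + if b < a then 1 else 0) =
      #ε * (n - #ε) := by
    have : ∀ a ∈ ε, ∀ b ∈ εᶜ, ((if a < b then (1 : ℤ) else 0) + if b < a then 1 else 0) = 1 := by
      intro a ha b hb
      rcases lt_trichotomy a b with h | h | h
      · simp [h, h.not_gt]
      · subst h
        exact absurd ha (mem_compl.mp hb)
      · simp [h, h.not_gt]
    rw [sum_congr rfl fun a ha => sum_congr rfl fun b hb => this a ha b hb]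
    simp [card_compl, Nat.cast_sub (show #ε ≤ n by simpa using card_le_univ ε), mul_sub]
  have hC : ∀ a : Fin n, ∑ b, ((if a < b then (1 : ℤ) else 0) - if b < a then 1 else 0) =
      (n : ℤ) - 1 - 2 * a := by
    intro a
    have h1 : #(univ.filter fun b => a < b) = n - 1 - a := by
      rw [← Fin.card_Ioi]; congr 1; ext; simp
    have h2 : #(univ.filter fun b => b < a) = a := by
      rw [← Fin.card_Iio a]; congr 1; ext; simp
    rw [sum_sub_distrib, sum_boole, sum_boole, h1, h2]
    have := a.2
    omega
  rw [← hB, ← sum_congr rfl fun a _ => hC a, hA]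
  have hD : ∀ a ∈ ε, ∑ b, ((if a < b then (1 : ℤ) else 0) - if b < a then 1 else 0) =
      ∑ b ∈ ε, ((if a < b then (1 : ℤ) else 0) - if b < a then 1 else 0) +
      ∑ b ∈ εᶜ, ((if a < b then (1 : ℤ) else 0) - if b < a then 1 else 0) := fun a _ =>
    (sum_add_sum_compl ε _).symm
  rw [sum_congr rfl hD, sum_add_distrib, hsum, zero_add, ← sum_add_distrib, mul_sum]
  refine sum_congr rfl fun a _ => ?_
  rw [mul_sum, ← sum_add_distrib]
  refine sum_congr rfl fun b _ => ?_
  ring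

/-- The matrix with the entries of `c` at the places `(a, b)`, `a < b`, `a ∈ ε`, `b ∉ ε`. -/
def blockPart (ε : Finset (Fin n)) (c : Fin n → Fin n → E) : Matrix (Fin n) (Fin n) E :=
  Matrix.of fun a b => if a ∈ ε ∧ b ∉ ε ∧ a < b then c a b else 0

/-- A middle index would have to lie both inside and outside `ε`. -/
theorem blockPart_mul_blockPart (ε : Finset (Fin n)) (c c' : Fin n → Fin n → E) :
    blockPart ε c * blockPart ε c' = 0 := by
  ext a b
  rw [Matrix.mul_apply]
  refine sum_eq_zero fun k _ => ?_
  simp only [blockPart, Matrix.of_apply]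
  by_cases hk : k ∈ ε <;> simp [hk]

/-- The unipotent matrix `1 + blockPart ε c`. -/
def blockUni (ε : Finset (Fin n)) (c : Fin n → Fin n → E) : GL (Fin n) E where
  val := 1 + blockPart ε c
  inv := 1 - blockPart ε c
  val_inv := by
    rw [mul_sub, mul_one, add_mul, one_mul, blockPart_mul_blockPart]
    abel
  inv_val := by
    rw [mul_add, mul_one, sub_mul, one_mul, blockPart_mul_blockPart]
    abel

theorem blockUni_mem (ε : Finset (Fin n)) (c : Fin n → Fin n → E) :
    blockUni ε c ∈ unipotent n E := by
  constructor
  · intro i j h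
    simp [blockUni, blockPart, Matrix.one_apply_ne h.ne', h.not_gt]
  · intro i
    simp [blockUni, blockPart]

namespace PlaceData

variable (P : PlaceData E O J)

/-- The index set of the cosets in `K ϖ_j^{(1^k, 0^{n-k})} K / K`. -/
def cosetIndex (n : ℕ) (j : J) (k : ℕ) : Finset (Σ _ : Finset (Fin n), Fin n → Fin n → E) :=
  (powersetCard k univ).sigma fun ε => Fintype.piFinset fun a => Fintype.piFinset fun b =>
    if a ∈ ε ∧ b ∉ ε ∧ a < b then P.res j else {0}

/-- The coset representatives of `K ϖ_j^{(1^k, 0^{n-k})} K / K`. -/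
def cosetRep (j : J) (x : Σ _ : Finset (Fin n), Fin n → Fin n → E) : GL (Fin n) E :=
  blockUni x.1 x.2 * P.torus (Pi.single j (indZ x.1))

/-- The elements of `K ϖ_j^{(1^k, 0^{n-k})} K`. -/
def IsMinuscule (j : J) (k : ℕ) (g : GL (Fin n) E) : Prop :=
  (∀ a b, g a b ∈ O) ∧ (∀ a b, P.unif j * (g⁻¹ : GL (Fin n) E) a b ∈ O) ∧
    ∀ i, P.ord i (detU g) = if i = j then (k : ℤ) else 0

variable {P}

theorem mul_apply_mem {g h : Matrix (Fin n) (Fin n) E} (hg : ∀ a b, g a b ∈ O)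
    (hh : ∀ a b, h a b ∈ O) (a b : Fin n) : (g * h) a b ∈ O := by
  rw [Matrix.mul_apply]
  exact O.sum_mem fun k _ => O.mul_mem (hg _ _) (hh _ _)

theorem IsMinuscule.mul_left {j : J} {k : ℕ} {g : GL (Fin n) E} (h : P.IsMinuscule j k g)
    {κ : GL (Fin n) E} (hκ : κ ∈ intGL O n) : P.IsMinuscule j k (κ * g) := by
  refine ⟨mul_apply_mem hκ.1 h.1, fun a b => ?_, fun i => ?_⟩
  · have := mul_apply_mem (g := P.unif j • (g⁻¹ : GL (Fin n) E).1) (fun a b => h.2.1 a b) hκ.2 a b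
    rw [smul_mul_assoc] at this
    rw [_root_.mul_inv_rev]
    exact this
  · rw [detU, map_mul, P.ord_mul, P.ord_detU_of_mem hκ, zero_add]
    exact h.2.2 i

theorem IsMinuscule.mul_right {j : J} {k : ℕ} {g : GL (Fin n) E} (h : P.IsMinuscule j k g)
    {κ : GL (Fin n) E} (hκ : κ ∈ intGL O n) : P.IsMinuscule j k (g * κ) := by
  refine ⟨mul_apply_mem h.1 hκ.1, fun a b => ?_, fun i => ?_⟩
  · have := mul_apply_mem (h := P.unif j • (g⁻¹ : GL (Fin n) E).1) hκ.2 (fun a b => h.2.1 a b) a b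
    rw [mul_smul_comm] at this
    rw [_root_.mul_inv_rev]
    exact this
  · rw [detU, map_mul, P.ord_mul, P.ord_detU_of_mem hκ, add_zero]
    exact h.2.2 i

theorem res_mem_of_mem_cosetIndex {j : J} {k : ℕ}
    {x : Σ _ : Finset (Fin n), Fin n → Fin n → E} (hx : x ∈ P.cosetIndex n j k) (a b : Fin n) :
    x.2 a b ∈ O ∧ (a ∈ x.1 → b ∉ x.1 → a < b → x.2 a b ∈ P.res j) ∧
      (¬(a ∈ x.1 ∧ b ∉ x.1 ∧ a < b) → x.2 a b = 0) := by
  have h := (mem_sigma.mp hx).2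
  rw [Fintype.mem_piFinset] at h
  have h := h a
  rw [Fintype.mem_piFinset] at h
  have h := h b
  split_ifs at h with hc
  · exact ⟨P.res_mem j _ h, fun _ _ _ => h, fun h' => absurd hc h'⟩
  · rw [mem_singleton] at h
    exact ⟨h ▸ O.zero_mem, fun h1 h2 h3 => absurd ⟨h1, h2, h3⟩ hc, fun _ => h⟩

theorem blockPart_mem {j : J} {k : ℕ} {x : Σ _ : Finset (Fin n), Fin n → Fin n → E}
    (hx : x ∈ P.cosetIndex n j k) (a b : Fin n) : blockPart x.1 x.2 a b ∈ O := by
  simp only [blockPart, Matrix.of_apply]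
  split_ifs
  · exact (res_mem_of_mem_cosetIndex hx a b).1
  · exact O.zero_mem

theorem one_apply_mem (a b : Fin n) : (1 : Matrix (Fin n) (Fin n) E) a b ∈ O := by
  rw [Matrix.one_apply]; split_ifs; exacts [O.one_mem, O.zero_mem]

theorem blockUni_mem_intGL {j : J} {k : ℕ} {x : Σ _ : Finset (Fin n), Fin n → Fin n → E}
    (hx : x ∈ P.cosetIndex n j k) : blockUni x.1 x.2 ∈ intGL O n :=
  ⟨fun a b => O.add_mem (one_apply_mem a b) (blockPart_mem hx a b),
    fun a b => O.sub_mem (one_apply_mem a b) (blockPart_mem hx a b)⟩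

theorem prod_unif_single (j : J) (l : Fin n → ℤ) (i : Fin n) :
    ∏ j', P.unif j' ^ (Pi.single j l : J → Fin n → ℤ) j' i = P.unif j ^ l i := by
  rw [prod_eq_single j]
  · simp
  · intro j' _ h
    simp [h]
  · simp

theorem torus_single (j : J) (l : Fin n → ℤ) :
    P.torus (Pi.single j l) = diagGL fun i => P.unif j ^ l i := by
  rw [torus, torusOf]
  congr 1
  funext i
  exact prod_unif_single j l i

theorem torus_single_inv (j : J) (l : Fin n → ℤ) :
    (P.torus (Pi.single j l))⁻¹ = diagGL fun i => P.unif j ^ (-l i) := by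
  rw [torus_single, diagGL_inv]
  congr 1
  funext i
  simp

theorem unif_mem (j : J) : (P.unif j : E) ∈ O := by
  refine (P.mem_iff _).mpr fun i => ?_
  rw [P.ord_unif]; split_ifs <;> simp

theorem isMinuscule_torus (j : J) {k : ℕ} {ε : Finset (Fin n)} (hε : #ε = k) :
    P.IsMinuscule j k (P.torus (Pi.single j (indZ ε))) := by
  refine ⟨fun a b => ?_, fun a b => ?_, fun i => ?_⟩
  · rw [torus_single]
    by_cases hab : a = b
    · subst hab
      rw [show (diagGL _ : GL (Fin n) E) a a = _ from Matrix.diagonal_apply_eq _ _]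
      by_cases ha : a ∈ ε
      · simpa [indZ, ha] using unif_mem j
      · simp [indZ, ha]
    · rw [show (diagGL _ : GL (Fin n) E) a b = _ from Matrix.diagonal_apply_ne _ hab]
      exact O.zero_mem
  · rw [torus_single_inv]
    by_cases hab : a = b
    · subst hab
      rw [show (diagGL _ : GL (Fin n) E) a a = _ from Matrix.diagonal_apply_eq _ _]
      by_cases ha : a ∈ ε
      · simp [indZ, ha]
      · simpa [indZ, ha] using unif_mem j
    · rw [show (diagGL _ : GL (Fin n) E) a b = _ from Matrix.diagonal_apply_ne _ hab, mul_zero]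
      exact O.zero_mem
  · rw [ord_detU_torus]
    by_cases hi : i = j
    · subst hi
      simp [indZ, hε]
    · simp [hi]

theorem isMinuscule_cosetRep {j : J} {k : ℕ} {x : Σ _ : Finset (Fin n), Fin n → Fin n → E}
    (hx : x ∈ P.cosetIndex n j k) : P.IsMinuscule j k (P.cosetRep j x) :=
  (isMinuscule_torus j (mem_powersetCard.mp (mem_sigma.mp hx).1).2).mul_left (blockUni_mem_intGL hx)

theorem ord_borelDiag_cosetRep (j : J) (x : Σ _ : Finset (Fin n), Fin n → Fin n → E)
    (i : Fin n) (h : P.cosetRep j x ∈ borelGL n E) :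
    P.ord j (borelDiag ⟨P.cosetRep j x, h⟩ i) = indZ x.1 i := by
  have : (⟨P.cosetRep j x, h⟩ : borelGL n E) =
      ⟨blockUni x.1 x.2, unipotent_le_borelGL (blockUni_mem _ _)⟩ *
      ⟨P.torus (Pi.single j (indZ x.1)), diagGL_mem_borelGL _⟩ := rfl
  rw [this, map_mul, borelDiag_unipotent (blockUni_mem _ _), one_mul, borelDiag_torus,
    ord_prod_unif]
  simp

theorem cosetRep_mem_borelGL (j : J) (x : Σ _ : Finset (Fin n), Fin n → Fin n → E) :
    P.cosetRep j x ∈ borelGL n E :=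
  (borelGL n E).mul_mem (unipotent_le_borelGL (blockUni_mem _ _)) (diagGL_mem_borelGL _)

/-- Distinct representatives lie in distinct cosets. -/
theorem cosetRep_injective {j : J} {k : ℕ} {x y : Σ _ : Finset (Fin n), Fin n → Fin n → E}
    (hx : x ∈ P.cosetIndex n j k) (hy : y ∈ P.cosetIndex n j k)
    (h : (P.cosetRep j x)⁻¹ * P.cosetRep j y ∈ intGL O n) : x = y := by
  obtain ⟨ε, c⟩ := x
  obtain ⟨ε', c'⟩ := y
  -- The diagonal entries of an upper triangular element of `K` have valuation zero, and those of
  -- the representatives record the indicator of `ε`.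
  have hε : ε = ε' := by
    set bx : borelGL n E := ⟨_, cosetRep_mem_borelGL (P := P) j ⟨ε, c⟩⟩ with hbx
    set yb : borelGL n E := ⟨_, cosetRep_mem_borelGL (P := P) j ⟨ε', c'⟩⟩ with hby
    ext i
    have h1 := P.ord_borelDiag_of_mem (b := bx⁻¹ * yb) h i j
    rw [map_mul, map_inv, Pi.mul_apply, Pi.inv_apply, ord_mul, ord_inv, hbx, hby,
      ord_borelDiag_cosetRep, ord_borelDiag_cosetRep] at h1
    simp only [indZ] at h1
    by_cases h2 : i ∈ ε <;> by_cases h3 : i ∈ ε' <;> simp [h2, h3] at h1 ⊢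
  subst hε
  congr 1
  funext a b
  by_cases hab : a ∈ ε ∧ b ∉ ε ∧ a < b
  · have hx' := (res_mem_of_mem_cosetIndex hx a b).2.1 hab.1 hab.2.1 hab.2.2
    have hy' := (res_mem_of_mem_cosetIndex hy a b).2.1 hab.1 hab.2.1 hab.2.2
    have h1 := h.1 a b
    -- Conjugation by the torus divides `c' a b - c a b` by the uniformizer, so integrality forces
    -- equal residue representatives.
    have h2 : (P.cosetRep j ⟨ε, c⟩)⁻¹ * P.cosetRep j ⟨ε, c'⟩ =
        (P.torus (Pi.single j (indZ ε)))⁻¹ * ((blockUni ε c)⁻¹ * blockUni ε c') *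
        P.torus (Pi.single j (indZ ε)) := by
      simp only [cosetRep]
      group
    rw [h2, torus_single_inv, torus_single, mul_diagGL_mul_apply] at h1
    have h3 : ((blockUni ε c)⁻¹ * blockUni ε c' : GL (Fin n) E) a b = c' a b - c a b := by
      change ((1 - blockPart ε c) * (1 + blockPart ε c')) a b = _
      rw [mul_add, mul_one, sub_mul, one_mul, blockPart_mul_blockPart, sub_zero]
      have hne : a ≠ b := hab.2.2.ne
      simp [blockPart, hab, Matrix.one_apply_ne hne]
      ring
    rw [h3] at h1
    simp only [indZ, hab.1, hab.2.1, if_true, if_false, _root_.zpow_neg, zpow_one, zpow_zero,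
      Units.val_one, mul_one] at h1
    exact (P.res_unique j _ hy' _ hx' _ h1 (Units.mul_inv_cancel_left _ _).symm).symm
  · exact ((res_mem_of_mem_cosetIndex hx a b).2.2 hab).trans
      ((res_mem_of_mem_cosetIndex hy a b).2.2 hab).symm

/-- The multiples of the uniformizer. -/
def unifIdeal (P : PlaceData E O J) (j : J) : AddSubgroup E where
  carrier := {x | ∃ y ∈ O, x = P.unif j * y}
  zero_mem' := ⟨0, O.zero_mem, by simp⟩
  add_mem' := by
    rintro _ _ ⟨y, hy, rfl⟩ ⟨z, hz, rfl⟩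
    exact ⟨y + z, O.add_mem hy hz, by ring⟩
  neg_mem' := by
    rintro _ ⟨y, hy, rfl⟩
    exact ⟨-y, O.neg_mem hy, by ring⟩

theorem mul_mem_unifIdeal {j : J} {x y : E} (hx : x ∈ P.unifIdeal j) (hy : y ∈ O) :
    x * y ∈ P.unifIdeal j := by
  obtain ⟨z, hz, rfl⟩ := hx
  exact ⟨z * y, O.mul_mem hz hy, by ring⟩

/-- Reduction of one row of an upper triangular matrix. -/
theorem exists_row_reduction {j : J} {ε : Finset (Fin n)} {b : borelGL n E}
    (hb : ∀ a a', b.1 a a' ∈ O) (hb' : ∀ a a', P.unif j * (b⁻¹).1 a a' ∈ O)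
    (h0 : ∀ i ∉ ε, ((borelDiag b i)⁻¹ : Eˣ).1 ∈ O)
    (h1 : ∀ i ∈ ε, (((P.unif j)⁻¹ * borelDiag b i : Eˣ) : E) ∈ O) {a : Fin n} (ha : a ∈ ε) (t : ℕ) :
    ∃ c : Fin n → E, (∀ m, c m ∈ (if m ∉ ε ∧ a < m ∧ m.val < t then P.res j else {0})) ∧
      ∀ m, m.val < t → b.1 a m - ∑ m', c m' * b.1 m' m ∈ P.unifIdeal j := by
  -- The columns are treated from left to right: the first `t` entries of row `a` are divisible by
  -- the uniformizer after subtracting multiples of the rows in `εᶜ` below `a`.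
  induction t with
  | zero => exact ⟨0, by simp, by simp⟩
  | succ t ih =>
    obtain ⟨c, hc, hr⟩ := ih
    have hcO : ∀ m, c m ∈ O := fun m => by
      have := hc m
      split_ifs at this
      · exact P.res_mem j _ this
      · rw [mem_singleton.mp this]; exact O.zero_mem
    have hc0 : ∀ m, ¬(m ∉ ε ∧ a < m ∧ m.val < t) → c m = 0 := fun m hm => by
      have := hc m
      rw [if_neg hm] at this
      exact mem_singleton.mp this
    by_cases htn : t < n
    swap
    · refine ⟨c, fun m => ?_, fun m hm => hr m (by omega)⟩
      have := hc m
      have hiff : m.val < t + 1 ↔ m.val < t := by have := m.2; omega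
      simpa only [hiff] using this
    set T : Fin n := ⟨t, htn⟩ with hT
    by_cases hcase : T ∉ ε ∧ a < T
    -- The diagonal entry in column `T ∉ ε` is invertible in `O`, so a residue multiple of row `T`
    -- clears the entry modulo the uniformizer. Upper triangularity leaves the earlier columns
    -- untouched.
    · obtain ⟨ρ, hρ, z, hz, hz'⟩ := P.res_exists j
        ((b.1 a T - ∑ m', c m' * b.1 m' T) * ((borelDiag b T)⁻¹ : Eˣ))
        (O.mul_mem (O.sub_mem (hb _ _) (O.sum_mem fun m _ => O.mul_mem (hcO m) (hb _ _)))
          (h0 T hcase.1))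
      have hcT : c T = 0 := hc0 T (by simp [hT])
      have hsum : ∀ m, ∑ m', Function.update c T ρ m' * b.1 m' m =
          ∑ m', c m' * b.1 m' m + ρ * b.1 T m := by
        intro m
        have : ∀ m', Function.update c T ρ m' * b.1 m' m =
            c m' * b.1 m' m + if m' = T then ρ * b.1 T m else 0 := by
          intro m'
          by_cases h : m' = T
          · subst h; simp [hcT]
          · simp [h]
        rw [sum_congr rfl fun m' _ => this m', sum_add_distrib]
        simp
      refine ⟨Function.update c T ρ, fun m => ?_, fun m hm => ?_⟩
      · by_cases hm : m = T
        · subst hm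
          rw [if_pos ⟨hcase.1, hcase.2, by simp [hT]⟩]
          simpa using hρ
        · have hiff : m.val < t + 1 ↔ m.val < t := by
            have : m.val ≠ t := fun h => hm (Fin.ext h)
            omega
          simpa only [Function.update_of_ne hm, hiff] using hc m
      · rw [hsum]
        rcases Nat.lt_succ_iff_lt_or_eq.mp hm with hm | hm
        · rw [b.2 T m (Fin.lt_def.mpr hm), mul_zero, add_zero]
          exact hr m hm
        · have : T = m := Fin.ext hm.symm
          clear_value T
          subst this
          refine ⟨z * b.1 T T, O.mul_mem hz (hb _ _), ?_⟩
          rw [← mul_assoc, ← hz', sub_mul, mul_assoc, ← borelDiag_apply, Units.inv_mul, mul_one]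
          ring
    · refine ⟨c, fun m => ?_, fun m hm => ?_⟩
      · by_cases hm : m = T
        · subst hm
          rw [if_neg (fun h => hcase ⟨h.1, h.2.1⟩), hc0 _ (fun h => hcase ⟨h.1, h.2.1⟩)]
          simp
        · have hiff : m.val < t + 1 ↔ m.val < t := by
            have : m.val ≠ t := fun h => hm (Fin.ext h)
            omega
          simpa only [hiff] using hc m
      · rcases Nat.lt_succ_iff_lt_or_eq.mp hm with hm | hm
        · exact hr m hm
        have : T = m := Fin.ext hm.symm
        clear_value T
        subst this
        rcases lt_trichotomy T a with hma | hma | hma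
        · have : b.1 a T - ∑ T', c T' * b.1 T' T = 0 := by
            rw [b.2 a T hma, zero_sub, neg_eq_zero]
            refine sum_eq_zero fun T' _ => ?_
            by_cases h : a < T'
            · rw [b.2 T' T (hma.trans h), mul_zero]
            · rw [hc0 T' fun h' => h h'.2.1, zero_mul]
          rw [this]
          exact (P.unifIdeal j).zero_mem
        · have : ∑ T', c T' * b.1 T' T = 0 := by
            refine sum_eq_zero fun T' _ => ?_
            by_cases h : a < T'
            · rw [b.2 T' T (hma ▸ h), mul_zero]
            · rw [hc0 T' fun h' => h h'.2.1, zero_mul]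
          rw [this, sub_zero, hma]
          refine ⟨_, h1 a ha, ?_⟩
          rw [Units.val_mul, Units.mul_inv_cancel_left, borelDiag_apply]
        -- In a column of `ε` to the right of `a` there is nothing to choose. The reduced row times
        -- column `T` of `ϖ b⁻¹` vanishes and all terms before `T` are divisible by `ϖ`, so the
        -- entry at `T` times the unit `ϖ / b_TT` is divisible too.
        · have hmε : T ∈ ε := by
            by_contra h
            exact hcase ⟨h, hma⟩
          set r : Fin n → E := fun T => b.1 a T - ∑ T', c T' * b.1 T' T with hrdef
          have hinv : ∀ a', ∑ T', b.1 a' T' * (P.unif j * (b⁻¹).1 T' T) =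
              if a' = T then (P.unif j : E) else 0 := by
            intro a'
            have : (b.1 * (b⁻¹).1 : GL (Fin n) E) a' T = if a' = T then 1 else 0 := by
              rw [Subgroup.coe_inv, mul_inv_cancel]
              simp [Matrix.one_apply]
            rw [Units.val_mul, Matrix.mul_apply] at this
            rw [sum_congr rfl fun T' _ => mul_left_comm _ _ _, ← mul_sum, this]
            split_ifs <;> simp
          have hsum : ∑ T', r T' * (P.unif j * (b⁻¹).1 T' T) = 0 := by
            simp only [hrdef, sub_mul, sum_sub_distrib, hinv, sum_mul]
            rw [sum_comm]
            simp only [mul_assoc, ← mul_sum, hinv]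
            simp [hma.ne, hc0 T fun h => h.1 hmε]
          rw [← add_sum_erase _ _ (mem_univ T), add_eq_zero_iff_eq_neg] at hsum
          have h2 : r T * (P.unif j * (b⁻¹).1 T T) ∈ P.unifIdeal j := by
            rw [hsum]
            refine neg_mem (sum_mem fun T' hm' => ?_)
            rcases lt_trichotomy T' T with h | h | h
            · exact mul_mem_unifIdeal (hr T' (hm ▸ Fin.lt_def.mp h)) (hb' _ _)
            · exact absurd h (ne_of_mem_erase hm')
            · rw [(b⁻¹).2 T' T h, mul_zero, mul_zero]
              exact zero_mem _
          have h3 := mul_mem_unifIdeal h2 (h1 T hmε)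
          have h4 : ((b⁻¹).1 T T : E) = ((borelDiag b T)⁻¹ : Eˣ) := rfl
          rw [h4, mul_assoc, ← Units.val_mul, ← Units.val_mul,
            show P.unif j * (borelDiag b T)⁻¹ * ((P.unif j)⁻¹ * borelDiag b T) = 1 by
              rw [mul_mul_mul_comm]; simp [mul_comm], Units.val_one, mul_one] at h3
          exact h3

/-- Every element of the double coset lies in the coset of some representative. -/
theorem IsMinuscule.exists_cosetRep {j : J} {k : ℕ} {g : GL (Fin n) E} (hg : P.IsMinuscule j k g) :
    ∃ x ∈ P.cosetIndex n j k, (P.cosetRep j x)⁻¹ * g ∈ intGL O n := by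
  obtain ⟨κ, hκ, hb⟩ := P.iwasawa n g
  set b : borelGL n E := ⟨g * κ, hb⟩ with hbdef
  have hbm : P.IsMinuscule j k b.1 := hg.mul_right hκ
  have hord0 : ∀ i a, 0 ≤ P.ord i (borelDiag b a) := fun i a => (P.mem_iff _).mp (hbm.1 a a) i
  -- Integrality of `ϖ_j b⁻¹` bounds the diagonal valuations from above.
  have hord1 : ∀ i a, P.ord i (borelDiag b a) ≤ if i = j then 1 else 0 := by
    intro i a
    have h := hbm.2.1 a a
    have h4 : P.unif j * ((b.1⁻¹ : GL (Fin n) E) a a : E) =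
      ((P.unif j * (borelDiag b a)⁻¹ : Eˣ) : E) := rfl
    rw [h4] at h
    have := (P.mem_iff _).mp h i
    rw [ord_mul, ord_unif, ord_inv] at this
    omega
  -- The set `ε` of the representative is read off from the diagonal; the valuation of the
  -- determinant gives its cardinality.
  set ε : Finset (Fin n) := univ.filter fun a => P.ord j (borelDiag b a) = 1 with hε
  have hordε : ∀ i a, P.ord i (borelDiag b a) = if i = j ∧ a ∈ ε then 1 else 0 := by
    intro i a
    have h0 := hord0 i a
    have h1 := hord1 i a
    by_cases hi : i = j
    · subst hi
      by_cases ha : a ∈ ε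
      · simp only [ha, and_self, if_true]
        exact (mem_filter.mp ha).2
      · simp only [ha, and_false, if_false]
        have : P.ord i (borelDiag b a) ≠ 1 := fun h => ha (mem_filter.mpr ⟨mem_univ _, h⟩)
        simp only [if_true] at h1
        omega
    · simp only [hi, false_and, if_false] at h1 ⊢
      omega
  have hcard : #ε = k := by
    have h1 := hbm.2.2 j
    rw [detU_borel, ord_prod] at h1
    simp only [hordε, true_and, if_true] at h1
    rw [sum_ite_mem, univ_inter] at h1
    simpa using h1
  have h0 : ∀ i ∉ ε, ((borelDiag b i)⁻¹ : Eˣ).1 ∈ O := by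
    intro i hi
    refine (P.mem_iff _).mpr fun j' => ?_
    rw [ord_inv, hordε]
    simp [hi]
  have h1 : ∀ i ∈ ε, (((P.unif j)⁻¹ * borelDiag b i : Eˣ) : E) ∈ O := by
    intro i hi
    refine (P.mem_iff _).mpr fun j' => ?_
    rw [ord_mul, ord_inv, ord_unif, hordε]
    simp [hi]
  have hrow : ∀ a, ∃ c : Fin n → E,
      (∀ m, c m ∈ (if a ∈ ε ∧ m ∉ ε ∧ a < m then P.res j else {0})) ∧
      (a ∈ ε → ∀ m, b.1 a m - ∑ m', c m' * b.1 m' m ∈ P.unifIdeal j) := by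
    intro a
    by_cases ha : a ∈ ε
    · obtain ⟨c, hc, hc'⟩ := exists_row_reduction (P := P) (b := b) hbm.1 hbm.2.1 h0 h1 ha n
      refine ⟨c, fun m => ?_, fun _ m => hc' m m.2⟩
      have := hc m
      simpa [ha] using this
    · exact ⟨0, by simp [ha], fun h => absurd h ha⟩
  choose c hc hc' using hrow
  have hx : (⟨ε, c⟩ : Σ _ : Finset (Fin n), Fin n → Fin n → E) ∈ P.cosetIndex n j k := by
    refine mem_sigma.mpr ⟨mem_powersetCard.mpr ⟨subset_univ _, hcard⟩, ?_⟩
    rw [Fintype.mem_piFinset]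
    intro a
    rw [Fintype.mem_piFinset]
    exact fun m => hc a m
  refine ⟨⟨ε, c⟩, hx, ?_⟩
  have hgb : (P.cosetRep j ⟨ε, c⟩)⁻¹ * g = (P.cosetRep j ⟨ε, c⟩)⁻¹ * b.1 * κ⁻¹ := by
    simp [hbdef, mul_assoc]
  rw [hgb]
  refine (intGL O n).mul_mem ?_ ((intGL O n).inv_mem hκ)
  refine P.mem_intGL_of_ord_det (fun a m => ?_) fun i => ?_
  · rw [cosetRep, _root_.mul_inv_rev, torus_single_inv, mul_assoc, diagGL_mul_apply]
    have hentry : ((blockUni ε c)⁻¹ * b.1 : GL (Fin n) E) a m =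
        b.1 a m - ∑ m', c a m' * b.1 m' m := by
      change ((1 - blockPart ε c) * (b.1 : Matrix (Fin n) (Fin n) E)) a m = _
      rw [sub_mul, one_mul, Matrix.sub_apply, Matrix.mul_apply]
      congr 1
      refine sum_congr rfl fun m' _ => ?_
      simp only [blockPart, Matrix.of_apply]
      split_ifs with h
      · rfl
      · rw [show c a m' = 0 from (res_mem_of_mem_cosetIndex hx a m').2.2 h]
    rw [hentry]
    by_cases ha : a ∈ ε
    · obtain ⟨y, hy, hy'⟩ := hc' a ha m
      rw [hy']
      simpa [indZ, ha] using hy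
    · have : ∑ m', c a m' * b.1 m' m = 0 := sum_eq_zero fun m' _ => by
        rw [show c a m' = 0 from (res_mem_of_mem_cosetIndex hx a m').2.2 fun h => ha h.1,
          zero_mul]
      simpa [indZ, ha, this] using hbm.1 a m
  · rw [detU, map_mul, map_inv, ord_mul, ord_inv, ← detU, ← detU,
      (isMinuscule_cosetRep hx).2.2 i, hbm.2.2 i]
    omega

/-- Left multiplication by `K` permutes the cosets. -/
theorem sum_mul_cosetRep {A : Type*} [AddCommMonoid A] {f : GL (Fin n) E → A}
    (hf : ∀ g, ∀ κ ∈ intGL O n, f (g * κ) = f g) (j : J) (k : ℕ) {κ : GL (Fin n) E}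
    (hκ : κ ∈ intGL O n) :
    ∑ x ∈ P.cosetIndex n j k, f (κ * P.cosetRep j x) =
      ∑ x ∈ P.cosetIndex n j k, f (P.cosetRep j x) := by
  have hex : ∀ κ ∈ intGL O n, ∀ x ∈ P.cosetIndex n j k, ∃ y ∈ P.cosetIndex n j k,
      (P.cosetRep j y)⁻¹ * (κ * P.cosetRep j x) ∈ intGL O n := fun κ hκ x hx =>
    ((isMinuscule_cosetRep hx).mul_left hκ).exists_cosetRep
  have hκ' := (intGL O n).inv_mem hκ
  choose i hi hi' using hex κ hκ
  choose i' hi2 hi2' using hex κ⁻¹ hκ'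
  refine sum_bij' i i' hi hi2 (fun x hx => ?_) (fun x hx => ?_) fun x hx => ?_
  · refine cosetRep_injective (hi2 _ _) hx ?_
    have h := (intGL O n).mul_mem ((intGL O n).mul_mem
      (hi2' (i x hx) (hi x hx)) (hi' x hx)) (intGL O n).one_mem
    simpa [mul_assoc] using h
  · refine cosetRep_injective (hi _ _) hx ?_
    have h := (intGL O n).mul_mem ((intGL O n).mul_mem
      (hi' (i' x hx) (hi2 x hx)) (hi2' x hx)) (intGL O n).one_mem
    simpa [mul_assoc] using h
  · rw [← hf (P.cosetRep j (i x hx)) _ (hi' x hx), mul_inv_cancel_left]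

end PlaceData

end Cosets

end AsaiZeta

namespace AsaiZeta

/-! ### Hecke operators on functions and the uniqueness of bi-invariant eigenfamilies. -/

section Hecke

open Matrix Finset

variable {E : Type*} [CommRing E] {O : Subring E} {J : Type*} [Fintype J] [DecidableEq J] {n : ℕ}

namespace PlaceData

variable {P : PlaceData E O J}

theorem torus_conj_unipotent (l : J → Fin n → ℤ) {u : GL (Fin n) E} (hu : u ∈ unipotent n E) :
    P.torus l * u * (P.torus l)⁻¹ ∈ unipotent n E := by
  refine ⟨(borelGL n E).mul_mem ((borelGL n E).mul_mem (diagGL_mem_borelGL _)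
    (unipotent_le_borelGL hu)) ((borelGL n E).inv_mem (diagGL_mem_borelGL _)), fun i => ?_⟩
  rw [torus, torusOf, diagGL_inv, mul_diagGL_mul_apply, hu.2 i, mul_one]
  exact Units.mul_inv _

theorem card_res_pos (j : J) : 0 < #(P.res j) := by
  obtain ⟨r, hr, -⟩ := P.res_exists j 0 O.zero_mem
  exact card_pos.mpr ⟨r, hr⟩

/-- The Hecke operator on functions that are left invariant under integral unipotent matrices. -/
theorem sum_torus_mul_cosetRep {f : GL (Fin n) E → ℂ}
    (hf : ∀ u ∈ unipotent n E, (∀ a b, u a b ∈ O) → ∀ g, f (u * g) = f g) (j : J) (k : ℕ)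
    {l : J → Fin n → ℤ} (hl : ∀ j, Antitone (l j)) :
    ∑ x ∈ P.cosetIndex n j k, f (P.torus l * P.cosetRep j x) =
      ∑ ε ∈ powersetCard k univ,
        (#(P.res j) : ℂ) ^ crossings ε * f (P.torus (l + Pi.single j (indZ ε))) := by
  rw [cosetIndex, sum_sigma]
  refine sum_congr rfl fun ε hε => ?_
  rw [sum_congr rfl (g := fun _ => f (P.torus (l + Pi.single j (indZ ε))))]
  · rw [sum_const, nsmul_eq_mul]
    congr 1
    rw [Fintype.card_piFinset]
    simp only [Fintype.card_piFinset, apply_ite Finset.card, card_singleton]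
    rw [crossings, ← prod_pow_eq_pow_sum]
    push_cast
    refine prod_congr rfl fun a _ => ?_
    rw [← prod_pow_eq_pow_sum]
    refine prod_congr rfl fun b _ => ?_
    split_ifs <;> simp
  · intro c hc
    have hx : (⟨ε, c⟩ : Σ _ : Finset (Fin n), Fin n → Fin n → E) ∈ P.cosetIndex n j k :=
      mem_sigma.mpr ⟨hε, hc⟩
    -- The unipotent part of the representative moves to the left across the torus and remains
    -- integral because the weight is dominant. All representatives with the same `ε` therefore give
    -- the same value.
    have h1 : P.torus l * P.cosetRep j ⟨ε, c⟩ = P.torus l * blockUni ε c * (P.torus l)⁻¹ *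
        P.torus (l + Pi.single j (indZ ε)) := by
      rw [torus_add, cosetRep]
      group
    rw [h1]
    exact hf _ (torus_conj_unipotent l (blockUni_mem ε c))
      (P.torus_conj_mem hl (blockUni_mem ε c) (blockUni_mem_intGL hx).1).1 _

/-- When `l` vanishes off `ε`, the multiset of coordinates of `l + indZ ε` consists of the nonzero
coordinates raised by one, and of ones and zeros in numbers fixed by `#ε`. It does not depend on the
choice of `ε`. -/
theorem exists_perm_add_indZ {l : Fin n → ℤ} {ε ε' : Finset (Fin n)} (hcard : #ε = #ε')
    (h : ∀ i ∉ ε, l i = 0) (h' : ∀ i ∉ ε', l i = 0) :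
    ∃ σ : Equiv.Perm (Fin n), l + indZ ε = (l + indZ ε') ∘ σ := by
  classical
  have key : ∀ (g : ℤ → ℤ) (ε : Finset (Fin n)), (∀ i ∉ ε, l i = 0) →
      ∑ i, g ((l + indZ ε) i) = ∑ i, (if l i = 0 then 0 else g (l i + 1) - g 1) + #ε * g 1 +
        (n - #ε) * g 0 := by
    intro g ε h
    have h1 : ∀ i, g ((l + indZ ε) i) = (if l i = 0 then 0 else g (l i + 1) - g 1) +
        ((if i ∈ ε then 1 else 0) * g 1 + (1 - if i ∈ ε then 1 else 0) * g 0) := by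
      intro i
      by_cases hi : i ∈ ε
      · by_cases hl : l i = 0 <;> simp [indZ, hi, hl]
      · simp [indZ, hi, h i hi]
    rw [sum_congr rfl fun i _ => h1 i, sum_add_distrib, sum_add_distrib, ← sum_mul, ← sum_mul,
      sum_sub_distrib]
    simp
    ring
  have hfib : ∀ c, Nonempty ({i // (l + indZ ε) i = c} ≃ {i // (l + indZ ε') i = c}) := by
    intro c
    refine Fintype.card_eq.mp ?_
    have h1 := key (fun x => if x = c then 1 else 0) ε h
    have h2 := key (fun x => if x = c then 1 else 0) ε' h'
    rw [← hcard, ← h1, sum_boole, sum_boole] at h2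
    rw [Fintype.card_subtype, Fintype.card_subtype]
    exact_mod_cast h2.symm
  refine ⟨Equiv.ofFiberEquiv fun c => (hfib c).some, ?_⟩
  funext i
  exact (Equiv.ofFiberEquiv_map _ i).symm

section Uniqueness

variable {M : Type*} {D : M → GL (Fin n) E → ℂ} {τ : J → ℕ → M → M}

/-- Permuting the weight at one place amounts to multiplication by elements of `K` on both sides
(the axiom `perm`); the places are treated one at a time. -/
theorem apply_torus_comp_perm (hl : ∀ m g, ∀ κ ∈ intGL O n, D m (κ * g) = D m g)
    (hr : ∀ m g, ∀ κ ∈ intGL O n, D m (g * κ) = D m g) (m : M) (l : J → Fin n → ℤ)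
    (σ : J → Equiv.Perm (Fin n)) : D m (P.torus fun j => l j ∘ σ j) = D m (P.torus l) := by
  have key : ∀ s : Finset J, D m (P.torus fun j => if j ∈ s then l j ∘ σ j else l j) =
      D m (P.torus l) := by
    intro s
    induction s using Finset.induction_on with
    | empty => simp
    | insert j s hj ih =>
      rw [← ih]
      obtain ⟨k, hk, k', hk', h⟩ := P.perm n j (σ j) fun j => if j ∈ s then l j ∘ σ j else l j
      have h1 : (fun j' => if j' ∈ insert j s then l j' ∘ σ j' else l j') =
          Function.update (fun j => if j ∈ s then l j ∘ σ j else l j) j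
            ((fun j => if j ∈ s then l j ∘ σ j else l j) j ∘ σ j) := by
        funext j'
        by_cases h : j' = j
        · subst h; simp [hj]
        · simp [h]
      rw [h1, torus, h, hr _ _ _ hk', hl _ _ _ hk]
      rfl
  simpa using key univ

theorem exists_antitone_perm (l : J → Fin n → ℤ) :
    ∃ σ : J → Equiv.Perm (Fin n), ∀ j, Antitone (l j ∘ σ j) := by
  refine ⟨fun j => Tuple.sort (-l j), fun j a b hab => ?_⟩
  have := Tuple.monotone_sort (-l j) hab
  simpa using this

variable (hl : ∀ m g, ∀ κ ∈ intGL O n, D m (κ * g) = D m g)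
  (hr : ∀ m g, ∀ κ ∈ intGL O n, D m (g * κ) = D m g)
  (hT : ∀ j k m g, ∑ x ∈ P.cosetIndex n j k, D m (g * P.cosetRep j x) = D (τ j k m) g)
  (h1 : ∀ m, D m 1 = 0)

include hl hT in
theorem apply_torus_sum (j : J) (k : ℕ) (m : M) {l : J → Fin n → ℤ} (hanti : ∀ j, Antitone (l j)) :
    D (τ j k m) (P.torus l) = ∑ ε ∈ powersetCard k univ,
        (#(P.res j) : ℂ) ^ crossings ε * D m (P.torus (l + Pi.single j (indZ ε))) := by
  rw [← hT, sum_torus_mul_cosetRep _ j k hanti]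
  intro u hu hu' g
  refine hl m g u (P.mem_intGL_of_ord_det hu' fun j => ?_)
  rw [detU_borel ⟨u, unipotent_le_borelGL hu⟩, borelDiag_unipotent hu]
  simp [ord_one]

include hl hr hT h1 in
-- Induction on the squared length of the weight. Lower a nonzero dominant `l` by one on its support
-- `ε₀` at some place to get a shorter `ν`, and apply the Hecke operator of degree `#ε₀` at `ν`. The
-- terms are either permutations of `l`, with nonnegative coefficients not all zero, or shorter than
-- `l` and zero by induction. The left-hand side also vanishes by induction.
theorem apply_torus_eq_zero_of_nonneg (N : ℕ) : ∀ l : J → Fin n → ℤ, (∀ j i, 0 ≤ l j i) →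
    ∑ j, ∑ i, l j i ^ 2 < N → ∀ m, D m (P.torus l) = 0 := by
  induction N with
  | zero =>
    intro l _ hN
    exact absurd hN (not_lt.mpr (by positivity))
  | succ N ih =>
    have main : ∀ l : J → Fin n → ℤ, (∀ j i, 0 ≤ l j i) → (∀ j, Antitone (l j)) →
        ∑ j, ∑ i, l j i ^ 2 < (N + 1 : ℕ) → ∀ m, D m (P.torus l) = 0 := by
      intro l hpos hanti hN m
      by_cases h0 : l = 0
      · rw [h0, torus_zero, h1]
      obtain ⟨j, hj⟩ : ∃ j, l j ≠ 0 := by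
        by_contra! h
        exact h0 (funext h)
      set ε₀ : Finset (Fin n) := univ.filter fun i => 0 < l j i with hε₀
      have hmem : ∀ i, i ∈ ε₀ ↔ 0 < l j i := fun i => by simp [hε₀]
      have hne : 0 < #ε₀ := by
        obtain ⟨i, hi⟩ := Function.ne_iff.mp hj
        exact card_pos.mpr ⟨i, (hmem i).mpr (lt_of_le_of_ne (hpos j i) (Ne.symm hi))⟩
      set ν : J → Fin n → ℤ := Function.update l j (l j - indZ ε₀) with hν
      have hνj : ν j = l j - indZ ε₀ := by simp [hν]
      have hνj' : ∀ i, ν j i = l j i - if 0 < l j i then 1 else 0 := fun i => by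
        rw [hνj, Pi.sub_apply, indZ]
        simp only [hmem]
      have hνne : ∀ j' ≠ j, ν j' = l j' := fun j' h => by simp [hν, h]
      have hνpos : ∀ j' i, 0 ≤ ν j' i := by
        intro j' i
        by_cases h : j' = j
        · subst h
          have := hpos j' i
          rw [hνj']
          split_ifs <;> omega
        · rw [hνne j' h]; exact hpos j' i
      have hνanti : ∀ j', Antitone (ν j') := by
        intro j' a b hab
        by_cases h : j' = j
        · subst h
          have h1 := hanti j' hab
          have h2 := hpos j' b
          rw [hνj', hνj']
          split_ifs <;> omega
        · rw [hνne j' h]; exact hanti j' hab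
      have hsplit : ∀ f : J → Fin n → ℤ, (∀ j' ≠ j, f j' = l j') →
          ∑ j', ∑ i, f j' i ^ 2 = ∑ j', ∑ i, l j' i ^ 2 + ∑ i, (f j i ^ 2 - l j i ^ 2) := by
        intro f hf
        have h2 : ∑ j' ∈ univ.erase j, ∑ i, f j' i ^ 2 = ∑ j' ∈ univ.erase j, ∑ i, l j' i ^ 2 :=
          sum_congr rfl fun j' hj' => by rw [hf j' (ne_of_mem_erase hj')]
        rw [← add_sum_erase _ _ (mem_univ j), ← add_sum_erase (a := j) univ (fun j' => ∑ i, l j' i ^ 2)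
          (mem_univ j), sum_sub_distrib, h2]
        ring
      -- Among the `ν + indZ ε` with `#ε = #ε₀`, the squared length is maximal, equal to that of
      -- `l`, exactly when `ν` vanishes off `ε`.
      have hsq : ∀ ε : Finset (Fin n), #ε = #ε₀ →
          ∑ i, ((ν j i + indZ ε i) ^ 2 - l j i ^ 2) = - 2 * ∑ i ∈ εᶜ, ν j i := by
        intro ε hε
        have e1 : ∀ i, (ν j i + indZ ε i) ^ 2 - l j i ^ 2 =
            -2 * (if i ∉ ε then ν j i else 0) + ((if i ∈ ε then 1 else 0) - indZ ε₀ i) := by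
          intro i
          rw [hνj']
          simp only [indZ, hmem]
          have := hpos j i
          by_cases h : 0 < l j i
          · by_cases h' : i ∈ ε <;> simp [h, h'] <;> ring
          · have h3 : l j i = 0 := by omega
            by_cases h' : i ∈ ε <;> simp [h3, h']
        rw [sum_congr rfl fun i _ => e1 i, sum_add_distrib, ← mul_sum, sum_sub_distrib,
          ← sum_filter]
        simp only [indZ, sum_boole, filter_mem_eq_inter, univ_inter, hε, sub_self, add_zero]
        congr 2
        ext; simp
      have hzero : D (τ j #ε₀ m) (P.torus ν) = 0 := by
        refine ih ν hνpos ?_ _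
        have h2 : ∑ i, (ν j i ^ 2 - l j i ^ 2) < 0 := by
          obtain ⟨i, hi⟩ := card_pos.mp hne
          refine sum_neg' (fun i _ => ?_) ⟨i, mem_univ i, ?_⟩
          · have := hpos j i
            rw [hνj']
            split_ifs <;> nlinarith
          · have := (hmem i).mp hi
            rw [hνj', if_pos this]
            nlinarith
        rw [hsplit ν hνne]
        push_cast at hN
        omega
      rw [apply_torus_sum hl hT j _ m hνanti] at hzero
      -- Coefficients are kept as natural numbers so that their sum can be seen to be nonzero.
      have hterm : ∀ ε ∈ powersetCard #ε₀ (univ : Finset (Fin n)),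
          (#(P.res j) : ℂ) ^ crossings ε * D m (P.torus (ν + Pi.single j (indZ ε))) =
          (((if ∀ i ∉ ε, ν j i = 0 then #(P.res j) ^ crossings ε else 0 : ℕ) : ℂ)) *
            D m (P.torus l) := by
        intro ε hε
        have hcard := (mem_powersetCard.mp hε).2
        split_ifs with hc
        · have hc₀ : ∀ i ∉ ε₀, ν j i = 0 := by
            intro i hi
            rw [hmem] at hi
            have := hpos j i
            rw [hνj', if_neg hi]
            omega
          obtain ⟨σ, hσ⟩ := exists_perm_add_indZ hcard hc hc₀
          have h3 : ν j + indZ ε₀ = l j := by rw [hνj]; abel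
          rw [h3] at hσ
          have h4 : ν + Pi.single j (indZ ε) = fun j' => l j' ∘
              (if j' = j then σ else 1 : Equiv.Perm (Fin n)) := by
            funext j'
            by_cases h : j' = j
            · subst h
              simp [hσ]
            · simp [h, hνne j' h]
          rw [h4, apply_torus_comp_perm hl hr m l fun j' => if j' = j then σ else 1]
          push_cast
          rfl
        · rw [Nat.cast_zero, zero_mul, ih, mul_zero]
          · intro j' i
            have h5 := hνpos j' i
            have h6 : 0 ≤ (Pi.single j (indZ ε) : J → Fin n → ℤ) j' i := by
              by_cases h : j' = j
              · subst h
                simp only [Pi.single_eq_same, indZ]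
                split_ifs <;> simp
              · simp [h]
            exact add_nonneg h5 h6
          · rw [hsplit _ fun j' h => by simp [h, hνne j' h]]
            simp only [Pi.add_apply, Pi.single_eq_same]
            rw [hsq ε hcard]
            push Not at hc
            obtain ⟨i, hi, hi'⟩ := hc
            have h6 : 0 < ∑ i ∈ εᶜ, ν j i :=
              sum_pos' (fun i _ => hνpos j i) ⟨i, mem_compl.mpr hi,
                lt_of_le_of_ne (hνpos j i) (Ne.symm hi')⟩
            push_cast at hN
            omega
      rw [sum_congr rfl hterm, ← sum_mul, ← Nat.cast_sum, mul_eq_zero] at hzero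
      refine hzero.resolve_left (Nat.cast_ne_zero.mpr (ne_of_gt ?_))
      refine sum_pos' (fun _ _ => Nat.zero_le _) ⟨ε₀, mem_powersetCard.mpr ⟨subset_univ _, rfl⟩, ?_⟩
      rw [if_pos]
      · exact pow_pos (card_res_pos j) _
      · intro i hi
        rw [hmem] at hi
        have := hpos j i
        rw [hνj', if_neg hi]
        omega
    intro l hpos hN m
    obtain ⟨σ, hσ⟩ := exists_antitone_perm l
    rw [← apply_torus_comp_perm hl hr m l σ]
    refine main _ (fun j i => hpos j _) hσ ?_ m
    refine lt_of_eq_of_lt (sum_congr rfl fun j _ => ?_) hN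
    exact Equiv.sum_comp (σ j) fun i => l j i ^ 2

include hl hr hT h1 in
/-- Uniqueness of spherical functions: a family of bi-`K`-invariant functions that is stable under
the Hecke operators vanishes if it vanishes at `1`. -/
theorem eq_zero_of_apply_one (hs : ∀ j m, ∃ m', τ j n m' = m) (m : M) (g : GL (Fin n) E) :
    D m g = 0 := by
  -- The operator of degree `n` is translation by the central element `ϖ_j`. Since it is onto the
  -- index set, values at `l` are values at `l + (N, …, N)` of another member of the family, which
  -- reduces the claim to nonnegative weights.
  have hshift : ∀ (j : J) (N : ℕ) (l : J → Fin n → ℤ), (∀ j, Antitone (l j)) → ∀ m, ∃ m',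
      D m (P.torus l) = D m' (P.torus (l + Pi.single j fun _ => (N : ℤ))) := by
    intro j N
    induction N with
    | zero =>
      intro l _ m
      refine ⟨m, ?_⟩
      have : (Pi.single j fun _ : Fin n => ((0 : ℕ) : ℤ)) = (0 : J → Fin n → ℤ) := by
        funext j' i
        by_cases h : j' = j
        · subst h; simp
        · simp [h]
      rw [this, add_zero]
    | succ N ih =>
      intro l hanti m
      obtain ⟨m', hm'⟩ := hs j m
      have h2 := apply_torus_sum (P := P) hl hT j n m' hanti
      have h3 : (powersetCard n univ : Finset (Finset (Fin n))) = {univ} := by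
        have := powersetCard_self (univ : Finset (Fin n))
        rwa [card_univ, Fintype.card_fin] at this
      rw [h3, sum_singleton, hm'] at h2
      have h4 : crossings (univ : Finset (Fin n)) = 0 := by simp [crossings]
      rw [h4, pow_zero, one_mul] at h2
      have hone : indZ (univ : Finset (Fin n)) = fun _ => (1 : ℤ) := by
        funext i; simp [indZ]
      obtain ⟨m'', hm''⟩ := ih (l + Pi.single j (indZ univ)) (fun j' a b hab => by
        have := hanti j' hab
        by_cases h : j' = j
        · subst h; simp [hone, this]
        · simp [h, this]) m'
      refine ⟨m'', ?_⟩
      rw [h2, hm'', add_assoc]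
      congr 3
      rw [← Pi.single_add]
      congr 1
      funext i
      simp [hone, add_comm]
  have hshift' : ∀ (N : ℕ) (l : J → Fin n → ℤ), (∀ j, Antitone (l j)) → ∀ (s : Finset J) m, ∃ m',
      D m (P.torus l) = D m' (P.torus fun j i => l j i + if j ∈ s then (N : ℤ) else 0) := by
    intro N l hanti s
    induction s using Finset.induction_on with
    | empty => intro m; exact ⟨m, by simp⟩
    | insert j s hj ih =>
      intro m
      obtain ⟨m', hm'⟩ := ih m
      obtain ⟨m'', hm''⟩ := hshift j N (fun j i => l j i + if j ∈ s then (N : ℤ) else 0)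
        (fun j a b hab => by simpa using hanti j hab) m'
      refine ⟨m'', ?_⟩
      rw [hm', hm'']
      congr 2
      funext j' i
      by_cases h : j' = j
      · subst h; simp [hj]
      · simp [h]
  have hanti0 : ∀ l : J → Fin n → ℤ, (∀ j, Antitone (l j)) → ∀ m, D m (P.torus l) = 0 := by
    intro l hanti m
    set N : ℕ := ∑ j, ∑ i, (l j i).natAbs with hN
    obtain ⟨m', hm'⟩ := hshift' N l hanti univ m
    rw [hm']
    refine apply_torus_eq_zero_of_nonneg hl hr hT h1
      ((∑ j, ∑ i, (l j i + if j ∈ univ then (N : ℤ) else 0) ^ 2).toNat + 1) _ (fun j i => ?_) ?_ m'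
    · have h2 : (l j i).natAbs ≤ N :=
        (single_le_sum (f := fun i => (l j i).natAbs) (fun _ _ => Nat.zero_le _) (mem_univ i)).trans
          (single_le_sum (f := fun j => ∑ i, (l j i).natAbs) (fun _ _ => Nat.zero_le _) (mem_univ j))
      simp only [mem_univ, if_true]
      omega
    · push_cast
      have := Int.self_le_toNat (∑ j, ∑ i, (l j i + if j ∈ univ then (N : ℤ) else 0) ^ 2)
      omega
  obtain ⟨k, hk, k', hk', l, rfl⟩ := P.exists_cartan g
  rw [hr _ _ _ hk', hl _ _ _ hk]
  obtain ⟨σ, hσ⟩ := exists_antitone_perm l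
  rw [← apply_torus_comp_perm hl hr m l σ]
  exact hanti0 _ hσ m

end Uniqueness

end PlaceData

end Hecke

/-! ### Functionals invariant under a compact subgroup, by averaging. -/

section InvariantFunctional

open Finset

variable {G : Type*} [Group G] {V : Type*} [AddCommGroup V] [Module ℂ V]

/-- The vector `v` is fixed by a subgroup of finite index of `K`. -/
def IsFiniteVector (ρ : Representation ℂ G V) (K : Subgroup G) (v : V) : Prop :=
  ∃ H : Subgroup K, H.FiniteIndex ∧ ∀ h ∈ H, ρ (h : G) v = v

variable {ρ : Representation ℂ G V} {K : Subgroup G}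

/-- Averaging over `K / H`, for a small normal subgroup `H` of finite index, kills every `ρ κ v - v`
and multiplies a fixed vector by the index. -/
theorem eq_zero_of_mem_span_sub {x : V} (hx : ∀ κ ∈ K, ρ κ x = x)
    (hmem : x ∈ Submodule.span ℂ {y | ∃ κ ∈ K, ∃ v, IsFiniteVector ρ K v ∧ y = ρ κ v - v}) : x = 0 := by
  -- Each generator needs its own `H`; quantifying over all smaller normal subgroups makes the
  -- property stable under sums. Normality makes right multiplication act on the cosets.
  have key : ∃ H₀ : Subgroup K, H₀.FiniteIndex ∧ ∀ H ≤ H₀, H.Normal →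
      ∀ [Fintype (K ⧸ H)], ∑ q : K ⧸ H, ρ (q.out : G) x = 0 := by
    clear hx
    induction hmem using Submodule.span_induction with
    | mem y hy =>
      obtain ⟨κ, hκ, v, ⟨H₀, hH₀, hv⟩, rfl⟩ := hy
      refine ⟨H₀, hH₀, fun H hle hnorm _ => ?_⟩
      simp only [map_sub, sum_sub_distrib]
      rw [sub_eq_zero]
      refine Eq.trans (sum_congr rfl fun q _ => ?_)
        (Equiv.sum_comp (Equiv.mulRight ((⟨κ, hκ⟩ : K) : K ⧸ H)) fun q : K ⧸ H => ρ (q.out : G) v)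
      have h1 : ((q.out * ⟨κ, hκ⟩ : K) : K ⧸ H) = q * ((⟨κ, hκ⟩ : K) : K ⧸ H) := by
        rw [QuotientGroup.mk_mul, QuotientGroup.out_eq']
      obtain ⟨h, hh⟩ := QuotientGroup.mk_out_eq_mul H (q.out * ⟨κ, hκ⟩ : K)
      rw [h1] at hh
      change _ = ρ ((q * ((⟨κ, hκ⟩ : K) : K ⧸ H)).out : G) v
      rw [hh, Subgroup.coe_mul, map_mul, Module.End.mul_apply, hv _ (hle h.2), Subgroup.coe_mul,
        map_mul, Module.End.mul_apply]
    | zero => exact ⟨⊤, inferInstance, fun H _ _ _ => by simp⟩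
    | add y z _ _ hy hz =>
      obtain ⟨H, hH, hy⟩ := hy
      obtain ⟨H', hH', hz⟩ := hz
      refine ⟨H ⊓ H', inferInstance, fun L hL hn _ => ?_⟩
      simp only [map_add, sum_add_distrib]
      rw [hy L (hL.trans inf_le_left) hn, hz L (hL.trans inf_le_right) hn, add_zero]
    | smul c y _ hy =>
      obtain ⟨H, hH, hy⟩ := hy
      refine ⟨H, hH, fun L hL hn _ => ?_⟩
      simp only [map_smul, ← smul_sum]
      rw [hy L hL hn, smul_zero]
  obtain ⟨H₀, hH₀, h⟩ := key
  have : Fintype (K ⧸ H₀.normalCore) := Fintype.ofFinite _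
  have h1 := h H₀.normalCore H₀.normalCore_le inferInstance
  rw [sum_congr rfl fun q _ => hx _ q.out.2, sum_const, card_univ, ← Nat.cast_smul_eq_nsmul ℂ,
    smul_eq_zero] at h1
  exact h1.resolve_left (Nat.cast_ne_zero.mpr Fintype.card_ne_zero)

/-- A `K`-fixed vector can be separated from a space of `K`-fixed vectors by a `K`-invariant
functional. -/
theorem exists_invariant_functional {M : Submodule ℂ V}
    (hM : ∀ m ∈ M, ∀ κ ∈ K, ρ κ m = m) {w : V} (hw : ∀ κ ∈ K, ρ κ w = w) (hwM : w ∉ M) :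
    ∃ f : V →ₗ[ℂ] ℂ, (∀ v, IsFiniteVector ρ K v → ∀ κ ∈ K, f (ρ κ v) = f v) ∧ (∀ m ∈ M, f m = 0) ∧ f w = 1 := by
  have hnot : w ∉ Submodule.span ℂ {y | ∃ κ ∈ K, ∃ v, IsFiniteVector ρ K v ∧ y = ρ κ v - v} ⊔ M := by
    intro h
    obtain ⟨x, hx, m, hm, hxm⟩ := Submodule.mem_sup.mp h
    have : x = 0 := eq_zero_of_mem_span_sub (fun κ hκ => by
      rw [eq_sub_of_add_eq hxm, map_sub, hw κ hκ, hM m hm κ hκ]) hx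
    rw [this, zero_add] at hxm
    exact hwM (hxm ▸ hm)
  obtain ⟨f, hf, hle⟩ := Submodule.exists_le_ker_of_notMem hnot
  refine ⟨(f w)⁻¹ • f, fun v hv κ hκ => ?_, fun m hm => ?_, by simp [hf]⟩
  · have : f (ρ κ v - v) = 0 := hle (Submodule.mem_sup_left (Submodule.subset_span ⟨κ, hκ, v, hv, rfl⟩))
    rw [map_sub, sub_eq_zero] at this
    simp [this]
  · have : f m = 0 := hle (Submodule.mem_sup_right hm)
    simp [this]

end InvariantFunctional

end AsaiZeta

namespace AsaiZeta

/-! ### Spherical Whittaker functions: support, Hecke action and Shintani's formula. -/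

section Whittaker

open Matrix Finset

variable {E : Type*} [CommRing E] {O : Subring E} {J : Type*} [Fintype J] [DecidableEq J] {n : ℕ}

namespace PlaceData

variable (P : PlaceData E O J)

/-- The square root of the cardinality of the residue field. -/
def rootCard (j : J) : ℂ := (Real.sqrt #(P.res j) : ℝ)

theorem rootCard_sq (j : J) : P.rootCard j ^ 2 = #(P.res j) := by
  rw [rootCard, ← Complex.ofReal_pow, Real.sq_sqrt (Nat.cast_nonneg _), Complex.ofReal_natCast]

theorem rootCard_ne_zero (j : J) : P.rootCard j ≠ 0 := by
  intro h
  have := P.rootCard_sq j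
  rw [h, zero_pow two_ne_zero] at this
  exact (card_res_pos (P := P) j).ne' (by exact_mod_cast this.symm)

/-- The square root of the modulus character at `ϖ^l`. -/
def modHalf (l : J → Fin n → ℤ) : ℂ :=
  ∏ j, ∏ i : Fin n, P.rootCard j ^ (-((n : ℤ) - 1 - 2 * i) * l j i)

theorem modHalf_add (l l' : J → Fin n → ℤ) :
    P.modHalf (l + l') = P.modHalf l * P.modHalf l' := by
  simp only [modHalf, Pi.add_apply, mul_add, zpow_add₀ (P.rootCard_ne_zero _), prod_mul_distrib]

theorem modHalf_ne_zero (l : J → Fin n → ℤ) : P.modHalf l ≠ 0 :=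
  prod_ne_zero_iff.mpr fun j _ => prod_ne_zero_iff.mpr fun _ _ =>
    zpow_ne_zero _ (P.rootCard_ne_zero j)

theorem modHalf_zero : P.modHalf (0 : J → Fin n → ℤ) = 1 := by simp [modHalf]

/-- The result depends on `ε` only through its cardinality, so dividing by `δ^(1/2)` makes all
coefficients of a Hecke operator equal. -/
theorem modHalf_single (j : J) (ε : Finset (Fin n)) :
    (#(P.res j) : ℂ) ^ crossings ε * P.modHalf (Pi.single j (indZ ε)) =
      P.rootCard j ^ (#ε * (n - #ε)) := by
  have hle : #ε ≤ n := by simpa using card_le_univ ε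
  have h1 : P.modHalf (Pi.single j (indZ ε)) =
      P.rootCard j ^ (-∑ i ∈ ε, ((n : ℤ) - 1 - 2 * i)) := by
    rw [modHalf, prod_eq_single j]
    · rw [Pi.single_eq_same, ← sum_neg_distrib]
      have : ∀ (s : Finset (Fin n)) (f : Fin n → ℤ),
          P.rootCard j ^ (∑ i ∈ s, f i) = ∏ i ∈ s, P.rootCard j ^ f i := by
        intro s f
        induction s using Finset.induction_on with
        | empty => simp
        | insert a s ha ih => rw [sum_insert ha, prod_insert ha, zpow_add₀ (P.rootCard_ne_zero j), ih]
      rw [this, ← prod_subset (subset_univ ε)]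
      · exact prod_congr rfl fun i hi => by simp [indZ, hi]
      · intro i _ hi
        simp [indZ, hi]
    · intro j' _ h
      simp [h]
    · simp
  rw [h1, ← rootCard_sq, ← pow_mul, ← zpow_natCast, ← zpow_natCast,
    ← zpow_add₀ (P.rootCard_ne_zero j)]
  congr 1
  have := two_mul_crossings ε
  push_cast [hle]
  rw [this]
  ring

/-- The normalized values of a function on the torus. -/
def normVal (f : GL (Fin n) E → ℂ) (l : J → Fin n → ℤ) : ℂ := f (P.torus l) / P.modHalf l

variable {P}

/-- On normalized values, the Hecke operator is the right-hand side of Pieri's rule up to a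
constant. -/
theorem sum_torus_mul_cosetRep_eq {f : GL (Fin n) E → ℂ}
    (hf : ∀ u ∈ unipotent n E, (∀ a b, u a b ∈ O) → ∀ g, f (u * g) = f g) (j : J) (k : ℕ)
    {l : J → Fin n → ℤ} (hl : ∀ j, Antitone (l j)) :
    ∑ x ∈ P.cosetIndex n j k, f (P.torus l * P.cosetRep j x) = P.modHalf l *
      (P.rootCard j ^ (k * (n - k)) *
        ∑ ε ∈ powersetCard k univ, P.normVal f (l + Pi.single j (indZ ε))) := by
  rw [sum_torus_mul_cosetRep hf j k hl, mul_sum, mul_sum]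
  refine sum_congr rfl fun ε hε => ?_
  rw [← (mem_powersetCard.mp hε).2, ← modHalf_single, normVal, modHalf_add]
  have h1 := P.modHalf_ne_zero l
  have h2 := P.modHalf_ne_zero (Pi.single j (indZ ε))
  field_simp

/-- A function on `GL_n(E)` that is left equivariant under a generic character of the unipotent
group and right invariant under the integral matrices. -/
structure IsSphericalWhittaker (O : Subring E) (ψ : AddChar E Circle) (W : GL (Fin n) E → ℂ) :
    Prop where
  unipotent_mul : ∀ u ∈ unipotent n E, ∀ g, W (u * g) = genericChar n ψ u * W g
  mul_mem : ∀ g, ∀ κ ∈ intGL O n, W (g * κ) = W g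

theorem genericChar_eq_one {ψ : AddChar E Circle}
    (hψ : ∀ x, (∀ a ∈ O, ψ (x * a) = 1) ↔ x ∈ O) {u : Matrix (Fin n) (Fin n) E}
    (hu : ∀ a b, u a b ∈ O) : genericChar n ψ u = 1 := by
  have h : ((-1) ^ n * ∑ i : Fin n, ∑ j : Fin n, if i.val + 1 = j.val then u i j else 0) ∈ O := by
    refine O.mul_mem (O.pow_mem (O.neg_mem O.one_mem) _) (O.sum_mem fun i _ => O.sum_mem fun j _ => ?_)
    split_ifs
    exacts [hu _ _, O.zero_mem]
  have := (hψ _).mpr h 1 O.one_mem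
  rw [mul_one] at this
  rw [genericChar, this]
  simp

variable {ψ : AddChar E Circle} (hψ : ∀ x, (∀ a ∈ O, ψ (x * a) = 1) ↔ x ∈ O)

include hψ in
theorem IsSphericalWhittaker.integral_mul {W : GL (Fin n) E → ℂ} (hW : IsSphericalWhittaker O ψ W)
    (u : GL (Fin n) E) (hu : u ∈ unipotent n E) (hu' : ∀ a b, u a b ∈ O) (g : GL (Fin n) E) :
    W (u * g) = W g := by
  rw [hW.unipotent_mul u hu, genericChar_eq_one hψ hu', one_mul]

/-- The elementary matrix `1 + a e_{ij}`. -/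
def elemGL {i j : Fin n} (h : i ≠ j) (a : E) : GL (Fin n) E where
  val := Matrix.transvection i j a
  inv := Matrix.transvection i j (-a)
  val_inv := by rw [Matrix.transvection_mul_transvection_same _ _ h]; simp
  inv_val := by rw [Matrix.transvection_mul_transvection_same _ _ h]; simp

theorem elemGL_apply {i j : Fin n} (h : i ≠ j) (a : E) (b c : Fin n) :
    elemGL h a b c = (if b = c then 1 else 0) + if i = b ∧ j = c then a else 0 := by
  change Matrix.transvection i j a b c = _
  simp [Matrix.transvection, Matrix.one_apply, Matrix.single_apply]

include hψ in
/-- A Whittaker function is supported on the dominant weights. -/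
theorem IsSphericalWhittaker.apply_torus_eq_zero {W : GL (Fin n) E → ℂ}
    (hW : IsSphericalWhittaker O ψ W) {l : J → Fin n → ℤ} (hl : ¬ ∀ j, Antitone (l j)) :
    W (P.torus l) = 0 := by
  push Not at hl
  obtain ⟨j, hj⟩ := hl
  rw [antitone_fin_iff] at hj
  push Not at hj
  obtain ⟨a, b, hab, hlt⟩ := hj
  have hne : a < b := Fin.lt_def.mpr (by omega)
  -- Conjugation by the torus multiplies the superdiagonal entry by `y`, which is not integral. As
  -- `ψ` has conductor `O`, some integral `t` makes the generic character nontrivial on the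
  -- conjugate of an element of `K`, so `W` is equal to a nontrivial multiple of itself at this
  -- point.
  set y : Eˣ := (∏ j, P.unif j ^ l j a) * (∏ j, P.unif j ^ l j b)⁻¹ with hy
  have hyO : (-1) ^ n * (y : E) ∉ O := by
    intro h
    have h1 : (y : E) ∈ O := by
      have := O.mul_mem (O.pow_mem (O.neg_mem O.one_mem) n) h
      rwa [← mul_assoc, ← mul_pow, neg_one_mul, neg_neg, one_pow, one_mul] at this
    have := (P.mem_iff y).mp h1 j
    rw [hy, ord_mul, ord_inv, ord_prod_unif, ord_prod_unif] at this
    omega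
  rw [← hψ] at hyO
  push Not at hyO
  obtain ⟨t, ht, htψ⟩ := hyO
  have hut : elemGL hne.ne t ∈ unipotent n E := by
    constructor
    · intro c d hdc
      rw [elemGL_apply, if_neg hdc.ne', if_neg (by rintro ⟨rfl, rfl⟩; exact hdc.not_gt hne),
        add_zero]
    · intro c
      rw [elemGL_apply, if_pos rfl, if_neg (by rintro ⟨rfl, rfl⟩; exact hne.ne rfl), add_zero]
  have hκ : elemGL hne.ne t ∈ intGL O n := by
    refine P.mem_intGL_of_ord_det (fun c d => ?_) fun j => ?_
    · rw [elemGL_apply]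
      refine O.add_mem ?_ ?_
      · split_ifs; exacts [O.one_mem, O.zero_mem]
      · split_ifs; exacts [ht, O.zero_mem]
    · rw [detU_borel ⟨_, unipotent_le_borelGL hut⟩, borelDiag_unipotent hut]
      simp [ord_one]
  have h1 := hW.mul_mem (P.torus l) _ hκ
  have h2 : P.torus l * elemGL hne.ne t =
      P.torus l * elemGL hne.ne t * (P.torus l)⁻¹ * P.torus l := by group
  rw [h2, hW.unipotent_mul _ (torus_conj_unipotent l hut)] at h1
  have h3 : genericChar n ψ (P.torus l * elemGL hne.ne t * (P.torus l)⁻¹ : GL (Fin n) E).1 =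
      ψ ((-1) ^ n * y * t) := by
    rw [genericChar, mul_assoc ((-1) ^ n)]
    congr 3
    rw [sum_eq_single a, sum_eq_single b]
    · rw [if_pos hab, torus, torusOf, diagGL_inv, mul_diagGL_mul_apply, elemGL_apply, if_neg hne.ne,
        if_pos ⟨rfl, rfl⟩, hy, Units.val_mul, Pi.inv_apply]
      ring
    · intro c _ hc
      rw [if_neg]
      intro h
      exact hc (Fin.ext (by omega))
    · simp
    · intro c _ hc
      refine sum_eq_zero fun d _ => ?_
      split_ifs with h
      · rw [torus, torusOf, diagGL_inv, mul_diagGL_mul_apply, elemGL_apply,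
          if_neg (by rintro rfl; omega), if_neg (by rintro ⟨rfl, rfl⟩; exact hc rfl)]
        simp
      · rfl
    · simp
  rw [h3] at h1
  by_contra hne0
  exact htψ (by
    have := mul_right_cancel₀ hne0 (h1.trans (one_mul _).symm)
    exact Subtype.ext this)

include hψ in
/-- The Hecke operators on the normalized values of a Whittaker function. -/
theorem IsSphericalWhittaker.normVal_cosetSum {W W' : GL (Fin n) E → ℂ}
    (hW : IsSphericalWhittaker O ψ W) (hW' : IsSphericalWhittaker O ψ W') {j : J} {k : ℕ}
    (h : ∀ g, W' g = ∑ x ∈ P.cosetIndex n j k, W (g * P.cosetRep j x)) {l : J → Fin n → ℤ}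
    (hl : Antitone (l j)) : P.normVal W' l = P.rootCard j ^ (k * (n - k)) *
        ∑ ε ∈ powersetCard k univ, P.normVal W (l + Pi.single j (indZ ε)) := by
  by_cases hl' : ∀ j, Antitone (l j)
  · rw [normVal, h, sum_torus_mul_cosetRep_eq (hW.integral_mul hψ) j k hl',
      mul_div_cancel_left₀ _ (P.modHalf_ne_zero l)]
  -- The weight fails to be dominant at a place other than `j`. The shifts at `j` do not repair
  -- this, so both sides vanish.
  · rw [normVal, hW'.apply_torus_eq_zero hψ hl', zero_div, sum_eq_zero, mul_zero]
    intro ε _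
    rw [normVal, hW.apply_torus_eq_zero hψ, zero_div]
    push Not at hl' ⊢
    obtain ⟨j', hj'⟩ := hl'
    refine ⟨j', ?_⟩
    have hne : j' ≠ j := by rintro rfl; exact hj' hl
    simpa [hne] using hj'

include hψ in
/-- The values of a spherical Whittaker function that is an eigenfunction. -/
theorem IsSphericalWhittaker.apply_torus_eq {W : GL (Fin n) E → ℂ}
    (hW : IsSphericalWhittaker O ψ W) (h1 : W 1 = 1) {α : J → Fin n → ℂ}
    (hα : ∀ j k, 1 ≤ k → k ≤ n → ∀ g, ∑ x ∈ P.cosetIndex n j k, W (g * P.cosetRep j x) =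
      P.rootCard j ^ (k * (n - k)) * esym (α j) k * W g) {l : J → Fin n → ℕ}
    (hl : ∀ j, Antitone (l j)) :
    W (P.torus fun j i => (l j i : ℤ)) =
      P.modHalf (fun j i => (l j i : ℤ)) * ∏ j, schur (α j) (l j) := by
  have key : ∀ s : Finset J, P.normVal W (fun j i => if j ∈ s then (l j i : ℤ) else 0) =
      ∏ j ∈ s, schur (α j) (l j) := by
    intro s
    induction s using Finset.induction_on with
    | empty =>
      have : (fun (j : J) (i : Fin n) => if j ∈ (∅ : Finset J) then (l j i : ℤ) else 0) = 0 := by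
        funext j i; simp
      rw [this, normVal, torus_zero, modHalf_zero, h1]
      simp
    | insert j s hj ih =>
      -- The places are switched on one at a time: with the weights at the other places frozen at
      -- `l₀`, the value is a solution of Pieri's rule in the weight at `j`.
      set l₀ : J → Fin n → ℤ := fun j i => if j ∈ s then (l j i : ℤ) else 0 with hl₀
      have h2 := eq_schur_of_pieri (α := α j) (a := fun m => P.normVal W (Function.update l₀ j m))
        (fun m hm => by
          rw [normVal, hW.apply_torus_eq_zero hψ, zero_div]
          intro h
          exact hm (by simpa using h j))
        (fun k hk hk' m hm => by
          have h3 : ∀ g, (P.rootCard j ^ (k * (n - k)) * esym (α j) k) * W g =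
            ∑ x ∈ P.cosetIndex n j k, W (g * P.cosetRep j x) := fun g => (hα j k hk hk' g).symm
          have h4 := hW.normVal_cosetSum (P := P) hψ
            (W' := fun g => (P.rootCard j ^ (k * (n - k)) * esym (α j) k) * W g)
            ⟨fun u hu g => by rw [hW.unipotent_mul u hu]; ring,
              fun g κ hκ => by rw [hW.mul_mem g κ hκ]⟩ h3
            (l := Function.update l₀ j m) (by simpa using hm)
          have h5 : ∀ ε, Function.update l₀ j m + Pi.single j (indZ ε) =
              Function.update l₀ j (m + indZ ε) := by
            intro ε
            funext j'
            by_cases h : j' = j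
            · subst h; simp
            · simp [h]
          simp only [h5] at h4
          refine mul_left_cancel₀ (pow_ne_zero (k * (n - k)) (P.rootCard_ne_zero j)) ?_
          rw [← h4, normVal, normVal]
          ring) (hl j)
      have h6 : Function.update l₀ j 0 = l₀ := by
        funext j' i
        by_cases h : j' = j
        · subst h; simp [hl₀, hj]
        · simp [h]
      have h7 : Function.update l₀ j (fun i => (l j i : ℤ)) =
          fun j' i => if j' ∈ insert j s then (l j' i : ℤ) else 0 := by
        funext j' i
        by_cases h : j' = j
        · subst h; simp
        · simp [h, hl₀]
      rw [← h7, h2, h6, ih, prod_insert hj, mul_comm]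
  have := key univ
  simp only [mem_univ, if_true] at this
  rw [← this, normVal, mul_div_cancel₀]
  exact P.modHalf_ne_zero _

include hψ in
/-- The Hecke operators commute. -/
theorem IsSphericalWhittaker.normVal_comm {j j' : J} {k k' : ℕ}
    {W W₁ W₂ W₁₂ W₂₁ : GL (Fin n) E → ℂ} (hW : IsSphericalWhittaker O ψ W)
    (hW₁ : IsSphericalWhittaker O ψ W₁) (hW₂ : IsSphericalWhittaker O ψ W₂)
    (hW₁₂ : IsSphericalWhittaker O ψ W₁₂) (hW₂₁ : IsSphericalWhittaker O ψ W₂₁)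
    (h₁ : ∀ g, W₁ g = ∑ x ∈ P.cosetIndex n j k, W (g * P.cosetRep j x))
    (h₂ : ∀ g, W₂ g = ∑ x ∈ P.cosetIndex n j' k', W (g * P.cosetRep j' x))
    (h₁₂ : ∀ g, W₁₂ g = ∑ x ∈ P.cosetIndex n j' k', W₁ (g * P.cosetRep j' x))
    (h₂₁ : ∀ g, W₂₁ g = ∑ x ∈ P.cosetIndex n j k, W₂ (g * P.cosetRep j x))
    {l : J → Fin n → ℤ} (hl : ∀ j, Antitone (l j)) : P.normVal W₁₂ l = P.normVal W₂₁ l := by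
  -- At a single place, composing two truncated Pieri operators on the dominant cone is not visibly
  -- symmetric. After antisymmetrization both are sums of shifts on the full lattice, and shifts
  -- commute. At different places the shifts involve different coordinates and no antisymmetrization
  -- is needed.
  by_cases hjj : j' = j
  · subst hjj
    have hsupp : ∀ {W : GL (Fin n) E → ℂ}, IsSphericalWhittaker O ψ W → ∀ m : Fin n → ℤ,
        ¬Antitone m → P.normVal W (Function.update l j' m) = 0 := by
      intro W hW m hm
      rw [normVal, hW.apply_torus_eq_zero hψ, zero_div]
      intro h
      exact hm (by simpa using h j')
    have hpieri : ∀ {W W' : GL (Fin n) E → ℂ}, IsSphericalWhittaker O ψ W →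
        IsSphericalWhittaker O ψ W' → ∀ {k : ℕ},
        (∀ g, W' g = ∑ x ∈ P.cosetIndex n j' k, W (g * P.cosetRep j' x)) → ∀ m,
        antisymExt (fun m => P.normVal W' (Function.update l j' m)) m =
          P.rootCard j' ^ (k * (n - k)) * ∑ ε ∈ powersetCard k univ,
            antisymExt (fun m => P.normVal W (Function.update l j' m)) (m + indZ ε) := by
      intro W W' hW hW' k h m
      rw [antisymExt_pieri (a := fun m => P.rootCard j' ^ (k * (n - k)) *
            P.normVal W (Function.update l j' m)) (k := k)
          (fun m hm => by rw [hsupp hW m hm, mul_zero]) (fun m hm => hsupp hW' m hm)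
          (fun m hm => ?_) m, mul_sum]
      · refine sum_congr rfl fun ε _ => ?_
        simp only [antisymExt, mul_sum]
        exact sum_congr rfl fun σ _ => by ring
      · rw [hW.normVal_cosetSum hψ hW' h (by simpa using hm), mul_sum]
        refine sum_congr rfl fun ε _ => ?_
        congr 2
        funext i
        by_cases h : i = j'
        · subst h; simp
        · simp [h]
    have hval : ∀ {W : GL (Fin n) E → ℂ}, IsSphericalWhittaker O ψ W → P.normVal W l =
        antisymExt (fun m => P.normVal W (Function.update l j' m)) (l j' + staircase n) := by
      intro W hW
      rw [antisymExt_of_antitone (fun m hm => hsupp hW m hm) (hl j'), Function.update_eq_self]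
    rw [hval hW₁₂, hval hW₂₁, hpieri hW₁ hW₁₂ h₁₂, hpieri hW₂ hW₂₁ h₂₁]
    simp only [hpieri hW hW₁ h₁, hpieri hW hW₂ h₂, mul_sum]
    rw [sum_comm]
    refine sum_congr rfl fun ε _ => sum_congr rfl fun ε' _ => ?_
    rw [add_right_comm]
    ring
  · rw [hW₁.normVal_cosetSum hψ hW₁₂ h₁₂ (hl j'), hW₂.normVal_cosetSum hψ hW₂₁ h₂₁ (hl j)]
    have e1 : ∀ ε, P.normVal W₁ (l + Pi.single j' (indZ ε)) = _ := fun ε =>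
      hW.normVal_cosetSum hψ hW₁ h₁ (by simpa [Ne.symm hjj] using hl j)
    have e2 : ∀ ε, P.normVal W₂ (l + Pi.single j (indZ ε)) = _ := fun ε =>
      hW.normVal_cosetSum hψ hW₂ h₂ (by simpa [hjj] using hl j')
    simp only [e1, e2]
    simp only [mul_sum]
    rw [sum_comm]
    refine sum_congr rfl fun ε _ => sum_congr rfl fun ε' _ => ?_
    rw [add_right_comm]
    ring

end PlaceData

end Whittaker

end AsaiZeta

namespace AsaiZeta

/-! ### Commuting operators, and Vieta's formulas. -/

section Scalars

/-- The Nullstellensatz: the quotient by a maximal ideal is finite over `ℂ`, hence equal to `ℂ`. -/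
theorem exists_sub_algebraMap_mem {A : Type*} [CommRing A] [Algebra ℂ A] [Algebra.FiniteType ℂ A]
    (I : Ideal A) [I.IsMaximal] (a : A) : ∃ c : ℂ, a - algebraMap ℂ A c ∈ I := by
  let _ := Ideal.Quotient.field I
  have hfinite := finite_of_finite_type_of_isJacobsonRing ℂ (A ⧸ I)
  obtain ⟨c, hc⟩ := (IsAlgClosed.algebraMap_bijective_of_isIntegral (k := ℂ)
    (K := A ⧸ I)).2 (Ideal.Quotient.mk _ a)
  exact ⟨c, Ideal.Quotient.eq.mp hc.symm⟩

open scoped IsMulCommutative in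
/-- Finitely many commuting operators without a common proper invariant subspace are scalars. -/
theorem exists_eq_smul_of_forall_invariant {M : Type*} [AddCommGroup M] [Module ℂ M] [Nontrivial M]
    {S : Set (Module.End ℂ M)} (hfin : S.Finite) (hcomm : ∀ a ∈ S, ∀ b ∈ S, a * b = b * a)
    (hsimple : ∀ N : Submodule ℂ M, (∀ T ∈ S, ∀ x ∈ N, T x ∈ N) → N = ⊥ ∨ N = ⊤)
    {T : Module.End ℂ M} (hT : T ∈ S) : ∃ c : ℂ, ∀ x, T x = c • x := by
  have hA := Algebra.isMulCommutative_adjoin ℂ hcomm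
  have hfg : Algebra.FiniteType ℂ (Algebra.adjoin ℂ S) :=
    (Subalgebra.fg_iff_finiteType _).mp ⟨hfin.toFinset, by simp⟩
  have hsim : IsSimpleModule (Algebra.adjoin ℂ S) M := by
    refine (isSimpleModule_iff _ _).mpr
      { exists_pair_ne := ⟨⊥, ⊤, bot_ne_top⟩
        eq_bot_or_eq_top := fun N => ?_ }
    rcases hsimple (N.restrictScalars ℂ) fun T hT x hx =>
      N.smul_mem (⟨T, Algebra.subset_adjoin hT⟩ : Algebra.adjoin ℂ S) hx with h | h
    · left
      exact (Submodule.restrictScalars_eq_bot_iff _ _ _).mp h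
    · right
      exact (Submodule.restrictScalars_eq_top_iff _ _ _).mp h
  -- The space is a simple module over the finitely generated commutative algebra spanned by the
  -- operators, so this algebra acts through a residue field, which is `ℂ`. No finiteness of
  -- dimension is used.
  have hmax : (Module.annihilator (Algebra.adjoin ℂ S) M).IsMaximal :=
    IsSimpleModule.annihilator_isMaximal
  obtain ⟨c, hc'⟩ := exists_sub_algebraMap_mem (Module.annihilator (Algebra.adjoin ℂ S) M)
    ⟨T, Algebra.subset_adjoin hT⟩
  refine ⟨c, fun x => ?_⟩
  have := Module.mem_annihilator.mp hc' x
  rw [sub_smul, sub_eq_zero, algebraMap_smul] at this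
  exact this

open Finset in
/-- Elementary symmetric polynomials with prescribed values. -/
theorem exists_esym_eq {n : ℕ} (e : ℕ → ℂ) (h0 : e 0 = 1) :
    ∃ α : Fin n → ℂ, ∀ k ≤ n, esym α k = e k := by
  classical
  -- By Vieta, the roots of this monic polynomial have the `e k` as their elementary symmetric
  -- functions.
  set p : Polynomial ℂ := ∑ k ∈ range (n + 1),
    Polynomial.C ((-1) ^ k * e k) * Polynomial.X ^ (n - k) with hp
  have hcoeff : ∀ k ≤ n, p.coeff (n - k) = (-1) ^ k * e k := by
    intro k hk
    rw [hp, Polynomial.finsetSum_coeff, sum_eq_single k]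
    · rw [Polynomial.coeff_C_mul, Polynomial.coeff_X_pow, if_pos rfl, mul_one]
    · intro b hb hbk
      rw [Polynomial.coeff_C_mul, Polynomial.coeff_X_pow, if_neg, mul_zero]
      rw [mem_range] at hb
      omega
    · intro h
      exact absurd (mem_range.mpr (by omega)) h
  have hle : p.natDegree ≤ n := by
    refine Polynomial.natDegree_sum_le_of_forall_le _ _ fun k _ => ?_
    refine (Polynomial.natDegree_C_mul_X_pow_le _ _).trans (Nat.sub_le _ _)
  have hdeg : p.natDegree = n := by
    refine le_antisymm hle (Polynomial.le_natDegree_of_ne_zero ?_)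
    have := hcoeff 0 (Nat.zero_le _)
    rw [Nat.sub_zero] at this
    rw [this, h0]
    simp
  have hlead : p.leadingCoeff = 1 := by
    rw [Polynomial.leadingCoeff, hdeg]
    have := hcoeff 0 (Nat.zero_le _)
    rw [Nat.sub_zero] at this
    rw [this, h0]
    simp
  have hcard : p.roots.card = p.natDegree :=
    (Polynomial.splits_iff_card_roots).mp (IsAlgClosed.splits p)
  have hlen : p.roots.toList.length = n := by rw [Multiset.length_toList, hcard, hdeg]
  set α : Fin n → ℂ := fun i => p.roots.toList.get (i.cast hlen.symm) with hα
  have hmap : univ.val.map α = p.roots := by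
    conv_rhs => rw [← Multiset.coe_toList p.roots]
    rw [Fin.univ_val_map]
    congr 1
    refine List.ext_get (by simp [hlen]) fun i h1 h2 => ?_
    simp [hα]
  refine ⟨α, fun k hk => ?_⟩
  have h1 := Polynomial.coeff_eq_esymm_roots_of_card hcard (k := n - k) (by omega)
  rw [hcoeff k hk, hlead, hdeg, Nat.sub_sub_self hk, one_mul, ← hmap, Finset.esymm_map_val] at h1
  exact (mul_left_cancel₀ (pow_ne_zero k (by norm_num)) h1).symm

end Scalars

/-! ### Hecke operators on the fixed vectors of an irreducible generic representation. -/

section RepTheory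

open Matrix Finset

variable {E : Type*} [CommRing E] {O : Subring E} {J : Type*} [Fintype J] [DecidableEq J] {n : ℕ}
  {V : Type*} [AddCommGroup V] [Module ℂ V]

theorem span_orbit_eq_top {G : Type*} [Group G] {ρ : Representation ℂ G V} (hirr : ρ.IsIrreducible)
    {v : V} (hv : v ≠ 0) : Submodule.span ℂ (Set.range fun g => ρ g v) = ⊤ := by
  let U : Subrepresentation ρ :=
    { toSubmodule := Submodule.span ℂ (Set.range fun g => ρ g v)
      apply_mem_toSubmodule := fun g w hw => by
        induction hw using Submodule.span_induction with
        | mem x hx =>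
          obtain ⟨h, rfl⟩ := hx
          refine Submodule.subset_span ⟨g * h, ?_⟩
          simp
        | zero => simp
        | add x y _ _ hx hy => rw [map_add]; exact add_mem hx hy
        | smul c x _ hx => rw [map_smul]; exact Submodule.smul_mem _ _ hx }
  have hmem : v ∈ Submodule.span ℂ (Set.range fun g => ρ g v) :=
    Submodule.subset_span ⟨1, by simp⟩
  rcases hirr.eq_bot_or_eq_top U with h | h
  · exfalso
    have h1 : v ∈ U := hmem
    rw [h] at h1
    exact hv ((Submodule.mem_bot ℂ).mp h1)
  · rw [eq_top_iff]
    intro w _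
    have h1 : w ∈ (⊤ : Subrepresentation ρ) := trivial
    rw [← h] at h1
    exact h1

/-- A functional that vanishes on an orbit vanishes. -/
theorem eq_zero_of_forall_apply_orbit {G : Type*} [Group G] {ρ : Representation ℂ G V}
    (hirr : ρ.IsIrreducible) {v : V} (hv : v ≠ 0) {f : V →ₗ[ℂ] ℂ} (hf : ∀ g, f (ρ g v) = 0) :
    f = 0 := by
  refine LinearMap.ext_on_range (span_orbit_eq_top hirr hv) fun g => ?_
  simp [hf]

variable (ρ : Representation ℂ (GL (Fin n) E) V)

/-- The vectors that are fixed by the integral matrices. -/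
def fixedVectors (O : Subring E) : Submodule ℂ V where
  carrier := {v | ∀ κ ∈ intGL O n, ρ κ v = v}
  zero_mem' := by simp
  add_mem' := by
    intro a b ha hb κ hκ
    rw [map_add, ha κ hκ, hb κ hκ]
  smul_mem' := by
    intro c a ha κ hκ
    rw [map_smul, ha κ hκ]

namespace PlaceData

variable (P : PlaceData E O J)

/-- The Hecke operators. -/
def heckeOp (j : J) (k : ℕ) : Module.End ℂ V := ∑ x ∈ P.cosetIndex n j k, ρ (P.cosetRep j x)

variable {P ρ}

theorem heckeOp_apply (j : J) (k : ℕ) (v : V) :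
    P.heckeOp ρ j k v = ∑ x ∈ P.cosetIndex n j k, ρ (P.cosetRep j x) v := by
  simp [heckeOp]

theorem heckeOp_mem {j : J} {k : ℕ} {v : V} (hv : v ∈ fixedVectors ρ O) :
    P.heckeOp ρ j k v ∈ fixedVectors ρ O := by
  intro κ hκ
  rw [heckeOp_apply, map_sum]
  refine Eq.trans (sum_congr rfl fun x _ => ?_)
    (sum_mul_cosetRep (P := P) (f := fun g => ρ g v) (fun g κ hκ => ?_) j k hκ)
  · simp
  · simp [hv κ hκ]

theorem heckeOp_of_lt {j : J} {k : ℕ} (h : n < k) : P.heckeOp ρ j k = 0 := by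
  refine sum_eq_zero fun x hx => ?_
  have h1 := (mem_powersetCard.mp (mem_sigma.mp hx).1).2
  have h2 := card_le_univ x.1
  rw [Fintype.card_fin] at h2
  omega

theorem blockUni_univ (c : Fin n → Fin n → E) : blockUni univ c = 1 := by
  ext i j
  simp [blockUni, blockPart]

theorem heckeOp_self (j : J) : P.heckeOp ρ j n = ρ (P.torus (Pi.single j fun _ => 1)) := by
  have h3 : (powersetCard n univ : Finset (Finset (Fin n))) = {univ} := by
    have := powersetCard_self (univ : Finset (Fin n))
    rwa [card_univ, Fintype.card_fin] at this
  rw [heckeOp, cosetIndex, h3, sum_sigma, sum_singleton]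
  have hone : indZ (univ : Finset (Fin n)) = fun _ => (1 : ℤ) := by
    funext i; simp [indZ]
  simp [cosetRep, blockUni_univ, hone]

theorem torus_single_const_comm (j : J) (t : ℤ) (g : GL (Fin n) E) :
    P.torus (Pi.single j fun _ => t) * g = g * P.torus (Pi.single j fun _ => t) := by
  rw [torus_single]
  ext a b
  rw [diagGL_mul_apply, mul_diagGL_apply, mul_comm]

variable {ψ : AddChar E Circle}

theorem isSphericalWhittaker {ℓ : V →ₗ[ℂ] ℂ} (hℓ : IsWhittakerFunctional ρ ψ ℓ) {v : V}
    (hv : v ∈ fixedVectors ρ O) : IsSphericalWhittaker O ψ fun g => ℓ (ρ g v) where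
  unipotent_mul u hu g := by
    rw [map_mul, Module.End.mul_apply, hℓ u hu]
  mul_mem g κ hκ := by
    rw [map_mul, Module.End.mul_apply, hv κ hκ]

theorem whittaker_heckeOp (ℓ : V →ₗ[ℂ] ℂ) (v : V) (j : J) (k : ℕ) (g : GL (Fin n) E) :
    ℓ (ρ g (P.heckeOp ρ j k v)) = ∑ x ∈ P.cosetIndex n j k, ℓ (ρ (g * P.cosetRep j x) v) := by
  simp [heckeOp_apply]

section Irreducible

variable (hirr : ρ.IsIrreducible) (hψ : ∀ x, (∀ a ∈ O, ψ (x * a) = 1) ↔ x ∈ O) {ℓ : V →ₗ[ℂ] ℂ}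
  (hℓ0 : ℓ ≠ 0) (hℓ : IsWhittakerFunctional ρ ψ ℓ)

include hirr hℓ0 hℓ in
-- By the Iwasawa decomposition the Whittaker function of a fixed vector is determined on the torus,
-- and a nonzero functional cannot vanish on the orbit of a nonzero vector.
theorem eq_zero_of_whittaker_torus {v : V} (hv : v ∈ fixedVectors ρ O)
    (h : ∀ l, ℓ (ρ (P.torus l) v) = 0) : v = 0 := by
  by_contra hv0
  refine hℓ0 (eq_zero_of_forall_apply_orbit hirr hv0 fun g => ?_)
  obtain ⟨u, hu, l, κ, hκ, rfl⟩ := P.exists_iwasawa g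
  have h1 := (isSphericalWhittaker hℓ hv).mul_mem (u * P.torus l) κ hκ
  have h2 := (isSphericalWhittaker hℓ hv).unipotent_mul u hu (P.torus l)
  rw [h1, h2, h, mul_zero]

include hirr hψ hℓ0 hℓ in
-- Commutativity is checked on Whittaker functions, where `normVal_comm` gives it on dominant
-- weights and both sides vanish elsewhere.
theorem heckeOp_comm {v : V} (hv : v ∈ fixedVectors ρ O) (j j' : J) (k k' : ℕ) :
    P.heckeOp ρ j k (P.heckeOp ρ j' k' v) = P.heckeOp ρ j' k' (P.heckeOp ρ j k v) := by
  have h1 := heckeOp_mem (P := P) (j := j) (k := k) hv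
  have h2 := heckeOp_mem (P := P) (j := j') (k := k') hv
  have h12 := heckeOp_mem (P := P) (j := j') (k := k') h1
  have h21 := heckeOp_mem (P := P) (j := j) (k := k) h2
  rw [← sub_eq_zero]
  refine eq_zero_of_whittaker_torus (P := P) hirr hℓ0 hℓ (sub_mem h21 h12) fun l => ?_
  rw [map_sub, map_sub, sub_eq_zero]
  have w := isSphericalWhittaker hℓ hv
  have w1 := isSphericalWhittaker hℓ h1
  have w2 := isSphericalWhittaker hℓ h2
  have w12 := isSphericalWhittaker hℓ h12
  have w21 := isSphericalWhittaker hℓ h21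
  by_cases hl : ∀ j, Antitone (l j)
  · have := IsSphericalWhittaker.normVal_comm (P := P) hψ w w1 w2 w12 w21
      (whittaker_heckeOp ℓ v j k) (whittaker_heckeOp ℓ v j' k')
      (whittaker_heckeOp ℓ _ j' k') (whittaker_heckeOp ℓ _ j k) hl
    rw [normVal, normVal, div_left_inj' (P.modHalf_ne_zero l)] at this
    exact this.symm
  · have e1 := w12.apply_torus_eq_zero (P := P) hψ hl
    have e2 := w21.apply_torus_eq_zero (P := P) hψ hl
    rw [e1, e2]

include hirr hψ hℓ0 hℓ in
/-- The Hecke operators act on the fixed vectors of an irreducible representation by scalars. -/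
theorem exists_heckeOp_eq_smul (hsm : ∀ v, IsFiniteVector ρ (intGL O n) v) (j : J) (k : ℕ) :
    ∃ c : ℂ, ∀ v ∈ fixedVectors ρ O, P.heckeOp ρ j k v = c • v := by
  by_cases hk : n < k
  · exact ⟨0, fun v _ => by rw [heckeOp_of_lt hk]; simp⟩
  by_cases hnt : fixedVectors ρ O = ⊥
  · refine ⟨0, fun v hv => ?_⟩
    rw [hnt, Submodule.mem_bot] at hv
    simp [hv]
  have : Nontrivial (fixedVectors ρ O) := Submodule.nontrivial_iff_ne_bot.mpr hnt
  set T : J → ℕ → Module.End ℂ (fixedVectors ρ O) := fun j k =>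
    (P.heckeOp ρ j k).restrict fun v hv => heckeOp_mem hv with hTdef
  have hZmem : ∀ j, ∀ v ∈ fixedVectors ρ O,
      ρ (P.torus (Pi.single j fun _ => -1)) v ∈ fixedVectors ρ O := by
    intro j v hv κ hκ
    rw [← Module.End.mul_apply, ← map_mul, ← torus_single_const_comm, map_mul,
      Module.End.mul_apply, hv κ hκ]
  set Z : J → Module.End ℂ (fixedVectors ρ O) := fun j =>
    (ρ (P.torus (Pi.single j fun _ => -1))).restrict (hZmem j) with hZdef
  have hcT : ∀ j j' k k', T j k * T j' k' = T j' k' * T j k := by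
    intro j j' k k'
    ext v
    exact heckeOp_comm hirr hψ hℓ0 hℓ v.2 j j' k k'
  have hTZ : ∀ j, T j n * Z j = 1 := by
    intro j
    ext v
    change P.heckeOp ρ j n (ρ (P.torus (Pi.single j fun _ => -1)) v) = v
    rw [heckeOp_self, ← Module.End.mul_apply, ← map_mul, ← torus_add, ← Pi.single_add]
    have : ((fun _ => 1) + fun _ => -1 : Fin n → ℤ) = 0 := by funext i; simp
    rw [this, Pi.single_zero, torus_zero, map_one]
    rfl
  have hZT : ∀ j, Z j * T j n = 1 := by
    intro j
    ext v
    change ρ (P.torus (Pi.single j fun _ => -1)) (P.heckeOp ρ j n v) = v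
    rw [heckeOp_self, ← Module.End.mul_apply, ← map_mul, ← torus_add, ← Pi.single_add]
    have : ((fun _ => -1) + fun _ => 1 : Fin n → ℤ) = 0 := by funext i; simp
    rw [this, Pi.single_zero, torus_zero, map_one]
    rfl
  have hcZ : ∀ (B : Module.End ℂ (fixedVectors ρ O)) j, B * T j n = T j n * B → B * Z j = Z j * B := by
    intro B j h
    calc B * Z j = Z j * T j n * (B * Z j) := by rw [hZT, one_mul]
      _ = Z j * (T j n * B) * Z j := by simp only [mul_assoc]
      _ = Z j * B * (T j n * Z j) := by rw [← h]; simp only [mul_assoc]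
      _ = Z j * B := by rw [hTZ, mul_one]
  -- The inverses of the operators of degree `n` are included, so that these operators are onto
  -- every invariant subspace, as `eq_zero_of_apply_one` requires.
  set S : Set (Module.End ℂ (fixedVectors ρ O)) :=
    (Set.range fun p : J × Fin (n + 1) => T p.1 p.2) ∪ Set.range Z with hS
  have hTS : ∀ j, ∀ k ≤ n, T j k ∈ S := fun j k hk =>
    Or.inl ⟨(j, ⟨k, Nat.lt_succ_of_le hk⟩), rfl⟩
  have hZS : ∀ j, Z j ∈ S := fun j => Or.inr ⟨j, rfl⟩
  have hcomm : ∀ a ∈ S, ∀ b ∈ S, a * b = b * a := by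
    rintro _ (⟨p, rfl⟩ | ⟨j, rfl⟩) _ (⟨q, rfl⟩ | ⟨j', rfl⟩)
    · exact hcT _ _ _ _
    · exact hcZ _ _ (hcT _ _ _ _)
    · exact (hcZ _ _ (hcT _ _ _ _)).symm
    · exact hcZ _ _ (hcZ _ _ (hcT _ _ _ _)).symm
  suffices hsimple : ∀ N : Submodule ℂ (fixedVectors ρ O), (∀ T ∈ S, ∀ x ∈ N, T x ∈ N) →
      N = ⊥ ∨ N = ⊤ by
    obtain ⟨c, hc⟩ := exists_eq_smul_of_forall_invariant (S := S)
      ((Set.finite_range _).union (Set.finite_range _)) hcomm hsimple (hTS j k (not_lt.mp hk))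
    exact ⟨c, fun v hv => congrArg Subtype.val (hc ⟨v, hv⟩)⟩
  intro N hN
  by_contra! hne
  obtain ⟨m₀, hm₀, hm₀0⟩ := Submodule.exists_mem_ne_zero_of_ne_bot hne.1
  obtain ⟨w, hw⟩ : ∃ w, w ∉ N := by
    by_contra! h
    exact hne.2 (eq_top_iff.mpr fun w _ => h w)
  -- A functional that kills the invariant subspace `N` but not `w` gives a family of
  -- bi-`K`-invariant functions `g ↦ f (ρ g m)`, for `m` in `N`, that vanish at `1`.
  obtain ⟨f, hf, hfN, hfw⟩ := exists_invariant_functional (ρ := ρ) (K := intGL O n)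
    (M := N.map (fixedVectors ρ O).subtype)
    (by rintro _ ⟨m, -, rfl⟩ κ hκ; exact m.2 κ hκ) (w := w) w.2
    (by rintro ⟨m, hm, hmw⟩; exact hw (Subtype.ext hmw ▸ hm))
  have hD := eq_zero_of_apply_one (P := P) (M := N) (D := fun m g => f (ρ g (m : fixedVectors ρ O)))
    (τ := fun j k m => ⟨T j k m.1, by
      by_cases hk : k ≤ n
      · exact hN _ (hTS j k hk) _ m.2
      · have : T j k m.1 = 0 := by
          apply Subtype.ext
          change P.heckeOp ρ j k m.1 = 0
          rw [heckeOp_of_lt (not_le.mp hk)]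
          rfl
        rw [this]
        exact N.zero_mem⟩)
    (fun m g κ hκ => by
      rw [map_mul, Module.End.mul_apply, hf _ (hsm _) κ hκ])
    (fun m g κ hκ => by
      rw [map_mul, Module.End.mul_apply, m.1.2 κ hκ])
    (fun j k m g => (whittaker_heckeOp f _ j k g).symm)
    (fun m => by
      rw [map_one]
      exact hfN _ ⟨m.1, m.2, rfl⟩)
    (fun j m => ⟨⟨Z j m.1, hN _ (hZS j) _ m.2⟩, Subtype.ext (by
      exact congrArg (fun B : Module.End ℂ (fixedVectors ρ O) => B m.1) (hTZ j))⟩)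
    ⟨m₀, hm₀⟩
  -- Hence `f` vanishes on the orbit of `m₀ ≠ 0`, so `f = 0` by irreducibility, contrary to `f w =
  -- 1`.
  have hf0 := eq_zero_of_forall_apply_orbit hirr (v := (m₀ : V))
    (fun h => hm₀0 (Subtype.ext h)) hD
  rw [hf0] at hfw
  simp at hfw

end Irreducible

end PlaceData

end RepTheory

end AsaiZeta

namespace AsaiZeta

/-! ### Averaging of vectors and the right regular action. -/

section Average

open Finset

variable {G : Type*} [Group G] {V : Type*} [AddCommGroup V] [Module ℂ V]

/-- Averaging a finite vector. -/
theorem IsFiniteVector.exists_average {ρ : Representation ℂ G V} {K : Subgroup G} {v : V}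
    (hv : IsFiniteVector ρ K v) : ∃ (N : ℕ) (κ : Fin N → G), N ≠ 0 ∧ (∀ i, κ i ∈ K) ∧
      ∀ κ' ∈ K, ρ κ' (∑ i, ρ (κ i) v) = ∑ i, ρ (κ i) v := by
  obtain ⟨H, hH, hv⟩ := hv
  have : Fintype (K ⧸ H) := Fintype.ofFinite _
  let e := Fintype.equivFin (K ⧸ H)
  refine ⟨Fintype.card (K ⧸ H), fun i => ((e.symm i).out : K), Fintype.card_ne_zero,
    fun i => SetLike.coe_mem _, fun κ' hκ' => ?_⟩
  rw [Equiv.sum_comp e.symm fun q => ρ (q.out : G) v, map_sum]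
  refine Eq.trans (sum_congr rfl fun q _ => ?_)
    (Equiv.sum_comp (MulAction.toPerm (⟨κ', hκ'⟩ : K)) fun q : K ⧸ H => ρ (q.out : G) v)
  obtain ⟨h, hh⟩ := QuotientGroup.mk_out_eq_mul H ((⟨κ', hκ'⟩ : K) * q.out)
  have h1 : (((⟨κ', hκ'⟩ : K) * q.out : K) : K ⧸ H) = (⟨κ', hκ'⟩ : K) • q := by
    conv_rhs => rw [← QuotientGroup.out_eq' q]
    rfl
  rw [h1] at hh
  change _ = ρ (((⟨κ', hκ'⟩ : K) • q).out : G) v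
  rw [hh, Subgroup.coe_mul, map_mul, Module.End.mul_apply, hv _ h.2, Subgroup.coe_mul, map_mul,
    Module.End.mul_apply]

variable (G) in
/-- The action of a group on functions by right translation. -/
def rightReg : Representation ℂ G (G → ℂ) where
  toFun g :=
    { toFun := fun f x => f (x * g)
      map_add' := fun _ _ => rfl
      map_smul' := fun _ _ => rfl }
  map_one' := by ext; simp
  map_mul' g h := by
    refine LinearMap.ext fun f => funext fun x => ?_
    change f (x * (g * h)) = f (x * g * h)
    rw [mul_assoc]

theorem rightReg_apply (g : G) (f : G → ℂ) (x : G) : rightReg G g f x = f (x * g) := rfl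

end Average

/-! ### Unramified principal series and Satake parameters. -/

section PrincipalSeries

open Matrix Finset

variable {E : Type*} [CommRing E] {O : Subring E} {J : Type*} [Fintype J] [DecidableEq J] {n : ℕ}
  {V : Type*} [AddCommGroup V] [Module ℂ V]

namespace PlaceData

variable (P : PlaceData E O J)

/-- The Satake parameters of the spherical function attached to `c`. -/
def satake (c : J → Fin n → ℂ) (j : J) (i : Fin n) : ℂ :=
  c j i * P.rootCard j ^ ((n : ℤ) - 1 - 2 * i)

variable {P}

theorem sphFun_unipotent_mul {c : J → Fin n → ℂ} (hc : ∀ j i, c j i ≠ 0) {u : GL (Fin n) E}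
    (hu : u ∈ unipotent n E) (g : GL (Fin n) E) : P.sphFun c (u * g) = P.sphFun c g := by
  have := P.sphFun_borel_mul hc ⟨u, unipotent_le_borelGL hu⟩ g
  rw [this]
  simp [borelChar, borelDiag_unipotent hu, ord_one]

theorem normVal_sphFun {c : J → Fin n → ℂ} (hc : ∀ j i, c j i ≠ 0) (l : J → Fin n → ℤ) :
    P.normVal (P.sphFun c) l = ∏ j, ∏ i, P.satake c j i ^ l j i := by
  have h1 := P.sphFun_unipotent_mul_torus hc (unipotent n E).one_mem l
  rw [one_mul] at h1
  rw [normVal, h1, prod_comm, div_eq_iff (P.modHalf_ne_zero l), modHalf, ← prod_mul_distrib]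
  refine prod_congr rfl fun j _ => ?_
  rw [← prod_mul_distrib]
  refine prod_congr rfl fun i _ => ?_
  rw [satake, mul_zpow, mul_assoc, ← _root_.zpow_mul, ← zpow_add₀ (P.rootCard_ne_zero j),
    show ((n : ℤ) - 1 - 2 * i) * l j i + -((n : ℤ) - 1 - 2 * i) * l j i = 0 by ring, zpow_zero,
    mul_one]

/-- At `g = 1` the normalized values are monomials in the Satake parameters, so the Hecke operator
yields an elementary symmetric polynomial. Equivariance on the left and invariance of the cosets
under `K` transport this to all `g`. -/
theorem sum_sphFun {c : J → Fin n → ℂ} (hc : ∀ j i, c j i ≠ 0) (j : J) (k : ℕ)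
    (g : GL (Fin n) E) : ∑ x ∈ P.cosetIndex n j k, P.sphFun c (g * P.cosetRep j x) =
      P.rootCard j ^ (k * (n - k)) * esym (P.satake c j) k * P.sphFun c g := by
  have h1 := sum_torus_mul_cosetRep_eq (P := P) (f := P.sphFun c)
    (fun u hu _ g => sphFun_unipotent_mul hc hu g) j k (l := 0) (fun j a b _ => le_rfl)
  rw [torus_zero, modHalf_zero, one_mul] at h1
  have h2 : ∑ ε ∈ powersetCard k univ, P.normVal (P.sphFun c) (0 + Pi.single j (indZ ε)) =
      esym (P.satake c j) k := by
    refine sum_congr rfl fun ε _ => ?_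
    rw [zero_add, normVal_sphFun hc, prod_eq_single j]
    · rw [← prod_subset (subset_univ ε)]
      · exact prod_congr rfl fun i hi => by simp [indZ, hi]
      · intro i _ hi
        simp [indZ, hi]
    · intro j' _ h
      simp [h]
    · simp
  rw [h2] at h1
  simp only [one_mul] at h1
  obtain ⟨κ, hκ, hb⟩ := P.iwasawa n g
  have hg : g = (⟨g * κ, hb⟩ : borelGL n E).1 * κ⁻¹ := by simp
  have hκ' := (intGL O n).inv_mem hκ
  have h3 : P.sphFun c g = P.borelChar c ⟨g * κ, hb⟩ := by
    conv_lhs => rw [hg]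
    exact P.sphFun_eq hc _ hκ'
  have h4 : ∀ x, P.sphFun c (g * P.cosetRep j x) =
      P.borelChar c ⟨g * κ, hb⟩ * P.sphFun c (κ⁻¹ * P.cosetRep j x) := by
    intro x
    rw [← P.sphFun_borel_mul hc]
    congr 1
    rw [← mul_assoc, ← hg]
  rw [sum_congr rfl fun x _ => h4 x, ← mul_sum, sum_mul_cosetRep (fun g κ hκ =>
    P.sphFun_mul_mem hc g hκ) j k hκ', h1, h3, mul_comm]

/-- A function in the principal series that is fixed by the integral matrices. -/
theorem eq_smul_sphFun {c : J → Fin n → ℂ} (hc : ∀ j i, c j i ≠ 0) {f : GL (Fin n) E → ℂ}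
    (hf : ∀ (b : borelGL n E) g, f (b.1 * g) = P.borelChar c b * f g)
    (hfK : ∀ κ ∈ intGL O n, rightReg _ κ f = f) (g : GL (Fin n) E) :
    f g = f 1 * P.sphFun c g := by
  obtain ⟨κ, hκ, hb⟩ := P.iwasawa n g
  have hκ' := (intGL O n).inv_mem hκ
  have hg : g = (⟨g * κ, hb⟩ : borelGL n E).1 * κ⁻¹ := by simp
  have h3 : P.sphFun c g = P.borelChar c ⟨g * κ, hb⟩ := by
    conv_lhs => rw [hg]
    exact P.sphFun_eq hc _ hκ'
  have h4 : f g = P.borelChar c ⟨g * κ, hb⟩ * f κ⁻¹ := by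
    rw [← hf, ← hg]
  have h5 : f κ⁻¹ = f 1 := by
    have := congrFun (hfK _ hκ') 1
    rwa [rightReg_apply, one_mul] at this
  rw [h4, h3, h5, mul_comm]

variable {ρ : Representation ℂ (GL (Fin n) E) V}

/-- The Hecke eigenvalues of an unramified subquotient of a principal series. -/
theorem heckeOp_eq_of_subquotient {c : J → Fin n → ℂ} (hc : ∀ j i, c j i ≠ 0)
    {U : Submodule ℂ (GL (Fin n) E → ℂ)}
    (hUb : ∀ f ∈ U, ∀ (b : borelGL n E) g, f (b.1 * g) = P.borelChar c b * f g)
    (hUfin : ∀ f ∈ U, IsFiniteVector (rightReg (GL (Fin n) E)) (intGL O n) f)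
    (hU : ∀ g, ∀ f ∈ U, rightReg _ g f ∈ U) {T : U →ₗ[ℂ] V} (hT : Function.Surjective T)
    (hTG : ∀ g (f : U), T ⟨rightReg _ g f, hU g f f.2⟩ = ρ g (T f)) {v : V}
    (hv : v ∈ fixedVectors ρ O) (j : J) (k : ℕ) :
    P.heckeOp ρ j k v = (P.rootCard j ^ (k * (n - k)) * esym (P.satake c j) k) • v := by
  obtain ⟨f, hf⟩ := hT v
  -- Averaging a preimage of `v` yields a `K`-fixed function that maps to `N • v`. It is a multiple
  -- of `sphFun`, whose eigenvalues are known.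
  obtain ⟨N, κ, hN, hκ, hfix⟩ := (hUfin f f.2).exists_average
  set F : U := ∑ i, ⟨rightReg _ (κ i) f, hU (κ i) f f.2⟩ with hF
  have hFval : (F : GL (Fin n) E → ℂ) = ∑ i, rightReg _ (κ i) (f : GL (Fin n) E → ℂ) := by
    rw [hF, AddSubmonoidClass.coe_finsetSum]
  have hTF : T F = (N : ℂ) • v := by
    rw [hF, map_sum, sum_congr rfl fun i _ => by rw [hTG, hf, hv _ (hκ i)]]
    simp [← Nat.cast_smul_eq_nsmul ℂ]
  have hFK : ∀ κ ∈ intGL O n, rightReg _ κ (F : GL (Fin n) E → ℂ) = F := by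
    rw [hFval]; exact hfix
  have hsum : ∑ x ∈ P.cosetIndex n j k,
      (⟨rightReg _ (P.cosetRep j x) F, hU _ F F.2⟩ : U) =
      (P.rootCard j ^ (k * (n - k)) * esym (P.satake c j) k) • F := by
    refine Subtype.ext (funext fun g => ?_)
    rw [AddSubmonoidClass.coe_finsetSum, Finset.sum_apply]
    have h := eq_smul_sphFun hc (hUb F F.2) hFK
    simp only [rightReg_apply, Submodule.coe_smul, Pi.smul_apply, smul_eq_mul]
    rw [sum_congr rfl fun x _ => h (g * P.cosetRep j x), ← mul_sum, sum_sphFun hc, h g]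
    ring
  have h1 := congrArg T hsum
  rw [map_sum, map_smul, hTF, sum_congr rfl fun x _ => by rw [hTG, hTF, map_smul], ← smul_sum,
    ← heckeOp_apply, smul_comm] at h1
  exact smul_right_injective V (Nat.cast_ne_zero.mpr hN : (N : ℂ) ≠ 0) h1

/-- The translate by `g` is fixed by `K ∩ g K g⁻¹`, of finite index in `K` by commensurability. -/
theorem sphFun_rightReg_finite {c : J → Fin n → ℂ} (hc : ∀ j i, c j i ≠ 0)
    (hcom : ∀ g : GL (Fin n) E, ∃ H : Subgroup (intGL O n), H.FiniteIndex ∧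
      ∀ h ∈ H, g⁻¹ * h.1 * g ∈ intGL O n) (g : GL (Fin n) E) :
    IsFiniteVector (rightReg (GL (Fin n) E)) (intGL O n) (rightReg _ g (P.sphFun c)) := by
  obtain ⟨H, hH, h⟩ := hcom g
  refine ⟨H, hH, fun κ hκ => funext fun x => ?_⟩
  simp only [rightReg_apply]
  rw [show x * κ.1 * g = x * g * (g⁻¹ * κ.1 * g) by group, P.sphFun_mul_mem hc _ (h κ hκ)]

/-- An irreducible unramified generic representation is a subquotient of a principal series. -/
theorem exists_subquotient (hirr : ρ.IsIrreducible) {ψ : AddChar E Circle}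
    (hψ : ∀ x, (∀ a ∈ O, ψ (x * a) = 1) ↔ x ∈ O) {ℓ : V →ₗ[ℂ] ℂ}
    (hℓ0 : ℓ ≠ 0) (hℓ : IsWhittakerFunctional ρ ψ ℓ)
    (hsm : ∀ v, IsFiniteVector ρ (intGL O n) v)
    (hcom : ∀ g : GL (Fin n) E, ∃ H : Subgroup (intGL O n), H.FiniteIndex ∧
      ∀ h ∈ H, g⁻¹ * h.1 * g ∈ intGL O n)
    {v : V} (hv : v ∈ fixedVectors ρ O) (hv0 : v ≠ 0) :
    ∃ c : J → Fin n → ℂ, (∀ j i, c j i ≠ 0) ∧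
      ∃ T : Submodule.span ℂ (Set.range fun g => rightReg _ g (P.sphFun c)) →ₗ[ℂ] V,
        Function.Surjective T ∧ ∀ g f f', f'.1 = rightReg _ g f.1 → T f' = ρ g (T f) := by
  choose e he using exists_heckeOp_eq_smul (P := P) hirr hψ hℓ0 hℓ hsm
  have h0 : ∀ j, e j 0 = 1 := by
    intro j
    have h1 := he j 0 v hv
    have h2 : P.heckeOp ρ j 0 v = v := by
      rw [heckeOp_apply, cosetIndex, powersetCard_zero, sum_sigma, sum_singleton]
      have hb : ∀ c : Fin n → Fin n → E, blockUni ∅ c = 1 := by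
        intro c; ext i j; simp [blockUni, blockPart]
      have hz : (Pi.single j (indZ ∅) : J → Fin n → ℤ) = 0 := by
        have : indZ (∅ : Finset (Fin n)) = 0 := by funext i; simp [indZ]
        rw [this, Pi.single_zero]
      simp [cosetRep, hb, hz, torus_zero]
    rw [h2] at h1
    have h3 : (1 - e j 0) • v = 0 := by rw [sub_smul, one_smul, ← h1, sub_self]
    rcases smul_eq_zero.mp h3 with h | h
    · exact (sub_eq_zero.mp h).symm
    · exact absurd h hv0
  have hen : ∀ j, e j n ≠ 0 := by
    intro j h
    have h1 := he j n v hv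
    rw [h, zero_smul, heckeOp_self] at h1
    have h2 := congrArg (ρ (P.torus (Pi.single j fun _ => 1))⁻¹) h1
    rw [← Module.End.mul_apply, ← map_mul, inv_mul_cancel, map_one, map_zero] at h2
    exact hv0 h2
  -- The Satake parameters are defined from the eigenvalues by Vieta; they are nonzero because the
  -- operator of degree `n` is invertible.
  have hα : ∀ j, ∃ α : Fin n → ℂ, ∀ k ≤ n,
      esym α k = e j k / P.rootCard j ^ (k * (n - k)) := fun j =>
    exists_esym_eq (fun k => e j k / P.rootCard j ^ (k * (n - k))) (by simp [h0])
  choose α hα using hα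
  have hα0 : ∀ j i, α j i ≠ 0 := by
    intro j i h
    have h1 := hα j n le_rfl
    have h3 : (powersetCard n univ : Finset (Finset (Fin n))) = {univ} := by
      have := powersetCard_self (univ : Finset (Fin n))
      rwa [card_univ, Fintype.card_fin] at this
    rw [esym, h3, sum_singleton, prod_eq_zero (mem_univ i) h] at h1
    simp only [Nat.sub_self, mul_zero, pow_zero, div_one] at h1
    exact hen j h1.symm
  set c : J → Fin n → ℂ := fun j i => α j i * P.rootCard j ^ (-((n : ℤ) - 1 - 2 * i)) with hcdef
  have hc : ∀ j i, c j i ≠ 0 := fun j i =>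
    mul_ne_zero (hα0 j i) (zpow_ne_zero _ (P.rootCard_ne_zero j))
  have hsat : P.satake c = α := by
    funext j i
    rw [satake, hcdef, mul_assoc, ← zpow_add₀ (P.rootCard_ne_zero j), neg_add_cancel, zpow_zero,
      mul_one]
  have hT : ∀ j k, ∀ v ∈ fixedVectors ρ O, P.heckeOp ρ j k v =
      (P.rootCard j ^ (k * (n - k)) * esym (P.satake c j) k) • v := by
    intro j k v hv
    by_cases hk : k ≤ n
    · rw [he j k v hv, hsat, hα j k hk,
        mul_div_cancel₀ _ (pow_ne_zero _ (P.rootCard_ne_zero j))]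
    · rw [heckeOp_of_lt (not_le.mp hk), esym, powersetCard_eq_empty.mpr (by simpa using hk)]
      simp
  refine ⟨c, hc, ?_⟩
  obtain ⟨f, hf, -, hfv⟩ := exists_invariant_functional (ρ := ρ) (K := intGL O n) (M := ⊥)
    (by simp) (w := v) hv (by simpa using hv0)
  obtain ⟨f', hf', -, hfv'⟩ := exists_invariant_functional (ρ := rightReg (GL (Fin n) E))
    (K := intGL O n) (M := ⊥) (by simp) (w := P.sphFun c)
    (fun κ hκ => funext fun x => P.sphFun_mul_mem hc x hκ) (by
      rw [Submodule.mem_bot]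
      intro h
      have h1 := P.sphFun_one hc (n := n)
      rw [h] at h1
      simp at h1)
  -- The two functions `f (ρ g v)` and `f' (g · sphFun)` are bi-`K`-invariant with the same Hecke
  -- eigenvalues and the same value at `1`. Their difference, multiplied by a scalar `t` that
  -- absorbs the eigenvalues, is a family to which uniqueness applies.
  have hD := fun g => eq_zero_of_apply_one (P := P) (M := ℂ)
    (D := fun t g => t * (f (ρ g v) - f' (rightReg _ g (P.sphFun c))))
    (τ := fun j k t => t * (P.rootCard j ^ (k * (n - k)) * esym (P.satake c j) k))
    (fun t g κ hκ => by
      simp only [map_mul, Module.End.mul_apply]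
      rw [hf _ (hsm _) κ hκ, hf' _ (sphFun_rightReg_finite hc hcom g) κ hκ])
    (fun t g κ hκ => by
      simp only [map_mul, Module.End.mul_apply]
      rw [hv κ hκ, show rightReg _ κ (P.sphFun c) = P.sphFun c from
        funext fun x => P.sphFun_mul_mem hc x hκ])
    (fun j k t g => by
      have e1 := whittaker_heckeOp (P := P) (ρ := ρ) f v j k g
      rw [hT j k v hv, map_smul, map_smul, smul_eq_mul] at e1
      have e2 : ∑ x ∈ P.cosetIndex n j k, f' (rightReg _ (g * P.cosetRep j x) (P.sphFun c)) =
          P.rootCard j ^ (k * (n - k)) * esym (P.satake c j) k *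
            f' (rightReg _ g (P.sphFun c)) := by
        rw [← map_sum, ← smul_eq_mul, ← map_smul]
        congr 1
        funext x
        rw [Finset.sum_apply]
        simp only [rightReg_apply, Pi.smul_apply, smul_eq_mul]
        rw [← sum_sphFun hc]
        simp only [mul_assoc]
      rw [← mul_sum, sum_sub_distrib, ← e1, e2]
      ring)
    (fun t => by simp [hfv, hfv'])
    (fun j t => ⟨t / esym (P.satake c j) n, by
      have : esym (P.satake c j) n ≠ 0 := by
        rw [hsat, hα j n le_rfl]
        exact div_ne_zero (hen j) (pow_ne_zero _ (P.rootCard_ne_zero j))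
      simp [this]⟩) 1 g
  simp only [one_mul, sub_eq_zero] at hD
  set L₁ : (GL (Fin n) E →₀ ℂ) →ₗ[ℂ] (GL (Fin n) E → ℂ) :=
    Finsupp.linearCombination ℂ fun g => rightReg _ g (P.sphFun c) with hL₁
  set L₂ : (GL (Fin n) E →₀ ℂ) →ₗ[ℂ] V := Finsupp.linearCombination ℂ fun g => ρ g v with hL₂
  have hshift₁ : ∀ h x, L₁ (x.mapDomain (h * ·)) = rightReg _ h (L₁ x) := by
    intro h x
    rw [hL₁, Finsupp.linearCombination_mapDomain, Finsupp.apply_linearCombination]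
    congr 2
    funext g
    simp
  have hshift₂ : ∀ h x, L₂ (x.mapDomain (h * ·)) = ρ h (L₂ x) := by
    intro h x
    rw [hL₂, Finsupp.linearCombination_mapDomain, Finsupp.apply_linearCombination]
    congr 2
    funext g
    simp
  have hff : ∀ x, f (L₂ x) = f' (L₁ x) := by
    intro x
    rw [hL₁, hL₂, Finsupp.apply_linearCombination, Finsupp.apply_linearCombination]
    congr 2
    funext g
    exact hD g
  -- So a linear relation between translates of `sphFun` also holds between the translates of `v`:
  -- otherwise `f` would vanish on the orbit of the nonzero vector `L₂ x`. This makes the map from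
  -- the span of translates to `V` well defined.
  have hker : ∀ x, L₁ x = 0 → L₂ x = 0 := by
    intro x hx
    by_contra hne
    have hf0 := eq_zero_of_forall_apply_orbit hirr hne (f := f) fun h => by
      rw [← hshift₂, hff, hshift₁, hx, map_zero, map_zero]
    rw [hf0] at hfv
    simp at hfv
  have hrange : LinearMap.range L₁ = Submodule.span ℂ (Set.range fun g => rightReg _ g (P.sphFun c)) :=
    Finsupp.range_linearCombination _
  rw [← hrange]
  set T : LinearMap.range L₁ →ₗ[ℂ] V :=
    (LinearMap.ker L₁).liftQ L₂ (fun x hx => hker x hx) ∘ₗ L₁.quotKerEquivRange.symm with hTdef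
  have hTL : ∀ x, T ⟨L₁ x, ⟨x, rfl⟩⟩ = L₂ x := by
    intro x
    have : L₁.quotKerEquivRange.symm ⟨L₁ x, ⟨x, rfl⟩⟩ = Submodule.Quotient.mk x := by
      rw [LinearEquiv.symm_apply_eq]
      rfl
    rw [hTdef, LinearMap.comp_apply, LinearEquiv.coe_coe, this]
    rfl
  refine ⟨T, fun w => ?_, ?_⟩
  · have : w ∈ LinearMap.range L₂ := by
      rw [hL₂, Finsupp.range_linearCombination, span_orbit_eq_top hirr hv0]
      trivial
    obtain ⟨x, rfl⟩ := this
    exact ⟨_, hTL x⟩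
  · rintro g ⟨_, x, rfl⟩ ⟨F', hF'⟩ h
    simp only at h
    subst h
    rw [hTL, ← hshift₂, ← hTL]
    congr 1
    exact Subtype.ext (hshift₁ g x).symm

end PlaceData

end PrincipalSeries

end AsaiZeta

namespace AsaiZeta

/-! ### Elementary and permutation matrices. -/

section Elimination

open Matrix Finset

variable {K : Type*} {n : ℕ}

/-- The unit `1 + N` for `N² = 0`. -/
def sqZeroGL [CommRing K] (N : Matrix (Fin n) (Fin n) K) (h : N * N = 0) : GL (Fin n) K where
  val := 1 + N
  inv := 1 - N
  val_inv := by rw [mul_sub, mul_one, add_mul, one_mul, h]; abel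
  inv_val := by rw [mul_add, mul_one, sub_mul, one_mul, h]; abel

/-- Permutation matrices. -/
def permGL (K : Type*) [CommRing K] (σ : Equiv.Perm (Fin n)) : GL (Fin n) K where
  val := Matrix.of fun i j => if i = σ j then 1 else 0
  inv := Matrix.of fun i j => if σ i = j then 1 else 0
  val_inv := by
    ext i j
    rw [Matrix.mul_apply, sum_eq_single (σ.symm i)]
    · simp [Matrix.one_apply]
    · intro k _ hk
      have : i ≠ σ k := fun h => hk (by simp [h])
      simp [this]
    · simp
  inv_val := by
    ext i j
    rw [Matrix.mul_apply, sum_eq_single (σ i)]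
    · simp [Matrix.one_apply]
    · intro k _ hk
      simp [hk.symm]
    · simp

theorem mul_permGL_apply [CommRing K] (g : GL (Fin n) K) (σ : Equiv.Perm (Fin n)) (a b : Fin n) :
    (g * permGL K σ : GL (Fin n) K) a b = g a (σ b) := by
  rw [Units.val_mul, Matrix.mul_apply, sum_eq_single (σ b)]
  · simp [permGL]
  · intro k _ hk
    simp [permGL, hk]
  · simp

theorem permGL_inv_mul_apply [CommRing K] (g : GL (Fin n) K) (σ : Equiv.Perm (Fin n))
    (a b : Fin n) : ((permGL K σ)⁻¹ * g : GL (Fin n) K) a b = g (σ a) b := by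
  rw [Units.val_mul, Matrix.mul_apply, sum_eq_single (σ a)]
  · simp [permGL]
  · intro k _ hk
    simp [permGL, hk.symm]
  · simp

variable [CommRing K] {O : Subring K}

theorem permGL_mem (σ : Equiv.Perm (Fin n)) : permGL K σ ∈ intGL O n := by
  refine ⟨fun i j => ?_, fun i j => ?_⟩
  · simp only [permGL, Matrix.of_apply]
    split_ifs
    exacts [O.one_mem, O.zero_mem]
  · change (if σ i = j then (1 : K) else 0) ∈ O
    split_ifs
    exacts [O.one_mem, O.zero_mem]

theorem sqZeroGL_mem {N : Matrix (Fin n) (Fin n) K} (h : N * N = 0) (hN : ∀ i j, N i j ∈ O) :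
    sqZeroGL N h ∈ intGL O n :=
  ⟨fun a b => O.add_mem (PlaceData.one_apply_mem a b) (hN a b),
    fun a b => O.sub_mem (PlaceData.one_apply_mem a b) (hN a b)⟩

end Elimination

/-! ### The Iwasawa and Cartan decompositions by Gaussian elimination. -/

section ValuationRing

open Matrix Finset

variable {K : Type*} [Field K] {O : Subring K} {n : ℕ}

/-- Divisibility is total in a valuation ring, so some nonzero entry divides all the others. -/
theorem exists_pivot (hO : ∀ x : K, x ∈ O ∨ x⁻¹ ∈ O) {ι : Type*} (s : Finset ι) (f : ι → K)
    (h : ∃ i ∈ s, f i ≠ 0) : ∃ i ∈ s, f i ≠ 0 ∧ ∀ j ∈ s, f j / f i ∈ O := by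
  classical
  induction s using Finset.induction_on with
  | empty => simp at h
  | insert a s ha ih =>
    by_cases hs : ∃ i ∈ s, f i ≠ 0
    · obtain ⟨i, hi, hi0, hdiv⟩ := ih hs
      rcases hO (f a / f i) with h1 | h1
      · refine ⟨i, mem_insert_of_mem hi, hi0, fun j hj => ?_⟩
        rcases mem_insert.mp hj with rfl | hj
        exacts [h1, hdiv j hj]
      · by_cases ha0 : f a = 0
        · refine ⟨i, mem_insert_of_mem hi, hi0, fun j hj => ?_⟩
          rcases mem_insert.mp hj with rfl | hj
          exacts [by simp [ha0, O.zero_mem], hdiv j hj]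
        refine ⟨a, mem_insert_self _ _, ha0, fun j hj => ?_⟩
        rcases mem_insert.mp hj with rfl | hj
        · rw [div_self ha0]; exact O.one_mem
        · have : f j / f a = f j / f i * (f a / f i)⁻¹ := by field_simp
          rw [this]
          exact O.mul_mem (hdiv j hj) h1
    · push Not at hs
      obtain ⟨i, hi, hi0⟩ := h
      have : i = a := by
        rcases mem_insert.mp hi with h | h
        exacts [h, absurd (hs i h) hi0]
      subst this
      refine ⟨i, hi, hi0, fun j hj => ?_⟩
      rcases mem_insert.mp hj with rfl | hj
      · rw [div_self hi0]; exact O.one_mem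
      · simp [hs j hj, O.zero_mem]

/-- The Iwasawa decomposition over a valuation ring. -/
theorem exists_mul_upperTriangular (hO : ∀ x : K, x ∈ O ∨ x⁻¹ ∈ O) (g : GL (Fin n) K) :
    ∃ k ∈ intGL O n, ∀ a b, b < a → (g * k : GL (Fin n) K) a b = 0 := by
  -- Rows are cleared from the bottom; `t` counts the rows already in triangular form.
  suffices H : ∀ t : ℕ, ∃ k ∈ intGL O n, ∀ a b : Fin n, n - t ≤ a.val → b < a →
      (g * k : GL (Fin n) K) a b = 0 by
    obtain ⟨k, hk, h⟩ := H n
    exact ⟨k, hk, fun a b hab => h a b (by simp) hab⟩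
  intro t
  induction t with
  | zero => exact ⟨1, (intGL O n).one_mem, fun a b ha => absurd a.2 (by omega)⟩
  | succ t ih =>
    obtain ⟨k, hk, h⟩ := ih
    by_cases ht : t < n
    swap
    · exact ⟨k, hk, fun a b _ => h a b (by omega)⟩
    set A : Fin n := ⟨n - (t + 1), by omega⟩ with hA
    have hcase : ∀ a : Fin n, n - (t + 1) ≤ a.val → a = A ∨ (A < a ∧ n - t ≤ a.val) := by
      intro a ha
      rcases ha.eq_or_lt with h1 | h1
      · left; exact Fin.ext h1.symm
      · right; exact ⟨h1, by omega⟩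
    by_cases hall : ∀ b ≤ A, (g * k : GL (Fin n) K) A b = 0
    · refine ⟨k, hk, fun a b ha hab => ?_⟩
      rcases hcase a ha with rfl | h1
      · exact hall b hab.le
      · exact h a b h1.2 hab
    push Not at hall
    -- The pivot is chosen among the columns up to the diagonal only, so that the column operations
    -- do not disturb the rows below, which vanish there.
    obtain ⟨b₀, hb₀, hb₀0, hdiv⟩ := exists_pivot hO (univ.filter (· ≤ A))
      (fun b => (g * k : GL (Fin n) K) A b) (by simpa using hall)
    have hb₀A : b₀ ≤ A := by simpa using hb₀
    set σ := Equiv.swap b₀ A with hσ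
    set M := g * k * permGL K σ with hM
    have hMap : ∀ a b, M a b = (g * k : GL (Fin n) K) a (σ b) := fun a b =>
      mul_permGL_apply _ _ _ _
    have hσle : ∀ b ≤ A, σ b ≤ A := by
      intro b hb
      rw [hσ, Equiv.swap_apply_def]
      split_ifs
      exacts [le_rfl, hb₀A, hb]
    have hpiv : M A A = (g * k : GL (Fin n) K) A b₀ := by rw [hMap, hσ, Equiv.swap_apply_right]
    set N : Matrix (Fin n) (Fin n) K := Matrix.of fun c b =>
      if c = A ∧ b < A then -(M A b / M A A) else 0 with hN
    have hNN : N * N = 0 := by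
      ext c b
      rw [Matrix.mul_apply]
      refine sum_eq_zero fun d _ => ?_
      simp only [hN, Matrix.of_apply]
      by_cases h1 : d < A
      · simp [h1.ne]
      · simp [h1]
    refine ⟨k * permGL K σ * sqZeroGL N hNN, (intGL O n).mul_mem
      ((intGL O n).mul_mem hk (permGL_mem σ)) (sqZeroGL_mem hNN fun c b => ?_), fun a b ha hab => ?_⟩
    · simp only [hN, Matrix.of_apply]
      split_ifs with h1
      · refine O.neg_mem ?_
        rw [hpiv, hMap]
        exact hdiv _ (by simpa using hσle b h1.2.le)
      · exact O.zero_mem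
    · rw [← mul_assoc, ← mul_assoc, ← hM]
      have h2 : (M * sqZeroGL N hNN : GL (Fin n) K) a b =
          M a b + M a A * N A b := by
        change (M.1 * (1 + N)) a b = _
        rw [mul_add, mul_one, Matrix.add_apply, Matrix.mul_apply, sum_eq_single A]
        · intro c _ hc
          simp [hN, hc]
        · simp
      rw [h2]
      rcases hcase a ha with rfl | h1
      · simp only [hN, Matrix.of_apply, hab, and_self, if_true]
        rw [hpiv] at *
        field_simp
        ring
      · rw [hMap, hMap, h a _ h1.2 ((hσle A le_rfl).trans_lt h1.1), zero_mul, add_zero]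
        by_cases hbA : b ≤ A
        · exact h a _ h1.2 ((hσle b hbA).trans_lt h1.1)
        · rw [hσ, Equiv.swap_apply_of_ne_of_ne]
          · exact h a b h1.2 hab
          · rintro rfl; exact hbA hb₀A
          · rintro rfl; exact hbA le_rfl

/-- The Cartan decomposition over a valuation ring. -/
theorem exists_mul_diagGL_mul (hO : ∀ x : K, x ∈ O ∨ x⁻¹ ∈ O) (g : GL (Fin n) K) :
    ∃ k ∈ intGL O n, ∃ k' ∈ intGL O n, ∃ a : Fin n → Kˣ, g = k * diagGL a * k' := by
  -- After `t` steps the first `t` rows and columns are diagonal.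
  suffices H : ∀ t : ℕ, ∃ k ∈ intGL O n, ∃ k' ∈ intGL O n, ∀ a b : Fin n, (a.val < t ∨ b.val < t) →
      a ≠ b → (k * g * k' : GL (Fin n) K) a b = 0 by
    obtain ⟨k, hk, k', hk', h⟩ := H n
    refine ⟨k⁻¹, (intGL O n).inv_mem hk, k'⁻¹, (intGL O n).inv_mem hk',
      borelDiag ⟨k * g * k', fun a b hab => h a b (Or.inl a.2) hab.ne'⟩, ?_⟩
    have : k * g * k' = diagGL (borelDiag ⟨k * g * k', fun a b hab => h a b (Or.inl a.2) hab.ne'⟩) := by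
      ext a b
      by_cases hab : a = b
      · subst hab
        exact (Matrix.diagonal_apply_eq _ _).symm
      · rw [h a b (Or.inl a.2) hab]
        exact (Matrix.diagonal_apply_ne _ hab).symm
    rw [← this]
    group
  intro t
  induction t with
  | zero => exact ⟨1, (intGL O n).one_mem, 1, (intGL O n).one_mem, fun a b h => by omega⟩
  | succ t ih =>
    obtain ⟨k, hk, k', hk', h⟩ := ih
    by_cases ht : t < n
    swap
    · exact ⟨k, hk, k', hk', fun a b _ => h a b (by omega)⟩
    set A : Fin n := ⟨t, ht⟩ with hA
    set M := k * g * k' with hM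
    have hlt : ∀ a : Fin n, a < A ↔ a.val < t := fun a => Fin.lt_def
    have hlt' : ∀ a : Fin n, a.val < t + 1 → a ≤ A := fun a ha => Fin.le_def.mpr (by simp [hA]; omega)
    by_cases hall : ∀ a b, A ≤ a → A ≤ b → M a b = 0
    · refine ⟨k, hk, k', hk', fun a b hab hne => ?_⟩
      by_cases h1 : a < A
      · exact h a b (Or.inl ((hlt a).mp h1)) hne
      by_cases h2 : b < A
      · exact h a b (Or.inr ((hlt b).mp h2)) hne
      exact hall a b (not_lt.mp h1) (not_lt.mp h2)
    push Not at hall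
    -- A pivot dividing the whole remaining block lets both its row and its column be cleared with
    -- integral multipliers.
    obtain ⟨⟨a₀, b₀⟩, hab₀, hab₀0, hdiv⟩ := exists_pivot hO
      (univ.filter fun p : Fin n × Fin n => A ≤ p.1 ∧ A ≤ p.2) (fun p => M p.1 p.2)
      (by
        obtain ⟨a, b, ha, hb, hne⟩ := hall
        exact ⟨(a, b), by simp [ha, hb], hne⟩)
    obtain ⟨ha₀, hb₀⟩ : A ≤ a₀ ∧ A ≤ b₀ := by simpa using hab₀
    set σ := Equiv.swap a₀ A with hσ
    set τ := Equiv.swap b₀ A with hτ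
    set Q := (permGL K σ)⁻¹ * M * permGL K τ with hQ
    have hQap : ∀ a b, Q a b = M (σ a) (τ b) := fun a b => by
      rw [hQ, mul_permGL_apply, permGL_inv_mul_apply]
    have hge : ∀ c₀, A ≤ c₀ → ∀ c, A ≤ c → A ≤ Equiv.swap c₀ A c := by
      intro c₀ hc₀ c hc
      rw [Equiv.swap_apply_def]
      split_ifs
      exacts [le_rfl, hc₀, hc]
    have hfix : ∀ c₀, A ≤ c₀ → ∀ c < A, Equiv.swap c₀ A c = c := by
      intro c₀ hc₀ c hc
      exact Equiv.swap_apply_of_ne_of_ne (hc.trans_le hc₀).ne hc.ne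
    have hQrow : ∀ a b, a < A → a ≠ b → Q a b = 0 := by
      intro a b ha hab
      rw [hQap, hσ, hfix _ ha₀ a ha]
      refine h a _ (Or.inl ((hlt a).mp ha)) fun he => hab ?_
      rw [hτ] at he
      rw [← Equiv.swap_apply_self b₀ A b, ← he, hfix _ hb₀ a ha]
    have hQcol : ∀ a b, b < A → a ≠ b → Q a b = 0 := by
      intro a b hb hab
      rw [hQap, hτ, hfix _ hb₀ b hb]
      refine h _ b (Or.inr ((hlt b).mp hb)) fun he => hab ?_
      rw [hσ] at he
      rw [← Equiv.swap_apply_self a₀ A a, he, hfix _ ha₀ b hb]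
    have hpiv : Q A A = M a₀ b₀ := by
      rw [hQap, hσ, hτ, Equiv.swap_apply_right, Equiv.swap_apply_right]
    have hdivQ : ∀ a b, A ≤ a → A ≤ b → Q a b / Q A A ∈ O := by
      intro a b ha hb
      rw [hpiv, hQap]
      exact hdiv (σ a, τ b) (by simp [hσ, hτ, hge _ ha₀ a ha, hge _ hb₀ b hb])
    have hp0 : Q A A ≠ 0 := by rw [hpiv]; exact hab₀0
    set N₁ : Matrix (Fin n) (Fin n) K := Matrix.of fun c b =>
      if b = A ∧ A < c then -(Q c A / Q A A) else 0 with hN₁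
    set N₂ : Matrix (Fin n) (Fin n) K := Matrix.of fun c b =>
      if c = A ∧ A < b then -(Q A b / Q A A) else 0 with hN₂
    have hNN₁ : N₁ * N₁ = 0 := by
      ext c b
      rw [Matrix.mul_apply]
      refine sum_eq_zero fun d _ => ?_
      simp only [hN₁, Matrix.of_apply]
      by_cases h1 : A < d
      · simp [h1.ne']
      · simp [h1]
    have hNN₂ : N₂ * N₂ = 0 := by
      ext c b
      rw [Matrix.mul_apply]
      refine sum_eq_zero fun d _ => ?_
      simp only [hN₂, Matrix.of_apply]
      by_cases h1 : A < d
      · simp [h1.ne']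
      · simp [h1]
    refine ⟨sqZeroGL N₁ hNN₁ * (permGL K σ)⁻¹ * k,
      (intGL O n).mul_mem ((intGL O n).mul_mem (sqZeroGL_mem hNN₁ fun c b => ?_)
        ((intGL O n).inv_mem (permGL_mem σ))) hk,
      k' * permGL K τ * sqZeroGL N₂ hNN₂, (intGL O n).mul_mem
      ((intGL O n).mul_mem hk' (permGL_mem τ)) (sqZeroGL_mem hNN₂ fun c b => ?_),
      fun a b hab hne => ?_⟩
    · simp only [hN₁, Matrix.of_apply]
      split_ifs with h1
      · exact O.neg_mem (hdivQ _ _ h1.2.le le_rfl)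
      · exact O.zero_mem
    · simp only [hN₂, Matrix.of_apply]
      split_ifs with h1
      · exact O.neg_mem (hdivQ _ _ le_rfl h1.2.le)
      · exact O.zero_mem
    · have hR : ∀ a b, ((1 + N₁) * Q.1) a b = Q a b + N₁ a A * Q A b := by
        intro a b
        rw [add_mul, one_mul, Matrix.add_apply, Matrix.mul_apply, sum_eq_single A]
        · intro c _ hc
          simp [hN₁, hc]
        · simp
      have hprod : sqZeroGL N₁ hNN₁ * (permGL K σ)⁻¹ * k * g * (k' * permGL K τ * sqZeroGL N₂ hNN₂) =
          sqZeroGL N₁ hNN₁ * Q * sqZeroGL N₂ hNN₂ := by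
        rw [hQ, hM]; group
      have h2 : (sqZeroGL N₁ hNN₁ * Q * sqZeroGL N₂ hNN₂ : GL (Fin n) K) a b =
          Q a b + N₁ a A * Q A b + (Q a A + N₁ a A * Q A A) * N₂ A b := by
        change ((1 + N₁) * Q.1 * (1 + N₂)) a b = _
        rw [mul_add, mul_one, Matrix.add_apply, hR, Matrix.mul_apply, sum_eq_single A, hR]
        · intro c _ hc
          simp [hN₂, hc]
        · simp
      rw [hprod, h2]
      have hN₁lt : ∀ a, ¬ A < a → N₁ a A = 0 := fun a ha => by simp [hN₁, ha]
      have hN₂lt : ∀ b, ¬ A < b → N₂ A b = 0 := fun b hb => by simp [hN₂, hb]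
      have hN₁gt : ∀ a, A < a → N₁ a A = -(Q a A / Q A A) := fun a ha => by simp [hN₁, ha]
      have hN₂gt : ∀ b, A < b → N₂ A b = -(Q A b / Q A A) := fun b hb => by simp [hN₂, hb]
      rcases lt_trichotomy a A with ha | ha | ha
      · rw [hN₁lt a ha.not_gt, hQrow a b ha hne, hQrow a A ha ha.ne]
        ring
      · subst ha
        rw [hN₁lt _ (lt_irrefl _)]
        rcases lt_trichotomy b A with hb | hb | hb
        · rw [hQcol _ b hb hne, hN₂lt b hb.not_gt]
          ring
        · exact absurd hb.symm hne
        · rw [hN₂gt b hb]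
          field_simp
          ring
      · rw [hN₁gt a ha]
        rcases lt_trichotomy b A with hb | hb | hb
        · rw [hQcol a b hb hne, hQcol A b hb hb.ne', hN₂lt b hb.not_gt]
          ring
        · subst hb
          rw [hN₂lt _ (lt_irrefl _)]
          field_simp
          ring
        · exfalso
          rcases hab with h1 | h1
          · exact absurd (hlt' a h1) ha.not_ge
          · exact absurd (hlt' b h1) hb.not_ge

/-- The place of a discretely valued field with finite residue field. -/
def fieldPlaceData (O : Subring K) (v : Kˣ → ℤ) (hmul : ∀ x y, v (x * y) = v x + v y)
    (hO : ∀ x : Kˣ, (x : K) ∈ O ↔ 0 ≤ v x) (ϖ : Kˣ) (hϖ : v ϖ = 1) (res : Finset K)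
    (hres : ∀ r ∈ res, r ∈ O) (hex : ∀ a ∈ O, ∃ r ∈ res, ∃ b ∈ O, a - r = ϖ * b)
    (huniq : ∀ r ∈ res, ∀ r' ∈ res, ∀ b ∈ O, r - r' = ϖ * b → r = r') : PlaceData K O Unit :=
  have hO' : ∀ x : K, x ∈ O ∨ x⁻¹ ∈ O := by
    intro x
    by_cases hx : x = 0
    · exact Or.inl (hx ▸ O.zero_mem)
    have h1 := hO (Units.mk0 x hx)
    have h2 := hO (Units.mk0 x hx)⁻¹
    have h3 : v (Units.mk0 x hx)⁻¹ = -v (Units.mk0 x hx) := by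
      have h4 := hmul 1 1
      have h5 := hmul (Units.mk0 x hx) (Units.mk0 x hx)⁻¹
      rw [mul_inv_cancel] at h5
      rw [one_mul] at h4
      omega
    simp only [Units.val_mk0, Units.val_inv_eq_inv_val] at h1 h2
    rw [h1, h2, h3]
    omega
  { ord := fun _ => v
    unif := fun _ => ϖ
    res := fun _ => res
    ord_mul := fun _ => hmul
    ord_unif := fun _ _ => by simp [hϖ]
    mem_iff := fun x => by simp [hO]
    res_mem := fun _ => hres
    res_exists := fun _ => hex
    res_unique := fun _ => huniq
    iwasawa := fun _ g => exists_mul_upperTriangular hO' g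
    cartan := fun _ g => exists_mul_diagGL_mul hO' g
    perm := fun n j σ l => by
      refine ⟨(permGL K σ)⁻¹, (intGL O n).inv_mem (permGL_mem σ), permGL K σ, permGL_mem σ, ?_⟩
      ext a b
      rw [mul_permGL_apply, permGL_inv_mul_apply]
      by_cases hab : a = b
      · subst hab
        rw [torusOf, torusOf, show (diagGL _ : GL (Fin n) K) a a = _ from Matrix.diagonal_apply_eq _ _,
          show (diagGL _ : GL (Fin n) K) (σ a) (σ a) = _ from Matrix.diagonal_apply_eq _ _]
        simp
      · rw [torusOf, torusOf, show (diagGL _ : GL (Fin n) K) a b = _ from Matrix.diagonal_apply_ne _ hab,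
          show (diagGL _ : GL (Fin n) K) (σ a) (σ b) = _ from
            Matrix.diagonal_apply_ne _ (σ.injective.ne hab)] }

end ValuationRing

end AsaiZeta

namespace AsaiZeta

/-! ### Finite products of places. -/

section Product

open Matrix Finset

variable {E A J : Type*} [CommRing E] [CommRing A] [Fintype J] [DecidableEq J] {n : ℕ}
  (e : E ≃+* (J → A))

/-- The components of an element of a product ring. -/
def component (j : J) : E →+* A := (Pi.evalRingHom (fun _ => A) j).comp (e : E →+* (J → A))

theorem component_symm_apply (j : J) (f : J → A) : component e j (e.symm f) = f j := by
  simp [component]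

theorem component_ext {x y : E} (h : ∀ j, component e j x = component e j y) : x = y :=
  e.injective (funext h)

/-- The component of an invertible matrix. -/
abbrev componentGL (j : J) : GL (Fin n) E →* GL (Fin n) A :=
  Matrix.GeneralLinearGroup.map (component e j)

theorem componentGL_apply (j : J) (g : GL (Fin n) E) (a b : Fin n) :
    componentGL e j g a b = component e j (g a b) := rfl

theorem componentGL_ext {g h : GL (Fin n) E} (H : ∀ j, componentGL e j g = componentGL e j h) :
    g = h := by
  ext a b
  refine component_ext e fun j => ?_
  rw [← componentGL_apply, H, componentGL_apply]

/-- The unit with given components. -/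
def glueUnit (u : J → Aˣ) : Eˣ where
  val := e.symm fun j => u j
  inv := e.symm fun j => ((u j)⁻¹ : Aˣ)
  val_inv := component_ext e fun j => by simp [component_symm_apply]
  inv_val := component_ext e fun j => by simp [component_symm_apply]

theorem component_glueUnit (j : J) (u : J → Aˣ) :
    Units.map (component e j : E →* A) (glueUnit e u) = u j :=
  Units.ext (component_symm_apply e j _)

/-- The invertible matrix with given components. -/
def glueGL (k : J → GL (Fin n) A) : GL (Fin n) E where
  val := Matrix.of fun a b => e.symm fun j => k j a b
  inv := Matrix.of fun a b => e.symm fun j => (k j)⁻¹ a b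
  val_inv := by
    ext a b
    refine component_ext e fun j => ?_
    have : (k j * (k j)⁻¹ : GL (Fin n) A) a b = (1 : Matrix (Fin n) (Fin n) A) a b := by simp
    rw [Units.val_mul, Matrix.mul_apply] at this
    rw [Matrix.mul_apply, map_sum]
    simp only [Matrix.of_apply, map_mul, component_symm_apply, this]
    simp only [Matrix.one_apply]
    split_ifs <;> simp
  inv_val := by
    ext a b
    refine component_ext e fun j => ?_
    have : ((k j)⁻¹ * (k j) : GL (Fin n) A) a b = (1 : Matrix (Fin n) (Fin n) A) a b := by simp
    rw [Units.val_mul, Matrix.mul_apply] at this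
    rw [Matrix.mul_apply, map_sum]
    simp only [Matrix.of_apply, map_mul, component_symm_apply, this]
    simp only [Matrix.one_apply]
    split_ifs <;> simp

theorem componentGL_glueGL (j : J) (k : J → GL (Fin n) A) : componentGL e j (glueGL e k) = k j := by
  ext a b
  exact component_symm_apply e j _

theorem componentGL_diagGL (j : J) (a : Fin n → Eˣ) : componentGL e j (diagGL a) =
    diagGL fun i => Units.map (component e j : E →* A) (a i) := by
  ext i i'
  rw [componentGL_apply]
  by_cases h : i = i'
  · subst h
    rw [show (diagGL a : GL (Fin n) E) i i = _ from Matrix.diagonal_apply_eq _ _,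
      show (diagGL _ : GL (Fin n) A) i i = _ from Matrix.diagonal_apply_eq _ _]
    rfl
  · rw [show (diagGL a : GL (Fin n) E) i i' = _ from Matrix.diagonal_apply_ne _ h,
      show (diagGL _ : GL (Fin n) A) i i' = _ from Matrix.diagonal_apply_ne _ h, map_zero]

variable {O : Subring E} {OA : Subring A}

theorem mem_intGL_iff_component (hO : ∀ x, x ∈ O ↔ ∀ j, component e j x ∈ OA) (g : GL (Fin n) E) :
    g ∈ intGL O n ↔ ∀ j, componentGL e j g ∈ intGL OA n := by
  constructor
  · rintro ⟨h, h'⟩ j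
    refine ⟨fun a b => (hO _).mp (h a b) j, fun a b => ?_⟩
    rw [← map_inv]
    exact (hO _).mp (h' a b) j
  · intro h
    refine ⟨fun a b => (hO _).mpr fun j => (h j).1 a b, fun a b => (hO _).mpr fun j => ?_⟩
    have := (h j).2 a b
    rw [← map_inv] at this
    exact this

theorem componentGL_torusOf (ϖ : Aˣ) (j : J) (l : J → Fin n → ℤ) :
    componentGL e j (torusOf (fun j => glueUnit e (Function.update 1 j ϖ)) l) =
      torusOf (fun _ : Unit => ϖ) fun _ => l j := by
  rw [torusOf, componentGL_diagGL, torusOf]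
  congr 1
  funext i
  rw [map_prod, prod_eq_single j]
  · rw [map_zpow, component_glueUnit]
    simp
  · intro j' _ h
    rw [map_zpow, component_glueUnit, Function.update_of_ne h.symm]
    simp
  · simp

/-- The places of a product of discretely valued fields. -/
def productPlaceData (hO : ∀ x, x ∈ O ↔ ∀ j, component e j x ∈ OA) (P : PlaceData A OA Unit) :
    PlaceData E O J where
  ord j x := P.ord () (Units.map (component e j : E →* A) x)
  unif j := glueUnit e (Function.update 1 j (P.unif ()))
  res j := by classical exact (P.res ()).image fun r => e.symm (Pi.single j r)
  ord_mul j x y := by rw [map_mul, P.ord_mul]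
  ord_unif i j := by
    rw [component_glueUnit]
    by_cases h : i = j
    · subst h
      simp [P.ord_unif]
    · simp [h, P.ord_one]
  mem_iff x := by
    rw [hO]
    refine forall_congr' fun j => ?_
    have := P.mem_iff (Units.map (component e j : E →* A) x)
    exact this.trans ⟨fun h => h (), fun h _ => h⟩
  res_mem j r hr := by
    classical
    obtain ⟨ρ, hρ, rfl⟩ := mem_image.mp hr
    refine (hO _).mpr fun i => ?_
    rw [component_symm_apply]
    by_cases h : i = j
    · subst h
      simpa using P.res_mem _ ρ hρ
    · simpa [h] using OA.zero_mem
  res_exists j a ha := by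
    classical
    obtain ⟨ρ, hρ, b, hb, hab⟩ := P.res_exists () (component e j a) ((hO a).mp ha j)
    -- Away from `j` the uniformizer is `1` and the representative is `0`, so the quotient there
    -- must be `a` itself.
    refine ⟨_, mem_image_of_mem _ hρ, e.symm (Function.update (e a) j b), (hO _).mpr fun i => ?_,
      component_ext e fun i => ?_⟩
    · rw [component_symm_apply]
      by_cases h : i = j
      · subst h
        simpa using hb
      · rw [Function.update_of_ne h]
        exact (hO a).mp ha i
    · rw [map_sub, map_mul, component_symm_apply, component_symm_apply]
      have h1 : component e i (glueUnit e (Function.update 1 j (P.unif ())) : E) =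
          (Function.update (1 : J → Aˣ) j (P.unif ()) i : A) := component_symm_apply e i _
      rw [h1]
      by_cases h : i = j
      · subst h
        simpa using hab
      · simp [h, component]
  res_unique j r hr r' hr' b hb h := by
    classical
    obtain ⟨ρ, hρ, rfl⟩ := mem_image.mp hr
    obtain ⟨ρ', hρ', rfl⟩ := mem_image.mp hr'
    have h2 := congrArg (component e j) h
    have h1 : component e j (glueUnit e (Function.update 1 j (P.unif ())) : E) =
        (Function.update (1 : J → Aˣ) j (P.unif ()) j : A) := component_symm_apply e j _
    rw [map_sub, map_mul, component_symm_apply, component_symm_apply, h1] at h2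
    simp only [Pi.single_eq_same, Function.update_self] at h2
    rw [P.res_unique () ρ hρ ρ' hρ' _ ((hO b).mp hb j) h2]
  iwasawa n g := by
    choose k hk h using fun j => P.iwasawa n (componentGL e j g)
    refine ⟨glueGL e k, (mem_intGL_iff_component e hO _).mpr fun j => by
      rw [componentGL_glueGL]; exact hk j, fun a b hab => component_ext e fun j => ?_⟩
    rw [← componentGL_apply, map_mul, componentGL_glueGL, h j a b hab, map_zero]
  cartan n g := by
    choose k hk k' hk' a h using fun j => P.cartan n (componentGL e j g)
    refine ⟨glueGL e k, (mem_intGL_iff_component e hO _).mpr fun j => by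
      rw [componentGL_glueGL]; exact hk j, glueGL e k', (mem_intGL_iff_component e hO _).mpr
      fun j => by rw [componentGL_glueGL]; exact hk' j, fun i => glueUnit e fun j => a j i,
      componentGL_ext e fun j => ?_⟩
    rw [map_mul, map_mul, componentGL_glueGL, componentGL_glueGL, componentGL_diagGL, h j]
    simp only [component_glueUnit]
  perm n j σ l := by
    obtain ⟨k, hk, k', hk', h⟩ := P.perm n () σ fun _ => l j
    have hm : ∀ κ ∈ intGL OA n, glueGL e (Function.update 1 j κ) ∈ intGL O n := by
      intro κ hκ
      refine (mem_intGL_iff_component e hO _).mpr fun i => ?_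
      rw [componentGL_glueGL]
      by_cases h : i = j
      · subst h
        simpa using hκ
      · simpa [h] using (intGL OA n).one_mem
    refine ⟨_, hm k hk, _, hm k' hk', componentGL_ext e fun i => ?_⟩
    rw [map_mul, map_mul, componentGL_glueGL, componentGL_glueGL, componentGL_torusOf,
      componentGL_torusOf]
    by_cases hi : i = j
    · subst hi
      have h1 : Function.update (fun _ : Unit => l i) () ((fun _ : Unit => l i) () ∘ σ) =
          fun _ => l i ∘ σ := by funext u; simp
      rw [h1] at h
      simpa using h
    · simp [hi]

end Product

end AsaiZeta

namespace AsaiZeta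

/-! ### Two descriptions of the integral matrices. -/

section IntegralMatrices

variable {F : Type*} [Field F] [ValuativeRel F] [TopologicalSpace F] [IsNonarchimedeanLocalField F]
  {E : Type*} [CommRing E] [Algebra F E]

theorem integralGL_eq_intGL (n : ℕ) : integralGL F n E = intGL (integers F E).toSubring n := by
  ext g
  constructor
  · rintro ⟨k, rfl⟩
    refine ⟨fun i j => (k i j).2, fun i j => ?_⟩
    rw [← map_inv]
    exact (k⁻¹ i j).2
  · rintro ⟨h, h'⟩
    have hinj : Function.Injective (algebraMap (integers F E) E) := Subtype.val_injective
    exact ⟨⟨Matrix.of fun i j => ⟨g i j, h i j⟩, Matrix.of fun i j => ⟨g⁻¹ i j, h' i j⟩,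
      Matrix.map_injective hinj ((Matrix.map_mul (f := algebraMap (integers F E) E)).trans
        (g.mul_inv.trans (Matrix.map_one _ (map_zero _) (map_one _)).symm)),
      Matrix.map_injective hinj ((Matrix.map_mul (f := algebraMap (integers F E) E)).trans
        (g.inv_mul.trans (Matrix.map_one _ (map_zero _) (map_one _)).symm))⟩, Units.ext rfl⟩

end IntegralMatrices

/-! ### The place of the base field. -/

section BaseField

variable {F : Type*} [Field F] [ValuativeRel F] [TopologicalSpace F] [IsNonarchimedeanLocalField F]

theorem mem_integer_iff_ord (x : Fˣ) : (x : F) ∈ 𝒪[F] ↔ 0 ≤ ord (x : F) := by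
  rw [Valuation.mem_integer_iff, ord, ← map_le_map_iff (IsNonarchimedeanLocalField.valueGroupWithZeroIsoInt F),
    map_one, ← WithZero.log_le_log (by simp) (by simp)]
  simp

theorem mem_integers_self {x : F} : x ∈ integers F F ↔ x ∈ 𝒪[F] := by
  constructor
  · intro h
    exact Valuation.Integers.mem_of_integral (Valuation.integer.integers _) h
  · intro h
    exact isIntegral_algebraMap (x := (⟨x, h⟩ : 𝒪[F]))

theorem ord_one : ord (1 : F) = 0 := by simp [ord]

theorem ord_inv (x : Fˣ) : ord ((x⁻¹ : Fˣ) : F) = -ord (x : F) := by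
  have := ord_mul x x⁻¹
  rw [mul_inv_cancel, Units.val_one, ord_one] at this
  omega

variable (F) in
theorem exists_ord_eq_one : ∃ x : Fˣ, ord (x : F) = 1 := by
  obtain ⟨x, hx⟩ := ValuativeRel.valuation_surjective
    ((IsNonarchimedeanLocalField.valueGroupWithZeroIsoInt F).symm (WithZero.exp (-1)))
  have hx0 : x ≠ 0 := by
    rintro rfl
    rw [map_zero, eq_comm, EmbeddingLike.map_eq_zero_iff] at hx
    exact WithZero.exp_ne_zero hx
  exact ⟨Units.mk0 x hx0, by simp [ord, hx]⟩

variable (F) in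
/-- A uniformizer of `F`. -/
def unifF : Fˣ := (exists_ord_eq_one F).choose

theorem ord_unifF : ord (unifF F : F) = 1 := (exists_ord_eq_one F).choose_spec

theorem mem_maximalIdeal_iff (x : 𝒪[F]) :
    x ∈ 𝓂[F] ↔ ∃ b ∈ 𝒪[F], (x : F) = unifF F * b := by
  rw [IsLocalRing.mem_maximalIdeal, mem_nonunits_iff]
  by_cases hx : (x : F) = 0
  · have : x = 0 := Subtype.ext hx
    subst this
    simp
  set u := Units.mk0 (x : F) hx
  have h1 := (mem_integer_iff_ord u).mp x.2
  have hb : (∃ b ∈ 𝒪[F], (x : F) = unifF F * b) ↔ 1 ≤ ord (u : F) := by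
    have h2 : (((unifF F)⁻¹ * u : Fˣ) : F) ∈ 𝒪[F] ↔ 1 ≤ ord (u : F) := by
      rw [mem_integer_iff_ord, ord_mul, ord_inv, ord_unifF]
      omega
    rw [← h2]
    constructor
    · rintro ⟨b, hb, h⟩
      convert hb
      simp [u, h]
    · intro h
      exact ⟨_, h, by simp [u]⟩
  have hu : IsUnit x ↔ ord (u : F) ≤ 0 := by
    have h2 : ((u⁻¹ : Fˣ) : F) ∈ 𝒪[F] ↔ ord (u : F) ≤ 0 := by
      rw [mem_integer_iff_ord, ord_inv]
      omega
    rw [← h2]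
    constructor
    · rintro ⟨y, rfl⟩
      convert ((y⁻¹ : (𝒪[F])ˣ) : 𝒪[F]).2
      rw [Units.val_inv_eq_inv_val]
      exact inv_eq_of_mul_eq_one_right (congrArg Subtype.val y.mul_inv)
    · intro h
      exact IsUnit.of_mul_eq_one ⟨_, h⟩ (Subtype.ext (by simp [u, hx]))
  rw [hb, hu]
  omega

/-- A representative in `𝒪_F` of an element of the residue field. -/
def residueRep (y : 𝓀[F]) : 𝒪[F] :=
  (IsLocalRing.residue_surjective y).choose

theorem residue_residueRep (y : 𝓀[F]) : IsLocalRing.residue 𝒪[F] (residueRep y) = y :=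
  (IsLocalRing.residue_surjective y).choose_spec

variable (F) in
/-- Representatives in `𝒪_F` of the residue field of `F`. -/
def resF : Finset F :=
  (Set.finite_range fun y : 𝓀[F] => (residueRep y : F)).toFinset

theorem mem_resF {r : F} : r ∈ resF F ↔ ∃ y : 𝓀[F], (residueRep y : F) = r := by
  simp [resF]

theorem card_resF : (resF F).card = residueCard F := by
  rw [residueCard, resF, ← Set.ncard_eq_toFinset_card _ _, ← Set.image_univ,
    Set.ncard_image_of_injective, Set.ncard_univ]
  exact Subtype.val_injective.comp (Function.LeftInverse.injective residue_residueRep)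

theorem sub_eq_unifF_mul_iff (x y : 𝒪[F]) : (∃ b ∈ 𝒪[F], (x : F) - y = unifF F * b) ↔
    IsLocalRing.residue 𝒪[F] x = IsLocalRing.residue 𝒪[F] y := by
  rw [← sub_eq_zero, ← map_sub, IsLocalRing.residue_eq_zero_iff, mem_maximalIdeal_iff]
  rfl

theorem resF_mem {r : F} (hr : r ∈ resF F) : r ∈ 𝒪[F] := by
  obtain ⟨y, rfl⟩ := mem_resF.mp hr
  exact Subtype.property _

theorem resF_exists {a : F} (ha : a ∈ 𝒪[F]) : ∃ r ∈ resF F, ∃ b ∈ 𝒪[F], a - r = unifF F * b := by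
  refine ⟨_, mem_resF.mpr ⟨IsLocalRing.residue 𝒪[F] ⟨a, ha⟩, rfl⟩, ?_⟩
  exact (sub_eq_unifF_mul_iff ⟨a, ha⟩ _).mpr (residue_residueRep _).symm

theorem resF_unique {r r' : F} (hr : r ∈ resF F) (hr' : r' ∈ resF F) {b : F} (hb : b ∈ 𝒪[F])
    (h : r - r' = unifF F * b) : r = r' := by
  obtain ⟨y, rfl⟩ := mem_resF.mp hr
  obtain ⟨y', rfl⟩ := mem_resF.mp hr'
  have := (sub_eq_unifF_mul_iff _ _).mp ⟨b, hb, h⟩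
  rw [residue_residueRep, residue_residueRep] at this
  rw [this]

variable (F) in
/-- The place of `F`. -/
def basePlace : PlaceData F 𝒪[F] Unit :=
  fieldPlaceData 𝒪[F] (fun x => ord (x : F)) ord_mul mem_integer_iff_ord (unifF F) ord_unifF
    (resF F) (fun _ => resF_mem) (fun _ => resF_exists) (fun _ hr _ hr' _ => resF_unique hr hr')

theorem residueCard_pos : 0 < residueCard F := Nat.card_pos

theorem absF_eq (x : Fˣ) : absF (x : F) = (residueCard F : ℝ) ^ (-ord (x : F)) := if_neg x.ne_zero

end BaseField

end AsaiZeta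

namespace AsaiZeta

/-- The image in `E` of the uniformizer of `F`. -/
def unifMap (F E : Type*) [Field F] [ValuativeRel F] [TopologicalSpace F]
    [IsNonarchimedeanLocalField F] [CommRing E] [Algebra F E] : Eˣ :=
  Units.map (algebraMap F E : F →* E) (unifF F)

/-! ### Places of quadratic field extensions, through the valuation of the norm. -/

section QuadraticField

variable {F : Type*} [Field F] [ValuativeRel F] [TopologicalSpace F] [IsNonarchimedeanLocalField F]
  {E : Type*} [Field E] [Algebra F E]

theorem sq_sub_trace_mul_add_norm (h2 : Module.finrank F E = 2) (x : E) :
    x ^ 2 - algebraMap F E (Algebra.trace F E x) * x + algebraMap F E (Algebra.norm F x) = 0 := by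
  have : FiniteDimensional F E := Module.finite_of_finrank_pos (by omega)
  let b := Module.finBasisOfFinrankEq F E h2
  have h := Matrix.aeval_self_charpoly (Algebra.leftMulMatrix b x)
  rw [Matrix.charpoly_fin_two, ← Algebra.trace_eq_matrix_trace, ← Algebra.norm_eq_matrix_det,
    Polynomial.aeval_algHom_apply, map_eq_zero_iff _ (Algebra.leftMulMatrix_injective b)] at h
  simpa using h

/-- A polynomial `Y² - Y + c` with `c` in the maximal ideal has a root. -/
theorem exists_root_of_mem_maximalIdeal {c : 𝒪[F]} (hc : c ∈ 𝓂[F]) :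
    ∃ y : 𝒪[F], y ^ 2 - y + c = 0 := by
  let := IsTopologicalAddGroup.rightUniformSpace F
  have := isUniformAddGroup_of_addCommGroup (G := F)
  have hH : HenselianRing 𝒪[F] 𝓂[F] := inferInstance
  have hm : (Polynomial.X ^ 2 - Polynomial.X + Polynomial.C c : Polynomial 𝒪[F]).Monic := by
    monicity!
  -- Hensel's lemma at the approximate root `1`, where the derivative `2Y - 1` equals `1`.
  obtain ⟨y, hy, -⟩ := hH.is_henselian _ hm 1 (by simpa using hc) (by
    simp only [Polynomial.derivative_add, Polynomial.derivative_sub, Polynomial.derivative_X_sq,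
      Polynomial.derivative_X, Polynomial.derivative_C]
    norm_num)
  exact ⟨y, by simpa [Polynomial.IsRoot] using hy⟩

theorem mem_integer_of_sq {a : F} (h : a ^ 2 ∈ 𝒪[F]) : a ∈ 𝒪[F] := by
  rw [Valuation.mem_integer_iff, map_pow] at *
  exact (pow_le_one_iff (two_ne_zero)).mp h

/-- If the trace is integral, the quadratic equation shows that `x` is integral. If it is not, while
the norm `N` is, then `N / t²` lies in the maximal ideal and Hensel's lemma splits the quadratic
equation. So `x` lies in `F`, and its norm is its square. In this way `ord ∘ N_{E/F}` describes the
integers without extending valuations. -/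
theorem mem_integers_iff_norm (h2 : Module.finrank F E = 2) (x : E) :
    x ∈ integers F E ↔ Algebra.norm F x ∈ 𝒪[F] := by
  have : FiniteDimensional F E := Module.finite_of_finrank_pos (by omega)
  constructor
  · intro h
    exact mem_integers_self.mp (Algebra.isIntegral_norm F h)
  intro hN
  have hq := sq_sub_trace_mul_add_norm h2 x
  set t := Algebra.trace F E x
  set N := Algebra.norm F x with hNdef
  by_cases ht : t ∈ 𝒪[F]
  · refine ⟨Polynomial.X ^ 2 - Polynomial.C ⟨t, ht⟩ * Polynomial.X + Polynomial.C ⟨N, hN⟩,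
      by monicity!, ?_⟩
    simp only [Polynomial.eval₂_add, Polynomial.eval₂_sub, Polynomial.eval₂_mul,
      Polynomial.eval₂_X_pow, Polynomial.eval₂_X, Polynomial.eval₂_C]
    exact hq
  have ht0 : t ≠ 0 := fun h => ht (h ▸ 𝒪[F].zero_mem)
  have hu : ord (Units.mk0 t ht0 : F) < 0 := by
    rw [← not_le, ← mem_integer_iff_ord]
    exact ht
  -- The substitution `x = t Y` turns the equation of `x` into `Y² - Y + N / t² = 0`.
  have hF : ∃ a : F, x = algebraMap F E a := by
    by_cases hN0 : N = 0
    · exact ⟨0, by rw [map_zero]; exact (Algebra.norm_eq_zero_iff).mp hN0⟩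
    have hmem : ∃ b ∈ 𝒪[F], N / t ^ 2 = unifF F * b := by
      set w : Fˣ := (unifF F)⁻¹ * (Units.mk0 N hN0 * (Units.mk0 t ht0)⁻¹ * (Units.mk0 t ht0)⁻¹) with hw
      refine ⟨w, (mem_integer_iff_ord w).mpr ?_, ?_⟩
      · have := (mem_integer_iff_ord (Units.mk0 N hN0)).mp hN
        rw [hw, ord_mul, ord_mul, ord_mul, ord_inv, ord_inv, ord_unifF]
        omega
      · rw [hw]
        push_cast
        simp only [Units.val_mk0]
        field_simp
    have hmem' : N / t ^ 2 ∈ 𝒪[F] := by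
      obtain ⟨b, hb, h⟩ := hmem
      rw [h]
      exact 𝒪[F].mul_mem ((mem_integer_iff_ord _).mpr (by rw [ord_unifF]; omega)) hb
    obtain ⟨y, hy⟩ := exists_root_of_mem_maximalIdeal
      ((mem_maximalIdeal_iff (⟨N / t ^ 2, hmem'⟩ : 𝒪[F])).mpr hmem)
    have hy' : (y : F) ^ 2 - y + N / t ^ 2 = 0 := congrArg Subtype.val hy
    have hN' : N = t * y * (t - t * y) := by
      field_simp at hy'
      linear_combination hy'
    have : (x - algebraMap F E (t * y)) * (x - algebraMap F E (t - t * y)) = 0 := by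
      rw [hN'] at hq
      simp only [map_mul, map_sub] at hq ⊢
      linear_combination hq
    rcases mul_eq_zero.mp this with h | h
    · exact ⟨_, sub_eq_zero.mp h⟩
    · exact ⟨_, sub_eq_zero.mp h⟩
  obtain ⟨a, rfl⟩ := hF
  rw [hNdef, Algebra.norm_algebraMap, h2] at hN
  exact isIntegral_algebraMap (A := E) (x := (⟨a, mem_integer_of_sq hN⟩ : 𝒪[F]))

variable (F) in
/-- The valuation `ord_F ∘ N_{E/F}`. -/
def normOrd (x : Eˣ) : ℤ := ord (Algebra.norm F (x : E))

theorem normOrd_mul (x y : Eˣ) : normOrd F (x * y) = normOrd F x + normOrd F y := by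
  have := ord_mul (Units.map (Algebra.norm F : E →* F) x) (Units.map (Algebra.norm F : E →* F) y)
  rw [← map_mul] at this
  exact this

theorem normOrd_inv (x : Eˣ) : normOrd F x⁻¹ = -normOrd F x := by
  have := ord_inv (Units.map (Algebra.norm F : E →* F) x)
  rw [← map_inv] at this
  exact this

theorem normOrd_algebraMap (h2 : Module.finrank F E = 2) (a : Fˣ) :
    normOrd F (Units.map (algebraMap F E : F →* E) a) = 2 * ord (a : F) := by
  rw [normOrd, Units.coe_map, MonoidHom.coe_coe, Algebra.norm_algebraMap, h2, pow_two,
    ← Units.val_mul, ord_mul]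
  ring

theorem mem_integers_iff_normOrd (h2 : Module.finrank F E = 2) (x : Eˣ) :
    (x : E) ∈ (integers F E).toSubring ↔ 0 ≤ normOrd F x := by
  rw [Subalgebra.mem_toSubring, mem_integers_iff_norm h2]
  exact mem_integer_iff_ord (Units.map (Algebra.norm F : E →* F) x)

/-- The ultrametric inequality, from the fact that the integers, which are the elements of
nonnegative `normOrd`, form a ring: divide by the summand of smaller valuation. -/
theorem le_normOrd_add (h2 : Module.finrank F E = 2) {a b c : Eˣ} (h : (c : E) = a + b) :
    normOrd F a ≤ normOrd F c ∨ normOrd F b ≤ normOrd F c := by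
  wlog hab : normOrd F a ≤ normOrd F b generalizing a b
  · exact (this (a := b) (b := a) (by rw [h, add_comm]) (le_of_not_ge hab)).symm
  left
  have h1 : ((b * a⁻¹ : Eˣ) : E) ∈ (integers F E).toSubring := by
    rw [mem_integers_iff_normOrd h2, normOrd_mul, normOrd_inv]
    omega
  have h3 : ((c * a⁻¹ : Eˣ) : E) ∈ (integers F E).toSubring := by
    have : ((c * a⁻¹ : Eˣ) : E) = 1 + (b * a⁻¹ : Eˣ) := by
      rw [Units.val_mul, Units.val_mul, h, add_mul, Units.mul_inv]
    rw [this]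
    exact add_mem (one_mem _) h1
  rw [mem_integers_iff_normOrd h2, normOrd_mul, normOrd_inv] at h3
  omega

theorem algebraMap_mem_integers_iff (h2 : Module.finrank F E = 2) (a : F) :
    algebraMap F E a ∈ (integers F E).toSubring ↔ a ∈ 𝒪[F] := by
  rw [Subalgebra.mem_toSubring]
  refine ⟨fun h => ?_, fun h => isIntegral_algebraMap (A := E) (x := (⟨a, h⟩ : 𝒪[F]))⟩
  rw [mem_integers_iff_norm h2, Algebra.norm_algebraMap, h2] at h
  exact mem_integer_of_sq h

/-- An element of odd norm valuation generates `E`, compatibly with integrality. -/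
theorem exists_add_mul_of_odd (h2 : Module.finrank F E = 2) {ϖ : Eˣ} (hϖ : normOrd F ϖ = 1) {a : E}
    (ha : a ∈ (integers F E).toSubring) : ∃ x ∈ 𝒪[F], ∃ y ∈ 𝒪[F],
      a = algebraMap F E x + algebraMap F E y * ϖ := by
  have : FiniteDimensional F E := Module.finite_of_finrank_pos (by omega)
  have hli : LinearIndependent F ![(1 : E), (ϖ : E)] := by
    refine LinearIndependent.pair_iff.mpr fun s t h => ?_
    rw [Algebra.smul_def, Algebra.smul_def, mul_one] at h
    by_cases ht : t = 0
    · subst ht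
      simpa using h
    exfalso
    have hs : s ≠ 0 := by
      rintro rfl
      simp [ht] at h
    have h3 : Units.map (algebraMap F E : F →* E) (-Units.mk0 s hs) =
        Units.map (algebraMap F E : F →* E) (Units.mk0 t ht) * ϖ := by
      ext
      push_cast
      simp only [Units.coe_map, Units.val_neg, Units.val_mk0, MonoidHom.coe_coe, map_neg]
      linear_combination -h
    have h4 := congrArg (normOrd F) h3
    rw [normOrd_mul, normOrd_algebraMap h2, normOrd_algebraMap h2, hϖ] at h4
    omega
  have hspan := hli.span_eq_top_of_card_eq_finrank (by simp [h2])
  have hmem : a ∈ Submodule.span F (Set.range ![(1 : E), (ϖ : E)]) := hspan ▸ Submodule.mem_top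
  rw [Matrix.range_cons, Matrix.range_cons, Matrix.range_empty, Set.union_empty,
    ← Set.insert_eq, Submodule.mem_span_pair] at hmem
  obtain ⟨x, y, rfl⟩ := hmem
  simp only [Algebra.smul_def, mul_one] at ha ⊢
  have hy : ∀ y : Fˣ, algebraMap F E y * ϖ ∈ (integers F E).toSubring → (y : F) ∈ 𝒪[F] := by
    intro y hy
    have := (mem_integers_iff_normOrd h2 (Units.map (algebraMap F E : F →* E) y * ϖ)).mp hy
    rw [normOrd_mul, normOrd_algebraMap h2, hϖ] at this
    exact (mem_integer_iff_ord y).mpr (by omega)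
  by_cases hx0 : x = 0
  · subst hx0
    refine ⟨0, 𝒪[F].zero_mem, y, ?_, rfl⟩
    by_cases hy0 : y = 0
    · exact hy0 ▸ 𝒪[F].zero_mem
    · rw [map_zero, zero_add] at ha
      exact hy (Units.mk0 y hy0) ha
  by_cases hy0 : y = 0
  · subst hy0
    refine ⟨x, (algebraMap_mem_integers_iff h2 x).mp (by simpa using ha), 0, 𝒪[F].zero_mem, rfl⟩
  set X := Units.map (algebraMap F E : F →* E) (Units.mk0 x hx0) with hX
  set Y := Units.map (algebraMap F E : F →* E) (Units.mk0 y hy0) * ϖ with hY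
  have hX' : normOrd F X = 2 * _ := normOrd_algebraMap h2 (Units.mk0 x hx0)
  have hY' : normOrd F Y = 2 * ord (Units.mk0 y hy0 : F) + 1 := by
    rw [hY, normOrd_mul, normOrd_algebraMap h2, hϖ]
  have hneg : ∀ u : Eˣ, normOrd F (-u) = normOrd F u := by
    intro u
    have h1 := normOrd_mul (F := F) (-1 : Eˣ) (-1)
    have h3 := normOrd_mul (F := F) (1 : Eˣ) 1
    have h4 := normOrd_mul (F := F) (-1 : Eˣ) u
    rw [neg_one_mul] at h4
    rw [mul_one] at h3
    rw [neg_one_mul, neg_neg] at h1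
    omega
  have hc0 : (X : E) + Y ≠ 0 := by
    intro h
    have : X = -Y := Units.ext (eq_neg_of_add_eq_zero_left h)
    have h4 := congrArg (normOrd F) this
    rw [hneg] at h4
    omega
  set c := Units.mk0 _ hc0 with hc
  have hcX : (c : E) = X + Y := rfl
  have h0 : 0 ≤ normOrd F c := (mem_integers_iff_normOrd h2 c).mp ha
  -- The valuations of `X` and `Y` have different parity, so no cancellation occurs and integrality
  -- of the sum gives that of both terms.
  have h1 := le_normOrd_add h2 (a := c) (b := -Y) (c := X) (by rw [hcX]; simp)
  have h3 := le_normOrd_add h2 (a := c) (b := -X) (c := Y) (by rw [hcX]; simp)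
  rw [hneg] at h1 h3
  refine ⟨x, (mem_integer_iff_ord (Units.mk0 x hx0)).mpr ?_, y,
    (mem_integer_iff_ord (Units.mk0 y hy0)).mpr ?_, rfl⟩
  all_goals omega

open Classical in
/-- The place of a ramified quadratic extension. -/
def ramifiedPlace (h2 : Module.finrank F E = 2) (ϖ : Eˣ) (hϖ : normOrd F ϖ = 1) :
    PlaceData E (integers F E).toSubring Unit :=
  fieldPlaceData _ (normOrd F) normOrd_mul (mem_integers_iff_normOrd h2) ϖ hϖ
    ((resF F).image (algebraMap F E))
    (fun r hr => by
      obtain ⟨ρ, hρ, rfl⟩ := Finset.mem_image.mp hr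
      exact (algebraMap_mem_integers_iff h2 ρ).mpr (resF_mem hρ))
    (fun a ha => by
      obtain ⟨x, hx, y, hy, rfl⟩ := exists_add_mul_of_odd h2 hϖ ha
      obtain ⟨r, hr, b, hb, h⟩ := resF_exists hx
      have hu : ((unifMap F E * ϖ⁻¹ : Eˣ) : E) ∈ (integers F E).toSubring := by
        rw [mem_integers_iff_normOrd h2, normOrd_mul, normOrd_inv, hϖ, unifMap,
          normOrd_algebraMap h2, ord_unifF]
        omega
      -- With `x - r = ϖ_F b`, the difference `x + y ϖ - r` is `ϖ` times `(ϖ_F / ϖ) b + y`.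
      refine ⟨_, Finset.mem_image_of_mem _ hr, (unifMap F E * ϖ⁻¹ : Eˣ) * algebraMap F E b +
        algebraMap F E y, add_mem (mul_mem hu ((algebraMap_mem_integers_iff h2 b).mpr hb))
          ((algebraMap_mem_integers_iff h2 y).mpr hy), ?_⟩
      rw [add_sub_right_comm, ← map_sub, h, map_mul, mul_add, mul_comm (unifMap F E), Units.val_mul,
        ← mul_assoc, ← mul_assoc, Units.mul_inv, one_mul, mul_comm (ϖ : E)]
      rfl)
    (fun r hr r' hr' b hb h => by
      obtain ⟨ρ, hρ, rfl⟩ := Finset.mem_image.mp hr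
      obtain ⟨ρ', hρ', rfl⟩ := Finset.mem_image.mp hr'
      by_cases h0 : ρ - ρ' = 0
      · rw [sub_eq_zero.mp h0]
      have hb0 : b ≠ 0 := by
        rintro rfl
        rw [mul_zero, ← map_sub, map_eq_zero] at h
        exact h0 h
      have h3 : Units.map (algebraMap F E : F →* E) (Units.mk0 _ h0) = ϖ * Units.mk0 b hb0 :=
        Units.ext (by simpa using h)
      have h4 := congrArg (normOrd F) h3
      have h5 := (mem_integers_iff_normOrd h2 (Units.mk0 b hb0)).mp hb
      rw [normOrd_mul, normOrd_algebraMap h2, hϖ] at h4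
      have h6 : (((unifF F)⁻¹ * Units.mk0 _ h0 : Fˣ) : F) ∈ 𝒪[F] := by
        rw [mem_integer_iff_ord, ord_mul, ord_inv, ord_unifF]
        omega
      rw [resF_unique hρ hρ' h6 (by simp)])

open Classical in
theorem card_ramifiedPlace (h2 : Module.finrank F E = 2) (ϖ : Eˣ) (hϖ : normOrd F ϖ = 1) (j : Unit) :
    ((ramifiedPlace h2 ϖ hϖ).res j).card = residueCard F := by
  rw [← card_resF]
  exact Finset.card_image_of_injective _ (algebraMap F E).injective

/-- The integers of `E` are finite (by separability) and free of rank two over `𝒪_F`. In these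
coordinates they are open and compact, and in the unramified case their residue ring has `q²`
elements. -/
theorem exists_integral_basis [CharZero F] (h2 : Module.finrank F E = 2) :
    ∃ B : Module.Basis (Fin 2) F E, ∀ a, a ∈ (integers F E).toSubring ↔ ∀ i, B.repr a i ∈ 𝒪[F] := by
  have : FiniteDimensional F E := Module.finite_of_finrank_pos (by omega)
  have : Module.IsTorsionFree 𝒪[F] E := Module.IsTorsionFree.trans_faithfulSMul 𝒪[F] F E
  have : Module.Finite 𝒪[F] (integers F E) := IsIntegralClosure.finite 𝒪[F] F E (integers F E)
  have : Module.Free 𝒪[F] (integers F E) := IsIntegralClosure.module_free 𝒪[F] F E (integers F E)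
  have hr : Module.finrank 𝒪[F] (integers F E) = 2 := by
    rw [IsIntegralClosure.rank 𝒪[F] F E (integers F E), h2]
  let b := Module.finBasisOfFinrankEq 𝒪[F] (integers F E) hr
  have : IsLocalization (Algebra.algebraMapSubmonoid (integers F E) (nonZeroDivisors 𝒪[F])) E :=
    IsIntegralClosure.isLocalization 𝒪[F] F E (integers F E)
  refine ⟨b.localizationLocalization F (nonZeroDivisors 𝒪[F]) E, fun a => ⟨fun ha i => ?_, fun h => ?_⟩⟩
  · have := b.localizationLocalization_repr_algebraMap F (nonZeroDivisors 𝒪[F]) E ⟨a, ha⟩ i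
    rw [show (algebraMap (integers F E) E) ⟨a, ha⟩ = a from rfl] at this
    rw [this]
    exact (b.repr ⟨a, ha⟩ i).2
  · rw [← (b.localizationLocalization F (nonZeroDivisors 𝒪[F]) E).sum_repr a]
    refine sum_mem fun i _ => ?_
    rw [Module.Basis.localizationLocalization_apply, Algebra.smul_def]
    exact mul_mem ((algebraMap_mem_integers_iff h2 _).mpr (h i)) (b i).2

variable [CharZero F]

open Classical in
/-- The place of an unramified quadratic extension. -/
def unramifiedPlace (h2 : Module.finrank F E = 2) (heven : ∀ x : Eˣ, Even (normOrd F x)) :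
    PlaceData E (integers F E).toSubring Unit :=
  have hv : ∀ x : Eˣ, 2 * (normOrd F x / 2) = normOrd F x :=
    fun x => Int.mul_ediv_cancel' (heven x).two_dvd
  have hϖ : normOrd F (unifMap F E) = 2 := by rw [unifMap, normOrd_algebraMap h2, ord_unifF]; rfl
  have hrepr : ∀ (x : F) (b : E) (i : Fin 2), (exists_integral_basis h2).choose.repr
      (algebraMap F E x * b) i = x * (exists_integral_basis h2).choose.repr b i := fun x b i => by
    rw [← Algebra.smul_def, map_smul]
    rfl
  fieldPlaceData _ (fun x => normOrd F x / 2)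
    (fun x y => by
      have h1 := hv x
      have h3 := hv y
      have h4 := hv (x * y)
      rw [normOrd_mul] at *
      omega)
    (fun x => by
      have h1 := hv x
      rw [mem_integers_iff_normOrd h2]
      omega) (unifMap F E) (by rw [hϖ]; rfl)
    ((Fintype.piFinset fun _ => resF F).image (exists_integral_basis (F := F) h2).choose.equivFun.symm)
    (fun r hr => by
      obtain ⟨ρ, hρ, rfl⟩ := Finset.mem_image.mp hr
      refine ((exists_integral_basis h2).choose_spec _).mpr fun i => ?_
      rw [← Module.Basis.equivFun_apply, LinearEquiv.apply_symm_apply]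
      exact resF_mem (Fintype.mem_piFinset.mp hρ i))
    (fun a ha => by
      choose r hr b hb h using fun i => resF_exists (((exists_integral_basis h2).choose_spec _).mp ha i)
      refine ⟨_, Finset.mem_image_of_mem _ (Fintype.mem_piFinset.mpr hr),
        (exists_integral_basis h2).choose.equivFun.symm b,
        ((exists_integral_basis h2).choose_spec _).mpr fun i => ?_,
        (exists_integral_basis (F := F) h2).choose.repr.injective (Finsupp.ext fun i => ?_)⟩
      · rw [← Module.Basis.equivFun_apply, LinearEquiv.apply_symm_apply]
        exact hb i
      · rw [unifMap, Units.coe_map, MonoidHom.coe_coe, hrepr, map_sub, Finsupp.sub_apply,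
          ← Module.Basis.equivFun_apply, ← Module.Basis.equivFun_apply, LinearEquiv.apply_symm_apply,
          ← Module.Basis.equivFun_apply, LinearEquiv.apply_symm_apply]
        exact h i)
    (fun r hr r' hr' b hb h => by
      obtain ⟨ρ, hρ, rfl⟩ := Finset.mem_image.mp hr
      obtain ⟨ρ', hρ', rfl⟩ := Finset.mem_image.mp hr'
      refine congrArg _ (funext fun i => resF_unique (Fintype.mem_piFinset.mp hρ i)
        (Fintype.mem_piFinset.mp hρ' i) (((exists_integral_basis h2).choose_spec _).mp hb i) ?_)
      rw [← hrepr]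
      have := congrArg (fun x => (exists_integral_basis (F := F) h2).choose.repr x i) h
      simp only [map_sub, Finsupp.sub_apply] at this
      rw [← Module.Basis.equivFun_apply, ← Module.Basis.equivFun_apply, LinearEquiv.apply_symm_apply,
        LinearEquiv.apply_symm_apply] at this
      exact this)

open Classical in
theorem card_unramifiedPlace (h2 : Module.finrank F E = 2) (heven : ∀ x : Eˣ, Even (normOrd F x))
    (j : Unit) : ((unramifiedPlace h2 heven).res j).card = residueCard F ^ 2 := by
  rw [← card_resF]
  exact (Finset.card_image_of_injective _ (LinearEquiv.injective _)).trans (by simp)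

end QuadraticField

end AsaiZeta

namespace AsaiZeta

/-! ### Openness and compactness of the integral matrices. -/

section Topology

variable {F : Type*} [Field F] [ValuativeRel F] [TopologicalSpace F] [IsNonarchimedeanLocalField F]

theorem isOpen_integer : IsOpen (𝒪[F] : Set F) := by
  let := IsTopologicalAddGroup.rightUniformSpace F
  have := isUniformAddGroup_of_addCommGroup (G := F)
  exact Valued.isOpen_integer F

theorem isCompact_integer : IsCompact (𝒪[F] : Set F) :=
  IsNonarchimedeanLocalField.isCompact_closedBall F 1

instance : T2Space F := by
  let := IsTopologicalAddGroup.rightUniformSpace F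
  have := isUniformAddGroup_of_addCommGroup (G := F)
  infer_instance

variable {E : Type*} [CommRing E] [Algebra F E] [TopologicalSpace E] [IsModuleTopology F E]
  {ι : Type*} [Fintype ι] (B : Module.Basis ι F E)

/-- Coordinates as a homeomorphism. -/
def coordHomeo : E ≃ₜ (ι → F) where
  toEquiv := B.equivFun.toEquiv
  continuous_toFun := IsModuleTopology.continuous_of_linearMap B.equivFun.toLinearMap
  continuous_invFun := by
    have : ContinuousAdd E := IsModuleTopology.toContinuousAdd F E
    exact IsModuleTopology.continuous_of_linearMap B.equivFun.symm.toLinearMap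

variable {B} {O : Subring E} (hB : ∀ a, a ∈ O ↔ ∀ i, B.repr a i ∈ 𝒪[F])

include hB

theorem coe_eq_preimage : (O : Set E) = coordHomeo B ⁻¹' (Set.univ.pi fun _ => (𝒪[F] : Set F)) := by
  ext a
  simp only [Set.mem_preimage, Set.mem_pi, Set.mem_univ, true_imp_iff]
  exact hB a

theorem isOpen_of_basis : IsOpen (O : Set E) := by
  rw [coe_eq_preimage hB]
  exact (isOpen_set_pi Set.finite_univ fun _ _ => isOpen_integer).preimage (coordHomeo B).continuous

theorem isCompact_of_basis : IsCompact (O : Set E) := by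
  rw [coe_eq_preimage hB, Homeomorph.isCompact_preimage]
  exact isCompact_univ_pi fun _ => isCompact_integer

omit hB in
theorem t2Space_of_basis (B : Module.Basis ι F E) : T2Space E := (coordHomeo B).symm.t2Space

omit hB in
theorem isTopologicalRing_of_basis (B : Module.Basis ι F E) : IsTopologicalRing E :=
  have : Module.Finite F E := Module.Finite.of_basis B
  IsModuleTopology.isTopologicalRing F E

end Topology

section IntegralSubgroup

variable {E : Type*} [CommRing E] [TopologicalSpace E] [IsTopologicalRing E] {O : Subring E} {n : ℕ}

theorem isOpen_intGL (hO : IsOpen (O : Set E)) : IsOpen (intGL O n : Set (GL (Fin n) E)) := by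
  have h : (intGL O n : Set (GL (Fin n) E)) = (⋂ i, ⋂ j, {g : GL (Fin n) E | g i j ∈ O}) ∩
      ⋂ i, ⋂ j, {g : GL (Fin n) E | g⁻¹ i j ∈ O} := by
    ext g
    simp [intGL]
  rw [h]
  refine (isOpen_iInter_of_finite fun i => isOpen_iInter_of_finite fun j => ?_).inter
    (isOpen_iInter_of_finite fun i => isOpen_iInter_of_finite fun j => ?_)
  · exact hO.preimage (Units.continuous_val.matrix_elem i j)
  · exact hO.preimage (Units.continuous_coe_inv.matrix_elem i j)

theorem isCompact_intGL [T2Space E] (hO : IsCompact (O : Set E)) :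
    IsCompact (intGL O n : Set (GL (Fin n) E)) := by
  have hM : IsCompact {M : Matrix (Fin n) (Fin n) E | ∀ i j, M i j ∈ O} := by
    have : {M : Matrix (Fin n) (Fin n) E | ∀ i j, M i j ∈ O} =
        Set.univ.pi fun _ => Set.univ.pi fun _ => (O : Set E) := by
      ext M
      exact ⟨fun h i _ j _ => h i j, fun h i j => h i trivial j trivial⟩
    rw [this]
    exact isCompact_univ_pi fun _ => isCompact_univ_pi fun _ => hO
  have h := (Units.isClosedEmbedding_embedProduct (α := Matrix (Fin n) (Fin n) E)).isCompact_preimage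
    (hM.prod (hM.image MulOpposite.continuous_op))
  convert h using 1
  ext g
  simp only [Set.mem_preimage, Units.embedProduct, Set.mem_prod, Set.mem_image]
  constructor
  · rintro ⟨h1, h2⟩
    exact ⟨h1, _, h2, rfl⟩
  · rintro ⟨h1, x, h2, h3⟩
    refine ⟨h1, ?_⟩
    rw [← MulOpposite.op_injective h3]
    exact h2

theorem finiteIndex_subgroupOf {G : Type*} [Group G] [TopologicalSpace G] [IsTopologicalGroup G]
    {K U : Subgroup G} (hK : IsCompact (K : Set G)) (hU : IsOpen (U : Set G)) :
    (U.subgroupOf K).FiniteIndex := by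
  have : CompactSpace K := isCompact_iff_compactSpace.mp hK
  have : Finite (K ⧸ U.subgroupOf K) :=
    Subgroup.quotient_finite_of_isOpen _ (hU.preimage continuous_subtype_val)
  exact Subgroup.finiteIndex_of_finite_quotient

variable [T2Space E]

/-- The open subgroup `K ∩ g K g⁻¹` of the compact group `K` has finite index. -/
theorem exists_conj_mem_intGL (hO : IsOpen (O : Set E)) (hO' : IsCompact (O : Set E))
    (g : GL (Fin n) E) : ∃ H : Subgroup (intGL O n), H.FiniteIndex ∧
      ∀ h ∈ H, g⁻¹ * h.1 * g ∈ intGL O n := by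
  refine ⟨((intGL O n).comap (MulAut.conj g⁻¹).toMonoidHom).subgroupOf (intGL O n),
    finiteIndex_subgroupOf (isCompact_intGL hO') ?_, fun h hh => ?_⟩
  · refine (isOpen_intGL hO).preimage (f := fun h : GL (Fin n) E => MulAut.conj g⁻¹ h) ?_
    simp only [MulAut.conj_apply]
    fun_prop
  · simpa [Subgroup.mem_subgroupOf] using hh

theorem isFiniteVector_of_isOpen (hO' : IsCompact (O : Set E)) {V : Type*} [AddCommGroup V] [Module ℂ V]
    {ρ : Representation ℂ (GL (Fin n) E) V} {v : V} {U : Subgroup (GL (Fin n) E)}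
    (hU : IsOpen (U : Set (GL (Fin n) E))) (h : ∀ k ∈ U, ρ k v = v) :
    IsFiniteVector ρ (intGL O n) v :=
  ⟨U.subgroupOf (intGL O n), finiteIndex_subgroupOf (isCompact_intGL hO') hU, fun k hk => h k hk⟩

theorem IsSmooth.isFiniteVector (hO' : IsCompact (O : Set E)) {V : Type*} [AddCommGroup V]
    [Module ℂ V] {ρ : Representation ℂ (GL (Fin n) E) V} (hρ : IsSmooth ρ) (v : V) :
    IsFiniteVector ρ (intGL O n) v :=
  isFiniteVector_of_isOpen hO' (U :=
    { carrier := {g | ρ g v = v}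
      one_mem' := by simp
      mul_mem' := fun {a b} ha hb => by
        simp only [Set.mem_ofPred_eq] at *
        rw [map_mul, Module.End.mul_apply, hb, ha]
      inv_mem' := fun {a} ha => by
        simp only [Set.mem_ofPred_eq] at *
        conv_lhs => rw [← ha]
        rw [← Module.End.mul_apply, ← map_mul, inv_mul_cancel, map_one, Module.End.one_apply] })
    (hρ v) fun _ h => h

end IntegralSubgroup

/-! ### The split algebra `F × F`. -/

section SplitAlgebra

variable {F : Type*} [Field F] [ValuativeRel F] [TopologicalSpace F] [IsNonarchimedeanLocalField F]
  {E : Type*} [CommRing E] [Algebra F E] (e : E ≃ₐ[F] F × F)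

/-- The split algebra as a ring of functions on two points. -/
def splitEquiv : E ≃+* (Fin 2 → F) :=
  e.toRingEquiv.trans (RingEquiv.piFinTwo fun _ => F).symm

theorem component_splitEquiv_zero (x : E) : component (splitEquiv e) 0 x = (e x).1 := rfl

theorem component_splitEquiv_one (x : E) : component (splitEquiv e) 1 x = (e x).2 := rfl

/-- The basis of the split algebra given by the two idempotents. -/
def splitBasis : Module.Basis (Fin 2) F E :=
  Module.Basis.ofEquivFun (e.toLinearEquiv.trans (LinearEquiv.piFinTwo F fun _ => F).symm)

theorem splitBasis_repr (x : E) (i : Fin 2) :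
    (splitBasis e).repr x i = component (splitEquiv e) i x := rfl

theorem component_splitBasis (i j : Fin 2) :
    component (splitEquiv e) i (splitBasis e j) = if j = i then 1 else 0 := by
  rw [← splitBasis_repr, Module.Basis.repr_self, Finsupp.single_apply]

/-- Projections preserve integrality; conversely the two idempotents are roots of `X² - X` and hence
integral. -/
theorem mem_integers_split_iff (x : E) : x ∈ (integers F E).toSubring ↔
    ∀ j, component (splitEquiv e) j x ∈ 𝒪[F] := by
  rw [Subalgebra.mem_toSubring]
  constructor
  · intro h
    have h' := h.map (e.toAlgHom.restrictScalars 𝒪[F])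
    rw [Fin.forall_fin_two]
    exact ⟨mem_integers_self.mp (h'.map ((AlgHom.fst F F F).restrictScalars 𝒪[F])),
      mem_integers_self.mp (h'.map ((AlgHom.snd F F F).restrictScalars 𝒪[F]))⟩
  · intro h
    rw [← (splitBasis e).sum_repr x]
    refine sum_mem fun i _ => ?_
    rw [Algebra.smul_def, splitBasis_repr]
    refine mul_mem (isIntegral_algebraMap (A := E) (x := (⟨_, h i⟩ : 𝒪[F])))
      ⟨Polynomial.X ^ 2 - Polynomial.X, by monicity!, ?_⟩
    rw [Polynomial.eval₂_sub, Polynomial.eval₂_X_pow, Polynomial.eval₂_X, sub_eq_zero]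
    refine component_ext (splitEquiv e) fun j => ?_
    rw [map_pow, component_splitBasis]
    simp

theorem norm_split (x : E) : Algebra.norm F x = (e x).1 * (e x).2 := by
  rw [Algebra.norm_eq_matrix_det (splitBasis e), Matrix.det_fin_two]
  simp only [Algebra.leftMulMatrix_eq_repr_mul, splitBasis_repr, map_mul, component_splitBasis]
  simp [component_splitEquiv_zero, component_splitEquiv_one]

/-- The places of the split algebra. -/
def splitPlace : PlaceData E (integers F E).toSubring (Fin 2) :=
  productPlaceData (splitEquiv e) (mem_integers_split_iff e) (basePlace F)

open Classical in
theorem card_splitPlace (j : Fin 2) : ((splitPlace e).res j).card = residueCard F := by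
  rw [← card_resF]
  exact Finset.card_image_of_injective _ ((splitEquiv e).symm.injective.comp (Pi.single_injective j))

theorem ord_splitPlace (j : Fin 2) (x : Eˣ) :
    (splitPlace e).ord j x = ord (component (splitEquiv e) j x) := rfl

end SplitAlgebra

end AsaiZeta

namespace AsaiZeta

/-! ### From the axiomatic places to principal series of `GL_n(E)`. -/

section UnramifiedSeries

open Matrix

variable {F : Type*} [Field F] [ValuativeRel F] [TopologicalSpace F] [IsNonarchimedeanLocalField F]
  {E : Type*} [CommRing E] [Algebra F E] [TopologicalSpace E] [IsTopologicalRing E] [T2Space E]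
  {J : Type*} [Fintype J] [DecidableEq J] {n : ℕ} {V : Type*} [AddCommGroup V] [Module ℂ V]

namespace PlaceData

variable {P : PlaceData E (integers F E).toSubring J}
  (habs : ∀ x : Eˣ, absE F (x : E) = ∏ j, ((P.res j).card : ℝ) ^ (-P.ord j x))

include habs

/-- Half-integral powers of the absolute value become integral powers of the square roots
`rootCard`, so the modulus factor takes the form used by `borelChar`. -/
theorem absE_rpow (x : Eˣ) (m : ℤ) : ((absE F (x : E) ^ ((m : ℝ) / 2) : ℝ) : ℂ) =
    ∏ j, P.rootCard j ^ (-m * P.ord j x) := by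
  have hQ : ∀ j, (0 : ℝ) < (P.res j).card := fun j => Nat.cast_pos.mpr (card_res_pos j)
  rw [habs, ← Real.finsetProd_rpow _ _ fun j _ => zpow_nonneg (hQ j).le _, Complex.ofReal_prod]
  refine Finset.prod_congr rfl fun j _ => ?_
  rw [rootCard, ← Complex.ofReal_zpow, Complex.ofReal_inj, Real.sqrt_eq_rpow, ← Real.rpow_intCast,
    ← Real.rpow_intCast, ← Real.rpow_mul (hQ j).le, ← Real.rpow_mul (hQ j).le]
  congr 1
  push_cast
  ring

variable {χ : Fin n → (Eˣ →* ℂˣ)} {a : J → Fin n → ℂ}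
  (hχ : ∀ i x, (χ i x : ℂ) = ∏ j, a j i ^ P.ord j x)

variable (P) in
/-- The inducing data (unnormalized) with Satake parameters `a`. -/
def unsatake (a : J → Fin n → ℂ) (j : J) (i : Fin n) : ℂ :=
  a j i * P.rootCard j ^ (-((n : ℤ) - 1 - 2 * i))

omit habs [TopologicalSpace E] [IsTopologicalRing E] [T2Space E] in
theorem satake_unsatake (a : J → Fin n → ℂ) : P.satake (P.unsatake a) = a := by
  funext j i
  rw [satake, unsatake, mul_assoc, ← zpow_add₀ (P.rootCard_ne_zero j)]
  simp

omit habs [TopologicalSpace E] [IsTopologicalRing E] [T2Space E] in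
theorem unsatake_ne_zero (ha : ∀ j i, a j i ≠ 0) (j : J) (i : Fin n) : P.unsatake a j i ≠ 0 :=
  mul_ne_zero (ha j i) (zpow_ne_zero _ (P.rootCard_ne_zero j))

include hχ

theorem borelChar_unsatake (b : borelGL n E) :
    ∏ i : Fin n, ((absE F (borelDiag b i : E) ^ (((n : ℝ) - 1 - 2 * (i : ℝ)) / 2) : ℝ) : ℂ) *
      (χ i (borelDiag b i) : ℂ) = P.borelChar (P.unsatake a) b := by
  rw [borelChar]
  refine Finset.prod_congr rfl fun i _ => ?_
  rw [show ((n : ℝ) - 1 - 2 * (i : ℝ)) = (((n : ℤ) - 1 - 2 * (i : ℕ) : ℤ) : ℝ) by push_cast; ring,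
    absE_rpow habs, hχ, ← Finset.prod_mul_distrib]
  refine Finset.prod_congr rfl fun j _ => ?_
  rw [unsatake, mul_zpow, ← _root_.zpow_mul, mul_comm]

theorem heckeOp_eq_of_isSubquotient (hO' : IsCompact ((integers F E).toSubring : Set E))
    (ha : ∀ j i, a j i ≠ 0) {π : Representation ℂ (GL (Fin n) E) V}
    (h : IsSubquotientOfPrincipalSeries F π χ) {v : V}
    (hv : v ∈ fixedVectors π (integers F E).toSubring) (j : J) (k : ℕ) :
    P.heckeOp π j k v = (P.rootCard j ^ (k * (n - k)) * esym (a j) k) • v := by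
  obtain ⟨U, hU, hUG, T, hT, hTG⟩ := h
  have := heckeOp_eq_of_subquotient (P := P) (unsatake_ne_zero ha)
    (fun f hf b g => by
      rw [← borelChar_unsatake habs hχ]
      exact (hU hf).2 b.1 (borelDiag b) b.2 (fun i => rfl) g)
    (fun f hf => by
      obtain ⟨U', hU', h'⟩ := (hU hf).1
      exact isFiniteVector_of_isOpen hO' hU' fun k hk => funext fun g => h' k hk g)
    hUG hT (fun g f => hTG g f _ fun x => rfl) hv j k
  rwa [satake_unsatake] at this

omit hχ in
-- The span of the translates of `sphFun` lies in the principal series: each translate is invariant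
-- under a conjugate of `K`, and the left equivariance is that of `sphFun`.
theorem exists_isSubquotient (hO : IsOpen ((integers F E).toSubring : Set E))
    (hO' : IsCompact ((integers F E).toSubring : Set E)) {π : Representation ℂ (GL (Fin n) E) V}
    (hirr : π.IsIrreducible) (hsm : IsSmooth π) {ψ : AddChar E Circle}
    (hψ : IsUnramifiedAddChar F ψ) {ℓ : V →ₗ[ℂ] ℂ} (hℓ0 : ℓ ≠ 0)
    (hℓ : IsWhittakerFunctional π ψ ℓ) {v : V}
    (hv : v ∈ fixedVectors π (integers F E).toSubring) (hv0 : v ≠ 0) :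
    ∃ a : J → Fin n → ℂ, (∀ j i, a j i ≠ 0) ∧ ∀ χ : Fin n → (Eˣ →* ℂˣ),
      (∀ i x, (χ i x : ℂ) = ∏ j, a j i ^ P.ord j x) → IsSubquotientOfPrincipalSeries F π χ := by
  obtain ⟨c, hc, T, hT, hTG⟩ := exists_subquotient (P := P) hirr hψ hℓ0 hℓ
    (hsm.isFiniteVector hO') (exists_conj_mem_intGL hO hO') hv hv0
  refine ⟨P.satake c, fun j i => mul_ne_zero (hc j i) (zpow_ne_zero _ (P.rootCard_ne_zero j)),
    fun χ hχ => ?_⟩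
  have hcc : P.unsatake (P.satake c) = c := by
    funext j i
    rw [unsatake, satake, mul_assoc, ← zpow_add₀ (P.rootCard_ne_zero j)]
    simp
  refine ⟨_, Submodule.span_le.mpr ?_, fun g f hf => ?_, T, hT, fun g f f' h => hTG g f f' (funext h)⟩
  · rintro _ ⟨g, rfl⟩
    refine ⟨⟨(intGL (integers F E).toSubring n).comap (MulAut.conj g⁻¹).toMonoidHom, ?_,
      fun k hk x => ?_⟩, fun b d hb hd x => ?_⟩
    · refine (isOpen_intGL hO).preimage (f := fun h : GL (Fin n) E => MulAut.conj g⁻¹ h) ?_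
      simp only [MulAut.conj_apply]
      fun_prop
    · simp only [rightReg_apply]
      rw [show x * k * g = x * g * (g⁻¹ * k * g) by group, P.sphFun_mul_mem hc _ (by simpa using hk)]
    · beta_reduce
      have hd' : borelDiag ⟨b, hb⟩ = d := funext fun i => Units.ext (hd i)
      rw [rightReg_apply, rightReg_apply, mul_assoc, P.sphFun_borel_mul hc ⟨b, hb⟩, ← hcc,
        ← borelChar_unsatake habs hχ, hd', hcc]
  · refine Submodule.span_induction (p := fun f _ => (fun x => f (x * g)) ∈
      Submodule.span ℂ (Set.range fun g => rightReg (GL (Fin n) E) g (P.sphFun c))) ?_ ?_ ?_ ?_ hf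
    · rintro _ ⟨h, rfl⟩
      refine Submodule.subset_span ⟨g * h, funext fun x => ?_⟩
      simp only [rightReg_apply, mul_assoc]
    · exact zero_mem _
    · exact fun f f' _ _ h h' => add_mem h h'
    · exact fun z f _ h => Submodule.smul_mem _ z h

end PlaceData

end UnramifiedSeries

end AsaiZeta

namespace AsaiZeta

/-! ### Indices of conjugate subgroups and of conjugates of `N(O)`. -/

section ConjIndex

variable {G : Type*} [Group G]

/-- The subgroup `t K t⁻¹`. -/
def conjSub (t : G) (K : Subgroup G) : Subgroup G := K.map (MulAut.conj t).toMonoidHom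

theorem mem_conjSub {t x : G} {K : Subgroup G} : x ∈ conjSub t K ↔ t⁻¹ * x * t ∈ K := by
  rw [conjSub, Subgroup.mem_map_equiv]
  simp [MulAut.conj_symm_apply]

theorem conjSub_mul (s t : G) (K : Subgroup G) : conjSub (s * t) K = conjSub s (conjSub t K) := by
  ext x
  simp only [mem_conjSub, mul_inv_rev, mul_assoc]

theorem relIndex_conjSub (t : G) (H K : Subgroup G) :
    (conjSub t H).relIndex (conjSub t K) = H.relIndex K :=
  Subgroup.relIndex_map_map_of_injective H K (MulAut.conj t).injective

end ConjIndex

section UnipotentIndex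

open Matrix Finset

variable {E : Type*} [CommRing E] {O : Subring E} {J : Type*} [Fintype J] [DecidableEq J] {n : ℕ}

variable (O n) in
/-- Integral unipotent matrices. -/
def intUnipotent : Subgroup (GL (Fin n) E) := unipotent n E ⊓ intGL O n

namespace PlaceData

variable (P : PlaceData E O J)

/-- The index of `ϖ^l N(O) ϖ^{-l}` in `N(O)`. -/
def uniIndex (l : J → Fin n → ℤ) : ℕ :=
  (conjSub (P.torus l) (intUnipotent O n)).relIndex (intUnipotent O n)

variable {P}

theorem mem_conj_intUnipotent_iff (l : J → Fin n → ℤ) {u : GL (Fin n) E} :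
    u ∈ conjSub (P.torus l) (intUnipotent O n) ↔
      u ∈ unipotent n E ∧ u ∈ conjSub (P.torus l) (intGL O n) := by
  rw [mem_conjSub, mem_conjSub, intUnipotent, Subgroup.mem_inf]
  refine and_congr_left fun _ => ⟨fun h => ?_, fun h => ?_⟩
  · have := torus_conj_unipotent (P := P) l h
    simpa [mul_assoc] using this
  · have := torus_conj_unipotent (P := P) (-l) h
    simpa [torus_neg, mul_assoc] using this

theorem conj_intUnipotent_le {l : J → Fin n → ℤ} (hl : ∀ j, Antitone (l j)) :
    conjSub (P.torus l) (intUnipotent O n) ≤ intUnipotent O n := by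
  intro u hu
  refine ⟨((mem_conj_intUnipotent_iff l).mp hu).1, ?_⟩
  rw [mem_conjSub] at hu
  have := P.torus_conj_mem hl hu.1 hu.2.1
  simpa [mul_assoc] using this

/-- For dominant weights the conjugates form a chain `t t' N(O) (t t')⁻¹ ≤ t N(O) t⁻¹ ≤ N(O)`, and
indices multiply. -/
theorem uniIndex_add {l l' : J → Fin n → ℤ} (hl : ∀ j, Antitone (l j)) (hl' : ∀ j, Antitone (l' j)) :
    P.uniIndex (l + l') = P.uniIndex l * P.uniIndex l' := by
  rw [uniIndex, torus_add, conjSub_mul, ← Subgroup.relIndex_mul_relIndex _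
    (conjSub (P.torus l) (intUnipotent O n)) _ ?_ (conj_intUnipotent_le hl), relIndex_conjSub,
    mul_comm, uniIndex, uniIndex]
  exact Subgroup.map_mono (conj_intUnipotent_le hl')

theorem uniIndex_zero : P.uniIndex (0 : J → Fin n → ℤ) = 1 := by
  rw [uniIndex, torus_zero, Subgroup.relIndex_eq_one]
  intro x hx
  rw [mem_conjSub]
  simpa using hx

/-- Classes of `N(O)` modulo its conjugate inject into the cosets of the minuscule double coset
through `u ↦ u t K`, so the representatives `blockUni ε c` already found serve here. -/
theorem uniIndex_single (j : J) (ε : Finset (Fin n)) (hε : Antitone (indZ ε)) :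
    P.uniIndex (Pi.single j (indZ ε)) = #(P.res j) ^ crossings ε := by
  classical
  set t := P.torus (Pi.single j (indZ ε)) with ht
  set C : Finset (Fin n → Fin n → E) := Fintype.piFinset fun a => Fintype.piFinset fun b =>
    if a ∈ ε ∧ b ∉ ε ∧ a < b then P.res j else {0} with hC
  have hcard : #C = #(P.res j) ^ crossings ε := by
    rw [hC, Fintype.card_piFinset]
    simp only [Fintype.card_piFinset, apply_ite Finset.card, card_singleton]
    rw [crossings, ← prod_pow_eq_pow_sum]
    refine prod_congr rfl fun a _ => ?_
    rw [← prod_pow_eq_pow_sum]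
    refine prod_congr rfl fun b _ => ?_
    split_ifs <;> simp
  have hidx : ∀ c ∈ C, (⟨ε, c⟩ : Σ _ : Finset (Fin n), Fin n → Fin n → E) ∈ P.cosetIndex n j #ε :=
    fun c hc => mem_sigma.mpr ⟨mem_powersetCard.mpr ⟨subset_univ _, rfl⟩, hc⟩
  have hN : ∀ c ∈ C, blockUni ε c ∈ intUnipotent O n := fun c hc =>
    ⟨blockUni_mem _ _, blockUni_mem_intGL (hidx c hc)⟩
  have key : ∀ u v : GL (Fin n) E, u ∈ intUnipotent O n → v ∈ intUnipotent O n →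
      (u⁻¹ * v ∈ conjSub t (intUnipotent O n) ↔ (u * t)⁻¹ * (v * t) ∈ intGL O n) := by
    intro u v hu hv
    rw [ht, mem_conj_intUnipotent_iff, mem_conjSub]
    have : u⁻¹ * v ∈ unipotent n E := mul_mem (inv_mem hu.1) hv.1
    simp only [this, true_and]
    rw [show t⁻¹ * (u⁻¹ * v) * t = (u * t)⁻¹ * (v * t) by group]
  rw [uniIndex, Subgroup.relIndex, Subgroup.index_eq_card, ← hcard, ← Nat.card_eq_finsetCard]
  symm
  refine Nat.card_eq_of_bijective (fun c : C =>
    (QuotientGroup.mk (⟨blockUni ε c.1, hN c.1 c.2⟩ : intUnipotent O n) :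
      intUnipotent O n ⧸ (conjSub t (intUnipotent O n)).subgroupOf (intUnipotent O n))) ⟨?_, ?_⟩
  · intro c c' h
    rw [QuotientGroup.eq, Subgroup.mem_subgroupOf] at h
    have h' := cosetRep_injective (hidx c.1 c.2) (hidx c'.1 c'.2)
      ((key _ _ (hN c.1 c.2) (hN c'.1 c'.2)).mp h)
    simp only [Sigma.mk.injEq, heq_eq_eq, true_and] at h'
    exact Subtype.ext h'
  · intro q
    induction q using QuotientGroup.induction_on with | _ u => ?_
    have hu := u.2
    have hmin : P.IsMinuscule j #ε (u.1 * t) := (isMinuscule_torus j rfl).mul_left hu.2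
    obtain ⟨⟨ε', c⟩, hx, hκ⟩ := hmin.exists_cosetRep
    -- Since `u t` and the representative differ by an element of `K`, their diagonal valuations
    -- agree.
    have hεε : ε' = ε := by
      set b : borelGL n E := ⟨P.cosetRep j ⟨ε', c⟩, P.cosetRep_mem_borelGL j _⟩
      set b' : borelGL n E := ⟨u.1 * t, mul_mem (unipotent_le_borelGL hu.1) (diagGL_mem_borelGL _)⟩
      have h1 : ∀ i, P.ord j (borelDiag (b⁻¹ * b') i) = 0 := fun i =>
        P.ord_borelDiag_of_mem (b := b⁻¹ * b') hκ i j
      have hb' : b' = ⟨u.1, unipotent_le_borelGL hu.1⟩ * ⟨t, diagGL_mem_borelGL _⟩ := rfl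
      ext i
      have h2 := h1 i
      rw [map_mul, map_inv, Pi.mul_apply, Pi.inv_apply, P.ord_mul, P.ord_inv,
        P.ord_borelDiag_cosetRep, hb', map_mul, borelDiag_unipotent hu.1, one_mul, P.borelDiag_torus,
        ord_prod_unif] at h2
      simp only [Pi.single_eq_same, indZ] at h2
      by_cases hi : i ∈ ε' <;> by_cases hi' : i ∈ ε <;> simp [hi, hi'] at h2 ⊢
    subst hεε
    have hc : c ∈ C := (mem_sigma.mp hx).2
    refine ⟨⟨c, hc⟩, ?_⟩
    rw [QuotientGroup.eq, Subgroup.mem_subgroupOf]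
    exact (key _ _ (hN c hc) hu).mpr hκ

end PlaceData

end UnipotentIndex

end AsaiZeta

namespace AsaiZeta

/-! ### The invariant measure on `N_n(F) \ GL_n(F)`. -/

section QuotientMeasure

open Matrix MeasureTheory

variable {F : Type*} [Field F] [ValuativeRel F] [TopologicalSpace F] [IsNonarchimedeanLocalField F]
  {n : ℕ}

namespace UnipotentQuotient

theorem mk_eq_mk {g h : GL (Fin n) F} : mk g = mk h ↔ ∃ u ∈ unipotent n F, h = u * g := by
  refine (Quotient.eq (r := QuotientGroup.rightRel (unipotent n F))).trans ?_
  rw [QuotientGroup.rightRel_apply]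
  exact ⟨fun h => ⟨_, h, by simp⟩, fun ⟨u, hu, h⟩ => by simpa [h] using hu⟩

theorem rightMul_mk (g h : GL (Fin n) F) : rightMul g (mk h) = mk (h * g) := rfl

theorem continuous_mk : Continuous (mk : GL (Fin n) F → UnipotentQuotient n F) := continuous_quot_mk

theorem isOpenMap_mk : IsOpenMap (mk : GL (Fin n) F → UnipotentQuotient n F) := by
  intro U hU
  refine isOpen_coinduced.mpr ?_
  change IsOpen (mk ⁻¹' (mk '' U) : Set (GL (Fin n) F))
  have : (mk ⁻¹' (mk '' U) : Set (GL (Fin n) F)) =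
      ⋃ u : unipotent n F, (fun g => u.1 * g) ⁻¹' U := by
    ext g
    simp only [Set.mem_preimage, Set.mem_iUnion]
    constructor
    · rintro ⟨h, hh, he⟩
      obtain ⟨u, hu, hgu⟩ := mk_eq_mk.mp he
      exact ⟨⟨u⁻¹, inv_mem hu⟩, by simpa [hgu] using hh⟩
    · rintro ⟨u, hu⟩
      exact ⟨_, hu, mk_eq_mk.mpr ⟨_, inv_mem u.2, by simp⟩⟩
  rw [this]
  exact isOpen_iUnion fun u => hU.preimage (continuous_const_mul u.1)

theorem continuous_rightMul (g : GL (Fin n) F) :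
    Continuous (rightMul g : UnipotentQuotient n F → UnipotentQuotient n F) :=
  continuous_quot_lift _ (continuous_mk.comp (continuous_mul_const g))

end UnipotentQuotient

open UnipotentQuotient

variable {μ : Measure (UnipotentQuotient n F)} (hμ : IsInvariantMeasure μ)

include hμ

theorem measure_image_mul (g : GL (Fin n) F) {U : Set (GL (Fin n) F)} (hU : IsOpen U) :
    μ (mk '' ((· * g) '' U)) = μ (mk '' U) := by
  conv_rhs => rw [← hμ.map_rightMul g⁻¹, Measure.map_apply (continuous_rightMul _).measurable
    (isOpenMap_mk U hU).measurableSet]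
  congr 1
  ext x
  obtain ⟨h, rfl⟩ := Quotient.exists_rep x
  change mk h ∈ mk '' ((· * g) '' U) ↔ rightMul g⁻¹ (mk h) ∈ mk '' U
  rw [rightMul_mk]
  constructor
  · rintro ⟨_, ⟨h', hh', rfl⟩, he⟩
    refine ⟨h', hh', ?_⟩
    rw [← rightMul_mk, ← he, rightMul_mk, mul_inv_cancel_right]
  · rintro ⟨h', hh', he⟩
    refine ⟨_, ⟨h', hh', rfl⟩, ?_⟩
    change mk (h' * g) = _
    rw [← rightMul_mk, he, rightMul_mk, inv_mul_cancel_right]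

/-- The volumes of the images of open compact subgroups. -/
theorem measure_mul_relIndex {H L : Subgroup (GL (Fin n) F)} (hLH : L ≤ H)
    (hH : IsOpen (H : Set (GL (Fin n) F))) (hL : IsOpen (L : Set (GL (Fin n) F)))
    (hfin : L.relIndex H ≠ 0) :
    (L.relIndex (unipotent n F ⊓ H) : ENNReal) * μ (mk '' (H : Set (GL (Fin n) F))) =
      (L.relIndex H : ENNReal) * μ (mk '' (L : Set (GL (Fin n) F))) := by
  classical
  have : (L.subgroupOf H).FiniteIndex := ⟨hfin⟩
  let := Fintype.ofFinite (H ⧸ L.subgroupOf H)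
  have hLm : MeasurableSet (mk '' (L : Set (GL (Fin n) F))) := (isOpenMap_mk _ hL).measurableSet
  have hHm : MeasurableSet (mk '' (H : Set (GL (Fin n) F))) := (isOpenMap_mk _ hH).measurableSet
  have h1 : ∀ q : H ⧸ L.subgroupOf H, μ (rightMul (q.out : GL (Fin n) F) ⁻¹'
      (mk '' (L : Set (GL (Fin n) F)))) = μ (mk '' (L : Set (GL (Fin n) F))) := fun q => by
    rw [← Measure.map_apply (continuous_rightMul _).measurable hLm, hμ.map_rightMul]
  -- Translates of the image of `L` cover the image of `H` with constant multiplicity `[N ∩ H : N ∩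
  -- L]`. Integration of this identity gives the claim.
  have h2 : ∀ x, ∑ q : H ⧸ L.subgroupOf H, Set.indicator (rightMul (q.out : GL (Fin n) F) ⁻¹'
      (mk '' (L : Set (GL (Fin n) F)))) (1 : UnipotentQuotient n F → ENNReal) x =
      L.relIndex (unipotent n F ⊓ H) * Set.indicator (mk '' (H : Set (GL (Fin n) F))) 1 x := by
    intro x
    obtain ⟨g, rfl⟩ := Quotient.exists_rep x
    change ∑ q : H ⧸ L.subgroupOf H, Set.indicator (rightMul (q.out : GL (Fin n) F) ⁻¹'
      (mk '' (L : Set (GL (Fin n) F)))) (1 : UnipotentQuotient n F → ENNReal) (mk g) = _ * Set.indicator _ 1 (mk g)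
    by_cases hg : mk g ∈ mk '' (H : Set (GL (Fin n) F))
    · obtain ⟨h, hh, he⟩ := hg
      rw [← he, Set.indicator_of_mem (Set.mem_image_of_mem _ hh), Pi.one_apply, mul_one]
      simp only [Set.indicator_apply, Set.mem_preimage, rightMul_mk, Pi.one_apply]
      rw [Finset.sum_boole]
      congr 1
      -- The classes `q` that hit a given point form a translate of the classes represented by `N ∩
      -- H`.
      set S : Set (H ⧸ L.subgroupOf H) := Set.range
        (Subgroup.quotientSubgroupOfEmbeddingOfLE L (inf_le_right : unipotent n F ⊓ H ≤ H)) with hS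
      have hQ : ∀ q : H ⧸ L.subgroupOf H, mk (h * (q.out : GL (Fin n) F)) ∈
          mk '' (L : Set (GL (Fin n) F)) ↔ (⟨h, hh⟩ : H) • q ∈ S := by
        intro q
        constructor
        · rintro ⟨l, hl, he⟩
          obtain ⟨u, hu, heu⟩ := mk_eq_mk.mp he
          have huH : u ∈ H := by
            rw [show u = h * q.out * l⁻¹ by rw [heu]; simp]
            exact mul_mem (mul_mem hh q.out.2) (inv_mem (hLH hl))
          refine ⟨QuotientGroup.mk ⟨u, hu, huH⟩, ?_⟩
          · rw [Subgroup.quotientSubgroupOfEmbeddingOfLE_apply_mk]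
            conv_rhs => rw [← q.out_eq']
            rw [MulAction.Quotient.smul_mk, QuotientGroup.eq, Subgroup.mem_subgroupOf]
            have : u⁻¹ * (h * q.out) = l := by rw [heu]; simp
            simpa [this] using hl
        · rintro ⟨u, hu⟩
          induction u using QuotientGroup.induction_on with | _ u => ?_
          rw [Subgroup.quotientSubgroupOfEmbeddingOfLE_apply_mk] at hu
          rw [← q.out_eq', MulAction.Quotient.smul_mk, QuotientGroup.eq, Subgroup.mem_subgroupOf] at hu
          refine ⟨_, hu, mk_eq_mk.mpr ⟨u, u.2.1, ?_⟩⟩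
          simp
      have hcard : Nat.card S = L.relIndex (unipotent n F ⊓ H) := by
        rw [Subgroup.relIndex, Subgroup.index_eq_card, hS, Nat.card_range_of_injective
          (Function.Embedding.injective _)]
      rw [← hcard, ← Fintype.card_subtype, ← Nat.card_eq_fintype_card]
      exact Nat.card_congr ((MulAction.toPerm (⟨h, hh⟩ : H)).subtypeEquiv hQ)
    · rw [Set.indicator_of_notMem hg, mul_zero]
      refine Finset.sum_eq_zero fun q _ => Set.indicator_of_notMem (fun hq => hg ?_) _
      obtain ⟨l, hl, he⟩ := hq
      refine ⟨l * (q.out : GL (Fin n) F)⁻¹, mul_mem (hLH hl) (inv_mem q.out.2), ?_⟩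
      rw [← rightMul_mk, he]
      change rightMul _ (rightMul _ (mk g)) = _
      rw [rightMul_mk, rightMul_mk, mul_inv_cancel_right]
  have h3 := congrArg (fun f => ∫⁻ x, f x ∂μ) (funext h2)
  simp only at h3
  rw [lintegral_finsetSum _ fun q _ => (measurable_one.indicator
    (hLm.preimage (continuous_rightMul _).measurable)), lintegral_const_mul _
    (measurable_one.indicator hHm), lintegral_indicator_one hHm] at h3
  simp only [lintegral_indicator_one (hLm.preimage (continuous_rightMul _).measurable), h1] at h3
  rw [← h3, Finset.sum_const, nsmul_eq_mul, Subgroup.relIndex, Subgroup.index_eq_card,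
    Nat.card_eq_fintype_card, Finset.card_univ]

end QuotientMeasure

/-! ### Volumes of the cells `N ϖ^l K`. -/

section TorusVolume

open Matrix MeasureTheory UnipotentQuotient

section InverseTranspose

variable {R : Type*} [CommRing R] {n : ℕ}

/-- The automorphism `g ↦ ᵗg⁻¹`. -/
def invTranspose : GL (Fin n) R →* GL (Fin n) R where
  toFun g :=
    { val := ((g⁻¹ : GL (Fin n) R) : Matrix (Fin n) (Fin n) R)ᵀ
      inv := (g : Matrix (Fin n) (Fin n) R)ᵀ
      val_inv := by rw [← transpose_mul, ← Units.val_mul, mul_inv_cancel]; simp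
      inv_val := by rw [← transpose_mul, ← Units.val_mul, inv_mul_cancel]; simp }
  map_one' := by
    refine Units.ext ?_
    change ((1 : GL (Fin n) R)⁻¹).valᵀ = 1
    simp
  map_mul' g h := by
    refine Units.ext ?_
    change ((g * h)⁻¹ : GL (Fin n) R).valᵀ = (g⁻¹).valᵀ * (h⁻¹).valᵀ
    rw [_root_.mul_inv_rev, Units.val_mul, transpose_mul]

theorem invTranspose_invTranspose (g : GL (Fin n) R) : invTranspose (invTranspose g) = g :=
  Units.ext (transpose_transpose _)

theorem map_invTranspose_intGL (O : Subring R) :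
    (intGL O n).map invTranspose = intGL O n := by
  have h : ∀ g ∈ intGL O n, invTranspose g ∈ intGL O n := fun g hg =>
    ⟨fun i j => hg.2 j i, fun i j => hg.1 j i⟩
  refine le_antisymm (Subgroup.map_le_iff_le_comap.mpr h) fun g hg => ?_
  exact ⟨_, h g hg, invTranspose_invTranspose g⟩

theorem invTranspose_diagGL (a : Fin n → Rˣ) : invTranspose (diagGL a) = (diagGL a)⁻¹ := by
  rw [diagGL_inv]
  exact Units.ext (diagonal_transpose _)

/-- Unimodularity by symmetry: inverse transpose preserves `K` and exchanges `a K a⁻¹` with `a⁻¹ K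
a`, and conjugation by `a` brings the pair back in the other order. -/
theorem relIndex_conj_intGL (O : Subring R) (a : Fin n → Rˣ) :
    (intGL O n).relIndex (conjSub (diagGL a) (intGL O n)) =
      (conjSub (diagGL a) (intGL O n)).relIndex (intGL O n) := by
  have hinj : Function.Injective (invTranspose (R := R) (n := n)) :=
    Function.LeftInverse.injective invTranspose_invTranspose
  have h : (conjSub (diagGL a) (intGL O n)).map invTranspose =
      conjSub (diagGL a)⁻¹ (intGL O n) := by
    conv_rhs => rw [← map_invTranspose_intGL O, ← invTranspose_diagGL]
    rw [conjSub, conjSub, Subgroup.map_map, Subgroup.map_map]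
    congr 1
    ext1 g
    simp
  rw [← Subgroup.relIndex_map_map_of_injective (conjSub (diagGL a) (intGL O n)) _ hinj, h,
    map_invTranspose_intGL, ← relIndex_conjSub (diagGL a) (conjSub (diagGL a)⁻¹ _), ← conjSub_mul,
    mul_inv_cancel]
  congr 1
  ext x
  simp [mem_conjSub]

end InverseTranspose

variable {F : Type*} [Field F] [ValuativeRel F] [TopologicalSpace F] [IsNonarchimedeanLocalField F]
  {n : ℕ} {μ : Measure (UnipotentQuotient n F)} {O : Subring F} {J : Type*} [Fintype J]
  [DecidableEq J] (P : PlaceData F O J)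

/-- The cell of `t K` is a translate of the image of `K' = t K t⁻¹`. Compare `K` and `K'` with `K ∩
K'`: the indices in both are equal, and the unipotent indices are `uniIndex` for `K` and `1` for
`K'`. -/
theorem measure_torus (hμ : IsInvariantMeasure μ) (hO : IsOpen (O : Set F))
    (hO' : IsCompact (O : Set F)) {l : J → Fin n → ℤ} (hl : ∀ j, Antitone (l j)) :
    μ (mk '' ((P.torus l * ·) '' (intGL O n : Set (GL (Fin n) F)))) =
      P.uniIndex l * μ (mk '' (intGL O n : Set (GL (Fin n) F))) := by
  set K := intGL O n with hK
  set t := P.torus l with ht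
  set K' := conjSub t K with hK'
  have hKo : IsOpen (K : Set (GL (Fin n) F)) := isOpen_intGL hO
  have hcoe : (K' : Set (GL (Fin n) F)) = (fun x => t⁻¹ * x * t) ⁻¹' K := by
    ext x
    exact mem_conjSub
  have hKo' : IsOpen (K' : Set (GL (Fin n) F)) := by
    rw [hcoe]
    exact hKo.preimage (by fun_prop)
  have hset : (t * ·) '' (K : Set (GL (Fin n) F)) = (· * t) '' (K' : Set (GL (Fin n) F)) := by
    ext x
    rw [Set.image_mul_left, Set.image_mul_right, Set.mem_preimage, Set.mem_preimage, hcoe,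
      Set.mem_preimage]
    simp [mul_assoc]
  have hLo : IsOpen ((K ⊓ K' : Subgroup _) : Set (GL (Fin n) F)) := hKo.inter hKo'
  -- This is where dominance enters: conjugation by the torus shrinks the integral unipotent group.
  have hN : unipotent n F ⊓ K' ≤ K ⊓ K' := fun x hx =>
    ⟨(PlaceData.conj_intUnipotent_le hl ((PlaceData.mem_conj_intUnipotent_iff l).mpr hx)).2, hx.2⟩
  have hsym : (K ⊓ K').relIndex K' = (K ⊓ K').relIndex K := by
    rw [Subgroup.inf_relIndex_right, Subgroup.inf_relIndex_left]
    exact relIndex_conj_intGL O _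
  have hfin : (K ⊓ K').relIndex K ≠ 0 :=
    (finiteIndex_subgroupOf (isCompact_intGL hO') hLo).index_ne_zero
  have h1 := measure_mul_relIndex hμ inf_le_left hKo hLo hfin
  have h2 := measure_mul_relIndex hμ inf_le_right hKo' hLo (hsym ▸ hfin)
  rw [Subgroup.relIndex_eq_one.mpr hN, Nat.cast_one, one_mul, hsym, ← h1] at h2
  rw [hset, measure_image_mul hμ t hKo', h2]
  congr 2
  rw [PlaceData.uniIndex, ← Subgroup.inf_relIndex_right (K ⊓ K'), ← Subgroup.inf_relIndex_right (conjSub _ _)]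
  congr 1
  ext x
  have := PlaceData.mem_conj_intUnipotent_iff (P := P) l (u := x)
  simp only [Subgroup.mem_inf, intUnipotent] at this ⊢
  tauto

namespace PlaceData

theorem antitone_indZ_Iic (k : Fin n) : Antitone (indZ (Finset.Iic k)) := by
  intro i j hij
  simp only [indZ, Finset.mem_Iic]
  split_ifs <;> omega

theorem crossings_Iic (k : Fin n) :
    crossings (Finset.Iic k) = (Finset.Iic k).card * (n - (Finset.Iic k).card) := by
  rw [show n - (Finset.Iic k).card = (Finset.Iic k)ᶜ.card by rw [Finset.card_compl, Fintype.card_fin],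
    ← Finset.card_product, Finset.card_eq_sum_ones, Finset.sum_product, crossings]
  simp only [← Finset.sum_filter, Finset.filter_and]
  rw [← Finset.sum_subset (Finset.subset_univ (Finset.Iic k))]
  · refine Finset.sum_congr rfl fun a ha => ?_
    rw [Finset.mem_Iic] at ha
    congr 1
    ext b
    simp only [Finset.mem_inter, Finset.mem_filter, Finset.mem_univ, true_and, Finset.mem_Iic,
      Finset.mem_compl]
    exact ⟨fun h => h.2.1, fun h => ⟨ha, h, by omega⟩⟩
  · intro a _ ha
    rw [Finset.mem_Iic] at ha
    simp [ha]

theorem uniIndex_mul_modHalf_sq_single (j : J) (k : Fin n) :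
    (P.uniIndex (Pi.single j (indZ (Finset.Iic k))) : ℂ) *
      P.modHalf (Pi.single j (indZ (Finset.Iic k))) ^ 2 = 1 := by
  have h := P.modHalf_single j (Finset.Iic k)
  have hr := P.rootCard_ne_zero j
  rw [← crossings_Iic, ← rootCard_sq] at h
  rw [uniIndex_single j _ (antitone_indZ_Iic k), Nat.cast_pow, ← rootCard_sq]
  rw [← pow_mul, two_mul, pow_add] at *
  have h0 := pow_ne_zero (crossings (Finset.Iic k)) hr
  have h1 : P.rootCard j ^ crossings (Finset.Iic k) * P.modHalf (Pi.single j (indZ (Finset.Iic k))) = 1 :=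
    mul_left_cancel₀ h0 (by rw [← mul_assoc, h, mul_one])
  rw [show ∀ a b : ℂ, a * a * b ^ 2 = (a * b) ^ 2 by intros; ring, h1, one_pow]

/-- Both factors are multiplicative on dominant weights, so the identity need only be checked on the
fundamental weights, which generate. -/
theorem uniIndex_mul_modHalf_sq (m : Fin n → ℕ) (j : J) :
    (P.uniIndex (Pi.single j fun i => (domWeight m i : ℤ)) : ℂ) *
      P.modHalf (Pi.single j fun i => (domWeight m i : ℤ)) ^ 2 = 1 := by
  let S : AddSubmonoid (J → Fin n → ℤ) :=
    { carrier := {l | (∀ j, Antitone (l j)) ∧ (P.uniIndex l : ℂ) * P.modHalf l ^ 2 = 1}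
      zero_mem' := ⟨fun _ _ _ _ => le_rfl, by simp [uniIndex_zero, modHalf_zero]⟩
      add_mem' := by
        rintro l l' ⟨h1, h2⟩ ⟨h1', h2'⟩
        refine ⟨fun j => (h1 j).add (h1' j), ?_⟩
        rw [uniIndex_add h1 h1', modHalf_add, Nat.cast_mul, mul_pow, mul_mul_mul_comm, h2, h2', one_mul] }
  have hk : ∀ k : Fin n, Pi.single j (indZ (Finset.Iic k)) ∈ S := fun k => by
    refine ⟨fun i => ?_, uniIndex_mul_modHalf_sq_single P j k⟩
    by_cases h : i = j
    · subst h
      rw [Pi.single_eq_same]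
      exact antitone_indZ_Iic k
    · rw [Pi.single_eq_of_ne h]
      exact fun _ _ _ => le_rfl
  have h := S.sum_mem (t := Finset.univ) fun k _ => S.nsmul_mem (hk k) (m k)
  have he : (Pi.single j fun i => (domWeight m i : ℤ) : J → Fin n → ℤ) =
      ∑ k, m k • Pi.single j (indZ (Finset.Iic k)) := by
    funext i a
    rw [Finset.sum_apply, Finset.sum_apply]
    by_cases h : i = j
    · subst h
      simp [domWeight, indZ]
    · simp [h]
  rw [he]
  exact h.2

end PlaceData

end TorusVolume

end AsaiZeta

namespace AsaiZeta

/-! ### Coordinates on dominant nonnegative weights. -/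

section DominantWeights

open Finset

variable {n : ℕ}

theorem antitone_domWeight (m : Fin n → ℕ) : Antitone (domWeight m) := by
  intro i j hij
  refine sum_le_sum fun k _ => ?_
  split_ifs <;> omega

/-- The coordinates are recovered from the last one backwards, as successive differences. -/
theorem domWeight_injective : Function.Injective (domWeight (n := n)) := by
  intro m m' h
  have hrec : ∀ (m : Fin n → ℕ) i, domWeight m i = m i + ∑ k, if i < k then m k else 0 := by
    intro m i
    rw [domWeight, ← add_sum_erase _ _ (mem_univ i), ← add_sum_erase (a := i) _ (fun k => if i < k then m k else 0) (mem_univ i)]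
    simp only [le_refl, if_true, lt_irrefl, if_false, zero_add]
    congr 1
    refine sum_congr rfl fun k hk => ?_
    have := ne_of_mem_erase hk
    split_ifs <;> first | rfl | (exfalso; omega)
  have key : ∀ d : ℕ, ∀ i : Fin n, n - i = d → m i = m' i := by
    intro d
    induction d using Nat.strong_induction_on with
    | _ d ih =>
      intro i hi
      have h1 := congrFun h i
      rw [hrec, hrec] at h1
      have : (∑ k, if i < k then m k else 0) = ∑ k, if i < k then m' k else 0 := by
        refine sum_congr rfl fun k _ => ?_
        split_ifs with hk
        · exact ih (n - k) (by omega) k rfl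
        · rfl
      omega
  exact funext fun i => key _ i rfl

theorem exists_domWeight : ∀ {n : ℕ} {l : Fin n → ℤ}, Antitone l → (∀ i, 0 ≤ l i) →
    ∃ m : Fin n → ℕ, l = fun i => (domWeight m i : ℤ)
  | 0, l, _, _ => ⟨0, funext fun i => i.elim0⟩
  | n + 1, l, hl, h0 => by
    obtain ⟨m, hm⟩ := exists_domWeight (l := fun i : Fin n => l i.castSucc - l (Fin.last n))
      (fun i j hij => sub_le_sub_right (hl (Fin.castSucc_le_castSucc_iff.mpr hij)) _)
      (fun i => sub_nonneg.mpr (hl (Fin.le_last _)))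
    refine ⟨Fin.snoc m (l (Fin.last n)).toNat, funext fun i => ?_⟩
    have ht := Int.toNat_of_nonneg (h0 (Fin.last n))
    refine Fin.lastCases ?_ (fun i => ?_) i
    · rw [domWeight_snoc_last, ht]
    · rw [domWeight_snoc_castSucc, Nat.cast_add, ht]
      have : l i.castSucc - l (Fin.last n) = _ := congrFun hm i
      omega

end DominantWeights

namespace PlaceData

open Matrix

variable {E : Type*} [CommRing E] {O : Subring E} {J : Type*} [Fintype J] [DecidableEq J] {n : ℕ}
  {P : PlaceData E O J}

/-- The cells `N ϖ^l K` are disjoint, because an upper triangular element of `K` has diagonal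
entries of valuation zero. -/
theorem torus_eq_of_mul_eq {l l' : J → Fin n → ℤ} {u k k' : GL (Fin n) E} (hu : u ∈ unipotent n E)
    (hk : k ∈ intGL O n) (hk' : k' ∈ intGL O n) (h : P.torus l' * k' = u * (P.torus l * k)) :
    l = l' := by
  have hb : (P.torus l')⁻¹ * (u * P.torus l) = k' * k⁻¹ := by
    rw [inv_mul_eq_iff_eq_mul, ← mul_assoc, h]
    group
  set b : borelGL n E := ⟨P.torus l', diagGL_mem_borelGL _⟩⁻¹ *
    (⟨u, unipotent_le_borelGL hu⟩ * ⟨P.torus l, diagGL_mem_borelGL _⟩) with hbdef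
  have hbm : b.1 ∈ intGL O n := by
    rw [show b.1 = (P.torus l')⁻¹ * (u * P.torus l) from rfl, hb]
    exact mul_mem hk' (inv_mem hk)
  funext j i
  have h1 := P.ord_borelDiag_of_mem hbm i j
  rw [hbdef, map_mul, map_mul, map_inv, borelDiag_unipotent hu, one_mul, P.borelDiag_torus,
    P.borelDiag_torus, Pi.mul_apply, Pi.inv_apply, P.ord_mul, P.ord_inv, ord_prod_unif,
    ord_prod_unif] at h1
  omega

end PlaceData

/-! ### Unfolding the zeta integral. -/

section ZetaSeries

open Matrix MeasureTheory UnipotentQuotient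

variable {F : Type*} [Field F] [ValuativeRel F] [TopologicalSpace F] [IsNonarchimedeanLocalField F]
  {n : ℕ}

open Classical in
theorem charIntegers_eq (v : Fin n → F) :
    charIntegers n F v = if ∀ i, v i ∈ 𝒪[F] then 1 else 0 := by
  rw [charIntegers, Set.indicator_apply]
  rfl

theorem charIntegers_mul_mem (v : Fin n → F) {k : GL (Fin n) F} (hk : k ∈ intGL 𝒪[F] n) :
    charIntegers n F (v ᵥ* (k : Matrix (Fin n) (Fin n) F)) = charIntegers n F v := by
  have h : ∀ v : Fin n → F, ∀ k ∈ intGL 𝒪[F] n, (∀ i, v i ∈ 𝒪[F]) →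
      ∀ i, (v ᵥ* (k : Matrix (Fin n) (Fin n) F)) i ∈ 𝒪[F] := fun v k hk hv i =>
    𝒪[F].sum_mem (t := Finset.univ) fun j _ => mul_mem (hv j) (hk.1 j i)
  have hiff : (∀ i, (v ᵥ* (k : Matrix (Fin n) (Fin n) F)) i ∈ 𝒪[F]) ↔ ∀ i, v i ∈ 𝒪[F] := by
    refine ⟨fun hv => ?_, h v k hk⟩
    have := h _ k⁻¹ (inv_mem hk) hv
    rwa [vecMul_vecMul, ← Units.val_mul, mul_inv_cancel, Units.val_one, vecMul_one] at this
  by_cases h' : ∀ i, v i ∈ 𝒪[F]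
  · rw [charIntegers_eq, charIntegers_eq, if_pos h', if_pos (hiff.mpr h')]
  · rw [charIntegers_eq, charIntegers_eq, if_neg h', if_neg (mt hiff.mp h')]

theorem charIntegers_torus (hn : 1 ≤ n) (l : Fin n → ℤ) :
    charIntegers n F (lastVec n F ᵥ* ((basePlace F).torus fun _ => l : GL (Fin n) F).1) =
      if 0 ≤ l ⟨n - 1, by omega⟩ then 1 else 0 := by
  have hv : ∀ i, (lastVec n F ᵥ* ((basePlace F).torus fun _ => l : GL (Fin n) F).1) i =
      if i.val + 1 = n then ((unifF F ^ l i : Fˣ) : F) else 0 := by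
    intro i
    have : ((basePlace F).torus fun _ => l : GL (Fin n) F).1 =
      Matrix.diagonal fun i => ((unifF F ^ l i : Fˣ) : F) := by
      rw [PlaceData.torus, torusOf]
      simp only [Finset.univ_unique, Finset.prod_singleton]
      rfl
    rw [this, vecMul_diagonal, lastVec]
    split_ifs <;> simp
  have hm : ∀ k : ℤ, ((unifF F ^ k : Fˣ) : F) ∈ 𝒪[F] ↔ 0 ≤ k := by
    intro k
    have := (basePlace F).mem_iff (unifF F ^ k)
    rw [this]
    have h1 : ∀ j, (basePlace F).ord j (unifF F ^ k) = k := fun j => by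
      rw [PlaceData.ord_zpow]
      exact (congrArg _ ord_unifF).trans (mul_one k)
    simp [h1]
  have hiff : (∀ i, (lastVec n F ᵥ* ((basePlace F).torus fun _ => l : GL (Fin n) F).1) i ∈ 𝒪[F]) ↔
      0 ≤ l ⟨n - 1, by omega⟩ := by
    simp only [hv]
    constructor
    · intro h
      have := h ⟨n - 1, by omega⟩
      rwa [if_pos (by simp; omega), hm] at this
    · intro h i
      split_ifs with hi
      · rw [hm]
        rwa [show i = ⟨n - 1, by omega⟩ from Fin.ext (by simp; omega)]
      · exact zero_mem _
  simp only [charIntegers_eq, hiff]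

theorem ord_det_torus_mul (l : Fin n → ℤ) {k : GL (Fin n) F} (hk : k ∈ intGL 𝒪[F] n) :
    ord (((basePlace F).torus (fun _ => l) * k : GL (Fin n) F) : Matrix (Fin n) (Fin n) F).det =
      ∑ i, l i := by
  have h1 := (basePlace F).ord_detU_torus () fun _ => l
  have h2 := (basePlace F).ord_detU_of_mem hk ()
  have h3 := (basePlace F).ord_mul () (PlaceData.detU ((basePlace F).torus fun _ => l)) (PlaceData.detU k)
  rw [h1, h2, add_zero, ← map_mul] at h3
  exact h3

theorem absF_cpow (x : Fˣ) {N : ℕ} (h : ord (x : F) = N) (s : ℂ) :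
    (absF (x : F) : ℂ) ^ s = ((residueCard F : ℂ) ^ (-s)) ^ N := by
  rw [absF_eq, h, _root_.zpow_neg, zpow_natCast, ← inv_pow]
  have hq : (0 : ℝ) < residueCard F := Nat.cast_pos.mpr residueCard_pos
  have hy : ((residueCard F : ℂ) ^ (-s)) = (((residueCard F : ℝ)⁻¹ : ℝ) : ℂ) ^ s := by
    rw [Complex.ofReal_inv, Complex.inv_cpow, Complex.cpow_neg]
    · rfl
    · rw [Complex.arg_ofReal_of_nonneg hq.le]
      exact Real.pi_pos.ne
  rw [hy]
  clear h hy
  induction N with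
  | zero => simp
  | succ N ih =>
    rw [pow_succ, Complex.ofReal_mul, Complex.mul_cpow_ofReal_nonneg (by positivity) (by positivity), ih,
      pow_succ]

variable {E : Type*} [CommRing E] [Algebra F E] {J : Type*} [Fintype J] [DecidableEq J]
  {P : PlaceData E (integers F E).toSubring J} {e : J → ℕ}

/-- The uniformizer of `F` is a product of powers `ϖ_j ^ e_j` times a unit, so a weight of `F` is
multiplied by the ramification indices. -/
theorem exists_map_torus_eq (he : ∀ j, P.ord j (unifMap F E) = e j) (l : Fin n → ℤ) :
    ∃ k ∈ intGL (integers F E).toSubring n,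
      GeneralLinearGroup.map (algebraMap F E) ((basePlace F).torus fun _ => l) =
        P.torus (fun j i => e j * l i) * k := by
  obtain ⟨k, hk, h⟩ := P.diagGL_eq_torus_mul fun i => unifMap F E ^ l i
  refine ⟨k, hk, ?_⟩
  have h1 : (fun j i => P.ord j (unifMap F E ^ l i)) = fun (j : J) (i : Fin n) => (e j * l i : ℤ) := by
    funext j i
    rw [P.ord_zpow, he, mul_comm]
  rw [← h1, ← h, PlaceData.torus, torusOf]
  simp only [Finset.univ_unique, Finset.prod_singleton]
  ext i j
  simp only [GeneralLinearGroup.map_apply]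
  by_cases hij : i = j
  · subst hij
    rw [show (diagGL _ : GL (Fin n) F) i i = _ from Matrix.diagonal_apply_eq _ _,
      show (diagGL _ : GL (Fin n) E) i i = _ from Matrix.diagonal_apply_eq _ _, unifMap, ← map_zpow]
    rfl
  · rw [show (diagGL _ : GL (Fin n) F) i j = _ from Matrix.diagonal_apply_ne _ hij,
      show (diagGL _ : GL (Fin n) E) i j = _ from Matrix.diagonal_apply_ne _ hij, map_zero]

theorem map_mem_intGL {k : GL (Fin n) F} (hk : k ∈ intGL 𝒪[F] n) :
    GeneralLinearGroup.map (algebraMap F E) k ∈ intGL (integers F E).toSubring n := by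
  have h : ∀ a ∈ 𝒪[F], algebraMap F E a ∈ (integers F E).toSubring := fun a ha =>
    isIntegral_algebraMap (A := E) (x := (⟨a, ha⟩ : 𝒪[F]))
  refine ⟨fun i j => h _ (hk.1 i j), fun i j => ?_⟩
  rw [← map_inv]
  exact h _ (hk.2 i j)

/-- Since `∏_j q_j ^ e_j = q_F²` (the degree formula), `δ_E^(1/2)` restricts to `δ_F`. This makes
the modulus cancel against the volume of the cell. -/
theorem modHalf_eq_sq (hcard : ∏ j, (P.res j).card ^ e j = residueCard F ^ 2) (l : Fin n → ℤ) :
    P.modHalf (fun j i => e j * l i) = (basePlace F).modHalf (fun _ => l) ^ 2 := by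
  have h1 : ∏ j, P.rootCard j ^ e j = (basePlace F).rootCard () ^ 2 := by
    have hF : ((basePlace F).res ()).card = residueCard F := card_resF
    rw [PlaceData.rootCard_sq, hF]
    simp only [PlaceData.rootCard, ← Complex.ofReal_pow]
    rw [← Complex.ofReal_prod, ← Complex.ofReal_natCast, Complex.ofReal_inj,
      ← sq_eq_sq₀ (by positivity) (by positivity), ← Finset.prod_pow]
    simp only [← pow_mul, mul_comm _ 2]
    simp only [pow_mul, Real.sq_sqrt (Nat.cast_nonneg _)]
    exact_mod_cast hcard
  have hF : (basePlace F).modHalf (fun _ => l) =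
      ∏ i : Fin n, (basePlace F).rootCard () ^ (-((n : ℤ) - 1 - 2 * i) * l i) := by
    rw [PlaceData.modHalf, Fintype.prod_unique]
  rw [hF, PlaceData.modHalf, Finset.prod_comm, ← Finset.prod_pow]
  refine Finset.prod_congr rfl fun i _ => ?_
  have h2 : ∀ z : ℤ, ∏ j, P.rootCard j ^ (z * (e j * l i)) =
      (∏ j, P.rootCard j ^ e j) ^ (z * l i) := fun z => by
    rw [← Finset.prod_zpow]
    refine Finset.prod_congr rfl fun j _ => ?_
    rw [← zpow_natCast, ← _root_.zpow_mul]
    congr 1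
    ring
  rw [h2, h1, ← zpow_natCast, ← zpow_natCast, ← _root_.zpow_mul, ← _root_.zpow_mul, mul_comm]

theorem integers_self_toSubring : (integers F F).toSubring = 𝒪[F] :=
  SetLike.ext fun _ => mem_integers_self

variable {ψ : AddChar E Circle} {V : Type*} [AddCommGroup V] [Module ℂ V]
  {π : Representation ℂ (GL (Fin n) E) V} {W : GL (Fin n) E → ℂ}
  {μ : Measure (UnipotentQuotient n F)}

/-- The zeta integral as a sum over dominant weights. -/
theorem zetaIntegral_eq (hn : 1 ≤ n) (hcard : ∏ j, (P.res j).card ^ e j = residueCard F ^ 2)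
    (he : ∀ j, P.ord j (unifMap F E) = e j) (he0 : ∃ j, 0 < e j)
    (hψF : ∀ x : F, ψ (algebraMap F E x) = 1) (hψ : IsUnramifiedAddChar F ψ)
    (hWm : W ∈ whittakerModel π ψ) (hW : PlaceData.IsSphericalWhittaker (integers F E).toSubring ψ W)
    (hW1 : W 1 = 1) {α : J → Fin n → ℂ}
    (hα : ∀ j k, 1 ≤ k → k ≤ n → ∀ g, ∑ x ∈ P.cosetIndex n j k, W (g * P.cosetRep j x) =
      P.rootCard j ^ (k * (n - k)) * esym (α j) k * W g)
    (hμ : IsInvariantMeasure μ) {s S : ℂ}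
    (hS : HasSum (fun m : Fin n → ℕ => (∏ j, schur (α j) fun i => e j * domWeight m i) *
      ((residueCard F : ℂ) ^ (-s)) ^ (∑ i, domWeight m i)) S) :
    Integrable (zetaIntegrandQuot W (charIntegers n F) s) μ ∧
      zetaIntegral μ W (charIntegers n F) s = volIntegral μ * S := by
  set K := intGL 𝒪[F] n with hK
  set f := zetaIntegrandQuot W (charIntegers n F) s with hf
  set T : (Fin n → ℤ) → GL (Fin n) F := fun l => (basePlace F).torus fun _ => l with hT
  set A : (Fin n → ℕ) → Set (UnipotentQuotient n F) := fun m =>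
    mk '' ((T (fun i => domWeight m i) * ·) '' (K : Set (GL (Fin n) F))) with hA
  have hKo : IsOpen (K : Set (GL (Fin n) F)) := isOpen_intGL isOpen_integer
  have hfm : ∀ g, f (mk g) = zetaIntegrand W (charIntegers n F) s g := fun g =>
    zetaIntegrandQuot_mk π ψ hψF W hWm _ s g
  have hAo : ∀ m, IsOpen (A m) := fun m =>
    isOpenMap_mk _ ((Homeomorph.mulLeft _).isOpenMap _ hKo)
  -- the values of the integrand
  have hval : ∀ l k, k ∈ K → f (mk (T l * k)) = W (P.torus fun j i => e j * l i) *
      (if 0 ≤ l ⟨n - 1, by omega⟩ then 1 else 0) *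
      (absF ((T l * k : GL (Fin n) F) : Matrix (Fin n) (Fin n) F).det : ℂ) ^ s := by
    intro l k hk
    obtain ⟨κ, hκ, h⟩ := exists_map_torus_eq he l
    rw [hfm, zetaIntegrand, map_mul, hT, h, mul_assoc (P.torus _), hW.mul_mem _ _
      (mul_mem hκ (map_mem_intGL hk)), Units.val_mul, ← vecMul_vecMul, charIntegers_mul_mem _ hk,
      charIntegers_torus hn]
  have hdom : ∀ m k, k ∈ K → f (mk (T (fun i => domWeight m i) * k)) =
      (basePlace F).modHalf (fun _ i => (domWeight m i : ℤ)) ^ 2 *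
      ((∏ j, schur (α j) fun i => e j * domWeight m i) *
      ((residueCard F : ℂ) ^ (-s)) ^ (∑ i, domWeight m i)) := by
    intro m k hk
    have h1 := hW.apply_torus_eq (P := P) hψ hW1 hα (l := fun j i => e j * domWeight m i)
      fun j => (antitone_domWeight m).const_mul' _
    have h2 := absF_cpow (PlaceData.detU (T (fun i => domWeight m i) * k))
      (N := ∑ i, domWeight m i) ((ord_det_torus_mul _ hk).trans (by push_cast; rfl)) s
    rw [hval _ _ hk, if_pos (Int.natCast_nonneg _), mul_one]
    push_cast at h1
    rw [h1, modHalf_eq_sq hcard, mul_assoc]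
    congr 2
  -- Outside the cells of dominant nonnegative weights, either `W` vanishes or `φ` does. A weight
  -- that is not dominant stays so over `E` because some ramification index is positive.
  have hzero : ∀ x, x ∉ ⋃ m, A m → f x = 0 := by
    intro x hx
    obtain ⟨g, rfl⟩ := Quotient.exists_rep x
    change f (mk g) = 0
    change mk g ∉ _ at hx
    obtain ⟨u, hu, l, k, hk, rfl⟩ := (basePlace F).exists_iwasawa g
    have hg : mk (u * (basePlace F).torus l * k) = mk (T (l ()) * k) :=
      mk_eq_mk.mpr ⟨u⁻¹, inv_mem hu, by rw [mul_assoc, inv_mul_cancel_left]⟩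
    rw [hg] at hx ⊢
    rw [hval _ _ hk]
    by_cases hl : Antitone (l ())
    · rw [if_neg, mul_zero, zero_mul]
      intro h0
      obtain ⟨m, hm⟩ := exists_domWeight hl fun i =>
        h0.trans (hl (Fin.le_def.mpr (Nat.le_sub_one_of_lt i.2)))
      exact hx (Set.mem_iUnion.mpr ⟨m, _, ⟨k, hk, rfl⟩, by rw [hm]⟩)
    · rw [hW.apply_torus_eq_zero (P := P) hψ, zero_mul, zero_mul]
      intro h
      obtain ⟨j, hj⟩ := he0
      refine hl fun a b hab => ?_
      have := h j hab
      simp only at this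
      exact le_of_mul_le_mul_left this (Nat.cast_pos.mpr hj)
  have hdisj : Pairwise (Function.onFun Disjoint A) := by
    intro m m' hmm
    refine Set.disjoint_left.mpr ?_
    rintro _ ⟨_, ⟨k, hk, rfl⟩, rfl⟩ ⟨_, ⟨k', hk', rfl⟩, he⟩
    refine hmm (domWeight_injective ?_)
    obtain ⟨u, hu, h⟩ := mk_eq_mk.mp he
    have h1 := PlaceData.torus_eq_of_mul_eq hu hk' hk h
    funext i
    have h2 := congrFun (congrFun h1 ()) i
    exact_mod_cast h2.symm
  have hvol : volIntegral μ = μ.real (mk '' (K : Set (GL (Fin n) F))) := by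
    rw [volIntegral, integralGL_eq_intGL, integers_self_toSubring]
  -- The volume of the cell cancels the modulus in the value of `W`.
  have hμA : ∀ m, (μ.real (A m) : ℂ) * (basePlace F).modHalf (fun _ i => (domWeight m i : ℤ)) ^ 2 =
      volIntegral μ := by
    intro m
    have h1 := PlaceData.uniIndex_mul_modHalf_sq (basePlace F) m ()
    have h2 : (Pi.single () fun i => (domWeight m i : ℤ) : Unit → Fin n → ℤ) =
        fun _ i => (domWeight m i : ℤ) := funext fun _ => Pi.single_eq_same _ _
    rw [h2] at h1
    have h3 := measure_torus (basePlace F) hμ isOpen_integer isCompact_integer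
      (l := fun _ i => (domWeight m i : ℤ)) fun _ a b hab => Nat.cast_le.mpr (antitone_domWeight m hab)
    rw [hvol, measureReal_def, hA, h3, ENNReal.toReal_mul, ENNReal.toReal_natCast]
    push_cast
    rw [mul_right_comm, h1, one_mul]
    rfl
  have hAfin : ∀ m, μ (A m) < ⊤ := fun m => hμ.finite_on_compacts _
    (((isCompact_intGL isCompact_integer).image (continuous_const_mul _)).image continuous_mk)
  have heq : ∀ m, Set.EqOn f (fun _ => (basePlace F).modHalf (fun _ i => (domWeight m i : ℤ)) ^ 2 *
      ((∏ j, schur (α j) fun i => e j * domWeight m i) *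
      ((residueCard F : ℂ) ^ (-s)) ^ (∑ i, domWeight m i))) (A m) := by
    rintro m _ ⟨_, ⟨k, hk, rfl⟩, rfl⟩
    exact hdom m k hk
  have hint : ∀ m, IntegrableOn f (A m) μ := fun m =>
    (integrableOn_const (hAfin m).ne).congr_fun (heq m).symm (hAo m).measurableSet
  have hintA : ∀ m, ∫ x in A m, f x ∂μ = volIntegral μ *
      ((∏ j, schur (α j) fun i => e j * domWeight m i) *
      ((residueCard F : ℂ) ^ (-s)) ^ (∑ i, domWeight m i)) := by
    intro m
    rw [setIntegral_congr_fun (hAo m).measurableSet (heq m), setIntegral_const, Complex.real_smul,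
      ← mul_assoc, hμA]
  have hnorm : ∀ m, ∫ x in A m, ‖f x‖ ∂μ = ‖(volIntegral μ : ℂ) *
      ((∏ j, schur (α j) fun i => e j * domWeight m i) *
      ((residueCard F : ℂ) ^ (-s)) ^ (∑ i, domWeight m i))‖ := by
    intro m
    rw [setIntegral_congr_fun (hAo m).measurableSet fun x hx => congrArg norm (heq m hx),
      setIntegral_const, ← hμA m, mul_assoc, norm_mul (μ.real (A m) : ℂ), Complex.norm_real,
      Real.norm_of_nonneg measureReal_nonneg]
    rfl
  have hsum := hS.mul_left (volIntegral μ : ℂ)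
  -- The integrand is constant on each cell, so the integrals of its norm are the norms of the terms
  -- of a convergent complex series, hence summable.
  have hU : IntegrableOn f (⋃ m, A m) μ :=
    integrableOn_iUnion_of_summable_integral_norm hint (by simpa only [hnorm] using hsum.summable.norm)
  refine ⟨(integrableOn_iff_integrable_of_support_subset fun x hx => ?_).mp hU, ?_⟩
  · by_contra h
    exact hx (hzero x h)
  · rw [zetaIntegral, ← setIntegral_eq_integral_of_forall_compl_eq_zero hzero]
    have := hasSum_integral_iUnion (fun m => (hAo m).measurableSet) hdisj hU
    simp only [hintA] at this
    exact this.unique hsum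

end ZetaSeries

end AsaiZeta

namespace AsaiZeta

/-! ### Artin factors of diagonalizable representations. -/

section ArtinFactor

variable {F : Type*} [Field F] [ValuativeRel F] [TopologicalSpace F] [IsNonarchimedeanLocalField F]

/-- In an eigenbasis the inertia invariants are spanned by the basis vectors on which inertia acts
trivially, and the determinant is that of a diagonal matrix. -/
theorem artinL_eq_prod {κ M : Type*} [Fintype κ] [AddCommGroup M] [Module ℂ M]
    {ρ : Representation ℂ (weilGroup F) M} (b : Module.Basis κ ℂ M) {χ : weilGroup F → κ → ℂ}
    (hχ : ∀ g k, ρ g (b k) = χ g k • b k) {S : Finset κ}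
    (hS : ∀ k, k ∈ S ↔ ∀ g ∈ inertia F, χ g k = 1) {c : κ → ℂ}
    (hc : ∀ Φ, weilDeg F Φ = Multiplicative.ofAdd 1 → ∀ k ∈ S, χ Φ k = c k)
    (hex : ∃ Φ, weilDeg F Φ = Multiplicative.ofAdd 1) (s : ℂ) :
    artinL ρ s = ∏ k ∈ S, (1 - c k * (residueCard F : ℂ) ^ (-s))⁻¹ := by
  have hrepr : ∀ g x k, b.repr (ρ g x) k = χ g k * b.repr x k := by
    intro g x k
    conv_lhs => rw [← b.sum_repr x]
    simp only [map_sum, map_smul, hχ, Finsupp.coe_finsetSum, Finset.sum_apply, Finsupp.smul_apply,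
      Module.Basis.repr_self, smul_eq_mul]
    classical
    rw [Finset.sum_eq_single k]
    · rw [Finsupp.single_eq_same]; ring
    · intro i _ hi
      rw [Finsupp.single_eq_of_ne hi.symm]; ring
    · simp
  let I := Representation.invariants (ρ.comp (inertia F).subtype)
  have hmem : ∀ k ∈ S, b k ∈ I := by
    rintro k hk ⟨g, hg⟩
    change ρ g (b k) = b k
    rw [hχ, (hS k).1 hk g hg, one_smul]
  have hzero : ∀ x ∈ I, ∀ k ∉ S, b.repr x k = 0 := by
    intro x hx k hk
    rw [hS] at hk
    push Not at hk
    obtain ⟨g, hg, hne⟩ := hk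
    have h1 : ρ g x = x := hx ⟨g, hg⟩
    have h2 := hrepr g x k
    rw [h1] at h2
    by_contra h0
    exact hne (mul_right_cancel₀ h0 (by rw [one_mul]; exact h2.symm))
  let v : S → I := fun k => ⟨b k, hmem k k.2⟩
  have hli : LinearIndependent ℂ v :=
    LinearIndependent.of_comp I.subtype (b.linearIndependent.comp _ Subtype.val_injective)
  have hsp : ⊤ ≤ Submodule.span ℂ (Set.range v) := by
    rintro ⟨x, hx⟩ -
    have : (⟨x, hx⟩ : I) = ∑ k : S, b.repr x k • v k := by
      refine Subtype.ext ?_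
      simp only [AddSubmonoidClass.coe_finsetSum, SetLike.val_smul]
      conv_lhs => rw [← b.sum_repr x]
      rw [Finset.univ_eq_attach, Finset.sum_attach S fun k => b.repr x k • b k]
      refine (Finset.sum_subset (Finset.subset_univ S) fun k _ hk => ?_).symm
      rw [hzero x hx k hk, zero_smul]
    rw [this]
    exact Submodule.sum_mem _ fun k _ => Submodule.smul_mem _ _ (Submodule.subset_span ⟨k, rfl⟩)
  let B : Module.Basis S ℂ I := Module.Basis.mk hli hsp
  have hB : ∀ k, B k = v k := fun k => Module.Basis.mk_apply hli hsp k
  classical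
  rw [artinL]
  have hΦ := Classical.epsilon_spec hex
  set Φ := Classical.epsilon fun Φ : weilGroup F => weilDeg F Φ = Multiplicative.ofAdd 1
  have hmat : LinearMap.toMatrix B B (1 - ((residueCard F : ℂ) ^ (-s)) •
      ρ.toInvariants (inertia F) Φ) =
      Matrix.diagonal fun k : S => 1 - c k * (residueCard F : ℂ) ^ (-s) := by
    have hBΦ : ∀ k, ρ.toInvariants (inertia F) Φ (B k) = c k • B k := by
      intro k
      rw [hB]
      refine Subtype.ext ?_
      change ρ Φ (b k) = c k • b k
      rw [hχ, hc Φ hΦ k k.2]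
    ext i j
    rw [LinearMap.toMatrix_apply, LinearMap.sub_apply, LinearMap.smul_apply, hBΦ, smul_smul,
      Module.End.one_apply, map_sub, map_smul, B.repr_self]
    by_cases h : i = j
    · subst h
      simp [mul_comm]
    · simp [h, Finsupp.single_eq_of_ne h]
  rw [← LinearMap.det_toMatrix B, hmat, Matrix.det_diagonal, Finset.univ_eq_attach,
    Finset.prod_attach S fun k => 1 - c k * (residueCard F : ℂ) ^ (-s), Finset.prod_inv_distrib]

theorem unramRep_single {n : ℕ} (z : Fin n → ℂˣ) (g : weilGroup F) (i : Fin n) :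
    unramRep z g (Pi.single i 1) =
      ((z i ^ (weilDeg F g).toAdd : ℂˣ) : ℂ) • (Pi.single i 1 : Fin n → ℂ) := by
  funext k
  change ((z k ^ (weilDeg F g).toAdd : ℂˣ) : ℂ) * (Pi.single i 1 : Fin n → ℂ) k = _
  by_cases h : k = i
  · subst h; simp
  · simp [h]

theorem weilDeg_eq_one_of_mem {g : weilGroup F} (hg : g ∈ inertia F) : weilDeg F g = 1 := hg

/-- The standard basis of `ℂⁿ ⊗ ℂⁿ`. -/
def tensorBasis (n : ℕ) : Module.Basis (Fin n × Fin n) ℂ ((Fin n → ℂ) ⊗[ℂ] (Fin n → ℂ)) :=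
  (Pi.basisFun ℂ (Fin n)).tensorProduct (Pi.basisFun ℂ (Fin n))

theorem tensorBasis_apply {n : ℕ} (k : Fin n × Fin n) :
    tensorBasis n k = (Pi.single k.1 1 : Fin n → ℂ) ⊗ₜ[ℂ] (Pi.single k.2 1 : Fin n → ℂ) := by
  rw [tensorBasis, Module.Basis.tensorProduct_apply, Pi.basisFun_apply, Pi.basisFun_apply]

theorem artinL_tprod (hex : ∃ Φ, weilDeg F Φ = Multiplicative.ofAdd 1) {n : ℕ}
    (z z' : Fin n → ℂˣ) (s : ℂ) :
    artinL ((unramRep (F := F) z).tprod (unramRep (F := F) z')) s =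
      ∏ i, ∏ j, (1 - (z i : ℂ) * z' j * (residueCard F : ℂ) ^ (-s))⁻¹ := by
  rw [artinL_eq_prod (tensorBasis n)
    (χ := fun g k => ((z k.1 ^ (weilDeg F g).toAdd : ℂˣ) : ℂ) * (z' k.2 ^ (weilDeg F g).toAdd : ℂˣ))
    (c := fun k => (z k.1 : ℂ) * z' k.2) (S := Finset.univ) ?_ ?_ ?_ hex]
  · rw [← Finset.univ_product_univ, Finset.prod_product]
  · intro g k
    rw [tensorBasis_apply, Representation.tprod_apply, TensorProduct.map_tmul, unramRep_single,
      unramRep_single, TensorProduct.smul_tmul_smul]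
  · intro k
    simp only [Finset.mem_univ, true_iff]
    intro g hg
    simp [weilDeg_eq_one_of_mem hg]
  · intro Φ hΦ k _
    simp [hΦ]

end ArtinFactor

end AsaiZeta

namespace AsaiZeta

/-! ### Diagonalization of the Asai representation. -/

section AsaiFactor

variable {F : Type*} [Field F] [ValuativeRel F] [TopologicalSpace F] [IsNonarchimedeanLocalField F]

theorem extendRep_unramRep_single {H : Subgroup (weilGroup F)} {n : ℕ} (z : Fin n → ℂˣ)
    {g : weilGroup F} (hg : g ∈ H) (i : Fin n) :
    extendRep H ((unramRep z).comp H.subtype) g (Pi.single i 1) =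
      ((z i ^ (weilDeg F g).toAdd : ℂˣ) : ℂ) • (Pi.single i 1 : Fin n → ℂ) := by
  rw [extendRep, dif_pos hg]
  exact unramRep_single z g i

/-- The sign that separates symmetric from alternating tensors. -/
def asaiSign {n : ℕ} (k : Fin n × Fin n) : ℂ := if k.1 ≤ k.2 then 1 else -1

theorem asaiSign_mul_self {n : ℕ} (k : Fin n × Fin n) : asaiSign k * asaiSign k = 1 := by
  unfold asaiSign; split_ifs <;> norm_num

theorem asaiSign_swap {n : ℕ} {i j : Fin n} (h : i ≠ j) : asaiSign (j, i) = -asaiSign (i, j) := by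
  unfold asaiSign
  rcases lt_or_gt_of_ne h with h | h
  · rw [if_neg (by simpa using h), if_pos (by simpa using h.le)]
  · rw [if_pos (by simpa using h.le), if_neg (by simpa using h), neg_neg]

/-- An eigenvector of the Asai representation of a sum of characters. -/
def asaiVec {n : ℕ} (y : Fin n → ℂˣ) (k : Fin n × Fin n) : (Fin n → ℂ) ⊗[ℂ] (Fin n → ℂ) :=
  tensorBasis n k + (asaiSign k * (y k.1 * (y k.2)⁻¹ : ℂˣ)) • tensorBasis n (k.2, k.1)

/-- For `i ≠ j` the vectors of `(i, j)` and `(j, i)` carry opposite signs, so they are independent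
combinations of the two basis tensors; for `i = j` the vector is twice the basis tensor. -/
theorem top_le_span_asaiVec {n : ℕ} (y : Fin n → ℂˣ) :
    ⊤ ≤ Submodule.span ℂ (Set.range (asaiVec y)) := by
  rw [← (tensorBasis n).span_eq, Submodule.span_le]
  rintro _ ⟨⟨i, j⟩, rfl⟩
  have hmem : ∀ k, asaiVec y k ∈ Submodule.span ℂ (Set.range (asaiVec y)) := fun k =>
    Submodule.subset_span ⟨k, rfl⟩
  by_cases h : i = j
  · subst h
    have : tensorBasis n (i, i) = (2⁻¹ : ℂ) • asaiVec y (i, i) := by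
      simp only [asaiVec, asaiSign, le_refl, if_true, mul_inv_cancel, Units.val_one, one_smul,
        mul_one, ← two_smul ℂ (tensorBasis n (i, i)), smul_smul]
      norm_num
    rw [this]
    exact Submodule.smul_mem _ _ (hmem _)
  · have : tensorBasis n (i, j) = (2⁻¹ : ℂ) • (asaiVec y (i, j) -
        (asaiSign (i, j) * (y i * (y j)⁻¹ : ℂˣ)) • asaiVec y (j, i)) := by
      have h1 : asaiSign (i, j) * ((y i * (y j)⁻¹ : ℂˣ) : ℂ) *
          (-asaiSign (i, j) * ((y j * (y i)⁻¹ : ℂˣ) : ℂ)) = -1 := by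
        rw [mul_mul_mul_comm, ← Units.val_mul, show y i * (y j)⁻¹ * (y j * (y i)⁻¹) = 1 by group,
          Units.val_one, mul_neg, asaiSign_mul_self]
        ring
      simp only [asaiVec, smul_add, smul_smul, asaiSign_swap h, h1]
      module
    rw [this]
    exact Submodule.smul_mem _ _ (Submodule.sub_mem _ (hmem _) (Submodule.smul_mem _ _ (hmem _)))

/-- The basis of eigenvectors of the Asai representation of a sum of characters. -/
def asaiBasis {n : ℕ} (y : Fin n → ℂˣ) :
    Module.Basis (Fin n × Fin n) ℂ ((Fin n → ℂ) ⊗[ℂ] (Fin n → ℂ)) :=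
  basisOfTopLeSpanOfCardEqFinrank (asaiVec y) (top_le_span_asaiVec y)
    (Module.finrank_eq_card_basis (tensorBasis n)).symm

theorem asaiBasis_apply {n : ℕ} (y : Fin n → ℂˣ) (k : Fin n × Fin n) :
    asaiBasis y k = asaiVec y k := by
  rw [asaiBasis, coe_basisOfTopLeSpanOfCardEqFinrank]

open Classical in
-- Elements of `H` act on `e_i ⊗ e_j` by the product of two characters of the degree; conjugation by
-- `w` does not change the degree. Elements outside also swap the factors and introduce the ratio
-- `(z_i / z_j) ^ deg w`. The coefficient in `asaiVec` is chosen to absorb this ratio, leaving only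
-- the sign.
theorem asaiRep_asaiVec {H : Subgroup (weilGroup F)} {w : weilGroup F}
    (hw : ∀ g, Xor (g * w ∈ H) (g ∈ H)) {n : ℕ} (z : Fin n → ℂˣ) (g : weilGroup F)
    (k : Fin n × Fin n) :
    asaiRep H ((unramRep z).comp H.subtype) w hw g
        (asaiVec (fun i => z i ^ (weilDeg F w).toAdd) k) =
      ((((z k.1 * z k.2) ^ (weilDeg F g).toAdd : ℂˣ) : ℂ) * (if g ∈ H then 1 else asaiSign k)) •
        asaiVec (fun i => z i ^ (weilDeg F w).toAdd) k := by
  have hin : ∀ g, g ∉ H → g * w⁻¹ ∈ H := fun g hg => by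
    have := hw (g * w⁻¹)
    rw [inv_mul_cancel_right] at this
    exact this.elim (fun h => absurd h.1 hg) (fun h => h.1)
  have hw0 : w ∉ H := fun h => by
    have := hw 1
    rw [one_mul] at this
    exact this.elim (fun h' => h'.2 H.one_mem) (fun h' => h'.2 h)
  have hin' : ∀ g, g ∉ H → w * g ∈ H := fun g hg => by
    have h1 : g⁻¹ * w⁻¹ ∈ H := hin _ (fun h => hg (by simpa using H.inv_mem h))
    simpa using H.inv_mem h1
  have hconj : ∀ g ∈ H, w * g * w⁻¹ ∈ H := fun g hg =>
    hin _ fun h => hw0 (by simpa using H.mul_mem h (H.inv_mem hg))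
  obtain ⟨i, j⟩ := k
  by_cases hg : g ∈ H
  · have h1 : ∀ i j, asaiRep H ((unramRep z).comp H.subtype) w hw g (tensorBasis n (i, j)) =
        (((z i * z j) ^ (weilDeg F g).toAdd : ℂˣ) : ℂ) • tensorBasis n (i, j) := by
      intro i j
      have : asaiRep H ((unramRep z).comp H.subtype) w hw g =
          TensorProduct.map (extendRep H ((unramRep z).comp H.subtype) g)
            (extendRep H ((unramRep z).comp H.subtype) (w * g * w⁻¹)) := if_pos hg
      rw [this, tensorBasis_apply, TensorProduct.map_tmul, extendRep_unramRep_single z hg,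
        extendRep_unramRep_single z (hconj g hg), TensorProduct.smul_tmul_smul,
        (weilDeg F).map_mul, (weilDeg F).map_mul, (weilDeg F).map_inv, mul_right_comm,
        mul_inv_cancel, one_mul, mul_zpow, Units.val_mul]
    simp only [asaiVec, map_add, map_smul, h1, if_pos hg, smul_add, smul_smul]
    rw [mul_comm (z j) (z i)]
    congr 2 <;> ring
  · have h1 : ∀ i j, asaiRep H ((unramRep z).comp H.subtype) w hw g (tensorBasis n (i, j)) =
        (((z i * z j) ^ (weilDeg F g).toAdd *
          (z i ^ (weilDeg F w).toAdd * (z j ^ (weilDeg F w).toAdd)⁻¹) : ℂˣ) : ℂ) •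
          tensorBasis n (j, i) := by
      intro i j
      have : asaiRep H ((unramRep z).comp H.subtype) w hw g =
          TensorProduct.map (extendRep H ((unramRep z).comp H.subtype) (g * w⁻¹))
            (extendRep H ((unramRep z).comp H.subtype) (w * g)) ∘ₗ
            (TensorProduct.comm ℂ (Fin n → ℂ) (Fin n → ℂ)).toLinearMap := if_neg hg
      rw [this, LinearMap.comp_apply, tensorBasis_apply, LinearEquiv.coe_coe,
        TensorProduct.comm_tmul, TensorProduct.map_tmul, extendRep_unramRep_single z (hin g hg),
        extendRep_unramRep_single z (hin' g hg), TensorProduct.smul_tmul_smul,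
        (weilDeg F).map_mul, (weilDeg F).map_mul, (weilDeg F).map_inv, tensorBasis_apply,
        ← Units.val_mul]
      congr 2
      simp only [toAdd_mul, toAdd_inv, zpow_add, zpow_neg, mul_zpow]
      simp only [mul_comm, mul_left_comm, mul_assoc]
    simp only [asaiVec, map_add, map_smul, h1, if_neg hg, smul_add, smul_smul]
    have h2 : ((z i * z j) ^ (weilDeg F g).toAdd *
          (z i ^ (weilDeg F w).toAdd * (z j ^ (weilDeg F w).toAdd)⁻¹) : ℂˣ).1 =
        ((z i * z j) ^ (weilDeg F g).toAdd : ℂˣ) * asaiSign (i, j) *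
          (asaiSign (i, j) * (z i ^ (weilDeg F w).toAdd * (z j ^ (weilDeg F w).toAdd)⁻¹ : ℂˣ)) := by
      rw [mul_assoc, ← mul_assoc (asaiSign _), asaiSign_mul_self, one_mul, Units.val_mul]
    rw [h2, add_comm]
    congr 2
    rw [mul_assoc, ← Units.val_mul, mul_comm (z j) (z i), show
      z i ^ (weilDeg F w).toAdd * (z j ^ (weilDeg F w).toAdd)⁻¹ * ((z i * z j) ^ (weilDeg F g).toAdd *
        (z j ^ (weilDeg F w).toAdd * (z i ^ (weilDeg F w).toAdd)⁻¹)) =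
        (z i * z j) ^ (weilDeg F g).toAdd by rw [mul_left_comm]; group]
    ring

/-- The Asai factor when inertia lies in `H` and elements of degree one do not. -/
theorem artinL_asaiRep_unramified (hex : ∃ Φ, weilDeg F Φ = Multiplicative.ofAdd 1)
    {H : Subgroup (weilGroup F)} {w : weilGroup F} (hw : ∀ g, Xor (g * w ∈ H) (g ∈ H))
    (hI : inertia F ≤ H) (hΦ : ∀ Φ, weilDeg F Φ = Multiplicative.ofAdd 1 → Φ ∉ H) {n : ℕ}
    (z : Fin n → ℂˣ) (s : ℂ) :
    artinL (asaiRep H ((unramRep z).comp H.subtype) w hw) s =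
      ∏ k : Fin n × Fin n, (1 - asaiSign k * (z k.1 * z k.2) * (residueCard F : ℂ) ^ (-s))⁻¹ := by
  classical
  refine artinL_eq_prod (asaiBasis fun i => z i ^ (weilDeg F w).toAdd)
    (fun g k => by rw [asaiBasis_apply]; exact asaiRep_asaiVec hw z g k)
    (S := Finset.univ) (fun k => ?_) (fun Φ h k _ => ?_) hex s
  · simp only [Finset.mem_univ, true_iff]
    intro g hg
    rw [weilDeg_eq_one_of_mem hg, if_pos (hI hg)]
    simp
  · rw [h, if_neg (hΦ Φ h), toAdd_ofAdd, zpow_one, Units.val_mul, mul_comm]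

/-- The Asai factor when inertia does not lie in `H`. -/
theorem artinL_asaiRep_ramified (hex : ∃ Φ, weilDeg F Φ = Multiplicative.ofAdd 1)
    {H : Subgroup (weilGroup F)} {w : weilGroup F} (hw : ∀ g, Xor (g * w ∈ H) (g ∈ H))
    (hI : ¬ inertia F ≤ H) {n : ℕ} (z : Fin n → ℂˣ) (s : ℂ) :
    artinL (asaiRep H ((unramRep z).comp H.subtype) w hw) s =
      ∏ k : Fin n × Fin n with k.1 ≤ k.2, (1 - z k.1 * z k.2 * (residueCard F : ℂ) ^ (-s))⁻¹ := by
  classical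
  refine artinL_eq_prod (asaiBasis fun i => z i ^ (weilDeg F w).toAdd)
    (fun g k => by rw [asaiBasis_apply]; exact asaiRep_asaiVec hw z g k)
    (fun k => ?_) (fun Φ h k hk => ?_) hex s
  · obtain ⟨τ, hτ, hτH⟩ := SetLike.not_le_iff_exists.1 hI
    rw [Finset.mem_filter_univ]
    refine ⟨fun hk g hg => ?_, fun h => ?_⟩
    · rw [weilDeg_eq_one_of_mem hg, asaiSign, if_pos hk, ite_self]
      simp
    · have := h τ hτ
      rw [weilDeg_eq_one_of_mem hτ, if_neg hτH, asaiSign] at this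
      by_contra hk
      rw [if_neg hk] at this
      norm_num at this
  · rw [Finset.mem_filter_univ] at hk
    rw [h, asaiSign, if_pos hk, ite_self, toAdd_ofAdd, zpow_one, Units.val_mul, mul_one]

end AsaiFactor

/-! ### Products over pairs of parameters. -/

section Products

theorem pairProd_eq_prod {n : ℕ} (f : ℂ → ℂ → ℂ) (x : Fin n → ℂ) :
    pairProd f x = ∏ k : Fin n × Fin n with k.1 < k.2, f (x k.1) (x k.2) := by
  rw [pairProd, Finset.prod_filter, ← Finset.univ_product_univ, Finset.prod_product]

theorem prod_le_eq {n : ℕ} (g : Fin n × Fin n → ℂ) :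
    ∏ k : Fin n × Fin n with k.1 ≤ k.2, g k =
      (∏ i, g (i, i)) * ∏ k : Fin n × Fin n with k.1 < k.2, g k := by
  simp only [Finset.prod_filter, ← Finset.univ_product_univ, Finset.prod_product,
    ← Finset.prod_mul_distrib]
  refine Finset.prod_congr rfl fun i _ => ?_
  rw [← Fintype.prod_ite_eq i fun j => g (i, j), ← Finset.prod_mul_distrib]
  refine Finset.prod_congr rfl fun j _ => ?_
  rcases lt_trichotomy i j with h | h | h
  · simp [h, h.le, h.ne]
  · simp [h]
  · simp [h.not_ge, h.not_gt, h.ne']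

theorem prod_eq_prod_diag_mul {n : ℕ} (g : Fin n × Fin n → ℂ) :
    ∏ k, g k = (∏ i, g (i, i)) * ∏ k : Fin n × Fin n with k.1 < k.2, g k * g (k.2, k.1) := by
  rw [← Finset.prod_filter_mul_prod_filter_not Finset.univ (fun k => k.1 ≤ k.2), prod_le_eq,
    Finset.prod_mul_distrib, mul_assoc]
  congr 2
  refine Finset.prod_bij' (fun k _ => (k.2, k.1)) (fun k _ => (k.2, k.1)) ?_ ?_ ?_ ?_ ?_ <;> simp

/-- The two factors of an unordered pair combine to `(1 - z_i z_j X)(1 + z_i z_j X) = 1 - z_i² z_j²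
X²`. -/
theorem prod_asaiSign_eq {n : ℕ} (z : Fin n → ℂ) (X : ℂ) :
    ∏ k : Fin n × Fin n, (1 - asaiSign k * (z k.1 * z k.2) * X)⁻¹ =
      (∏ i, (1 - z i ^ 2 * X)⁻¹) * pairProd (fun a b => (1 - a * b * X ^ 2)⁻¹) fun i => z i ^ 2 := by
  rw [prod_eq_prod_diag_mul, pairProd_eq_prod]
  congr 1
  · simp [asaiSign, sq]
  · refine Finset.prod_congr rfl fun k hk => ?_
    rw [Finset.mem_filter_univ] at hk
    rw [← mul_inv]
    congr 1
    simp only [asaiSign, if_pos hk.le, if_neg hk.not_ge]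
    ring

theorem prod_le_asai_eq {n : ℕ} (z : Fin n → ℂ) (X : ℂ) :
    ∏ k : Fin n × Fin n with k.1 ≤ k.2, (1 - z k.1 * z k.2 * X)⁻¹ =
      (∏ i, (1 - z i * z i * X)⁻¹) * pairProd (fun a b => (1 - a * b * X)⁻¹) z := by
  rw [prod_le_eq, pairProd_eq_prod]

/-- A product over pairs does not depend on the order of the parameters. -/
theorem pairProd_comp_perm {n : ℕ} {f : ℂ → ℂ → ℂ} (hf : ∀ a b, f a b = f b a) (x : Fin n → ℂ)
    (σ : Equiv.Perm (Fin n)) : pairProd f (x ∘ σ) = pairProd f x := by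
  rw [pairProd_eq_prod, pairProd_eq_prod]
  refine Finset.prod_bij'
    (fun k _ => if σ k.1 < σ k.2 then (σ k.1, σ k.2) else (σ k.2, σ k.1))
    (fun k _ => if σ.symm k.1 < σ.symm k.2 then (σ.symm k.1, σ.symm k.2) else
      (σ.symm k.2, σ.symm k.1)) ?_ ?_ ?_ ?_ ?_
  all_goals
    rintro ⟨i, j⟩ hk
    simp only [Finset.mem_filter_univ] at hk ⊢
  · have := σ.injective.ne hk.ne
    split_ifs with h
    · exact h
    · exact lt_of_le_of_ne (not_lt.1 h) this.symm
  · have := σ.symm.injective.ne hk.ne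
    split_ifs with h
    · exact h
    · exact lt_of_le_of_ne (not_lt.1 h) this.symm
  · split_ifs with h h' h' <;> simp_all [lt_asymm]
  · split_ifs with h h' h' <;> simp_all [lt_asymm]
  · split_ifs with h
    · rfl
    · exact hf _ _

end Products

end AsaiZeta

namespace AsaiZeta

/-! ### The residue field of the algebraic closure and the Galois action on it. -/

section ResidueFieldBar

variable (F : Type*) [Field F] [ValuativeRel F] [TopologicalSpace F] [IsNonarchimedeanLocalField F]

theorem isOpen_maximalIdeal : IsOpen ((𝓂[F] : Ideal 𝒪[F]) : Set 𝒪[F]) := by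
  have h : ((𝓂[F] : Ideal 𝒪[F]) : Set 𝒪[F]) =
      (fun x : 𝒪[F] => (unifF F : F)⁻¹ * x) ⁻¹' (𝒪[F] : Set F) := by
    ext x
    rw [SetLike.mem_coe, mem_maximalIdeal_iff, Set.mem_preimage, SetLike.mem_coe]
    constructor
    · rintro ⟨b, hb, hx⟩
      rw [hx, inv_mul_cancel_left₀ (unifF F).ne_zero]
      exact hb
    · exact fun hx => ⟨_, hx, by rw [mul_inv_cancel_left₀ (unifF F).ne_zero]⟩
  rw [h]
  exact isOpen_integer.preimage (continuous_const.mul continuous_subtype_val)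

/-- In a domain that is finite over `𝒪_F`, the powers of an element come close to an idempotent. -/
theorem exists_pow_mem_or_pow_sub_one_mem (C : Type*) [CommRing C] [IsDomain C] [Algebra 𝒪[F] C]
    [Module.Finite 𝒪[F] C] [Module.IsTorsionFree 𝒪[F] C] (x : C) :
    ∃ k : ℕ, x ^ (k + 1) ∈ Ideal.map (algebraMap 𝒪[F] C) 𝓂[F] ∨
      x ^ (k + 1) - 1 ∈ Ideal.map (algebraMap 𝒪[F] C) 𝓂[F] := by
  let b := Module.Free.chooseBasis 𝒪[F] C
  let e : C ≃ₗ[𝒪[F]] (Module.Free.ChooseBasisIndex 𝒪[F] C → 𝒪[F]) := b.equivFun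
  let _ : TopologicalSpace C := moduleTopology 𝒪[F] C
  have : IsModuleTopology 𝒪[F] C := ⟨rfl⟩
  have : ContinuousAdd C := IsModuleTopology.toContinuousAdd 𝒪[F] C
  have he : Continuous e := IsModuleTopology.continuous_of_linearMap e.toLinearMap
  have he' : Continuous e.symm := IsModuleTopology.continuous_of_linearMap e.symm.toLinearMap
  have : T2Space C := T2Space.of_injective_continuous e.injective he
  have : CompactSpace C := by
    refine ⟨?_⟩
    rw [← e.symm.surjective.range_eq]
    exact isCompact_range he'
  have hmul : Continuous (fun p : C × C => p.1 * p.2) :=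
    IsModuleTopology.continuous_mul_of_finite 𝒪[F] C
  have : ContinuousMul C := ⟨hmul⟩
  let U : Set C := {c | ∀ i, e c i ∈ 𝓂[F]}
  have hUo : IsOpen U := by
    rw [show U = ⋂ i, {c | e c i ∈ 𝓂[F]} by ext; simp [U]]
    exact isOpen_iInter_of_finite fun i =>
      (isOpen_maximalIdeal F).preimage ((continuous_apply i).comp he)
  have hU0 : (0 : C) ∈ U := fun i => by simp
  have hU : ∀ c ∈ U, c ∈ Ideal.map (algebraMap 𝒪[F] C) 𝓂[F] := by
    intro c hc
    rw [← b.sum_equivFun c]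
    refine Ideal.sum_mem _ fun i _ => ?_
    rw [Algebra.smul_def]
    exact Ideal.mul_mem_right _ _ (Ideal.mem_map_of_mem _ (hc i))
  -- The closure of the positive powers of `x` is a compact semigroup and contains an idempotent,
  -- which is `0` or `1` in a domain. Some power of `x` then lies in a given neighbourhood of it.
  obtain ⟨m, hm, hmm⟩ := exists_idempotent_in_compact_subsemigroup
    (fun r : C => continuous_mul_const r) (closure (Set.range fun k : ℕ => x ^ (k + 1)))
    ⟨_, subset_closure ⟨0, rfl⟩⟩ isClosed_closure.isCompact (by
      intro y hy z hz
      refine map_mem_closure₂ hmul hy hz ?_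
      rintro _ ⟨k, rfl⟩ _ ⟨l, rfl⟩
      exact ⟨k + l + 1, by rw [← pow_add]; ring_nf⟩)
  have key : ∀ t : C, m - t = 0 → ∃ k : ℕ, x ^ (k + 1) - t ∈ U := by
    intro t ht
    have hc : Continuous fun c : C => c - t := by
      simpa [sub_eq_add_neg] using continuous_add_const (-t)
    have := mem_closure_iff.1 hm _ (hUo.preimage hc) (by simpa [ht] using hU0)
    obtain ⟨_, hy, k, rfl⟩ := this
    exact ⟨k, hy⟩
  rcases (IsIdempotentElem.iff_eq_zero_or_one (p := m)).1 hmm with h | h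
  · obtain ⟨k, hk⟩ := key 0 (by rw [h, sub_zero])
    exact ⟨k, Or.inl (hU _ (by simpa using hk))⟩
  · obtain ⟨k, hk⟩ := key 1 (by rw [h, sub_self])
    exact ⟨k, Or.inr (hU _ hk)⟩

/-- The ring of integers of the algebraic closure. -/
abbrev integersBar : Type _ := integers F (AlgebraicClosure F)

theorem algebraMap_integersBar_injective :
    Function.Injective (algebraMap 𝒪[F] (integersBar F)) := by
  intro a b h
  have : algebraMap F (AlgebraicClosure F) a = algebraMap F (AlgebraicClosure F) b :=
    congrArg Subtype.val h
  exact Subtype.ext ((algebraMap F (AlgebraicClosure F)).injective this)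

instance : Module.IsTorsionFree 𝒪[F] (integersBar F) :=
  Module.isTorsionFree_iff_algebraMap_injective.2 (algebraMap_integersBar_injective F)

/-- Apply the preceding dichotomy to the finite algebra generated by `x`; the nilpotent alternative
is excluded because `maxIdealBar` is radical. -/
theorem exists_pow_sub_one_mem_maxIdealBar {x : integersBar F} (hx : x ∉ maxIdealBar F) :
    ∃ k : ℕ, x ^ (k + 1) - 1 ∈ maxIdealBar F := by
  let C := Algebra.adjoin 𝒪[F] {x}
  have hfin : Module.Finite 𝒪[F] C :=
    Module.Finite.iff_fg.2 (IsIntegral.fg_adjoin_singleton (Algebra.IsIntegral.isIntegral x))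
  obtain ⟨k, hk⟩ := exists_pow_mem_or_pow_sub_one_mem F C ⟨x, Algebra.self_mem_adjoin_singleton _ x⟩
  have hmap : ∀ c : C, c ∈ Ideal.map (algebraMap 𝒪[F] C) 𝓂[F] → (c : integersBar F) ∈
      maxIdealBar F := by
    intro c hc
    refine Ideal.le_radical ?_
    have := Ideal.mem_map_of_mem (C.val : C →+* integersBar F) hc
    rwa [Ideal.map_map, AlgHom.comp_algebraMap] at this
  rcases hk with hk | hk
  · refine absurd ?_ hx
    have := hmap _ hk
    exact (Ideal.radical_isRadical _) ⟨k + 1, this⟩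
  · exact ⟨k, hmap _ hk⟩

/-- Lying over: some prime of the integral extension contracts to the maximal ideal of `𝒪_F`. -/
theorem maxIdealBar_ne_top : maxIdealBar F ≠ ⊤ := by
  rw [maxIdealBar, Ne, Ideal.radical_eq_top]
  have : (algebraMap 𝒪[F] (integersBar F)).IsIntegral := fun x => Algebra.IsIntegral.isIntegral x
  obtain ⟨Q, hQ, hQ'⟩ := Ideal.exists_ideal_over_maximal_of_isIntegral
    (S := integersBar F) 𝓂[F] (by rw [(RingHom.injective_iff_ker_eq_bot _).1 (algebraMap_integersBar_injective F)]; exact bot_le)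
  intro h
  have h1 : Ideal.map (algebraMap 𝒪[F] (integersBar F)) 𝓂[F] ≤ Q := by
    rw [Ideal.map_le_iff_le_comap, hQ']
  rw [h, top_le_iff] at h1
  exact hQ.ne_top h1

/-- Every element outside has a power congruent to `1`, so it is a unit modulo the ideal. -/
instance isMaximal_maxIdealBar : (maxIdealBar F).IsMaximal := by
  rw [Ideal.isMaximal_iff]
  refine ⟨(Ideal.ne_top_iff_one _).1 (maxIdealBar_ne_top F), fun J x hJ hx hxJ => ?_⟩
  obtain ⟨k, hk⟩ := exists_pow_sub_one_mem_maxIdealBar F hx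
  have := J.sub_mem (J.mul_mem_left (x ^ k) hxJ) (hJ hk)
  rwa [← pow_succ, sub_sub_cancel] at this

instance liesOver_maxIdealBar : (maxIdealBar F).LiesOver 𝓂[F] := by
  refine ⟨?_⟩
  have hle : 𝓂[F] ≤ (maxIdealBar F).under 𝒪[F] := fun a ha =>
    Ideal.le_radical (Ideal.mem_map_of_mem _ ha)
  exact (IsLocalRing.maximalIdeal.isMaximal 𝒪[F]).eq_of_le
    (Ideal.comap_ne_top _ (maxIdealBar_ne_top F)) hle

/-- The Galois action on the ring of integers of the algebraic closure. -/
instance galoisAction :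
    MulSemiringAction (AlgebraicClosure F ≃ₐ[F] AlgebraicClosure F) (integersBar F) where
  smul σ x := ⟨σ x, by
    obtain ⟨y, hy⟩ := exists_integers_apply F σ x
    exact hy ▸ y.2⟩
  one_smul _ := rfl
  mul_smul _ _ _ := rfl
  smul_zero σ := Subtype.ext (map_zero σ)
  smul_add σ _ _ := Subtype.ext (map_add σ _ _)
  smul_one σ := Subtype.ext (map_one σ)
  smul_mul σ _ _ := Subtype.ext (map_mul σ _ _)

variable {F}

theorem coe_galois_smul (σ : AlgebraicClosure F ≃ₐ[F] AlgebraicClosure F) (x : integersBar F) :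
    ((σ • x : integersBar F) : AlgebraicClosure F) = σ x := rfl

theorem galois_smul_algebraMap (σ : AlgebraicClosure F ≃ₐ[F] AlgebraicClosure F) (a : 𝒪[F]) :
    σ • algebraMap 𝒪[F] (integersBar F) a = algebraMap 𝒪[F] (integersBar F) a :=
  Subtype.ext (σ.commutes a)

instance : SMulCommClass (AlgebraicClosure F ≃ₐ[F] AlgebraicClosure F) 𝒪[F] (integersBar F) where
  smul_comm σ a x := by
    rw [Algebra.smul_def, Algebra.smul_def, smul_mul', galois_smul_algebraMap]

instance isGalois_algebraicClosure [CharZero F] : IsGalois F (AlgebraicClosure F) where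

theorem mem_maxIdealBar_smul (σ : AlgebraicClosure F ≃ₐ[F] AlgebraicClosure F) {x : integersBar F}
    (hx : x ∈ maxIdealBar F) : σ • x ∈ maxIdealBar F := by
  obtain ⟨m, hm⟩ := hx
  refine ⟨m, ?_⟩
  have h := Ideal.mem_map_of_mem (MulSemiringAction.toRingHom _ (integersBar F) σ) hm
  rw [Ideal.map_map, show (MulSemiringAction.toRingHom _ (integersBar F) σ).comp
    (algebraMap 𝒪[F] (integersBar F)) = algebraMap 𝒪[F] (integersBar F) from
      RingHom.ext (galois_smul_algebraMap σ), map_pow] at h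
  exact h

end ResidueFieldBar

end AsaiZeta

namespace AsaiZeta

/-! ### Lifting automorphisms of the residue field. -/

section Frobenius

variable (F : Type*) [Field F] [ValuativeRel F] [TopologicalSpace F] [IsNonarchimedeanLocalField F]

/-- The residue field of the algebraic closure. -/
abbrev residueBar : Type _ := integersBar F ⧸ maxIdealBar F

instance : Field (residueBar F) := Ideal.Quotient.field _

instance : Field (𝒪[F] ⧸ 𝓂[F]) := Ideal.Quotient.field _

instance : Finite (𝒪[F] ⧸ 𝓂[F]) := inferInstanceAs (Finite 𝓀[F])

instance : Fintype (𝒪[F] ⧸ 𝓂[F]) := Fintype.ofFinite _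

theorem card_residue : Fintype.card (𝒪[F] ⧸ 𝓂[F]) = residueCard F := by
  rw [← Nat.card_eq_fintype_card]
  rfl

instance : Algebra.IsAlgebraic (𝒪[F] ⧸ 𝓂[F]) (residueBar F) := by
  have : Algebra.IsIntegral 𝒪[F] (integersBar F) := inferInstance
  have : Algebra.IsIntegral (𝒪[F] ⧸ 𝓂[F]) (residueBar F) := by
    refine ⟨fun x => ?_⟩
    obtain ⟨x, rfl⟩ := Ideal.Quotient.mk_surjective x
    obtain ⟨f, hf, hx⟩ := Algebra.IsIntegral.isIntegral (R := 𝒪[F]) x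
    refine ⟨f.map (Ideal.Quotient.mk 𝓂[F]), hf.map _, ?_⟩
    rw [Polynomial.eval₂_map, show (algebraMap (𝒪[F] ⧸ 𝓂[F]) (residueBar F)).comp
      (Ideal.Quotient.mk 𝓂[F]) = (Ideal.Quotient.mk (maxIdealBar F)).comp
        (algebraMap 𝒪[F] (integersBar F)) from rfl, ← Polynomial.hom_eval₂, hx, map_zero]
  exact Algebra.IsIntegral.isAlgebraic

/-- The Frobenius automorphism of the residue field of the algebraic closure. -/
def frobBar : residueBar F ≃+* residueBar F :=
  (FiniteField.frobeniusAlgEquivOfAlgebraic (𝒪[F] ⧸ 𝓂[F]) (residueBar F)).toRingEquiv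

variable {F}

theorem frobBar_apply (x : residueBar F) : frobBar F x = x ^ residueCard F := by
  rw [← card_residue]
  exact congrFun (FiniteField.coe_frobeniusAlgEquivOfAlgebraic _ _) x

theorem frobBar_mk_algebraMap (a : 𝒪[F]) :
    frobBar F (Ideal.Quotient.mk (maxIdealBar F) (algebraMap 𝒪[F] (integersBar F) a)) =
      Ideal.Quotient.mk (maxIdealBar F) (algebraMap 𝒪[F] (integersBar F) a) :=
  (FiniteField.frobeniusAlgEquivOfAlgebraic (𝒪[F] ⧸ 𝓂[F]) (residueBar F)).commutes
    (Ideal.Quotient.mk 𝓂[F] a)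

theorem pow_residueCard_pow_injective (a : ℕ) :
    Function.Injective fun x : residueBar F => x ^ residueCard F ^ a := by
  induction a with
  | zero => intro x y; simp
  | succ a ih =>
    intro x y h
    simp only [pow_succ, pow_mul, ← frobBar_apply] at h
    exact ih ((frobBar F).injective h)

theorem mk_pow_residueCard (a : 𝒪[F]) :
    (Ideal.Quotient.mk (maxIdealBar F) (algebraMap 𝒪[F] (integersBar F) a)) ^ residueCard F =
      Ideal.Quotient.mk (maxIdealBar F) (algebraMap 𝒪[F] (integersBar F) a) := by
  rw [← frobBar_apply, frobBar_mk_algebraMap]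

theorem IsGeomFrobPow.mk_pow_eq {σ : AlgebraicClosure F ≃ₐ[F] AlgebraicClosure F} {k : ℤ}
    (h : IsGeomFrobPow F σ k) : ∃ a b : ℕ, (b : ℤ) - a = k ∧ ∀ x : integersBar F,
      (Ideal.Quotient.mk (maxIdealBar F) (σ • x)) ^ residueCard F ^ b =
        (Ideal.Quotient.mk (maxIdealBar F) x) ^ residueCard F ^ a := by
  obtain ⟨a, b, hab, h⟩ := h
  refine ⟨a, b, hab, fun x => ?_⟩
  rw [← map_pow, ← map_pow, Ideal.Quotient.eq]
  exact h x (σ • x) rfl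

theorem mk_smul_eq_of_mem_inertia {w : weilGroup F} (hw : w ∈ inertia F) (x : integersBar F) :
    Ideal.Quotient.mk (maxIdealBar F) (w.1.1 • x) = Ideal.Quotient.mk (maxIdealBar F) x := by
  obtain ⟨a, b, hab, h⟩ := IsGeomFrobPow.mk_pow_eq w.2
  have hk : w.1.2 = 1 := hw
  rw [hk, toAdd_one, sub_eq_zero] at hab
  obtain rfl := Int.ofNat_injective hab
  exact pow_residueCard_pow_injective b (h x)

theorem mk_pow_eq_of_weilDeg_eq {w : weilGroup F} (hw : weilDeg F w = Multiplicative.ofAdd 1)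
    {x : integersBar F} (hx : w.1.1 • x = x) :
    Ideal.Quotient.mk (maxIdealBar F) x ^ residueCard F = Ideal.Quotient.mk (maxIdealBar F) x := by
  obtain ⟨a, b, hab, h⟩ := IsGeomFrobPow.mk_pow_eq w.2
  have hk : w.1.2 = Multiplicative.ofAdd 1 := hw
  rw [hk, toAdd_ofAdd] at hab
  obtain rfl : b = a + 1 := by omega
  have := h x
  rw [hx, pow_succ', pow_mul] at this
  exact pow_residueCard_pow_injective a this

/-- The stabilizer of a prime surjects onto the automorphisms of its residue field over that of the
invariants `A`. With the discrete topology on the integers, the profinite group `H` acts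
continuously, since stabilizers of algebraic elements are open. -/
theorem exists_galois_smul_mk_eq {A : Type*} [CommRing A] [Algebra A (integersBar F)]
    [CharZero F] (H : Subgroup (AlgebraicClosure F ≃ₐ[F] AlgebraicClosure F))
    (hH : IsClosed (H : Set (AlgebraicClosure F ≃ₐ[F] AlgebraicClosure F)))
    [SMulCommClass H A (integersBar F)] [Algebra.IsInvariant A (integersBar F) H]
    (φ : residueBar F ≃+* residueBar F)
    (hφ : ∀ a : A, φ (Ideal.Quotient.mk _ (algebraMap A _ a)) =
      Ideal.Quotient.mk _ (algebraMap A _ a)) :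
    ∃ σ ∈ H, ∀ x : integersBar F, (Ideal.Quotient.mk (maxIdealBar F) (σ • x)) =
      φ (Ideal.Quotient.mk (maxIdealBar F) x) := by
  let _ : TopologicalSpace (integersBar F) := ⊥
  have : DiscreteTopology (integersBar F) := ⟨rfl⟩
  have : ContinuousSMul (AlgebraicClosure F ≃ₐ[F] AlgebraicClosure F) (integersBar F) := by
    refine continuousSMul_iff_stabilizer_isOpen.2 fun x => ?_
    convert stabilizer_isOpen_of_isIntegral (K := F) (x : AlgebraicClosure F) using 1
    ext σ
    exact Subtype.ext_iff
  have : CompactSpace H := isCompact_iff_compactSpace.1 hH.isCompact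
  let φ' : residueBar F ≃ₐ[A ⧸ (maxIdealBar F).under A] residueBar F :=
    AlgEquiv.ofRingEquiv (f := φ) fun a => by
      obtain ⟨a, rfl⟩ := Ideal.Quotient.mk_surjective a
      exact hφ a
  obtain ⟨⟨σ, hσ⟩, h⟩ := Ideal.Quotient.stabilizerHom_surjective_of_profinite (G := H)
    ((maxIdealBar F).under A) (maxIdealBar F) φ'
  refine ⟨σ, σ.2, fun x => ?_⟩
  exact congrArg (fun f => f (Ideal.Quotient.mk _ x)) h

theorem mem_integers_of_algebraMap_mem {a : F}
    (h : algebraMap F (AlgebraicClosure F) a ∈ integers F (AlgebraicClosure F)) : a ∈ 𝒪[F] := by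
  rw [← mem_integers_self]
  exact (isIntegral_algHom_iff ((Algebra.ofId F (AlgebraicClosure F)).restrictScalars 𝒪[F])
    (algebraMap F (AlgebraicClosure F)).injective).1 h

/-- Lift the arithmetic Frobenius of the residue field to the absolute Galois group and take the
inverse. -/
theorem exists_weilDeg_eq_one [CharZero F] : ∃ Φ, weilDeg F Φ = Multiplicative.ofAdd 1 := by
  have : Algebra.IsInvariant 𝒪[F] (integersBar F)
      (⊤ : Subgroup (AlgebraicClosure F ≃ₐ[F] AlgebraicClosure F)) := by
    refine ⟨fun b hb => ?_⟩
    obtain ⟨a, ha⟩ := (InfiniteGalois.mem_range_algebraMap_iff_fixed (k := F)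
      (b : AlgebraicClosure F)).2 fun σ => congrArg Subtype.val (hb ⟨σ, trivial⟩)
    exact ⟨⟨a, mem_integers_of_algebraMap_mem (ha ▸ b.2)⟩, Subtype.ext ha⟩
  have : SMulCommClass (⊤ : Subgroup (AlgebraicClosure F ≃ₐ[F] AlgebraicClosure F)) 𝒪[F]
      (integersBar F) := ⟨fun σ a x => smul_comm σ.1 a x⟩
  obtain ⟨σ, -, hσ⟩ := exists_galois_smul_mk_eq (A := 𝒪[F]) ⊤ isClosed_univ
    (frobBar F) frobBar_mk_algebraMap
  refine ⟨⟨(σ⁻¹, Multiplicative.ofAdd 1), 0, 1, by simp, fun x y hy => ?_⟩, rfl⟩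
  have hx : σ • y = x := Subtype.ext (by
    rw [coe_galois_smul, hy]
    exact σ.apply_symm_apply _)
  rw [← Ideal.Quotient.eq, pow_one, pow_zero, pow_one, map_pow, ← frobBar_apply, ← hx]
  exact (hσ y).symm

end Frobenius

/-! ### Inertia and Frobenius relative to a quadratic extension. -/

section Quadratic

/-- A double root of a quadratic polynomial with coefficients fixed by `φ` is fixed by `φ`. -/
theorem map_eq_self_of_double_root {k : Type*} [CommRing k] [IsDomain k] (φ : k →+* k) {u t N : k}
    (h : u ^ 2 - t * u + N = 0) (h1 : t - u = u) (ht : φ t = t) (hN : φ N = N) : φ u = u := by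
  have h4 := congrArg φ h
  simp only [map_add, map_sub, map_mul, map_pow, map_zero, ht, hN] at h4
  obtain rfl := sub_eq_iff_eq_add.1 h1
  -- The transformed equation reads `(φ u - u)² = 0`. Nothing is divided by two, so residue
  -- characteristic two is allowed.
  refine sub_eq_zero.1 (pow_eq_zero_iff two_ne_zero |>.1 ?_)
  linear_combination h4 - h

variable {F : Type*} [Field F] [ValuativeRel F] [TopologicalSpace F] [IsNonarchimedeanLocalField F]
  [CharZero F] {E : Type*} [Field E] [Algebra F E]

omit [CharZero F] in
theorem map_mem_integers {A A' : Type*} [CommRing A] [CommRing A'] [Algebra F A] [Algebra F A']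
    (i : A →ₐ[F] A') {a : A} (ha : a ∈ integers F A) : i a ∈ integers F A' :=
  IsIntegral.map (i.restrictScalars 𝒪[F]) ha

/-- The map from the integers of `E` to those of the algebraic closure. -/
def integersHom (i : E →ₐ[F] AlgebraicClosure F) : integers F E →+* integersBar F where
  toFun a := ⟨i a, map_mem_integers i a.2⟩
  map_one' := Subtype.ext (map_one i)
  map_mul' _ _ := Subtype.ext (map_mul i _ _)
  map_zero' := Subtype.ext (map_zero i)
  map_add' _ _ := Subtype.ext (map_add i _ _)

theorem exists_integersHom_eq (i : E →ₐ[F] AlgebraicClosure F) {x : E} {b : integersBar F}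
    (h : i x = b) : ∃ a, integersHom i a = b :=
  ⟨⟨x, (isIntegral_algHom_iff (i.restrictScalars 𝒪[F]) i.injective).1 (h ▸ b.2)⟩, Subtype.ext h⟩

theorem integersHom_algebraMap (i : E →ₐ[F] AlgebraicClosure F) (a : 𝒪[F]) :
    integersHom i (algebraMap 𝒪[F] (integers F E) a) = algebraMap 𝒪[F] (integersBar F) a :=
  Subtype.ext (i.commutes a)

variable (h2 : Module.finrank F E = 2)
include h2

/-- An element of valuation zero is a unit. One of positive `normOrd` has its square divisible by
the uniformizer of `F`, hence lies in the radical. -/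
theorem integersHom_mem_maxIdealBar (i : E →ₐ[F] AlgebraicClosure F) (x : Eˣ)
    (hx : (x : E) ∈ integers F E) :
    integersHom i ⟨x, hx⟩ ∈ maxIdealBar F ↔ 0 < normOrd F x := by
  have h0 := (mem_integers_iff_normOrd h2 x).1 hx
  constructor
  · intro h
    refine lt_of_le_of_ne h0 fun h1 => maxIdealBar_ne_top F ?_
    have hx' : ((x⁻¹ : Eˣ) : E) ∈ integers F E := by
      rw [← Subalgebra.mem_toSubring, mem_integers_iff_normOrd h2, normOrd_inv, ← h1, neg_zero]
    refine Ideal.eq_top_of_isUnit_mem _ h (IsUnit.map _ (IsUnit.of_mul_eq_one ⟨_, hx'⟩ ?_))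
    exact Subtype.ext x.mul_inv
  · intro h
    have hx' : ((x * x * (unifMap F E)⁻¹ : Eˣ) : E) ∈ integers F E := by
      rw [← Subalgebra.mem_toSubring, mem_integers_iff_normOrd h2, normOrd_mul, normOrd_mul,
        normOrd_inv, unifMap, normOrd_algebraMap h2, ord_unifF]
      omega
    have hϖ : (⟨unifF F, by rw [mem_integer_iff_ord, ord_unifF]; norm_num⟩ : 𝒪[F]) ∈ 𝓂[F] := by
      rw [mem_maximalIdeal_iff]
      exact ⟨1, 𝒪[F].one_mem, (mul_one _).symm⟩
    refine ⟨2, ?_⟩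
    have : (⟨x, hx⟩ : integers F E) ^ 2 = algebraMap 𝒪[F] (integers F E) ⟨unifF F, by
        rw [mem_integer_iff_ord, ord_unifF]; norm_num⟩ * ⟨_, hx'⟩ := by
      refine Subtype.ext ?_
      change (x : E) ^ 2 = ((unifMap F E : Eˣ) : E) * ((x * x * (unifMap F E)⁻¹ : Eˣ) : E)
      rw [← Units.val_mul, mul_comm, inv_mul_cancel_right, Units.val_mul, sq]
    rw [← map_pow, this, map_mul, integersHom_algebraMap]
    exact Ideal.mul_mem_right _ _ (Ideal.mem_map_of_mem _ hϖ)

/-- Inertia moves a ramified quadratic extension. -/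
theorem not_inertia_le_weilSubgroup {ϖ : Eˣ} (hϖ : normOrd F ϖ = 1)
    (i : E →ₐ[F] AlgebraicClosure F) : ¬ inertia F ≤ weilSubgroup i := by
  have hϖO : (ϖ : E) ∈ integers F E := (mem_integers_iff_normOrd h2 ϖ).2 (by omega)
  -- The residue degree is one: integers of `E` are congruent to integers of `F`.
  have hmk : ∀ a : integers F E, ∃ c : 𝒪[F], Ideal.Quotient.mk (maxIdealBar F) (integersHom i a) =
      Ideal.Quotient.mk (maxIdealBar F) (algebraMap 𝒪[F] (integersBar F) c) := by
    rintro ⟨a, ha⟩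
    obtain ⟨x, hx, y, hy, h⟩ := exists_add_mul_of_odd h2 hϖ ha
    refine ⟨⟨x, hx⟩, ?_⟩
    have : (⟨a, ha⟩ : integers F E) = algebraMap 𝒪[F] (integers F E) ⟨x, hx⟩ +
        algebraMap 𝒪[F] (integers F E) ⟨y, hy⟩ * ⟨ϖ, hϖO⟩ := Subtype.ext h
    have h0 : Ideal.Quotient.mk (maxIdealBar F) (integersHom i ⟨ϖ, hϖO⟩) = 0 :=
      Ideal.Quotient.eq_zero_iff_mem.2 ((integersHom_mem_maxIdealBar h2 i ϖ hϖO).2 (by omega))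
    rw [this, map_add, map_mul, map_add, map_mul, h0, mul_zero, add_zero, integersHom_algebraMap]
  have : FiniteDimensional F E := Module.finite_of_finrank_pos (by omega)
  obtain ⟨σ₀, hσ₀⟩ : ∃ σ : AlgebraicClosure F ≃ₐ[F] AlgebraicClosure F, ∃ x, σ (i x) ≠ i x := by
    by_contra! hall
    have htop : ∀ x : E, x ∈ (⊥ : Subalgebra F E) := by
      intro x
      obtain ⟨a, ha⟩ := (InfiniteGalois.mem_range_algebraMap_iff_fixed (k := F) (i x)).2
        fun σ => hall σ x
      exact ⟨a, i.injective ((i.commutes a).trans ha)⟩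
    have : (⊥ : Subalgebra F E) = ⊤ := eq_top_iff.2 fun x _ => htop x
    rw [Subalgebra.bot_eq_top_iff_finrank_eq_one] at this
    omega
  let H : Subgroup (AlgebraicClosure F ≃ₐ[F] AlgebraicClosure F) := i.fieldRange.fixingSubgroup
  let _ : Algebra (integers F E) (integersBar F) := (integersHom i).toAlgebra
  have hHi : ∀ σ ∈ H, ∀ x : E, σ (i x) = i x := fun σ hσ x =>
    (IntermediateField.mem_fixingSubgroup_iff _ _).1 hσ _ ⟨x, rfl⟩
  have : Algebra.IsInvariant (integers F E) (integersBar F) H := by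
    refine ⟨fun b hb => ?_⟩
    have hb' : (b : AlgebraicClosure F) ∈ IntermediateField.fixedField H := fun σ =>
      congrArg Subtype.val (hb σ)
    rw [InfiniteGalois.fixedField_fixingSubgroup] at hb'
    obtain ⟨x, hx⟩ := hb'
    exact exists_integersHom_eq i hx
  have hfix : ∀ (σ : H) (a : integers F E), σ • integersHom i a = integersHom i a := fun σ a =>
    Subtype.ext (hHi σ σ.2 a)
  have : SMulCommClass H (integers F E) (integersBar F) := ⟨fun σ a x => by
    rw [Algebra.smul_def, Algebra.smul_def, smul_mul']
    exact congrArg (· * _) (hfix σ a)⟩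
  have hcomap : maxIdealBar F = Ideal.map
      (MulSemiringAction.toRingEquiv _ (integersBar F) σ₀ : integersBar F →+* integersBar F)
      (maxIdealBar F) := by
    refine le_antisymm (fun x hx => ?_) (Ideal.map_le_iff_le_comap.2 fun x hx =>
      mem_maxIdealBar_smul σ₀ hx)
    have := Ideal.mem_map_of_mem
      (MulSemiringAction.toRingEquiv _ (integersBar F) σ₀ : integersBar F →+* integersBar F)
      (mem_maxIdealBar_smul σ₀⁻¹ hx)
    simpa using this
  -- Take `σ₀` that moves `E`. Its action on the residue field fixes the residues of `E`, as they
  -- come from `F`, so some `h` fixing `E` has the same action. Then `σ₀ h⁻¹` lies in inertia and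
  -- moves `E`.
  obtain ⟨h, hh, hhσ⟩ := exists_galois_smul_mk_eq (A := integers F E) H
    (InfiniteGalois.fixingSubgroup_isClosed _)
    (Ideal.quotientEquiv _ _ (MulSemiringAction.toRingEquiv _ (integersBar F) σ₀) hcomap)
    (fun a => by
      obtain ⟨c, hc⟩ := hmk a
      change Ideal.quotientEquiv _ _ _ hcomap (Ideal.Quotient.mk _ (integersHom i a)) =
        Ideal.Quotient.mk _ (integersHom i a)
      rw [hc]
      exact congrArg (Ideal.Quotient.mk _) (galois_smul_algebraMap σ₀ c))
  have hmem : IsGeomFrobPow F (σ₀ * h⁻¹) 0 := by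
    refine ⟨0, 0, by simp, fun x y hy => ?_⟩
    have h1 := hhσ (h⁻¹ • x)
    rw [smul_inv_smul] at h1
    have h2 : y = σ₀ • h⁻¹ • x := Subtype.ext hy
    rw [← Ideal.Quotient.eq, pow_zero, pow_one, pow_one, h1, h2]
    rfl
  intro hle
  have := hle (show (⟨(σ₀ * h⁻¹, 1), hmem⟩ : weilGroup F) ∈ inertia F from rfl)
  obtain ⟨x, hx⟩ := hσ₀
  refine hx ?_
  have h3 := this x
  change σ₀ (h⁻¹ (i x)) = i x at h3
  rwa [hHi _ (H.inv_mem hh)] at h3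

/-- An unramified quadratic extension has a larger residue field. -/
theorem exists_mk_pow_ne (heven : ∀ x : Eˣ, Even (normOrd F x)) (i : E →ₐ[F] AlgebraicClosure F) :
    ∃ a : integers F E, Ideal.Quotient.mk (maxIdealBar F) (integersHom i a) ^ residueCard F ≠
      Ideal.Quotient.mk (maxIdealBar F) (integersHom i a) := by
  classical
  by_contra! hall
  let P := unramifiedPlace h2 heven
  have hO : ∀ r ∈ P.res (), r ∈ integers F E := P.res_mem ()
  let f : P.res () → residueBar F := fun r =>
    Ideal.Quotient.mk (maxIdealBar F) (integersHom i ⟨r, hO r r.2⟩)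
  have hf : Function.Injective f := by
    rintro ⟨r, hr⟩ ⟨r', hr'⟩ h
    by_contra hne
    have hsub : r - r' ≠ 0 := sub_ne_zero.2 fun h => hne (Subtype.ext h)
    have hsubO : r - r' ∈ integers F E := sub_mem (hO r hr) (hO r' hr')
    have h1 := Ideal.Quotient.eq.1 h
    rw [← map_sub] at h1
    have h3 := (integersHom_mem_maxIdealBar h2 i (Units.mk0 _ hsub) hsubO).1 h1
    obtain ⟨m, hm⟩ := heven (Units.mk0 _ hsub)
    have h4 : ((Units.mk0 _ hsub * (unifMap F E)⁻¹ : Eˣ) : E) ∈ (integers F E).toSubring := by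
      rw [mem_integers_iff_normOrd h2, normOrd_mul, normOrd_inv, unifMap, normOrd_algebraMap h2,
        ord_unifF]
      omega
    refine hne (Subtype.ext (P.res_unique () r hr r' hr' _ h4 ?_))
    change r - r' = (unifMap F E : Eˣ) * _
    rw [← Units.val_mul, mul_comm, inv_mul_cancel_right, Units.val_mk0]
  -- If every residue of `E` were fixed by Frobenius, the `q²` distinct residues would all be roots
  -- of a polynomial of degree `q`.
  let g : Polynomial (residueBar F) := Polynomial.X ^ residueCard F - Polynomial.X
  have hq : 1 < residueCard F := by
    rw [← card_residue]
    exact Fintype.one_lt_card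
  have hdeg : g.natDegree = residueCard F := FiniteField.X_pow_card_sub_X_natDegree_eq _ hq
  have hg : g ≠ 0 := FiniteField.X_pow_card_sub_X_ne_zero _ hq
  have hcard : (Finset.univ.image f).card = residueCard F ^ 2 := by
    rw [Finset.card_image_of_injective _ hf, Finset.card_univ, Fintype.card_coe,
      ← card_unramifiedPlace h2 heven ()]
  have hle : Finset.univ.image f ⊆ g.roots.toFinset := by
    intro u hu
    obtain ⟨r, -, rfl⟩ := Finset.mem_image.1 hu
    rw [Multiset.mem_toFinset, Polynomial.mem_roots hg]
    simp only [g, Polynomial.IsRoot.def, Polynomial.eval_sub, Polynomial.eval_pow,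
      Polynomial.eval_X, sub_eq_zero]
    exact hall _
  have := (Finset.card_le_card hle).trans ((Multiset.toFinset_card_le _).trans g.card_roots')
  rw [hcard, hdeg] at this
  nlinarith

/-- The Galois conjugate of an element of a quadratic extension. -/
theorem galois_apply_eq_or (i : E →ₐ[F] AlgebraicClosure F)
    (σ : AlgebraicClosure F ≃ₐ[F] AlgebraicClosure F) (x : E) :
    σ (i x) = i x ∨ σ (i x) = algebraMap F (AlgebraicClosure F) (Algebra.trace F E x) - i x := by
  have h := congrArg i (sq_sub_trace_mul_add_norm h2 x)
  simp only [map_add, map_sub, map_mul, map_pow, map_zero, AlgHom.commutes] at h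
  have h' := congrArg σ h
  simp only [map_add, map_sub, map_mul, map_pow, map_zero, AlgEquiv.commutes] at h'
  rw [← sub_eq_zero (b := i x), ← sub_eq_zero (b := _ - i x), ← mul_eq_zero]
  linear_combination h' - h

theorem exists_add_mul_of_not_mem {a : E} (ha : a ∉ (⊥ : Subalgebra F E)) (x : E) :
    ∃ c d : F, x = algebraMap F E c + algebraMap F E d * a := by
  have : FiniteDimensional F E := Module.finite_of_finrank_pos (by omega)
  have hli : LinearIndependent F ![(1 : E), a] := by
    rw [LinearIndependent.pair_iff' one_ne_zero]
    exact fun c hc => ha ⟨c, by rw [← hc, Algebra.smul_def, mul_one]; rfl⟩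
  have hsp := hli.span_eq_top_of_card_eq_finrank (by rw [Fintype.card_fin, h2])
  have hx : x ∈ Submodule.span F (Set.range ![(1 : E), a]) := hsp ▸ Submodule.mem_top
  rw [Matrix.range_cons, Matrix.range_cons, Matrix.range_empty, Set.union_empty,
    Set.singleton_union, Submodule.mem_span_pair] at hx
  obtain ⟨c, d, rfl⟩ := hx
  exact ⟨c, d, by rw [Algebra.smul_def, Algebra.smul_def, mul_one]⟩

/-- An integer `a` of `E` whose residue is not fixed by Frobenius generates `E`, and no element of
degree one fixes it. An inertia element that moved `a` would send it to its conjugate with the same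
residue. The residue would then be a double root of a quadratic over the residue field of `F`, hence
fixed by Frobenius. -/
theorem inertia_le_weilSubgroup (heven : ∀ x : Eˣ, Even (normOrd F x))
    (i : E →ₐ[F] AlgebraicClosure F) : inertia F ≤ weilSubgroup i ∧
      ∀ Φ, weilDeg F Φ = Multiplicative.ofAdd 1 → Φ ∉ weilSubgroup i := by
  obtain ⟨a, ha⟩ := exists_mk_pow_ne h2 heven i
  refine ⟨fun τ hτ => ?_, fun Φ hΦ hmem => ha (mk_pow_eq_of_weilDeg_eq hΦ (Subtype.ext (hmem a)))⟩
  have haF : (a : E) ∉ (⊥ : Subalgebra F E) := by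
    rintro ⟨c, hc⟩
    have hc' : c ∈ 𝒪[F] := (algebraMap_mem_integers_iff h2 c).1 (by
      change algebraMap F E c ∈ integers F E
      rw [show algebraMap F E c = a from hc]
      exact a.2)
    rw [show a = algebraMap 𝒪[F] (integers F E) ⟨c, hc'⟩ from Subtype.ext hc.symm,
      integersHom_algebraMap] at ha
    exact ha (mk_pow_residueCard _)
  have : FiniteDimensional F E := Module.finite_of_finrank_pos (by omega)
  have hfix : τ.1.1 (i a) = i a := by
    refine (galois_apply_eq_or h2 i τ.1.1 a).resolve_right fun h => ?_
    have ht : Algebra.trace F E (a : E) ∈ 𝒪[F] := mem_integers_self.1 (Algebra.isIntegral_trace a.2)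
    have hN : Algebra.norm F (a : E) ∈ 𝒪[F] := mem_integers_self.1 (Algebra.isIntegral_norm F a.2)
    have hq := sq_sub_trace_mul_add_norm h2 (a : E)
    have h1 := mk_smul_eq_of_mem_inertia hτ (integersHom i a)
    have h2 : τ.1.1 • integersHom i a = algebraMap 𝒪[F] (integersBar F) ⟨_, ht⟩ - integersHom i a :=
      Subtype.ext h
    have h3 : integersHom i a ^ 2 - algebraMap 𝒪[F] (integersBar F) ⟨_, ht⟩ * integersHom i a +
        algebraMap 𝒪[F] (integersBar F) ⟨_, hN⟩ = 0 := by
      rw [← integersHom_algebraMap i, ← integersHom_algebraMap i, ← map_pow, ← map_mul, ← map_sub,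
        ← map_add, ← map_zero (integersHom i)]
      exact congrArg _ (Subtype.ext hq)
    have h3' := congrArg (Ideal.Quotient.mk (maxIdealBar F)) h3
    rw [h2] at h1
    simp only [map_add, map_sub, map_mul, map_pow, map_zero] at h3' h1
    rw [← frobBar_apply] at ha
    exact ha (map_eq_self_of_double_root (frobBar F : residueBar F →+* residueBar F) h3' h1
      (frobBar_mk_algebraMap _) (frobBar_mk_algebraMap _))
  intro x
  obtain ⟨c, d, rfl⟩ := exists_add_mul_of_not_mem h2 haF x
  change τ.1.1 (i _) = i _
  rw [map_add, map_mul, map_add, map_mul, hfix, AlgHom.commutes, AlgHom.commutes,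
    AlgEquiv.commutes, AlgEquiv.commutes]

end Quadratic

end AsaiZeta

namespace AsaiZeta

/-- The two families are the root multisets of the same polynomial, and a bijection of fibres is a
permutation of indices. -/
theorem exists_perm_of_esym_eq {n : ℕ} {a b : Fin n → ℂ} (h : ∀ k, esym a k = esym b k) :
    ∃ σ : Equiv.Perm (Fin n), a = b ∘ σ := by
  classical
  have hprod : ∀ c : Fin n → ℂ, ((Finset.univ.val.map c).map fun t => Polynomial.X - Polynomial.C t).prod =
      ∑ j ∈ Finset.range (n + 1), (-1) ^ j * (Polynomial.C (esym c j) * Polynomial.X ^ (n - j)) := by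
    intro c
    rw [Multiset.prod_X_sub_X_eq_sum_esymm, Multiset.card_map, Finset.card_val, Finset.card_univ,
      Fintype.card_fin]
    simp only [Finset.esymm_map_val]
    rfl
  have hroots : Finset.univ.val.map a = Finset.univ.val.map b := by
    rw [← Polynomial.roots_multiset_prod_X_sub_C (Finset.univ.val.map a), hprod,
      ← Polynomial.roots_multiset_prod_X_sub_C (Finset.univ.val.map b), hprod]
    simp only [h]
  have hcard : ∀ c, Fintype.card {i // a i = c} = Fintype.card {i // b i = c} := by
    intro c
    have := congrArg (Multiset.count c) hroots
    rw [Multiset.count_map, Multiset.count_map] at this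
    rw [Fintype.card_subtype, Fintype.card_subtype]
    simpa only [Finset.card_def, Finset.filter_val, eq_comm] using this
  refine ⟨Equiv.ofFiberEquiv fun c => Fintype.equivOfCardEq (hcard c), funext fun i => ?_⟩
  exact (Equiv.ofFiberEquiv_map _ i).symm

/-! ### The zeta integral and the Asai factor. -/

section Assembly

open MeasureTheory Matrix PlaceData

variable {F : Type*} [Field F] [ValuativeRel F] [TopologicalSpace F] [IsNonarchimedeanLocalField F]
  [CharZero F]

theorem one_lt_residueCard : 1 < residueCard F := by
  rw [← card_residue]
  exact Fintype.one_lt_card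

/-- This supplies the half-plane: the generating series converges for small `X = q^(-s)`, that is,
for large real part. -/
theorem exists_norm_cpow_lt {ρ : ℝ} (hρ : 0 < ρ) :
    ∃ C : ℝ, ∀ s : ℂ, C < s.re → ‖(residueCard F : ℂ) ^ (-s)‖ < ρ := by
  have hq : (1 : ℝ) < residueCard F := by exact_mod_cast one_lt_residueCard
  refine ⟨-Real.logb (residueCard F) ρ, fun s hs => ?_⟩
  rw [Complex.norm_natCast_cpow_of_pos (zero_lt_one.trans one_lt_residueCard), Complex.neg_re]
  calc (residueCard F : ℝ) ^ (-s.re) < (residueCard F : ℝ) ^ Real.logb (residueCard F) ρ :=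
        Real.rpow_lt_rpow_of_exponent_lt hq (by linarith)
    _ = ρ := Real.rpow_logb (by linarith) hq.ne' hρ

variable {E : Type*} [CommRing E] [Algebra F E] [TopologicalSpace E] {J : Type*} [Fintype J]
  [DecidableEq J] {n : ℕ} {V : Type*} [AddCommGroup V] [Module ℂ V]

/-- The zeta integral is the Asai factor as soon as the generating function of the Schur polynomials
of the Satake parameters is. -/
theorem zetaIntegral_eq_asaiL [IsTopologicalRing E] [T2Space E]
    {P : PlaceData E (integers F E).toSubring J} {e : J → ℕ}
    (habs : ∀ x : Eˣ, absE F (x : E) = ∏ j, ((P.res j).card : ℝ) ^ (-P.ord j x))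
    (hO : IsOpen ((integers F E).toSubring : Set E))
    (hO' : IsCompact ((integers F E).toSubring : Set E))
    (hcard : ∏ j, (P.res j).card ^ e j = residueCard F ^ 2)
    (he : ∀ j, P.ord j (unifMap F E) = e j) (he0 : ∃ j, 0 < e j)
    {Λ : (J → Fin n → ℂ) → ℂ → ℂ}
    (hΛ : ∀ α, ∃ ρ : ℝ, 0 < ρ ∧ ∀ X : ℂ, X ≠ 0 → ‖X‖ < ρ →
      HasSum (fun m : Fin n → ℕ => (∏ j, schur (α j) fun i => e j * domWeight m i) *
        X ^ (∑ i, domWeight m i)) (Λ α X))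
    (hΛσ : ∀ α (σ : J → Equiv.Perm (Fin n)) X, Λ (fun j => α j ∘ σ j) X = Λ α X)
    (hn : 1 ≤ n) {ψ : AddChar E Circle} (hψF : ∀ x : F, ψ (algebraMap F E x) = 1)
    (hψ : IsUnramifiedAddChar F ψ) {π : Representation ℂ (GL (Fin n) E) V}
    (hirr : π.IsIrreducible) (hsm : IsSmooth π)
    (hval : ∀ s L, IsAsaiLValue (F := F) π s L → ∃ (χ : Fin n → (Eˣ →* ℂˣ)) (a : J → Fin n → ℂ),
      (∀ j i, a j i ≠ 0) ∧ (∀ i x, (χ i x : ℂ) = ∏ j, a j i ^ P.ord j x) ∧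
      IsSubquotientOfPrincipalSeries F π χ ∧ L = Λ a ((residueCard F : ℂ) ^ (-s)))
    (hexi : ∀ a : J → Fin n → ℂ, (∀ j i, a j i ≠ 0) → ∃ χ : Fin n → (Eˣ →* ℂˣ),
      (∀ i x, (χ i x : ℂ) = ∏ j, a j i ^ P.ord j x) ∧
      (IsSubquotientOfPrincipalSeries F π χ → ∀ s, ∃ L, IsAsaiLValue (F := F) π s L))
    {W : GL (Fin n) E → ℂ} (hW : W ∈ whittakerModel π ψ)
    (hWK : ∀ k ∈ integralGL F n E, ∀ g, W (g * k) = W g) (hW1 : W 1 = 1)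
    {μ : Measure (UnipotentQuotient n F)} (hμ : IsInvariantMeasure μ) :
    ∃ C : ℝ, ∀ s : ℂ, C < s.re →
      Integrable (zetaIntegrandQuot W (charIntegers n F) s) μ ∧
      zetaIntegral μ W (charIntegers n F) s = (volIntegral μ : ℂ) * asaiL F π s := by
  obtain ⟨ℓ, hℓ0, hℓ, v, hv⟩ := id hW
  have hv0 : v ≠ 0 := by
    rintro rfl
    rw [hv, map_zero, map_zero] at hW1
    exact zero_ne_one hW1
  have hvK : v ∈ fixedVectors π (integers F E).toSubring := by
    intro k hk
    by_contra hne
    -- Invariance of `W` makes `ℓ` vanish on the orbit of `π k v - v`, so `v` itself is fixed.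
    refine hℓ0 (eq_zero_of_forall_apply_orbit hirr (sub_ne_zero.2 hne) fun g => ?_)
    rw [map_sub, map_sub, ← Module.End.mul_apply, ← map_mul, ← hv, ← hv, sub_eq_zero]
    exact hWK k (by rwa [integralGL_eq_intGL]) g
  have hWs : PlaceData.IsSphericalWhittaker (integers F E).toSubring ψ W := by
    rw [show W = fun g => ℓ (π g v) from funext hv]
    exact PlaceData.isSphericalWhittaker hℓ hvK
  obtain ⟨a, ha, hsub⟩ := exists_isSubquotient (P := P) habs hO hO' hirr hsm hψ hℓ0 hℓ hvK hv0
  obtain ⟨χ, hχ, hex⟩ := hexi a ha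
  have hecke := heckeOp_eq_of_isSubquotient (P := P) habs hχ hO' ha (hsub χ hχ) hvK
  obtain ⟨ρ, hρ, hsum⟩ := hΛ a
  obtain ⟨C, hC⟩ := exists_norm_cpow_lt (F := F) hρ
  refine ⟨C, fun s hs => ?_⟩
  have hX0 : (residueCard F : ℂ) ^ (-s) ≠ 0 := by
    rw [Ne, Complex.cpow_eq_zero_iff, not_and_or]
    exact Or.inl (Nat.cast_ne_zero.2 (zero_lt_one.trans one_lt_residueCard).ne')
  -- The value chosen in `asaiL` comes from some principal series with subquotient `π`. Its Hecke
  -- eigenvalues on `v` agree with those of `a`, so its parameters are a permutation of `a`, and `Λ`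
  -- is symmetric.
  have hL : asaiL F π s = Λ a ((residueCard F : ℂ) ^ (-s)) := by
    obtain ⟨χ', b, hb, hχ', hsub', hLb⟩ := hval s _ (Classical.epsilon_spec (hex (hsub χ hχ) s))
    have hecke' := heckeOp_eq_of_isSubquotient (P := P) habs hχ' hO' hb hsub' hvK
    have hperm : ∀ j, ∃ σ : Equiv.Perm (Fin n), b j = a j ∘ σ := fun j =>
      exists_perm_of_esym_eq fun k => by
        have := smul_left_injective ℂ hv0 ((hecke' j k).symm.trans (hecke j k))
        exact mul_left_cancel₀ (pow_ne_zero _ (P.rootCard_ne_zero j)) this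
    choose σ hσ using hperm
    rw [asaiL, hLb, show b = fun j => a j ∘ σ j from funext hσ, hΛσ]
  rw [hL]
  refine zetaIntegral_eq hn hcard he he0 hψF hψ hW hWs hW1 (α := a) (fun j k _ _ g => ?_) hμ
    (hsum _ hX0 (hC s hs))
  have := whittaker_heckeOp (P := P) (ρ := π) ℓ v j k g
  rw [hecke, map_smul, map_smul, smul_eq_mul] at this
  simp only [hv]
  exact this.symm

end Assembly

end AsaiZeta

namespace AsaiZeta

theorem not_isField_of_algEquiv_prod {F E : Type*} [Field F] [CommRing E] [Algebra F E]
    (e : E ≃ₐ[F] F × F) : ¬ IsField E := by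
  intro hE
  have := hE.isDomain
  have h : e.symm (1, 0) * e.symm (0, 1) = 0 := by
    rw [← map_mul, Prod.mk_mul_mk, mul_zero, zero_mul, Prod.mk_zero_zero, map_zero]
  rcases mul_eq_zero.1 h with h | h
  · exact one_ne_zero (congrArg Prod.fst ((map_eq_zero_iff _ e.symm.injective).1 h))
  · exact one_ne_zero (congrArg Prod.snd ((map_eq_zero_iff _ e.symm.injective).1 h))

/-! ### Quadratic field extensions. -/

section FieldCase

open MeasureTheory Matrix PlaceData

variable {F : Type*} [Field F] [ValuativeRel F] [TopologicalSpace F] [IsNonarchimedeanLocalField F]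
  [CharZero F] {E : Type*} [Field E] [Algebra F E]

theorem coe_unramChar_comp_norm (z : ℂˣ) (x : Eˣ) :
    (((unramChar (F := F) z).comp (Units.map (Algebra.norm F : E →* F)) x : ℂˣ) : ℂ) =
      (z : ℂ) ^ normOrd F x := by
  rw [← Units.val_zpow_eq_zpow_val]
  rfl

theorem absE_eq_normOrd (x : Eˣ) : absE F (x : E) = (residueCard F : ℝ) ^ (-normOrd F x) :=
  absF_eq (Units.map (Algebra.norm F : E →* F) x)

/-- Powers of the uniformizer of `F` change the valuation of the norm by even numbers, so any odd
value could be moved to `1`. This separates ramified from unramified extensions. -/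
theorem even_normOrd_of_ne_one (h2 : Module.finrank F E = 2) (h : ∀ x : Eˣ, normOrd F x ≠ 1)
    (x : Eˣ) : Even (normOrd F x) := by
  by_contra hodd
  rw [Int.not_even_iff_odd] at hodd
  obtain ⟨m, hm⟩ := hodd
  refine h (x * Units.map (algebraMap F E : F →* E) (unifF F ^ (-m))) ?_
  rw [normOrd_mul, normOrd_algebraMap h2, hm]
  have : ord ((unifF F ^ (-m) : Fˣ) : F) = -m := by
    let f : Fˣ →* Multiplicative ℤ :=
      { toFun := fun y => Multiplicative.ofAdd (ord (y : F))
        map_one' := by rw [Units.val_one, ord_one]; rfl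
        map_mul' := fun y z => by rw [ord_mul]; rfl }
    have h1 : f (unifF F ^ (-m)) = f (unifF F) ^ (-m) := map_zpow f _ _
    have h3 := congrArg Multiplicative.toAdd h1
    simpa [f, ord_unifF] using h3
  rw [this]
  ring

variable [TopologicalSpace E] [IsModuleTopology F E] {n : ℕ}
  {V : Type*} [AddCommGroup V] [Module ℂ V]

theorem isAsaiLValue_iff_of_field {π : Representation ℂ (GL (Fin n) E) V} {s L : ℂ}
    (h2 : Module.finrank F E = 2) : IsAsaiLValue (F := F) π s L ↔
    ∃ (z : Fin n → ℂˣ) (i : E →ₐ[F] AlgebraicClosure F) (w : weilGroup F)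
      (hw : w ∉ weilSubgroup i),
      IsSubquotientOfPrincipalSeries F π
        (fun j => (unramChar (F := F) (z j)).comp (Units.map (Algebra.norm F : E →* F))) ∧
      L = artinL (asaiRep (weilSubgroup i) ((unramRep z).comp (weilSubgroup i).subtype) w
        (weilSubgroup_xor (Field.toIsField E) h2 i w hw)) s := by
  constructor
  · rintro (⟨hE, h2', z, i, w, hw, h⟩ | ⟨e, -⟩)
    · exact ⟨z, i, w, hw, h⟩
    · exact absurd (Field.toIsField E) (not_isField_of_algEquiv_prod e)
  · rintro ⟨z, i, w, hw, h⟩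
    exact Or.inl ⟨Field.toIsField E, h2, z, i, w, hw, h⟩

variable (h2 : Module.finrank F E = 2) (hn : 1 ≤ n) {ψ : AddChar E Circle}
  (hψF : ∀ x : F, ψ (algebraMap F E x) = 1) (hψ : IsUnramifiedAddChar F ψ)
  {π : Representation ℂ (GL (Fin n) E) V} (hirr : π.IsIrreducible) (hsm : IsSmooth π)
  {W : GL (Fin n) E → ℂ} (hW : W ∈ whittakerModel π ψ)
  (hWK : ∀ k ∈ integralGL F n E, ∀ g, W (g * k) = W g) (hW1 : W 1 = 1)
  {μ : Measure (UnipotentQuotient n F)} (hμ : IsInvariantMeasure μ)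
include h2 hn hψF hψ hirr hsm hW hWK hW1 hμ

/-- The ramification index is `2`, so only Schur functions of even weights occur. On the Galois side
only the eigenvectors with sign `+1` are fixed by inertia. -/
theorem zetaIntegral_eq_asaiL_ramified {ϖ : Eˣ} (hϖ : normOrd F ϖ = 1) :
    ∃ C : ℝ, ∀ s : ℂ, C < s.re →
      Integrable (zetaIntegrandQuot W (charIntegers n F) s) μ ∧
      zetaIntegral μ W (charIntegers n F) s = (volIntegral μ : ℂ) * asaiL F π s := by
  classical
  obtain ⟨B, hB⟩ := exists_integral_basis (F := F) h2
  have := t2Space_of_basis B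
  have := isTopologicalRing_of_basis B
  have : FiniteDimensional F E := Module.finite_of_finrank_pos (by omega)
  have hin := not_inertia_le_weilSubgroup h2 hϖ
  refine zetaIntegral_eq_asaiL (P := ramifiedPlace h2 ϖ hϖ) (e := fun _ => 2)
    (Λ := fun α X => (∏ i, (1 - α () i * α () i * X)⁻¹) *
      pairProd (fun a b => (1 - a * b * X)⁻¹) (α ()))
    (fun x => ?_) (isOpen_of_basis hB) (isCompact_of_basis hB) ?_ (fun _ => ?_) ⟨(), two_pos⟩
    (fun α => ?_) (fun α σ X => ?_) hn hψF hψ hirr hsm (fun s L hL => ?_) (fun a ha => ?_)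
    hW hWK hW1 hμ
  · rw [Finset.univ_unique, Finset.prod_singleton, card_ramifiedPlace, absE_eq_normOrd]
    rfl
  · rw [Finset.univ_unique, Finset.prod_singleton, card_ramifiedPlace]
  · exact (normOrd_algebraMap h2 _).trans (by rw [ord_unifF]; rfl)
  · simpa using hasSum_schur_even (α ())
  · dsimp only
    rw [pairProd_comp_perm fun a b => by rw [mul_comm a b]]
    congr 1
    exact Equiv.prod_comp (σ ()) fun i => (1 - α () i * α () i * X)⁻¹
  · obtain ⟨z, i, w, hw, hsub, rfl⟩ := (isAsaiLValue_iff_of_field h2).1 hL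
    refine ⟨_, fun _ i => z i, fun _ i => (z i).ne_zero, fun i x => ?_, hsub, ?_⟩
    · rw [coe_unramChar_comp_norm, Finset.univ_unique, Finset.prod_singleton]
      rfl
    · rw [artinL_asaiRep_ramified exists_weilDeg_eq_one _ (hin i), prod_le_asai_eq fun i => (z i : ℂ)]
  · refine ⟨fun i => (unramChar (F := F) (Units.mk0 _ (ha () i))).comp
      (Units.map (Algebra.norm F : E →* F)), fun i x => ?_, fun h s => ?_⟩
    · rw [coe_unramChar_comp_norm, Finset.univ_unique, Finset.prod_singleton]
      rfl
    · let i : E →ₐ[F] AlgebraicClosure F := IsAlgClosed.lift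
      obtain ⟨w, -, hw⟩ := SetLike.not_le_iff_exists.1 (hin i)
      exact ⟨_, (isAsaiLValue_iff_of_field h2).2 ⟨_, i, w, hw, h, rfl⟩⟩

/-- The valuation of `E` is half of `normOrd`, so the character attached to `z` has Satake parameter
`z²`. All Schur functions occur, and the signs of Frobenius produce the factors in `X²`. -/
theorem zetaIntegral_eq_asaiL_unramified (heven : ∀ x : Eˣ, Even (normOrd F x)) :
    ∃ C : ℝ, ∀ s : ℂ, C < s.re →
      Integrable (zetaIntegrandQuot W (charIntegers n F) s) μ ∧
      zetaIntegral μ W (charIntegers n F) s = (volIntegral μ : ℂ) * asaiL F π s := by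
  classical
  obtain ⟨B, hB⟩ := exists_integral_basis (F := F) h2
  have := t2Space_of_basis B
  have := isTopologicalRing_of_basis B
  have : FiniteDimensional F E := Module.finite_of_finrank_pos (by omega)
  have hin := inertia_le_weilSubgroup h2 heven
  have hdiv : ∀ x : Eˣ, 2 * (normOrd F x / 2) = normOrd F x := fun x =>
    Int.mul_ediv_cancel' (heven x).two_dvd
  have hpow : ∀ (c : ℂ) (x : Eˣ), c ^ normOrd F x = (c ^ 2) ^ (normOrd F x / 2) := fun c x => by
    rw [← zpow_natCast, ← _root_.zpow_mul, Nat.cast_ofNat, hdiv]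
  refine zetaIntegral_eq_asaiL (P := unramifiedPlace h2 heven) (e := fun _ => 1)
    (Λ := fun α X => (∏ i, (1 - α () i * X)⁻¹) *
      pairProd (fun a b => (1 - a * b * X ^ 2)⁻¹) (α ()))
    (fun x => ?_) (isOpen_of_basis hB) (isCompact_of_basis hB) ?_ (fun _ => ?_) ⟨(), one_pos⟩
    (fun α => ?_) (fun α σ X => ?_) hn hψF hψ hirr hsm (fun s L hL => ?_) (fun a ha => ?_)
    hW hWK hW1 hμ
  · rw [Finset.univ_unique, Finset.prod_singleton, card_unramifiedPlace, absE_eq_normOrd, ← hdiv x,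
      Nat.cast_pow, ← zpow_natCast, ← _root_.zpow_mul, ← mul_neg]
    rfl
  · rw [Finset.univ_unique, Finset.prod_singleton, card_unramifiedPlace, pow_one]
  · change normOrd F (unifMap F E) / 2 = 1
    rw [unifMap, normOrd_algebraMap h2, ord_unifF]
    rfl
  · simpa using hasSum_schur (α ())
  · dsimp only
    rw [pairProd_comp_perm fun a b => by rw [mul_comm a b]]
    congr 1
    exact Equiv.prod_comp (σ ()) fun i => (1 - α () i * X)⁻¹
  · obtain ⟨z, i, w, hw, hsub, rfl⟩ := (isAsaiLValue_iff_of_field h2).1 hL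
    refine ⟨_, fun _ i => z i ^ 2, fun _ i => pow_ne_zero _ (z i).ne_zero, fun i x => ?_, hsub, ?_⟩
    · rw [coe_unramChar_comp_norm, Finset.univ_unique, Finset.prod_singleton, hpow]
      rfl
    · rw [artinL_asaiRep_unramified exists_weilDeg_eq_one _ (hin i).1 (hin i).2,
        prod_asaiSign_eq fun i => (z i : ℂ)]
  -- A square root of the Satake parameter is needed to write the character as one of `Fˣ` composed
  -- with the norm.
  · choose c hc using fun i => IsAlgClosed.exists_pow_nat_eq (a () i) two_pos
    have hc0 : ∀ i, c i ≠ 0 := fun i h => ha () i (by rw [← hc, h, zero_pow two_ne_zero])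
    refine ⟨fun i => (unramChar (F := F) (Units.mk0 _ (hc0 i))).comp
      (Units.map (Algebra.norm F : E →* F)), fun i x => ?_, fun h s => ?_⟩
    · rw [coe_unramChar_comp_norm, Finset.univ_unique, Finset.prod_singleton, hpow, Units.val_mk0, hc]
      rfl
    · let i : E →ₐ[F] AlgebraicClosure F := IsAlgClosed.lift
      obtain ⟨w, hw⟩ := exists_weilDeg_eq_one (F := F)
      exact ⟨_, (isAsaiLValue_iff_of_field h2).2 ⟨_, i, w, (hin i).2 w hw, h, rfl⟩⟩

theorem zetaIntegral_eq_asaiL_of_field :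
    ∃ C : ℝ, ∀ s : ℂ, C < s.re →
      Integrable (zetaIntegrandQuot W (charIntegers n F) s) μ ∧
      zetaIntegral μ W (charIntegers n F) s = (volIntegral μ : ℂ) * asaiL F π s := by
  by_cases h : ∃ ϖ : Eˣ, normOrd F ϖ = 1
  · obtain ⟨ϖ, hϖ⟩ := h
    exact zetaIntegral_eq_asaiL_ramified h2 hn hψF hψ hirr hsm hW hWK hW1 hμ hϖ
  · push Not at h
    exact zetaIntegral_eq_asaiL_unramified h2 hn hψF hψ hirr hsm hW hWK hW1 hμ
      (even_normOrd_of_ne_one h2 h)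

end FieldCase

/-! ### The split algebra and conclusion. -/

section SplitCase

open MeasureTheory Matrix PlaceData

variable {F : Type*} [Field F] [ValuativeRel F] [TopologicalSpace F] [IsNonarchimedeanLocalField F]
  [CharZero F] {E : Type*} [CommRing E] [Algebra F E] [TopologicalSpace E] [IsModuleTopology F E]
  {n : ℕ} {V : Type*} [AddCommGroup V] [Module ℂ V]

omit [ValuativeRel F] [TopologicalSpace F] [IsNonarchimedeanLocalField F] [CharZero F]
  [TopologicalSpace E] [IsModuleTopology F E] in
-- An automorphism of `F × F` is determined by the image of the idempotent `(1, 0)`, which is again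
-- a nontrivial idempotent. It controls the freedom of identification in `IsAsaiLValue`.
theorem algEquiv_prod_eq_or_eq_swap (e e' : E ≃ₐ[F] F × F) :
    (∀ x, e' x = e x) ∨ ∀ x, e' x = (e x).swap := by
  let f : (F × F) ≃ₐ[F] (F × F) := e.symm.trans e'
  have hx : ∀ x, e' x = (e x).1 • f (1, 0) + (e x).2 • (1 - f (1, 0)) := by
    intro x
    rw [← map_one f, ← map_sub, ← map_smul, ← map_smul, ← map_add]
    change e' x = e' (e.symm _)
    congr 1
    rw [AlgEquiv.eq_symm_apply]
    ext <;> simp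
  have hid : f (1, 0) * f (1, 0) = f (1, 0) := by rw [← map_mul]; simp
  have h1 : (f (1, 0)).1 = 0 ∨ (f (1, 0)).1 = 1 :=
    IsIdempotentElem.iff_eq_zero_or_one.1 (congrArg Prod.fst hid)
  have h2 : (f (1, 0)).2 = 0 ∨ (f (1, 0)).2 = 1 :=
    IsIdempotentElem.iff_eq_zero_or_one.1 (congrArg Prod.snd hid)
  rcases h1 with h1 | h1 <;> rcases h2 with h2 | h2
  · have : f (1, 0) = f 0 := by rw [map_zero]; exact Prod.ext h1 h2
    exact absurd (congrArg Prod.fst (f.injective this)) one_ne_zero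
  · right
    intro x
    rw [hx]
    ext <;> simp [h1, h2]
  · left
    intro x
    rw [hx]
    ext <;> simp [h1, h2]
  · have : f (1, 0) = f 1 := by rw [map_one]; exact Prod.ext h1 h2
    exact absurd (congrArg Prod.snd (f.injective this)) zero_ne_one

theorem zetaIntegral_eq_asaiL_of_split (e : E ≃ₐ[F] F × F) (hn : 1 ≤ n) {ψ : AddChar E Circle}
    (hψF : ∀ x : F, ψ (algebraMap F E x) = 1) (hψ : IsUnramifiedAddChar F ψ)
    {π : Representation ℂ (GL (Fin n) E) V} (hirr : π.IsIrreducible) (hsm : IsSmooth π)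
    {W : GL (Fin n) E → ℂ} (hW : W ∈ whittakerModel π ψ)
    (hWK : ∀ k ∈ integralGL F n E, ∀ g, W (g * k) = W g) (hW1 : W 1 = 1)
    {μ : Measure (UnipotentQuotient n F)} (hμ : IsInvariantMeasure μ) :
    ∃ C : ℝ, ∀ s : ℂ, C < s.re →
      Integrable (zetaIntegrandQuot W (charIntegers n F) s) μ ∧
      zetaIntegral μ W (charIntegers n F) s = (volIntegral μ : ℂ) * asaiL F π s := by
  classical
  have := t2Space_of_basis (splitBasis e)
  have := isTopologicalRing_of_basis (splitBasis e)
  have hB := mem_integers_split_iff e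
  have hchar : ∀ (e' : E ≃ₐ[F] F × F) (z z' : ℂˣ) (x : Eˣ), (((unramChar (F := F) z).comp (Units.map
      ((RingHom.fst F F).comp (e' : E →+* F × F) : E →* F)) *
      (unramChar (F := F) z').comp (Units.map ((RingHom.snd F F).comp
        (e' : E →+* F × F) : E →* F))) x : ℂˣ).1 =
      (z : ℂ) ^ ord (e' x).1 * (z' : ℂ) ^ ord (e' x).2 := fun e' z z' x => by
    rw [← Units.val_zpow_eq_zpow_val, ← Units.val_zpow_eq_zpow_val, ← Units.val_mul]
    rfl
  refine zetaIntegral_eq_asaiL (P := splitPlace e) (e := fun _ => 1)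
    (Λ := fun α X => ∏ i, ∏ j, (1 - α 0 i * α 1 j * X)⁻¹)
    (fun x => ?_) (isOpen_of_basis (B := splitBasis e) hB)
    (isCompact_of_basis (B := splitBasis e) hB) ?_ (fun j => ?_) ⟨0, one_pos⟩
    (fun α => ?_) (fun α σ X => ?_) hn hψF hψ hirr hsm (fun s L hL => ?_) (fun a ha => ?_)
    hW hWK hW1 hμ
  · let u (j : Fin 2) : Fˣ := Units.map (component (splitEquiv e) j : E →* F) x
    have h : absE F (x : E) = absF ((u 0 * u 1 : Fˣ) : F) := congrArg absF (norm_split e x)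
    rw [h, absF_eq, ord_mul, neg_add, zpow_add₀ (by
      exact_mod_cast (zero_lt_one.trans one_lt_residueCard).ne'), Fin.prod_univ_two,
      card_splitPlace, card_splitPlace]
    rfl
  · simp only [card_splitPlace, pow_one, Fin.prod_univ_two, sq]
  · rw [ord_splitPlace, Nat.cast_one, ← ord_unifF (F := F)]
    congr 1
    change component (splitEquiv e) j (algebraMap F E (unifF F)) = unifF F
    fin_cases j
    · exact congrArg Prod.fst (e.commutes (unifF F : F))
    · exact congrArg Prod.snd (e.commutes (unifF F : F))
  · simpa [Fin.prod_univ_two] using hasSum_schur_mul_schur (α 0) (α 1)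
  · simp only [Function.comp_apply]
    rw [Equiv.prod_comp (σ 0) fun i => ∏ j, (1 - α 0 i * α 1 (σ 1 j) * X)⁻¹]
    exact Finset.prod_congr rfl fun i _ =>
      Equiv.prod_comp (σ 1) fun j => (1 - α 0 i * α 1 j * X)⁻¹
  · rcases hL with ⟨hE, -⟩ | ⟨e', z, z', hsub, rfl⟩
    · exact absurd hE (not_isField_of_algEquiv_prod e)
    rw [artinL_tprod exists_weilDeg_eq_one]
    rcases algEquiv_prod_eq_or_eq_swap e e' with hee | hee
    · refine ⟨_, ![fun i => z i, fun i => z' i], ?_, fun i x => ?_, hsub, rfl⟩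
      · rw [Fin.forall_fin_two]
        exact ⟨fun i => (z i).ne_zero, fun i => (z' i).ne_zero⟩
      · rw [hchar, hee, Fin.prod_univ_two]
        rfl
    -- If the identification is swapped, the two families of parameters exchange roles; Cauchy's
    -- product is symmetric under this exchange.
    · refine ⟨_, ![fun i => z' i, fun i => z i], ?_, fun i x => ?_, hsub, ?_⟩
      · rw [Fin.forall_fin_two]
        exact ⟨fun i => (z' i).ne_zero, fun i => (z i).ne_zero⟩
      · rw [hchar, hee, Fin.prod_univ_two, mul_comm]
        rfl
      · rw [Finset.prod_comm]
        exact Finset.prod_congr rfl fun i _ => Finset.prod_congr rfl fun j _ => by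
          rw [mul_comm (z j : ℂ)]
          rfl
  · refine ⟨fun j => (unramChar (F := F) (Units.mk0 _ (ha 0 j))).comp (Units.map
      ((RingHom.fst F F).comp (e : E →+* F × F) : E →* F)) *
      (unramChar (F := F) (Units.mk0 _ (ha 1 j))).comp (Units.map ((RingHom.snd F F).comp
        (e : E →+* F × F) : E →* F)), fun i x => ?_, fun h s => ⟨_, Or.inr ⟨e, _, _, h, rfl⟩⟩⟩
    rw [hchar, Fin.prod_univ_two]
    rfl

end SplitCase

end AsaiZeta

end

theorem lemma3p6p1
    {F : Type*} [Field F] [ValuativeRel F] [TopologicalSpace F] [IsNonarchimedeanLocalField F]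
    [CharZero F]
    {E : Type*} [CommRing E] [Algebra F E] [TopologicalSpace E] [IsModuleTopology F E]
    (hE : (IsField E ∧ Module.finrank F E = 2) ∨ Nonempty (E ≃ₐ[F] F × F))
    {n : ℕ} (hn : 1 ≤ n)
    (ψ' : AddChar F Circle) (hψ' : Continuous ψ') (hψ'_unram : AsaiZeta.IsUnramifiedAddChar F ψ')
    (ψ : AddChar E Circle) (hψ : Continuous ψ) (hψ_triv : ∀ x : F, ψ (algebraMap F E x) = 1)
    (hψ_unram : AsaiZeta.IsUnramifiedAddChar F ψ)
    {V : Type*} [AddCommGroup V] [Module ℂ V] (π : Representation ℂ (GL (Fin n) E) V)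
    (hπ_irr : π.IsIrreducible) (hπ_smooth : AsaiZeta.IsSmooth π)
    (hπ_gen : AsaiZeta.IsGeneric π ψ) (hπ_unram : AsaiZeta.IsUnramified F π)
    (W : GL (Fin n) E → ℂ) (hW : W ∈ AsaiZeta.whittakerModel π ψ)
    (hWK : ∀ k ∈ AsaiZeta.integralGL F n E, ∀ g, W (g * k) = W g) (hW1 : W 1 = 1)
    (μ : MeasureTheory.Measure (AsaiZeta.UnipotentQuotient n F))
    (hμ : AsaiZeta.IsInvariantMeasure μ) :
    ∃ C : ℝ, ∀ s : ℂ, C < s.re →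
      MeasureTheory.Integrable
        (AsaiZeta.zetaIntegrandQuot W (AsaiZeta.charIntegers n F) s) μ ∧
      AsaiZeta.zetaIntegral μ W (AsaiZeta.charIntegers n F) s =
        (AsaiZeta.volIntegral μ : ℂ) * AsaiZeta.asaiL F π s := by
  rcases hE with ⟨hE, h2⟩ | ⟨⟨e⟩⟩
  · exact @AsaiZeta.zetaIntegral_eq_asaiL_of_field F _ _ _ _ _ E hE.toField _ _ _ n V _ _ h2 hn ψ
      hψ_triv hψ_unram π hπ_irr hπ_smooth W hW hWK hW1 μ hμ
  · exact AsaiZeta.zetaIntegral_eq_asaiL_of_split e hn hψ_triv hψ_unram hπ_irr hπ_smooth hW hWK hW1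
      hμ
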